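/- Let $d\in C^\infty(\mathbb R)$ be positive, with $1/d$ and $d,d',d'',\dots$ all bounded. For small $\varepsilon>0$ consider a light ray in the planar waveguide $0\le y\le d(\varepsilon x)$: between the walls it follows the Hamiltonian $p_x^2+p_y^2-1$ on the zero level ($\dot x=2p_x$, $\dot y=2p_y$, constant momentum), and it is reflected specularly at both walls. Put $X=\varepsilon x$. Let $I=|p_y|\,d(X)/\pi$ be the action and $\phi$ the phase ($\phi=\pi y/d(X)$ when $p_y>0$ and $\phi=\pi(2-y/d(X))$ when $p_y<0$), continued continuously along the ray to a real-valued function of time. Let $f$ be the $2\pi$-periodic function with $f(\phi)=\phi$ on $(0,\pi)$ and $f(\phi)=\phi-2\pi$ on $(\pi,2\pi)$, and let $\hat p_x=p_x+\varepsilon\frac{I d'(X)}{d(X)}f(\phi)$. The Hamiltonian in the variables $(I,\phi,\hat p_x,x)$ is $$H=\frac{\pi^2I^2}{d^2}+\Big(\hat p_x-\varepsilon\frac{I d'}{d}f(\phi)\Big)^2-1 .$$ For $r\ge1$ let $S=S_1+\varepsilon S_2+\dots+\varepsilon^{r-2}S_{r-1}$ and $\mathcal H_{\Sigma,r}=\frac{\pi^2\tilde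 I^2}{d^2}+\tilde p_x^2-1+\varepsilon\mathcal H_1+\dots+\varepsilon^{r-1}\mathcal H_{r-1}$ be the functions $S_i(\tilde I,\phi,\tilde p_x,X)$ (with zero average over $\phi$) and $\mathcal H_i(\tilde I,\tilde p_x,X)$ constructed order by order by the adiabatic perturbation procedure, so that the change of variables with the generating function $\tilde I\phi+\tilde p_xx+\varepsilon S(\tilde I,\phi,\tilde p_x,\varepsilon x,\varepsilon)$, i.e. $$I=\tilde I+\varepsilon\,\partial_\phi S,\quad \tilde\phi=\phi+\varepsilon\,\partial_{\tilde I}S,\quad \hat p_x=\tilde p_x+\varepsilon^2\partial_XS,\quad \tilde x=x+\varepsilon\,\partial_{\tilde p_x}S ,$$ brings $H$ to the form $\mathcal H_{\Sigma,r}(\tilde I,\tilde p_x,\varepsilon\tilde x,\varepsilon)+O(\varepsilon^r)$. (At upper-wall reflections, $I$, $f(\phi)$ and $\partial_\phi S$ are understood as their values just after the reflection.) Fix $a,L>0$ and consider rays with $I(0)\ge a$. The constants $C$ and $\varepsilon_0$ below depend only on $d,a,L$, on the integers $r,k$ and, in (2c), (2d), on the margin $\delta>0$; the estimates hold for all $0<\varepsilon<\varepsilon_0$.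 **(1)** For every natural $r$, every such ray defined on $[0,T]$ with $0\le T\le L\varepsilon^{-r}$ satisfies $|I(t)-I(0)|\le C\varepsilon$ for $0\le t\le T$. **(2)** Let $r,k\ge1$ and consider such a ray on $[0,T]$ with $0\le T\le L\varepsilon^{-k}$. (a) For each $t\in[0,T]$ the change of variables assigns to $(I,\phi,\hat p_x,x)(t)$ exactly one point $(\tilde I,\tilde\phi,\tilde p_x,\tilde x)(t)$ with $|\tilde I-I|\le a/2$, $|\tilde p_x-\hat p_x|\le1$. (b) Put $J=\tilde I(0)$. For $t\in[0,T]$: $|\tilde I(t)-J|\le C\varepsilon^r$ and $|I(t)-(J+\varepsilon\,\partial_\phi S(J,\phi(t),\tilde p_x(t),\varepsilon x(t),\varepsilon))|\le C\varepsilon^r$. Let $g(X)=1-\pi^2I(0)^2/d(X)^2$ and $X_0=\varepsilon x(0)$. Assume in (c), (d) that one of the following holds: (i) $g\ge\delta$ on $\mathbb R$; (ii) (one hump) there is $X_1\le X_0$ with $g(X_1)=0$ and $g(X)\ge\delta\min(X-X_1,1)$ for all $X\ge X_1$, or there is $X_1\ge X_0$ with $g(X_1)=0$ and $g(X)\ge\delta\min(X_1-X,1)$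 for all $X\le X_1$; (iii) (resonator) there are $X_1<X_2$ with $X_1\le X_0\le X_2$, $g(X_1)=g(X_2)=0$ and $g(X)\ge\delta\min(X-X_1,X_2-X)$ on $[X_1,X_2]$. (c) For every $t\in[0,T]$ there is a point $(P,Y)$ with $\mathcal H_{\Sigma,r}(J,P,Y,\varepsilon)=0$, $|\tilde p_x(t)-P|\le C\varepsilon^r$ and $|\varepsilon\tilde x(t)-Y|\le C\varepsilon^r$. (d) Let $(J,\psi,p,\xi)(t)$, $0\le t\le T$, be a solution of the Hamiltonian system with the Hamiltonian $\mathcal H_{\Sigma,r}(J,p,\varepsilon\xi,\varepsilon)$ ($J$ constant, $\psi$ conjugate to $J$, $p$ to $\xi$) with initial values $(\tilde I,\tilde\phi,\tilde p_x,\tilde x)(0)$. Then for $t\in[0,T]$ $$|\tilde I-J|\le C\varepsilon^r,\quad |\tilde\phi-\psi|\le C\varepsilon^{r-k},\quad |\tilde p_x-p|\le C\varepsilon^{r-k+1},\quad |\varepsilon\tilde x-\varepsilon\xi|\le C\varepsilon^{r-k+1}.$$ Moreover, exactly one point $(I_*,\phi_*,p_*,x_*)(t)$ corresponds to $(J,\psi,p,\xi)(t)$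 under the change of variables, and $$|\phi-\phi_*|\le C\varepsilon^{r-k},\quad |\hat p_x-p_*|\le C\varepsilon^{r-k+1},\quad |\varepsilon x-\varepsilon x_*|\le C\varepsilon^{r-k+1},\quad |I-I_*|\le C\varepsilon ,$$ and $|I-I_*|\le C\varepsilon^{r-k+1}$ whenever $f(\phi)-f(\phi_*)=\phi-\phi_*$, i.e. whenever no reflection at the upper wall separates the phases $\phi$ and $\phi_*$. -/

import Mathlib

open Set Filter Topology

noncomputable section

namespace Waveguide

/-! ### Rays between the walls `y = 0` and `y = d (ε x)`, Hamiltonian `p_x ^ 2 + p_y ^ 2 - 1` -/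

/-- A light ray on the time interval `[0, T]`, on the level `p_x ^ 2 + p_y ^ 2 - 1 = 0`.
Between consecutive reflections the momentum is constant and `ẋ = 2 p_x`, `ẏ = 2 p_y`; at a
reflection the momentum is reflected specularly in the tangent of the wall. The momentum at a
reflection time is the reflected one, so at a wall it never points out of the waveguide. -/
structure IsRay (d : ℝ → ℝ) (ε T : ℝ) (x y px py : ℝ → ℝ) : Prop where
  level : ∀ t ∈ Icc 0 T, px t ^ 2 + py t ^ 2 - 1 = 0
  inside : ∀ t ∈ Icc 0 T, 0 ≤ y t ∧ y t ≤ d (ε * x t)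
  lower_outgoing : ∀ t ∈ Icc 0 T, y t = 0 → 0 ≤ py t
  upper_outgoing : ∀ t ∈ Icc 0 T, y t = d (ε * x t) →
    py t ≤ ε * deriv d (ε * x t) * px t
  /-- `R` is the finite set of reflection times. -/
  motion : ∃ R : Finset ℝ, ∀ s t : ℝ, 0 ≤ s → s < t → t ≤ T → (∀ q ∈ R, q ∉ Ioo s t) →
    x t = x s + 2 * (t - s) * px s ∧
    y t = y s + 2 * (t - s) * py s ∧
    (t ∉ R → px t = px s ∧ py t = py s) ∧
    (t ∈ R →
      (y t = 0 ∧ px t = px s ∧ py t = - py s) ∨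
      (y t = d (ε * x t) ∧
        px t = px s + 2 * (ε * deriv d (ε * x t)) *
          ((py s - ε * deriv d (ε * x t) * px s) / (1 + (ε * deriv d (ε * x t)) ^ 2)) ∧
        py t = py s - 2 *
          ((py s - ε * deriv d (ε * x t) * px s) / (1 + (ε * deriv d (ε * x t)) ^ 2))))

/-! ### Action-angle variables -/

/-- The action `I = |p_y| d(X) / π`, `X = ε x`. -/
def action (d : ℝ → ℝ) (ε x py : ℝ) : ℝ := |py| * d (ε * x) / Real.pi

/-- The phase in `[0, 2π]`: it is `π y / d` on the way up and `π (2 - y / d)` on the way down. -/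
def phase (d : ℝ → ℝ) (ε x y py : ℝ) : ℝ :=
  if 0 < py then Real.pi * (y / d (ε * x)) else Real.pi * (2 - y / d (ε * x))

/-- The `2π`-periodic function `f` with `f φ = φ` on `(0, π)` and `f φ = φ - 2π` on `(π, 2π)`.
It is smooth except for jumps at `π + 2πℤ`, where it takes its right limit `-π`. -/
def sawtooth (φ : ℝ) : ℝ := toIcoMod Real.two_pi_pos (-Real.pi) φ

/-- `Φ` is the phase along the ray, as a continuous real-valued function of time. -/
def IsPhaseLift (d : ℝ → ℝ) (ε T : ℝ) (x y py Φ : ℝ → ℝ) : Prop :=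
  ContinuousOn Φ (Icc 0 T) ∧
    ∀ t ∈ Icc 0 T, ∃ n : ℤ, Φ t = phase d ε (x t) (y t) (py t) + 2 * Real.pi * n

/-- A value of the variables (action, phase, longitudinal momentum, longitudinal coordinate). -/
@[ext] structure Point where
  I : ℝ
  φ : ℝ
  p : ℝ
  x : ℝ

/-- The variables `(I, φ, p̂_x, x)` along a ray; the generating function
`p̂_x x + W(I, y, ε x)` gives `p_x = p̂_x - ε (I d' / d) f(φ)`. -/
def rayPoint (d : ℝ → ℝ) (ε : ℝ) (x px py Φ : ℝ → ℝ) (t : ℝ) : Point where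
  I := action d ε (x t) (py t)
  φ := Φ t
  p := px t + ε * (action d ε (x t) (py t) * deriv d (ε * x t) / d (ε * x t)) * sawtooth (Φ t)
  x := x t

/-- The Hamiltonian in the variables `(I, φ, p̂_x, X = ε x)`. It depends on `φ` only through
`u = f(φ)`. -/
def hamiltonian (d : ℝ → ℝ) (ε I u p X : ℝ) : ℝ :=
  Real.pi ^ 2 * I ^ 2 / d X ^ 2 + (p - ε * (I * deriv d X / d X) * u) ^ 2 - 1

/-! ### The adiabatic perturbation procedure

Functions of the phase `φ` are written as functions of `u = f(φ)`; their `φ`-average is the average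
over `u ∈ [-π, π]`, and `∂/∂φ` is `∂/∂u`. -/

/-- Partial sums `S = S₁ + ε S₂ + … + ε ^ (m - 1) S_m` (arguments `ε I u p X`) and
`K = 𝓗₀ + ε 𝓗₁ + … + ε ^ m 𝓗_m` (arguments `ε I p X`). -/
structure NormalForm where
  S : ℝ → ℝ → ℝ → ℝ → ℝ → ℝ
  K : ℝ → ℝ → ℝ → ℝ → ℝ

namespace NormalForm

def dI (N : NormalForm) (ε I u p X : ℝ) : ℝ := deriv (fun I' => N.S ε I' u p X) I
def dφ (N : NormalForm) (ε I u p X : ℝ) : ℝ := deriv (fun u' => N.S ε I u' p X) u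
def dp (N : NormalForm) (ε I u p X : ℝ) : ℝ := deriv (fun p' => N.S ε I u p' X) p
def dX (N : NormalForm) (ε I u p X : ℝ) : ℝ := deriv (fun X' => N.S ε I u p X') X

/-- The difference of the exact Hamiltonian and `K`, expressed in the mixed variables
`(Ĩ, φ, p̃_x, X)` of the generating function `Ĩ φ + p̃_x x + ε S(Ĩ, φ, p̃_x, ε x, ε)`. -/
def residual (d : ℝ → ℝ) (N : NormalForm) (ε I u p X : ℝ) : ℝ :=
  hamiltonian d ε (I + ε * N.dφ ε I u p X) u (p + ε ^ 2 * N.dX ε I u p X) X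
    - N.K ε I p (X + ε ^ 2 * N.dp ε I u p X)

/-- The coefficient of `ε ^ (m + 1)` in the residual. -/
def coeff (d : ℝ → ℝ) (m : ℕ) (N : NormalForm) (I u p X : ℝ) : ℝ :=
  iteratedDeriv (m + 1) (fun ε => N.residual d ε I u p X) 0 / (Nat.factorial (m + 1) : ℝ)

/-- The average over the phase. -/
def average (g : ℝ → ℝ) : ℝ := (2 * Real.pi)⁻¹ * ∫ u in (-Real.pi)..Real.pi, g u

/-- `𝓗_{m+1}`, the phase average of the coefficient. -/
def nextK (d : ℝ → ℝ) (m : ℕ) (N : NormalForm) (I p X : ℝ) : ℝ :=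
  average fun u => N.coeff d m I u p X

/-- A primitive in the phase of `(𝓗_{m+1} - coeff) / ω`, with `ω = 2 π² I / d²`. -/
def primitive (d : ℝ → ℝ) (m : ℕ) (N : NormalForm) (I u p X : ℝ) : ℝ :=
  ∫ v in (0 : ℝ)..u,
    (N.nextK d m I p X - N.coeff d m I v p X) / (2 * Real.pi ^ 2 * I / d X ^ 2)

/-- `S_{m+1}`, the solution with zero average of
`coeff + ω ∂S_{m+1}/∂φ = 𝓗_{m+1}`. -/
def nextS (d : ℝ → ℝ) (m : ℕ) (N : NormalForm) (I u p X : ℝ) : ℝ :=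
  N.primitive d m I u p X - average fun v => N.primitive d m I v p X

/-- One step of the procedure. -/
def step (d : ℝ → ℝ) (m : ℕ) (N : NormalForm) : NormalForm where
  S ε I u p X := N.S ε I u p X + ε ^ m * N.nextS d m I u p X
  K ε I p X := N.K ε I p X + ε ^ (m + 1) * N.nextK d m I p X

end NormalForm

/-- The result of `m` steps, starting from `S = 0`, `𝓗₀ = π² I² / d² + p² - 1`. -/
def iterate (d : ℝ → ℝ) : ℕ → NormalForm
  | 0 => { S := fun _ _ _ _ _ => 0
           K := fun _ I p X => Real.pi ^ 2 * I ^ 2 / d X ^ 2 + p ^ 2 - 1 }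
  | m + 1 => (iterate d m).step d m

/-- For `r ≥ 1`: `S = S₁ + ε S₂ + … + ε ^ (r - 2) S_{r-1}` and
`𝓗_{Σ,r} = 𝓗₀ + ε 𝓗₁ + … + ε ^ (r - 1) 𝓗_{r-1}`. -/
def normalForm (d : ℝ → ℝ) (r : ℕ) : NormalForm := iterate d (r - 1)

/-- The canonical change of variables `z = (I, φ, p̂_x, x) ↔ w = (Ĩ, φ̃, p̃_x, x̃)` with the
generating function `Ĩ φ + p̃_x x + ε S(Ĩ, φ, p̃_x, ε x, ε)`. -/
def IsChange (d : ℝ → ℝ) (r : ℕ) (ε : ℝ) (z w : Point) : Prop :=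
  z.I = w.I + ε * (normalForm d r).dφ ε w.I (sawtooth z.φ) w.p (ε * z.x) ∧
  w.φ = z.φ + ε * (normalForm d r).dI ε w.I (sawtooth z.φ) w.p (ε * z.x) ∧
  z.p = w.p + ε ^ 2 * (normalForm d r).dX ε w.I (sawtooth z.φ) w.p (ε * z.x) ∧
  w.x = z.x + ε * (normalForm d r).dp ε w.I (sawtooth z.φ) w.p (ε * z.x)

/-- `w` is the image of `z` under the change of variables, on the near-identity branch. The
equations for `w` are implicit and may have spurious solutions far from `z`. -/
def IsImage (d : ℝ → ℝ) (r : ℕ) (ε a : ℝ) (z w : Point) : Prop :=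
  IsChange d r ε z w ∧ |w.I - z.I| ≤ a / 2 ∧ |w.p - z.p| ≤ 1

/-- `v = (J, ψ, p, x)` solves, on `[0, T]`, the Hamiltonian system with the Hamiltonian
`𝓗_{Σ,r}(J, p, ε x, ε)`. -/
def IsApproxSolution (d : ℝ → ℝ) (r : ℕ) (ε T : ℝ) (v : ℝ → Point) : Prop :=
  ∀ t ∈ Icc 0 T,
    HasDerivWithinAt (fun s => (v s).I) 0 (Icc 0 T) t ∧
    HasDerivWithinAt (fun s => (v s).φ)
      (deriv (fun J => (normalForm d r).K ε J (v t).p (ε * (v t).x)) (v t).I) (Icc 0 T) t ∧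
    HasDerivWithinAt (fun s => (v s).p)
      (-(ε * deriv (fun X => (normalForm d r).K ε (v t).I (v t).p X) (ε * (v t).x))) (Icc 0 T) t ∧
    HasDerivWithinAt (fun s => (v s).x)
      (deriv (fun p => (normalForm d r).K ε (v t).I p (ε * (v t).x)) (v t).p) (Icc 0 T) t

/-- `F - 2U(X)` for `F = 1` (the zero energy level) and `2U(X) = π² J² / d(X)²`. -/
def gap (d : ℝ → ℝ) (J X : ℝ) : ℝ := 1 - Real.pi ^ 2 * J ^ 2 / d X ^ 2

/-- The conditions on the slow motion in the potential `2U = π² J² / d²` at `F = 1`, from the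
position `X₀`, with margin `δ`:
1. `F` exceeds `2U` everywhere;
2. the ray moves in a half-line bounded by one hump, at which it can be reflected only once;
3. the ray moves between two humps (a resonator). -/
def SlowCondition (d : ℝ → ℝ) (δ J X₀ : ℝ) : Prop :=
  (∀ X, δ ≤ gap d J X) ∨
  (∃ X₁, X₁ ≤ X₀ ∧ gap d J X₁ = 0 ∧ ∀ X, X₁ ≤ X → δ * min (X - X₁) 1 ≤ gap d J X) ∨
  (∃ X₁, X₀ ≤ X₁ ∧ gap d J X₁ = 0 ∧ ∀ X, X ≤ X₁ → δ * min (X₁ - X) 1 ≤ gap d J X) ∨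
  (∃ X₁ X₂, X₁ < X₂ ∧ X₁ ≤ X₀ ∧ X₀ ≤ X₂ ∧ gap d J X₁ = 0 ∧ gap d J X₂ = 0 ∧
    ∀ X, X₁ ≤ X → X ≤ X₂ → δ * min (X - X₁) (X₂ - X) ≤ gap d J X)

end Waveguide

end

open scoped ContDiff

noncomputable section

namespace Waveguide

/-! ### Symbol classes -/

/-! Write `m = r - 1`, and let `u = f(φ)` range over `[-π, π]`. The Hamiltonian is polynomial in `ε`
and `u`, so the perturbation procedure stays inside explicit algebras of functions (`Coef`, `Pol`,
`Shf`) whose members are smooth for `I > 0` and, together with their derivatives, bounded uniformly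
in `X`. Each step solves the equation that cancels the next Taylor coefficient in `ε`. After `m`
steps the residual, that is, the exact Hamiltonian minus `K` in the mixed variables, is of order `ε
^ (m + 1)` (`isOrder_iterate`), and so are its derivatives in the other variables
(`Shf.IsOrder.pd`). Differentiating the residual identity shows that between reflections the
improved action drifts at rate `O(ε ^ (m + 1))` (`exists_deriv_mixed`, `Small.flight_error`).

The obstacle is the upper wall, where `f` jumps and the classical smooth theory does not apply. A
reflection there keeps `p̂_x`, `x` and the energy, while `u` passes from `π` to `-π` and `I` jumps
by `O(ε)`. The coefficients of the procedure are corrected by their full phase average, so `S` and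
its derivatives in `I`, `p`, `X` agree at `u = ±π`; only `∂S/∂φ` jumps. `K` does not contain the
phase, so the residual identity used at both ends says that the action predicted after the
reflection, with the improved action frozen, has energy `O(ε ^ (m + 1))`. The true action has energy
zero and the Hamiltonian is strictly monotone in `I`, so prediction and truth differ by `O(ε ^ (m +
1))` (`Small.flight_step`). Each upper reflection lowers `u` by `2π` while `u` moves at bounded
speed, so reflections are paid for by elapsed time and the total drift is `O(ε ^ (m + 1) * (T + 1))`
(`Small.conservation`).

Over times `L ε ^ (-k)` one order per power of `1 / ε` is lost. It is recovered by running the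
argument at order `m + k` and comparing the improved actions of orders `m` and `m + k`, which differ
by `O(ε ^ (m + 1))` (`Tame.image_at`). The case `m = 0` is the conservation of the original action.

For the slow variables the improved action is frozen at its initial value `J` and a momentum `q` is
defined from the momentum equation of the change of variables alone. The resulting `(q, Y)` is
continuous through reflections, solves the one-degree-of-freedom system of `K` up to `ε * O(ε ^ (m +
1))`, and has `K = O(ε ^ (m + 1))` (`Tame.exists_slowCurve`). The conditions on the humps keep the
gradient of `K` away from zero along it (`Slow.speed`), so a point of the exact zero level lies
within `O(ε ^ (m + 1))` (`Slow.exists_level`).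

Comparison with an exact averaged solution cannot use Gronwall's inequality over the whole interval,
since it would lose an exponential. Instead (`shadowing`), errors across the energy levels are
controlled by the energy at all times, and errors along the flow are removed after each unit of slow
time by a shift of the clock. The shifts add up linearly, giving `O(ε ^ r * (1 + ε T))`, hence `O(ε
^ (r - k + 1))`; the fast phase loses one more power of `ε`. The original variables are recovered by
a contraction (`Small.existsUnique_change`, `Small.recover`), where the jump of `∂S/∂φ` is the
reason for the weaker bound on the action when an upper reflection separates the phases. -/

/-- The hypotheses on the width of the waveguide. -/
structure Profile (d : ℝ → ℝ) : Prop where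
  smooth : ContDiff ℝ ∞ d
  bounded : ∀ n : ℕ, ∃ B : ℝ, ∀ X : ℝ, |iteratedDeriv n d X| ≤ B
  pos : ∃ c : ℝ, 0 < c ∧ ∀ X : ℝ, c ≤ d X

theorem Profile.d_pos {d : ℝ → ℝ} (hd : Profile d) (X : ℝ) : 0 < d X := by
  obtain ⟨c, hc, h⟩ := hd.pos
  exact hc.trans_le (h X)

/-- The space of the variables `(ε, I, u, p, X)`. -/
abbrev E5 : Type := ℝ × ℝ × ℝ × ℝ × ℝ

/-- The derivative of `G` in the direction `v`. -/
def pd (v : E5) (G : E5 → ℝ) (z : E5) : ℝ := fderiv ℝ G z v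

def vε : E5 := (1, 0, 0, 0, 0)
def vI : E5 := (0, 1, 0, 0, 0)
def vu : E5 := (0, 0, 1, 0, 0)
def vp : E5 := (0, 0, 0, 1, 0)
def vX : E5 := (0, 0, 0, 0, 1)

def coordε : E5 →L[ℝ] ℝ := ContinuousLinearMap.fst ℝ ℝ _
def coordI : E5 →L[ℝ] ℝ :=
  (ContinuousLinearMap.fst ℝ ℝ (ℝ × ℝ × ℝ)).comp (ContinuousLinearMap.snd ℝ ℝ _)
def coordu : E5 →L[ℝ] ℝ :=
  (ContinuousLinearMap.fst ℝ ℝ (ℝ × ℝ)).comp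
    ((ContinuousLinearMap.snd ℝ ℝ _).comp (ContinuousLinearMap.snd ℝ ℝ _))
def coordp : E5 →L[ℝ] ℝ :=
  (ContinuousLinearMap.fst ℝ ℝ ℝ).comp
    ((ContinuousLinearMap.snd ℝ ℝ _).comp
      ((ContinuousLinearMap.snd ℝ ℝ _).comp (ContinuousLinearMap.snd ℝ ℝ _)))
def coordX : E5 →L[ℝ] ℝ :=
  (ContinuousLinearMap.snd ℝ ℝ ℝ).comp
    ((ContinuousLinearMap.snd ℝ ℝ _).comp
      ((ContinuousLinearMap.snd ℝ ℝ _).comp (ContinuousLinearMap.snd ℝ ℝ _)))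

theorem isOpen_actPos : IsOpen {z : E5 | 0 < z.2.1} :=
  isOpen_lt continuous_const (by fun_prop)

theorem fderiv_comp_coord {g : ℝ → ℝ} (l : E5 →L[ℝ] ℝ) {z : E5}
    (hg : DifferentiableAt ℝ g (l z)) (v : E5) :
    fderiv ℝ (fun z => g (l z)) z v = deriv g (l z) * l v := by
  have := (hg.hasDerivAt.comp_hasFDerivAt z l.hasFDerivAt).fderiv
  simp only [Function.comp_def] at this
  rw [this]; simp

theorem fderiv_expand (G : E5 → ℝ) (z w : E5) :
    fderiv ℝ G z w = w.1 * pd vε G z + w.2.1 * pd vI G z + w.2.2.1 * pd vu G z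
      + w.2.2.2.1 * pd vp G z + w.2.2.2.2 * pd vX G z := by
  have : w = w.1 • vε + w.2.1 • vI + w.2.2.1 • vu + w.2.2.2.1 • vp + w.2.2.2.2 • vX := by
    ext <;> simp [vε, vI, vu, vp, vX]
  conv_lhs => rw [this]
  simp only [map_add, map_smul, smul_eq_mul, pd]

/-- Polynomials in `I`, `1 / I`, `p`, `1 / d(X)` and the derivatives of `d` at `X`. -/
inductive Coef (d : ℝ → ℝ) : (E5 → ℝ) → Prop
  | const (c : ℝ) : Coef d fun _ => c
  | act : Coef d fun z => z.2.1
  | inv : Coef d fun z => (z.2.1)⁻¹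
  | mom : Coef d fun z => z.2.2.2.1
  | jet (n : ℕ) : Coef d fun z => iteratedDeriv n d z.2.2.2.2
  | dinv : Coef d fun z => (d z.2.2.2.2)⁻¹
  | add {f g : E5 → ℝ} : Coef d f → Coef d g → Coef d fun z => f z + g z
  | mul {f g : E5 → ℝ} : Coef d f → Coef d g → Coef d fun z => f z * g z

/-- Polynomials in `ε` and `u` with coefficients in `Coef d`, up to equality for `I > 0`. -/
inductive Pol (d : ℝ → ℝ) : (E5 → ℝ) → Prop
  | mono (n k : ℕ) {c : E5 → ℝ} : Coef d c → Pol d fun z => z.1 ^ n * z.2.2.1 ^ k * c z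
  | add {f g : E5 → ℝ} : Pol d f → Pol d g → Pol d fun z => f z + g z
  | congr {f g : E5 → ℝ} : Pol d f → (∀ z : E5, 0 < z.2.1 → f z = g z) → Pol d g

/-- The map `X ↦ X + ε² Q`. -/
def shiftMap (Q : E5 → ℝ) (z : E5) : E5 :=
  (z.1, z.2.1, z.2.2.1, z.2.2.2.1, z.2.2.2.2 + z.1 ^ 2 * Q z)

/-- The algebra generated by `Pol d` and its functions at `X + ε² Q`. -/
inductive Shf (d : ℝ → ℝ) (Q : E5 → ℝ) : (E5 → ℝ) → Prop
  | pol {f : E5 → ℝ} : Pol d f → Shf d Q f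
  | shift {f : E5 → ℝ} : Pol d f → Shf d Q fun z => f (shiftMap Q z)
  | add {f g : E5 → ℝ} : Shf d Q f → Shf d Q g → Shf d Q fun z => f z + g z
  | mul {f g : E5 → ℝ} : Shf d Q f → Shf d Q g → Shf d Q fun z => f z * g z
  | congr {f g : E5 → ℝ} : Shf d Q f → (∀ z : E5, 0 < z.2.1 → f z = g z) → Shf d Q g

/-- The region of bounded variables. -/
def Dom (ρ : ℝ) : Set E5 :=
  {z | |z.1| ≤ 1 ∧ ρ⁻¹ ≤ z.2.1 ∧ z.2.1 ≤ ρ ∧ |z.2.2.1| ≤ ρ ∧ |z.2.2.2.1| ≤ ρ}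

theorem act_pos_of_mem {ρ : ℝ} (hρ : 0 < ρ) {z : E5} (hz : z ∈ Dom ρ) : 0 < z.2.1 :=
  (inv_pos.2 hρ).trans_le hz.2.1

theorem convex_Dom (ρ : ℝ) : Convex ℝ (Dom ρ) := by
  have h1 : ∀ (l : E5 →L[ℝ] ℝ) (r : ℝ), Convex ℝ {z : E5 | |l z| ≤ r} := by
    intro l r
    have : {z : E5 | |l z| ≤ r} = l ⁻¹' (Icc (-r) r) := by
      ext z; simp [abs_le]
    rw [this]
    exact (convex_Icc _ _).is_linear_preimage l.toLinearMap.isLinear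
  have h2 : Convex ℝ {z : E5 | ρ⁻¹ ≤ z.2.1 ∧ z.2.1 ≤ ρ} :=
    (convex_Icc ρ⁻¹ ρ).is_linear_preimage coordI.toLinearMap.isLinear
  have : Dom ρ = {z | |coordε z| ≤ 1} ∩ ({z : E5 | ρ⁻¹ ≤ z.2.1 ∧ z.2.1 ≤ ρ} ∩
      ({z | |coordu z| ≤ ρ} ∩ {z | |coordp z| ≤ ρ})) := by
    ext z
    simp only [Dom, mem_ofPred_eq, mem_inter_iff, coordε, coordu, coordp]
    constructor
    · rintro ⟨a, b, c, e, f⟩; exact ⟨a, ⟨b, c⟩, e, f⟩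
    · rintro ⟨a, ⟨b, c⟩, e, f⟩; exact ⟨a, b, c, e, f⟩
  rw [this]
  exact (h1 _ _).inter (h2.inter ((h1 _ _).inter (h1 _ _)))

/-! ### Coefficients: smoothness, derivatives, bounds. -/

section Coef
variable {d : ℝ → ℝ}

theorem Profile.contDiff_iteratedDeriv (hd : Profile d) (n : ℕ) :
    ContDiff ℝ ∞ (iteratedDeriv n d) := by
  rw [iteratedDeriv_eq_iterate]
  exact ContDiff.iterate_deriv n hd.smooth

theorem Coef.contDiffAt (hd : Profile d) {c : E5 → ℝ} (hc : Coef d c) {z : E5}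
    (hz : 0 < z.2.1) : ContDiffAt ℝ ∞ c z := by
  induction hc with
  | const c => exact contDiffAt_const
  | act => fun_prop
  | inv => exact ContDiffAt.inv (by fun_prop) hz.ne'
  | mom => fun_prop
  | jet n => exact ((hd.contDiff_iteratedDeriv n).comp (by fun_prop)).contDiffAt
  | dinv => exact ContDiffAt.inv ((hd.smooth.comp (by fun_prop)).contDiffAt) (hd.d_pos _).ne'
  | add _ _ h1 h2 => exact h1.add h2
  | mul _ _ h1 h2 => exact h1.mul h2

/-- The generators `1 / I`, `1 / d` and the jets of `d` differentiate into products of generators.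
The restriction to `I > 0` is needed for `1 / I` only. -/
theorem Coef.pd (hd : Profile d) {c : E5 → ℝ} (hc : Coef d c) (v : E5) :
    ∃ c', Coef d c' ∧ ∀ z : E5, 0 < z.2.1 → fderiv ℝ c z v = c' z := by
  induction hc with
  | const c => exact ⟨_, .const 0, fun z _ => by simp⟩
  | act =>
    refine ⟨_, .const v.2.1, fun z _ => ?_⟩
    exact congrArg (fun l : E5 →L[ℝ] ℝ => l v) (coordI.fderiv (x := z))
  | inv =>
    refine ⟨_, .mul (.const (-v.2.1)) (.mul .inv .inv), fun z hz => ?_⟩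
    have := fderiv_comp_coord (g := fun x => x⁻¹) coordI (z := z)
      (differentiableAt_inv hz.ne') v
    refine this.trans ?_
    rw [deriv_inv]
    change -(z.2.1 ^ 2)⁻¹ * v.2.1 = _
    rw [sq, mul_inv]; ring
  | mom =>
    refine ⟨_, .const v.2.2.2.1, fun z _ => ?_⟩
    exact congrArg (fun l : E5 →L[ℝ] ℝ => l v) (coordp.fderiv (x := z))
  | jet n =>
    refine ⟨_, .mul (.const v.2.2.2.2) (.jet (n + 1)), fun z hz => ?_⟩
    have := fderiv_comp_coord (g := iteratedDeriv n d) coordX (z := z)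
      ((hd.contDiff_iteratedDeriv n).differentiable (by simp) _) v
    refine this.trans ?_
    rw [iteratedDeriv_succ, mul_comm]; rfl
  | dinv =>
    refine ⟨_, .mul (.const (-v.2.2.2.2)) (.mul (.jet 1) (.mul .dinv .dinv)), fun z hz => ?_⟩
    have hdd := hd.smooth.differentiable (by simp) (coordX z)
    have := fderiv_comp_coord (g := fun x => (d x)⁻¹) coordX (z := z)
      (hdd.inv (hd.d_pos _).ne') v
    refine this.trans ?_
    rw [deriv_fun_inv'' hdd (hd.d_pos _).ne', iteratedDeriv_one]
    change -deriv d z.2.2.2.2 / d z.2.2.2.2 ^ 2 * v.2.2.2.2 = _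
    rw [div_eq_mul_inv, sq, mul_inv]; ring
  | add h1 h2 ih1 ih2 =>
    obtain ⟨a, ha, ha'⟩ := ih1
    obtain ⟨b, hb, hb'⟩ := ih2
    refine ⟨_, .add ha hb, fun z hz => ?_⟩
    rw [fderiv_fun_add ((h1.contDiffAt hd hz).differentiableAt (by simp))
      ((h2.contDiffAt hd hz).differentiableAt (by simp))]
    simp [ha' z hz, hb' z hz]
  | mul h1 h2 ih1 ih2 =>
    obtain ⟨a, ha, ha'⟩ := ih1
    obtain ⟨b, hb, hb'⟩ := ih2
    refine ⟨_, .add (.mul h1 hb) (.mul h2 ha), fun z hz => ?_⟩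
    rw [fderiv_fun_mul ((h1.contDiffAt hd hz).differentiableAt (by simp))
      ((h2.contDiffAt hd hz).differentiableAt (by simp))]
    simp [ha' z hz, hb' z hz]

/-- Coefficients see neither `ε` nor the phase; this lets them be pulled out of phase integrals and
of the evaluation at `ε = 0`. -/
theorem Coef.indep {c : E5 → ℝ} (hc : Coef d c) (z w : E5) (h1 : z.2.1 = w.2.1)
    (h2 : z.2.2.2 = w.2.2.2) : c z = c w := by
  induction hc with
  | const c => rfl
  | act => exact h1
  | inv => simp only [h1]
  | mom => simp only [h2]
  | jet n => simp only [h2]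
  | dinv => simp only [h2]
  | add _ _ ih1 ih2 => simp only [ih1, ih2]
  | mul _ _ ih1 ih2 => simp only [ih1, ih2]

theorem Coef.bounded (hd : Profile d) {c : E5 → ℝ} (hc : Coef d c) {ρ : ℝ} (hρ : 0 < ρ) :
    ∃ B, ∀ z ∈ Dom ρ, |c z| ≤ B := by
  induction hc with
  | const c => exact ⟨|c|, fun _ _ => le_rfl⟩
  | act => exact ⟨ρ, fun z hz => by rw [abs_of_pos (act_pos_of_mem hρ hz)]; exact hz.2.2.1⟩
  | inv =>
    refine ⟨ρ, fun z hz => ?_⟩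
    rw [abs_of_pos (inv_pos.2 (act_pos_of_mem hρ hz))]
    exact inv_le_of_inv_le₀ hρ hz.2.1
  | mom => exact ⟨ρ, fun z hz => hz.2.2.2.2⟩
  | jet n =>
    obtain ⟨B, hB⟩ := hd.bounded n
    exact ⟨B, fun z _ => hB _⟩
  | dinv =>
    obtain ⟨c, hc, h⟩ := hd.pos
    refine ⟨c⁻¹, fun z _ => ?_⟩
    rw [abs_of_pos (inv_pos.2 (hd.d_pos _))]
    exact inv_anti₀ hc (h _)
  | add _ _ h1 h2 =>
    obtain ⟨A, hA⟩ := h1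
    obtain ⟨B, hB⟩ := h2
    exact ⟨A + B, fun z hz => (abs_add_le _ _).trans (add_le_add (hA z hz) (hB z hz))⟩
  | mul _ _ h1 h2 =>
    obtain ⟨A, hA⟩ := h1
    obtain ⟨B, hB⟩ := h2
    refine ⟨A * B, fun z hz => ?_⟩
    rw [abs_mul]
    exact mul_le_mul (hA z hz) (hB z hz) (abs_nonneg _) ((abs_nonneg _).trans (hA z hz))

end Coef

/-! ### Polynomials in `ε` and the phase. -/

namespace Pol
variable {d : ℝ → ℝ}

theorem of_coef {c : E5 → ℝ} (hc : Coef d c) : Pol d c :=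
  (mono 0 0 hc).congr fun z _ => by simp

theorem const (c : ℝ) : Pol d fun _ => c := of_coef (.const c)

theorem mul {f g : E5 → ℝ} (hf : Pol d f) (hg : Pol d g) : Pol d fun z => f z * g z := by
  induction hf with
  | mono n k hc =>
    induction hg with
    | mono m l he =>
      exact (mono (n + m) (k + l) (hc.mul he)).congr fun z _ => by ring
    | add _ _ h1 h2 => exact (h1.add h2).congr fun z _ => by ring
    | congr _ h ih => exact ih.congr fun z hz => by rw [h z hz]
  | add _ _ h1 h2 => exact (h1.add h2).congr fun z _ => by ring
  | congr _ h ih => exact ih.congr fun z hz => by rw [h z hz]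

theorem const_mul (c : ℝ) {f : E5 → ℝ} (hf : Pol d f) : Pol d fun z => c * f z :=
  (const c).mul hf

theorem neg {f : E5 → ℝ} (hf : Pol d f) : Pol d fun z => -f z :=
  (hf.const_mul (-1)).congr fun z _ => by ring

theorem sub {f g : E5 → ℝ} (hf : Pol d f) (hg : Pol d g) : Pol d fun z => f z - g z :=
  (hf.add hg.neg).congr fun z _ => by ring

theorem pow {f : E5 → ℝ} (hf : Pol d f) (n : ℕ) : Pol d fun z => f z ^ n := by
  induction n with
  | zero => simpa using const 1
  | succ n ih => exact (ih.mul hf).congr fun z _ => by ring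

theorem eps : Pol d fun z => z.1 := (mono 1 0 (.const 1)).congr fun z _ => by simp
theorem phase : Pol d fun z => z.2.2.1 := (mono 0 1 (.const 1)).congr fun z _ => by simp

theorem contDiffAt (hd : Profile d) {f : E5 → ℝ} (hf : Pol d f) {z : E5}
    (hz : 0 < z.2.1) : ContDiffAt ℝ ∞ f z := by
  induction hf with
  | mono n k hc =>
    exact ContDiffAt.mul (by fun_prop) (hc.contDiffAt hd hz)
  | add _ _ h1 h2 => exact h1.add h2
  | congr _ h ih =>
    refine ih.congr_of_eventuallyEq ?_
    filter_upwards [isOpen_actPos.mem_nhds hz] with w hw using (h w hw).symm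

theorem pd (hd : Profile d) {f : E5 → ℝ} (hf : Pol d f) (v : E5) :
    Pol d (Waveguide.pd v f) := by
  induction hf with
  | @mono n k c hc =>
    obtain ⟨c', hc', h⟩ := hc.pd hd v
    -- The truncated exponents at `n = 0` and `k = 0` are harmless, because the factors `n` and `k`
    -- vanish there.
    refine (((mono (n - 1) k ((Coef.const (n * v.1)).mul hc)).add
      (mono n (k - 1) ((Coef.const (k * v.2.2.1)).mul hc))).add (mono n k hc')).congr
      fun z hz => ?_
    have e1 : DifferentiableAt ℝ (fun z : E5 => z.1 ^ n) z := by fun_prop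
    have e2 : DifferentiableAt ℝ (fun z : E5 => z.2.2.1 ^ k) z := by fun_prop
    have e3 := (hc.contDiffAt hd hz).differentiableAt (by simp)
    have f1 : fderiv ℝ (fun z : E5 => z.1 ^ n) z v = n * z.1 ^ (n - 1) * v.1 := by
      refine (fderiv_comp_coord (g := fun x => x ^ n) coordε (by fun_prop) v).trans ?_
      rw [deriv_pow_field]; rfl
    have f2 : fderiv ℝ (fun z : E5 => z.2.2.1 ^ k) z v = k * z.2.2.1 ^ (k - 1) * v.2.2.1 := by
      refine (fderiv_comp_coord (g := fun x => x ^ k) coordu (by fun_prop) v).trans ?_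
      rw [deriv_pow_field]; rfl
    simp only [Waveguide.pd]
    rw [fderiv_fun_mul (e1.fun_mul e2) e3, fderiv_fun_mul e1 e2]
    simp only [add_apply, smul_apply, smul_eq_mul,
      f1, f2, h z hz]
    ring
  | add h1 h2 ih1 ih2 =>
    refine (ih1.add ih2).congr fun z hz => ?_
    simp only [Waveguide.pd]
    rw [fderiv_fun_add ((h1.contDiffAt hd hz).differentiableAt (by simp))
      ((h2.contDiffAt hd hz).differentiableAt (by simp))]
    simp
  | congr h1 h ih =>
    refine ih.congr fun z hz => ?_
    simp only [Waveguide.pd]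
    rw [Filter.EventuallyEq.fderiv_eq]
    filter_upwards [isOpen_actPos.mem_nhds hz] with w hw using h w hw

theorem bounded (hd : Profile d) {f : E5 → ℝ} (hf : Pol d f) {ρ : ℝ} (hρ : 0 < ρ) :
    ∃ B, ∀ z ∈ Dom ρ, |f z| ≤ B := by
  induction hf with
  | mono n k hc =>
    obtain ⟨B, hB⟩ := hc.bounded hd hρ
    refine ⟨1 * ρ ^ k * B, fun z hz => ?_⟩
    rw [abs_mul, abs_mul, abs_pow, abs_pow]
    have h1 : |z.1| ^ n ≤ 1 := pow_le_one₀ (abs_nonneg _) hz.1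
    have h2 : |z.2.2.1| ^ k ≤ ρ ^ k := pow_le_pow_left₀ (abs_nonneg _) hz.2.2.2.1 k
    have h3 := hB z hz
    gcongr
  | add _ _ h1 h2 =>
    obtain ⟨A, hA⟩ := h1
    obtain ⟨B, hB⟩ := h2
    exact ⟨A + B, fun z hz => (abs_add_le _ _).trans (add_le_add (hA z hz) (hB z hz))⟩
  | congr _ h ih =>
    obtain ⟨A, hA⟩ := ih
    exact ⟨A, fun z hz => by rw [← h z (act_pos_of_mem hρ hz)]; exact hA z hz⟩

/-- The value at `ε = 0`. -/
theorem at_zero {f : E5 → ℝ} (hf : Pol d f) : Pol d fun z => f (0, z.2) := by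
  induction hf with
  | @mono n k c hc =>
    -- The constant `0 ^ n` is `1` for `n = 0` and `0` otherwise, so it selects the monomials free
    -- of `ε`.
    refine (mono 0 k ((Coef.const (0 ^ n)).mul hc)).congr fun z hz => ?_
    simp only [hc.indep (0, z.2) z rfl rfl]
    ring
  | add _ _ h1 h2 => exact h1.add h2
  | congr _ h ih => exact ih.congr fun z hz => h _ hz

end Pol

/-! ### Functions evaluated at a shifted slow coordinate. -/

namespace Shf
variable {d : ℝ → ℝ} {Q : E5 → ℝ}

theorem neg {f : E5 → ℝ} (hf : Shf d Q f) : Shf d Q fun z => -f z :=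
  ((Shf.pol (Pol.const (-1))).mul hf).congr fun z _ => by ring

theorem sub {f g : E5 → ℝ} (hf : Shf d Q f) (hg : Shf d Q g) : Shf d Q fun z => f z - g z :=
  (hf.add hg.neg).congr fun z _ => by ring

theorem contDiffAt (hd : Profile d) (hQ : Pol d Q) {f : E5 → ℝ} (hf : Shf d Q f) {z : E5}
    (hz : 0 < z.2.1) : ContDiffAt ℝ ∞ f z := by
  induction hf with
  | pol h => exact h.contDiffAt hd hz
  | @shift f h =>
    have h1 : ContDiffAt ℝ ∞ (shiftMap Q) z := by
      have := hQ.contDiffAt hd hz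
      unfold shiftMap
      fun_prop
    exact ContDiffAt.comp z (g := f) (h.contDiffAt (z := shiftMap Q z) hd hz) h1
  | add _ _ h1 h2 => exact h1.add h2
  | mul _ _ h1 h2 => exact h1.mul h2
  | congr _ h ih =>
    refine ih.congr_of_eventuallyEq ?_
    filter_upwards [isOpen_actPos.mem_nhds hz] with w hw using (h w hw).symm

theorem differentiableAt (hd : Profile d) (hQ : Pol d Q) {f : E5 → ℝ} (hf : Shf d Q f) {z : E5}
    (hz : 0 < z.2.1) : DifferentiableAt ℝ f z :=
  (hf.contDiffAt hd hQ hz).differentiableAt (by simp)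

theorem hasFDerivAt_shiftMap (hd : Profile d) (hQ : Pol d Q) {z : E5} (hz : 0 < z.2.1) (v : E5) :
    ∃ l : E5 →L[ℝ] E5, HasFDerivAt (shiftMap Q) l z ∧
      l v = v + (2 * z.1 * v.1 * Q z + z.1 ^ 2 * fderiv ℝ Q z v) • vX := by
  have hQ' := ((hQ.contDiffAt hd hz).differentiableAt (by simp)).hasFDerivAt
  have h1 : HasFDerivAt (fun z : E5 => z.1) coordε z := coordε.hasFDerivAt
  have h2 := (h1.pow 2).mul hQ'
  have h3 := (hasFDerivAt_id z).add (h2.smul_const vX)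
  refine ⟨_, h3.congr_of_eventuallyEq (Eventually.of_forall fun w => ?_), ?_⟩
  · simp only [shiftMap, vX, Pi.add_apply, id, Pi.mul_apply]
    ext <;> simp
  · simp [coordε, vX]
    ring

/-- The chain rule for the shift only produces an extra `X`-derivative, again shifted, with a factor
in `Pol d`. -/
theorem pd (hd : Profile d) (hQ : Pol d Q) {f : E5 → ℝ} (hf : Shf d Q f) (v : E5) :
    Shf d Q (Waveguide.pd v f) := by
  induction hf with
  | pol h => exact .pol (h.pd hd v)
  | @shift f h =>
    refine ((Shf.shift (h.pd hd v)).add (Shf.mul (.pol ((((Pol.const (2 * v.1)).mul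
      Pol.eps).mul hQ).add ((Pol.eps.pow 2).mul (hQ.pd hd v)))) (.shift (h.pd hd vX)))).congr
      fun z hz => ?_
    obtain ⟨l, hl, hlv⟩ := hasFDerivAt_shiftMap hd hQ hz v
    have hf' := ((h.contDiffAt (z := shiftMap Q z) hd hz).differentiableAt (by simp)).hasFDerivAt
    simp only [Waveguide.pd]
    rw [show (fun z => f (shiftMap Q z)) = f ∘ shiftMap Q from rfl,
      (HasFDerivAt.comp z hf' hl).fderiv]
    simp only [ContinuousLinearMap.comp_apply, hlv, map_add, map_smul, smul_eq_mul]
    ring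
  | add h1 h2 ih1 ih2 =>
    refine (ih1.add ih2).congr fun z hz => ?_
    simp only [Waveguide.pd]
    rw [fderiv_fun_add (h1.differentiableAt hd hQ hz) (h2.differentiableAt hd hQ hz)]
    simp
  | mul h1 h2 ih1 ih2 =>
    refine ((h1.mul ih2).add (h2.mul ih1)).congr fun z hz => ?_
    simp only [Waveguide.pd]
    rw [fderiv_fun_mul (h1.differentiableAt hd hQ hz) (h2.differentiableAt hd hQ hz)]
    simp
  | congr h1 h ih =>
    refine ih.congr fun z hz => ?_
    simp only [Waveguide.pd]
    rw [Filter.EventuallyEq.fderiv_eq]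
    filter_upwards [isOpen_actPos.mem_nhds hz] with w hw using h w hw

/-- The shift moves only `X`, which `Dom` leaves unrestricted, so shifted functions inherit the
bound. -/
theorem bounded (hd : Profile d) {f : E5 → ℝ} (hf : Shf d Q f) {ρ : ℝ} (hρ : 0 < ρ) :
    ∃ B, ∀ z ∈ Dom ρ, |f z| ≤ B := by
  induction hf with
  | pol h => exact h.bounded hd hρ
  | shift h =>
    obtain ⟨B, hB⟩ := h.bounded hd hρ
    exact ⟨B, fun z hz => hB _ hz⟩
  | add _ _ h1 h2 =>
    obtain ⟨A, hA⟩ := h1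
    obtain ⟨B, hB⟩ := h2
    exact ⟨A + B, fun z hz => (abs_add_le _ _).trans (add_le_add (hA z hz) (hB z hz))⟩
  | mul _ _ h1 h2 =>
    obtain ⟨A, hA⟩ := h1
    obtain ⟨B, hB⟩ := h2
    refine ⟨A * B, fun z hz => ?_⟩
    rw [abs_mul]
    exact mul_le_mul (hA z hz) (hB z hz) (abs_nonneg _) ((abs_nonneg _).trans (hA z hz))
  | congr _ h ih =>
    obtain ⟨A, hA⟩ := ih
    exact ⟨A, fun z hz => by rw [← h z (act_pos_of_mem hρ hz)]; exact hA z hz⟩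

/-- At `ε = 0` the shift is the identity. Hence the Taylor coefficients of the residual are back in
`Pol d`, and the recursive procedure never leaves that class. -/
theorem at_zero {f : E5 → ℝ} (hf : Shf d Q f) : Pol d fun z => f (0, z.2) := by
  induction hf with
  | pol h => exact h.at_zero
  | shift h => exact h.at_zero.congr fun z _ => by simp [shiftMap]
  | add _ _ h1 h2 => exact h1.add h2
  | mul _ _ h1 h2 => exact h1.mul h2
  | congr _ h ih => exact ih.congr fun z hz => h _ hz

theorem lipschitz (hd : Profile d) (hQ : Pol d Q) {f : E5 → ℝ} (hf : Shf d Q f) {ρ : ℝ}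
    (hρ : 0 < ρ) : ∃ B, ∀ z ∈ Dom ρ, ∀ w ∈ Dom ρ, |f z - f w| ≤ B * ‖z - w‖ := by
  obtain ⟨B1, h1⟩ := (hf.pd hd hQ vε).bounded hd hρ
  obtain ⟨B2, h2⟩ := (hf.pd hd hQ vI).bounded hd hρ
  obtain ⟨B3, h3⟩ := (hf.pd hd hQ vu).bounded hd hρ
  obtain ⟨B4, h4⟩ := (hf.pd hd hQ vp).bounded hd hρ
  obtain ⟨B5, h5⟩ := (hf.pd hd hQ vX).bounded hd hρ
  refine ⟨B1 + B2 + B3 + B4 + B5, fun z hz w hw => ?_⟩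
  have := (convex_Dom ρ).norm_image_sub_le_of_norm_hasFDerivWithin_le (f := f)
    (f' := fun z => fderiv ℝ f z) (C := B1 + B2 + B3 + B4 + B5)
    (fun x hx => (hf.differentiableAt hd hQ (act_pos_of_mem hρ hx)).hasFDerivAt.hasFDerivWithinAt)
    (fun x hx => ?_) hw hz
  · simpa [Real.norm_eq_abs] using this
  · have hB : 0 ≤ B1 + B2 + B3 + B4 + B5 := by
      have := abs_nonneg (Waveguide.pd vε f x)
      have := abs_nonneg (Waveguide.pd vI f x)
      have := abs_nonneg (Waveguide.pd vu f x)
      have := abs_nonneg (Waveguide.pd vp f x)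
      have := abs_nonneg (Waveguide.pd vX f x)
      linarith [h1 x hx, h2 x hx, h3 x hx, h4 x hx, h5 x hx]
    refine ContinuousLinearMap.opNorm_le_bound _ hB fun y => ?_
    rw [fderiv_expand, Real.norm_eq_abs]
    have n1 : |y.1| ≤ ‖y‖ := norm_fst_le y
    have m1 : ‖y.2‖ ≤ ‖y‖ := norm_snd_le y
    have n2 : |y.2.1| ≤ ‖y‖ := (norm_fst_le y.2).trans m1
    have m2 : ‖y.2.2‖ ≤ ‖y‖ := (norm_snd_le y.2).trans m1
    have n3 : |y.2.2.1| ≤ ‖y‖ := (norm_fst_le y.2.2).trans m2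
    have m3 : ‖y.2.2.2‖ ≤ ‖y‖ := (norm_snd_le y.2.2).trans m2
    have n4 : |y.2.2.2.1| ≤ ‖y‖ := (norm_fst_le y.2.2.2).trans m3
    have n5 : |y.2.2.2.2| ≤ ‖y‖ := (norm_snd_le y.2.2.2).trans m3
    have k : ∀ a b B : ℝ, |a| ≤ ‖y‖ → |b| ≤ B → |a * b| ≤ B * ‖y‖ := by
      intro a b B ha hb
      rw [abs_mul, mul_comm]
      exact mul_le_mul hb ha (abs_nonneg _) ((abs_nonneg _).trans hb)
    have k1 := k _ _ _ n1 (h1 x hx)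
    have k2 := k _ _ _ n2 (h2 x hx)
    have k3 := k _ _ _ n3 (h3 x hx)
    have k4 := k _ _ _ n4 (h4 x hx)
    have k5 := k _ _ _ n5 (h5 x hx)
    rw [abs_le] at *
    constructor <;> linarith [k1.1, k1.2, k2.1, k2.2, k3.1, k3.2, k4.1, k4.2, k5.1, k5.2]

theorem pd_comm (hd : Profile d) (hQ : Pol d Q) {f : E5 → ℝ} (hf : Shf d Q f) {z : E5}
    (hz : 0 < z.2.1) (v w : E5) :
    Waveguide.pd v (Waveguide.pd w f) z = Waveguide.pd w (Waveguide.pd v f) z := by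
  have hc := hf.contDiffAt hd hQ hz
  have hs := hc.isSymmSndFDerivAt (by simp; norm_cast)
  have hdiff : DifferentiableAt ℝ (fderiv ℝ f) z :=
    (hc.fderiv_right (m := 1) (by norm_cast)).differentiableAt (by simp)
  have key : ∀ v w : E5, Waveguide.pd v (Waveguide.pd w f) z = fderiv ℝ (fderiv ℝ f) z v w := by
    intro v w
    have := (hdiff.hasFDerivAt.clm_apply (hasFDerivAt_const w z)).fderiv
    simp only [Waveguide.pd]
    change fderiv ℝ (fun y => fderiv ℝ f y w) z v = _
    rw [this]; simp
  rw [key, key, hs.eq]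

end Shf

/-! ### Taylor expansion in `ε` -/

theorem abs_sub_taylor_le {f : ℝ → ℝ} (hf : ContDiff ℝ ∞ f) (n : ℕ) {B x : ℝ}
    (hB : ∀ y ∈ Icc (0 : ℝ) 1, |iteratedDeriv n f y| ≤ B) (hx : x ∈ Icc (0 : ℝ) 1) :
    |f x - ∑ i ∈ Finset.range n, iteratedDeriv i f 0 / (i.factorial : ℝ) * x ^ i| ≤ B * x ^ n := by
  rcases n with _ | n
  · simpa using hB x hx
  have hw : ∀ k : ℕ, ∀ y ∈ Icc (0 : ℝ) 1,
      iteratedDerivWithin k f (Icc 0 1) y = iteratedDeriv k f y := fun k y hy =>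
    iteratedDerivWithin_eq_iteratedDeriv (uniqueDiffOn_Icc one_pos)
      ((hf.of_le (by exact_mod_cast le_top)).contDiffAt) hy
  have h0 : (0 : ℝ) ∈ Icc (0 : ℝ) 1 := ⟨le_rfl, zero_le_one⟩
  have := taylor_mean_remainder_bound (f := f) (n := n) (C := B) zero_le_one
    ((hf.of_le (by exact_mod_cast le_top)).contDiffOn) hx
    (fun y hy => by rw [hw _ y hy]; exact hB y hy)
  rw [taylor_within_apply] at this
  simp only [hw _ 0 h0, sub_zero, smul_eq_mul, Real.norm_eq_abs] at this
  have hB0 : 0 ≤ B := (abs_nonneg _).trans (hB x hx)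
  have e : ∑ i ∈ Finset.range (n + 1), iteratedDeriv i f 0 / (i.factorial : ℝ) * x ^ i =
      ∑ i ∈ Finset.range (n + 1), ((i.factorial : ℝ)⁻¹ * x ^ i) * iteratedDeriv i f 0 :=
    Finset.sum_congr rfl fun i _ => by ring
  rw [e]
  refine this.trans (div_le_self (mul_nonneg hB0 (pow_nonneg hx.1 _)) ?_)
  exact_mod_cast Nat.one_le_iff_ne_zero.2 (Nat.factorial_ne_zero n)

/-- If the derivatives below `i` vanish, Taylor's formula and the bound on `f`, both divided by `x ^
i`, force the coefficient of `x ^ i` to be `O(x)` as `x → 0+`. -/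
theorem iteratedDeriv_eq_zero_of_abs_le {f : ℝ → ℝ} (hf : ContDiff ℝ ∞ f) {n : ℕ} {B : ℝ}
    (hB : ∀ x ∈ Ioc (0 : ℝ) 1, |f x| ≤ B * x ^ n) {i : ℕ} (hi : i < n) :
    iteratedDeriv i f 0 = 0 := by
  induction i using Nat.strong_induction_on with
  | _ i ih =>
    obtain ⟨A, hA⟩ : ∃ A, ∀ y ∈ Icc (0 : ℝ) 1, |iteratedDeriv (i + 1) f y| ≤ A := by
      have hc : Continuous (iteratedDeriv (i + 1) f) :=
        hf.continuous_iteratedDeriv _ (by exact_mod_cast le_top)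
      obtain ⟨A, hA⟩ := isCompact_Icc.exists_bound_of_continuousOn (s := Icc (0 : ℝ) 1)
        hc.continuousOn
      exact ⟨A, hA⟩
    have hB0 : 0 ≤ B := by simpa using (abs_nonneg _).trans (hB 1 ⟨one_pos, le_rfl⟩)
    have key : ∀ x ∈ Ioc (0 : ℝ) 1, |iteratedDeriv i f 0 / (i.factorial : ℝ)| ≤ (A + B) * x := by
      intro x hx
      have h1 := abs_sub_taylor_le hf (i + 1) hA ⟨hx.1.le, hx.2⟩
      rw [Finset.sum_range_succ, Finset.sum_eq_zero, zero_add] at h1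
      · have h2 := hB x hx
        have h3 : x ^ n ≤ x ^ (i + 1) := pow_le_pow_of_le_one hx.1.le hx.2 hi
        have h4 : |iteratedDeriv i f 0 / (i.factorial : ℝ) * x ^ i| ≤ (A + B) * x ^ (i + 1) := by
          have h5 := abs_sub_abs_le_abs_sub (iteratedDeriv i f 0 / (i.factorial : ℝ) * x ^ i) (f x)
          rw [abs_sub_comm] at h5
          have h6 := mul_le_mul_of_nonneg_left h3 hB0
          linarith
        rw [abs_mul, abs_of_pos (pow_pos hx.1 i), pow_succ', ← mul_assoc] at h4
        exact le_of_mul_le_mul_right h4 (pow_pos hx.1 i)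
      · intro j hj
        rw [ih j (Finset.mem_range.1 hj) ((Finset.mem_range.1 hj).trans hi)]; simp
    have hlim : Tendsto (fun x : ℝ => (A + B) * x) (𝓝[>] 0) (𝓝 0) := by
      have : Tendsto (fun x : ℝ => (A + B) * x) (𝓝 0) (𝓝 ((A + B) * 0)) :=
        (continuous_const.mul continuous_id).tendsto 0
      rw [mul_zero] at this
      exact this.mono_left nhdsWithin_le_nhds
    have hle := ge_of_tendsto hlim (b := |iteratedDeriv i f 0 / (i.factorial : ℝ)|) (by
      filter_upwards [Ioc_mem_nhdsGT (zero_lt_one (α := ℝ))] with x hx using key x hx)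
    have := abs_nonpos_iff.1 hle
    rcases div_eq_zero_iff.1 this with h | h
    · exact h
    · exact absurd (by exact_mod_cast h) (Nat.factorial_ne_zero i)

theorem hasDerivAt_comp_curve {G : E5 → ℝ} {c : ℝ → E5} {v : E5} {t : ℝ}
    (hG : DifferentiableAt ℝ G (c t)) (hc : HasDerivAt c v t) :
    HasDerivAt (fun s => G (c s)) (fderiv ℝ G (c t) v) t :=
  hG.hasFDerivAt.comp_hasDerivAt t hc

namespace Shf
variable {d : ℝ → ℝ} {Q : E5 → ℝ}

theorem pd_iter (hd : Profile d) (hQ : Pol d Q) {f : E5 → ℝ} (hf : Shf d Q f) (v : E5) (n : ℕ) :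
    Shf d Q ((Waveguide.pd v)^[n] f) := by
  induction n with
  | zero => exact hf
  | succ n ih => rw [Function.iterate_succ_apply']; exact ih.pd hd hQ v

/-- Rewrites iterated derivatives in `ε` as iterated directional derivatives, for which the bounds
of the class are available. -/
theorem iteratedDeriv_eps (hd : Profile d) (hQ : Pol d Q) {f : E5 → ℝ} (hf : Shf d Q f)
    {w : ℝ × ℝ × ℝ × ℝ} (hw : 0 < w.1) (n : ℕ) :
    iteratedDeriv n (fun e => f (e, w)) = fun e => (Waveguide.pd vε)^[n] f (e, w) := by
  induction n with
  | zero => simp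
  | succ n ih =>
    rw [iteratedDeriv_succ, ih]
    funext e
    have hc : HasDerivAt (fun e : ℝ => ((e, w) : E5)) vε e :=
      (hasDerivAt_id e).prodMk (hasDerivAt_const e w)
    rw [Function.iterate_succ_apply']
    exact (hasDerivAt_comp_curve
      ((hf.pd_iter hd hQ vε n).differentiableAt hd hQ (z := (e, w)) hw) hc).deriv

theorem contDiff_eps (hd : Profile d) (hQ : Pol d Q) {f : E5 → ℝ} (hf : Shf d Q f)
    {w : ℝ × ℝ × ℝ × ℝ} (hw : 0 < w.1) : ContDiff ℝ ∞ fun e => f (e, w) := by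
  rw [contDiff_iff_contDiffAt]
  intro e
  exact ContDiffAt.comp e (g := f) (hf.contDiffAt hd hQ (z := (e, w)) hw)
    (f := fun e : ℝ => ((e, w) : E5)) (by fun_prop)

theorem taylor (hd : Profile d) (hQ : Pol d Q) {f : E5 → ℝ} (hf : Shf d Q f) (n : ℕ) {ρ : ℝ}
    (hρ : 0 < ρ) : ∃ B, ∀ z ∈ Dom ρ, 0 ≤ z.1 →
      |f z - ∑ i ∈ Finset.range n, (Waveguide.pd vε)^[i] f (0, z.2) / (i.factorial : ℝ) * z.1 ^ i|
        ≤ B * z.1 ^ n := by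
  obtain ⟨B, hB⟩ := (hf.pd_iter hd hQ vε n).bounded hd hρ
  refine ⟨B, fun z hz h0 => ?_⟩
  have hw := act_pos_of_mem hρ hz
  have h1 : z.1 ∈ Icc (0 : ℝ) 1 := ⟨h0, (le_abs_self _).trans hz.1⟩
  have := abs_sub_taylor_le (hf.contDiff_eps hd hQ hw) n (B := B) (fun y hy => ?_) h1
  · simpa only [hf.iteratedDeriv_eps hd hQ hw] using this
  · rw [hf.iteratedDeriv_eps hd hQ hw]
    exact hB (y, z.2) ⟨by rw [abs_of_nonneg hy.1]; exact hy.2, hz.2⟩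

/-- `f` is of order `ε ^ n`, uniformly in bounded regions. -/
def IsOrder (f : E5 → ℝ) (n : ℕ) : Prop :=
  ∀ ρ : ℝ, 0 < ρ → ∃ B, ∀ z ∈ Dom ρ, 0 ≤ z.1 → |f z| ≤ B * z.1 ^ n

theorem pd_iter_eq_zero (hd : Profile d) (hQ : Pol d Q) {f : E5 → ℝ} (hf : Shf d Q f) {n : ℕ}
    (hn : IsOrder f n) {i : ℕ} (hi : i < n) {w : ℝ × ℝ × ℝ × ℝ} (hw : 0 < w.1) :
    (Waveguide.pd vε)^[i] f (0, w) = 0 := by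
  -- Any radius above `w.1`, `w.1⁻¹` and the sizes of phase and momentum puts the whole segment `0 <
  -- ε ≤ 1` over `w` into `Dom`.
  have hρ : 0 < w.1 + w.1⁻¹ + |w.2.1| + |w.2.2.1| := by positivity
  obtain ⟨B, hB⟩ := hn _ hρ
  have hi' := inv_pos.2 hw
  have h1 := abs_nonneg w.2.1
  have h2 := abs_nonneg w.2.2.1
  have := iteratedDeriv_eq_zero_of_abs_le (hf.contDiff_eps hd hQ hw) (n := n) (B := B)
    (fun x hx => hB (x, w) ⟨by rw [abs_of_pos hx.1]; exact hx.2, ?_, ?_, ?_, ?_⟩ hx.1.le) hi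
  · rwa [hf.iteratedDeriv_eps hd hQ hw] at this
  · exact inv_le_of_inv_le₀ hw (by linarith)
  · change w.1 ≤ _; linarith
  · change |w.2.1| ≤ _; linarith
  · change |w.2.2.1| ≤ _; linarith

/-- Together with `pd_iter_eq_zero` this turns the analytic statement "of order `ε ^ n`" into the
vanishing of the first `n` Taylor coefficients at `ε = 0`, which survives differentiation. -/
theorem isOrder_of_eq_zero (hd : Profile d) (hQ : Pol d Q) {f : E5 → ℝ} (hf : Shf d Q f) {n : ℕ}
    (h : ∀ i < n, ∀ w : ℝ × ℝ × ℝ × ℝ, 0 < w.1 → (Waveguide.pd vε)^[i] f (0, w) = 0) :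
    IsOrder f n := by
  intro ρ hρ
  obtain ⟨B, hB⟩ := hf.taylor hd hQ n hρ
  refine ⟨B, fun z hz h0 => ?_⟩
  have := hB z hz h0
  rwa [Finset.sum_eq_zero, sub_zero] at this
  intro i hi
  rw [h i (Finset.mem_range.1 hi) _ (act_pos_of_mem hρ hz)]; simp

/-- A size estimate alone would say nothing about derivatives. Here the first `n` coefficients in
`ε` vanish identically for `I > 0`, and differentiation in a direction without `ε`-component
commutes with taking coefficients. -/
theorem IsOrder.pd (hd : Profile d) (hQ : Pol d Q) {f : E5 → ℝ} (hf : Shf d Q f) {n : ℕ}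
    (hn : IsOrder f n) {v : E5} (hv : v.1 = 0) : IsOrder (Waveguide.pd v f) n := by
  refine isOrder_of_eq_zero hd hQ (hf.pd hd hQ v) fun i hi w hw => ?_
  have comm : ∀ (i : ℕ) (z : E5), 0 < z.2.1 →
      (Waveguide.pd vε)^[i] (Waveguide.pd v f) z = Waveguide.pd v ((Waveguide.pd vε)^[i] f) z := by
    intro i
    induction i with
    | zero => intro z _; rfl
    | succ i ih =>
      intro z hz
      rw [Function.iterate_succ_apply', Function.iterate_succ_apply',
        ← (hf.pd_iter hd hQ vε i).pd_comm hd hQ hz vε v]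
      have : (Waveguide.pd vε)^[i] (Waveguide.pd v f) =ᶠ[𝓝 z]
          Waveguide.pd v ((Waveguide.pd vε)^[i] f) := by
        filter_upwards [isOpen_actPos.mem_nhds hz] with y hy using ih y hy
      simp only [Waveguide.pd] at this ⊢
      rw [this.fderiv_eq]
  rw [comm i _ hw]
  have hc : HasDerivAt (fun t : ℝ => ((0, w) : E5) + t • v) v 0 := by
    simpa using ((hasDerivAt_id (0 : ℝ)).smul_const v).const_add ((0, w) : E5)
  have h0 : ((0, w) : E5) + (0 : ℝ) • v = (0, w) := by simp
  have hdiff := (hf.pd_iter hd hQ vε i).differentiableAt hd hQ (z := (0, w)) hw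
  have h1 := hasDerivAt_comp_curve (G := (Waveguide.pd vε)^[i] f)
    (c := fun t : ℝ => ((0, w) : E5) + t • v) (t := 0) (by rw [h0]; exact hdiff) hc
  rw [h0] at h1
  have h2 : (fun t : ℝ => (Waveguide.pd vε)^[i] f (((0, w) : E5) + t • v)) =ᶠ[𝓝 0]
      fun _ => (0 : ℝ) := by
    have : ∀ᶠ t : ℝ in 𝓝 0, (((0, w) : E5) + t • v) ∈ {z : E5 | 0 < z.2.1} := by
      refine hc.continuousAt.eventually_mem (isOpen_actPos.mem_nhds ?_)
      rw [h0]; exact hw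
    filter_upwards [this] with t ht
    have e : ((0, w) : E5) + t • v = (0, (((0, w) : E5) + t • v).2) := by
      ext <;> simp [hv]
    rw [e]
    exact hf.pd_iter_eq_zero hd hQ hn hi ht
  exact h1.unique ((hasDerivAt_const (0 : ℝ) (0 : ℝ)).congr_of_eventuallyEq h2)

end Shf

/-! ### The functions of the perturbation procedure -/

section Integrals
variable {d : ℝ → ℝ}

theorem Pol.continuous_phase (hd : Profile d) {f : E5 → ℝ} (hf : Pol d f) {z : E5}
    (hz : 0 < z.2.1) : Continuous fun v => f (z.1, z.2.1, v, z.2.2.2) := by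
  rw [continuous_iff_continuousAt]
  intro v
  exact ContinuousAt.comp (f := fun v : ℝ => ((z.1, z.2.1, v, z.2.2.2) : E5)) (g := f)
    (hf.contDiffAt hd (z := (z.1, z.2.1, v, z.2.2.2)) hz).continuousAt (by fun_prop)

/-- Polynomials in the phase integrate explicitly, so averages (and likewise primitives, below) of
symbols are symbols. -/
theorem Pol.integral (hd : Profile d) {f : E5 → ℝ} (hf : Pol d f) (a b : ℝ) :
    Pol d fun z => ∫ v in a..b, f (z.1, z.2.1, v, z.2.2.2) := by
  induction hf with
  | @mono n k c hc =>
    refine (Pol.mono n 0 ((Coef.const ((b ^ (k + 1) - a ^ (k + 1)) / (k + 1))).mul hc)).congr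
      fun z _ => ?_
    have : ∀ v : ℝ, z.1 ^ n * v ^ k * c (z.1, z.2.1, v, z.2.2.2) = (z.1 ^ n * c z) * v ^ k := by
      intro v
      rw [hc.indep (z.1, z.2.1, v, z.2.2.2) z rfl rfl]; ring
    simp only [this]
    rw [intervalIntegral.integral_const_mul, integral_pow]; ring
  | @add f g hf hg h1 h2 =>
    refine (h1.add h2).congr fun z hz => ?_
    rw [intervalIntegral.integral_add ((hf.continuous_phase hd hz).intervalIntegrable _ _)
      ((hg.continuous_phase hd hz).intervalIntegrable _ _)]
  | congr _ h ih =>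
    refine ih.congr fun z hz => ?_
    exact intervalIntegral.integral_congr fun v _ => h _ hz

theorem Pol.primitive (hd : Profile d) {f : E5 → ℝ} (hf : Pol d f) :
    Pol d fun z => ∫ v in (0 : ℝ)..z.2.2.1, f (z.1, z.2.1, v, z.2.2.2) := by
  induction hf with
  | @mono n k c hc =>
    refine (Pol.mono n (k + 1) ((Coef.const (1 / (k + 1))).mul hc)).congr fun z _ => ?_
    have : ∀ v : ℝ, z.1 ^ n * v ^ k * c (z.1, z.2.1, v, z.2.2.2) = (z.1 ^ n * c z) * v ^ k := by
      intro v
      rw [hc.indep (z.1, z.2.1, v, z.2.2.2) z rfl rfl]; ring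
    simp only [this]
    rw [intervalIntegral.integral_const_mul, integral_pow]; simp; ring
  | @add f g hf hg h1 h2 =>
    refine (h1.add h2).congr fun z hz => ?_
    rw [intervalIntegral.integral_add ((hf.continuous_phase hd hz).intervalIntegrable _ _)
      ((hg.continuous_phase hd hz).intervalIntegrable _ _)]
  | congr _ h ih =>
    refine ih.congr fun z hz => ?_
    exact intervalIntegral.integral_congr fun v _ => h _ hz

theorem Pol.average (hd : Profile d) {f : E5 → ℝ} (hf : Pol d f) :
    Pol d fun z => NormalForm.average fun v => f (z.1, z.2.1, v, z.2.2.2) :=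
  (hf.integral hd (-Real.pi) Real.pi).const_mul _

theorem Pol.width (d : ℝ → ℝ) : Pol d fun z => d z.2.2.2.2 :=
  (Pol.of_coef (.jet 0)).congr fun z _ => by simp
theorem Pol.slope (d : ℝ → ℝ) : Pol d fun z => deriv d z.2.2.2.2 :=
  (Pol.of_coef (.jet 1)).congr fun z _ => by simp
theorem Pol.widthInv (d : ℝ → ℝ) : Pol d fun z => (d z.2.2.2.2)⁻¹ := Pol.of_coef .dinv
theorem Pol.act (d : ℝ → ℝ) : Pol d fun z => z.2.1 := Pol.of_coef .act
theorem Pol.actInv (d : ℝ → ℝ) : Pol d fun z => (z.2.1)⁻¹ := Pol.of_coef .inv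
theorem Pol.mom (d : ℝ → ℝ) : Pol d fun z => z.2.2.2.1 := Pol.of_coef .mom

end Integrals

/-! ### One step of the procedure inside the symbol classes. -/

def Hmap (d : ℝ → ℝ) (z : E5) : ℝ := hamiltonian d z.1 z.2.1 z.2.2.1 z.2.2.2.1 z.2.2.2.2

namespace NormalForm

def Smap (N : NormalForm) (z : E5) : ℝ := N.S z.1 z.2.1 z.2.2.1 z.2.2.2.1 z.2.2.2.2
def Kmap (N : NormalForm) (z : E5) : ℝ := N.K z.1 z.2.1 z.2.2.2.1 z.2.2.2.2
def Rmap (d : ℝ → ℝ) (N : NormalForm) (z : E5) : ℝ :=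
  N.residual d z.1 z.2.1 z.2.2.1 z.2.2.2.1 z.2.2.2.2
def coeffMap (d : ℝ → ℝ) (m : ℕ) (N : NormalForm) (z : E5) : ℝ :=
  N.coeff d m z.2.1 z.2.2.1 z.2.2.2.1 z.2.2.2.2
def nextKmap (d : ℝ → ℝ) (m : ℕ) (N : NormalForm) (z : E5) : ℝ :=
  N.nextK d m z.2.1 z.2.2.2.1 z.2.2.2.2
def nextSmap (d : ℝ → ℝ) (m : ℕ) (N : NormalForm) (z : E5) : ℝ :=
  N.nextS d m z.2.1 z.2.2.1 z.2.2.2.1 z.2.2.2.2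

/-- The mixed-variable point `(ε, I + ε ∂S/∂φ, u, p + ε² ∂S/∂X, X)`. -/
def oldPoint (N : NormalForm) (z : E5) : E5 :=
  (z.1, z.2.1 + z.1 * pd vu N.Smap z, z.2.2.1, z.2.2.2.1 + z.1 ^ 2 * pd vX N.Smap z, z.2.2.2.2)

variable {d : ℝ → ℝ} {N : NormalForm}

/-- The definitions use one-variable derivatives; the calculus of symbols uses directional
derivatives on `E5`. They are identified where `S` is differentiable, namely for `I > 0`; the next
three lemmas do the same for the other variables. -/
theorem dI_eq (hd : Profile d) (hS : Pol d N.Smap) {z : E5} (hz : 0 < z.2.1) :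
    N.dI z.1 z.2.1 z.2.2.1 z.2.2.2.1 z.2.2.2.2 = pd vI N.Smap z :=
  (hasDerivAt_comp_curve (G := N.Smap) (c := fun s => (z.1, s, z.2.2)) (t := z.2.1)
    ((hS.contDiffAt hd hz).differentiableAt (by simp))
    ((hasDerivAt_const _ _).prodMk ((hasDerivAt_id _).prodMk (hasDerivAt_const _ _)))).deriv

theorem dφ_eq (hd : Profile d) (hS : Pol d N.Smap) {z : E5} (hz : 0 < z.2.1) :
    N.dφ z.1 z.2.1 z.2.2.1 z.2.2.2.1 z.2.2.2.2 = pd vu N.Smap z :=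
  (hasDerivAt_comp_curve (G := N.Smap) (c := fun s => (z.1, z.2.1, s, z.2.2.2)) (t := z.2.2.1)
    ((hS.contDiffAt hd hz).differentiableAt (by simp))
    ((hasDerivAt_const _ _).prodMk ((hasDerivAt_const _ _).prodMk
      ((hasDerivAt_id _).prodMk (hasDerivAt_const _ _))))).deriv

theorem dp_eq (hd : Profile d) (hS : Pol d N.Smap) {z : E5} (hz : 0 < z.2.1) :
    N.dp z.1 z.2.1 z.2.2.1 z.2.2.2.1 z.2.2.2.2 = pd vp N.Smap z :=
  (hasDerivAt_comp_curve (G := N.Smap) (c := fun s => (z.1, z.2.1, z.2.2.1, s, z.2.2.2.2))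
    (t := z.2.2.2.1) ((hS.contDiffAt hd hz).differentiableAt (by simp))
    ((hasDerivAt_const _ _).prodMk ((hasDerivAt_const _ _).prodMk
      ((hasDerivAt_const _ _).prodMk ((hasDerivAt_id _).prodMk (hasDerivAt_const _ _)))))).deriv

theorem dX_eq (hd : Profile d) (hS : Pol d N.Smap) {z : E5} (hz : 0 < z.2.1) :
    N.dX z.1 z.2.1 z.2.2.1 z.2.2.2.1 z.2.2.2.2 = pd vX N.Smap z :=
  (hasDerivAt_comp_curve (G := N.Smap) (c := fun s => (z.1, z.2.1, z.2.2.1, z.2.2.2.1, s))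
    (t := z.2.2.2.2) ((hS.contDiffAt hd hz).differentiableAt (by simp))
    ((hasDerivAt_const _ _).prodMk ((hasDerivAt_const _ _).prodMk
      ((hasDerivAt_const _ _).prodMk ((hasDerivAt_const _ _).prodMk (hasDerivAt_id _)))))).deriv

theorem Rmap_eq (hd : Profile d) (hS : Pol d N.Smap) {z : E5} (hz : 0 < z.2.1) :
    N.Rmap d z = Hmap d (N.oldPoint z) - N.Kmap (shiftMap (pd vp N.Smap) z) := by
  simp only [Rmap, residual, dφ_eq hd hS hz, dX_eq hd hS hz, dp_eq hd hS hz]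
  rfl

theorem pol_Hmap_oldPoint (hd : Profile d) (hS : Pol d N.Smap) :
    Pol d fun z => Hmap d (N.oldPoint z) := by
  have a := (Pol.act d).add (Pol.eps.mul (hS.pd hd vu))
  have b := (Pol.mom d).add ((Pol.eps.pow 2).mul (hS.pd hd vX))
  refine ((((a.pow 2).mul ((Pol.widthInv d).pow 2)).const_mul (Real.pi ^ 2)).add
    ((b.sub (Pol.eps.mul ((a.mul ((Pol.slope d).mul (Pol.widthInv d))).mul Pol.phase))).pow 2)
    |>.sub (Pol.const 1)).congr fun z _ => ?_
  simp only [Hmap, oldPoint, hamiltonian]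
  ring

/-- The part coming from the exact Hamiltonian is a polynomial symbol. Only `K`, taken at `X + ε²
∂S/∂p`, requires the larger class. -/
theorem shf_Rmap (hd : Profile d) (hS : Pol d N.Smap) (hK : Pol d N.Kmap) :
    Shf d (pd vp N.Smap) (N.Rmap d) :=
  ((Shf.pol (pol_Hmap_oldPoint hd hS)).sub (Shf.shift hK)).congr fun _ hz =>
    (Rmap_eq hd hS hz).symm

theorem coeffMap_eq (hd : Profile d) (hS : Pol d N.Smap) (hK : Pol d N.Kmap) (m : ℕ) {z : E5}
    (hz : 0 < z.2.1) :
    N.coeffMap d m z = (pd vε)^[m + 1] (N.Rmap d) (0, z.2) / (Nat.factorial (m + 1) : ℝ) := by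
  have := congrFun ((shf_Rmap hd hS hK).iteratedDeriv_eps hd (hS.pd hd vp) (w := z.2) hz (m + 1)) 0
  simp only [coeffMap, coeff, ← this]
  rfl

theorem pol_coeffMap (hd : Profile d) (hS : Pol d N.Smap) (hK : Pol d N.Kmap) (m : ℕ) :
    Pol d (N.coeffMap d m) :=
  ((((shf_Rmap hd hS hK).pd_iter hd (hS.pd hd vp) vε (m + 1)).at_zero).const_mul
    (Nat.factorial (m + 1) : ℝ)⁻¹).congr fun z hz => by
      rw [coeffMap_eq hd hS hK m hz]; ring

theorem pol_nextKmap (hd : Profile d) (hS : Pol d N.Smap) (hK : Pol d N.Kmap) (m : ℕ) :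
    Pol d (N.nextKmap d m) :=
  (pol_coeffMap hd hS hK m).average hd

/-- The phase derivative of the next term of the generating function. -/
def slopeS (d : ℝ → ℝ) (m : ℕ) (N : NormalForm) (z : E5) : ℝ :=
  (N.nextKmap d m z - N.coeffMap d m z) / (2 * Real.pi ^ 2 * z.2.1 / d z.2.2.2.2 ^ 2)

theorem pol_slopeS (hd : Profile d) (hS : Pol d N.Smap) (hK : Pol d N.Kmap) (m : ℕ) :
    Pol d (N.slopeS d m) :=
  ((((pol_nextKmap hd hS hK m).sub (pol_coeffMap hd hS hK m)).mul
    ((Pol.actInv d).mul ((Pol.width d).pow 2))).const_mul (2 * Real.pi ^ 2)⁻¹).congr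
    fun z hz => by
      have := hd.d_pos z.2.2.2.2
      have := Real.pi_pos
      simp only [slopeS]
      field_simp

theorem nextSmap_eq (m : ℕ) (z : E5) : N.nextSmap d m z =
    (∫ v in (0 : ℝ)..z.2.2.1, N.slopeS d m (z.1, z.2.1, v, z.2.2.2)) -
      average fun u => ∫ v in (0 : ℝ)..u, N.slopeS d m (z.1, z.2.1, v, z.2.2.2) := rfl

theorem pol_nextSmap (hd : Profile d) (hS : Pol d N.Smap) (hK : Pol d N.Kmap) (m : ℕ) :
    Pol d (N.nextSmap d m) :=
  have h := (pol_slopeS hd hS hK m).primitive hd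
  h.sub (h.average hd)

theorem pd_nextSmap (hd : Profile d) (hS : Pol d N.Smap) (hK : Pol d N.Kmap) (m : ℕ) {z : E5}
    (hz : 0 < z.2.1) : pd vu (N.nextSmap d m) z = N.slopeS d m z := by
  have h1 := hasDerivAt_comp_curve (G := N.nextSmap d m) (c := fun s => (z.1, z.2.1, s, z.2.2.2))
    (t := z.2.2.1) (((pol_nextSmap hd hS hK m).contDiffAt hd hz).differentiableAt (by simp))
    ((hasDerivAt_const _ _).prodMk ((hasDerivAt_const _ _).prodMk
      ((hasDerivAt_id _).prodMk (hasDerivAt_const _ _))))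
  have hc := (pol_slopeS hd hS hK m).continuous_phase hd hz
  have h2 := (intervalIntegral.integral_hasDerivAt_right (hc.intervalIntegrable 0 z.2.2.1)
    (hc.stronglyMeasurableAtFilter _ _) hc.continuousAt).sub_const
      (average fun u => ∫ v in (0 : ℝ)..u, N.slopeS d m (z.1, z.2.1, v, z.2.2.2))
  exact h1.unique h2

/-- The increment over a period is the integral of `(𝓗_{m+1} - coeff) / ω`, with `ω` independent of
the phase, and it vanishes because `𝓗_{m+1}` is the average of `coeff`. The later treatment of
reflections rests on this. -/
theorem nextSmap_periodic (hd : Profile d) (hS : Pol d N.Smap) (hK : Pol d N.Kmap) (m : ℕ)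
    {ε I : ℝ} (hI : 0 < I) (q : ℝ × ℝ) :
    N.nextSmap d m (ε, I, Real.pi, q) = N.nextSmap d m (ε, I, -Real.pi, q) := by
  rw [nextSmap_eq, nextSmap_eq]
  have hc := (pol_slopeS hd hS hK m).continuous_phase hd (z := (ε, I, 0, q)) hI
  have hcc := (pol_coeffMap hd hS hK m).continuous_phase hd (z := (ε, I, 0, q)) hI
  congr 1
  rw [← sub_eq_zero, intervalIntegral.integral_interval_sub_left (hc.intervalIntegrable _ _)
    (hc.intervalIntegrable _ _)]
  have hpi := Real.pi_pos
  simp only [slopeS]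
  rw [intervalIntegral.integral_div, div_eq_zero_iff]
  left
  have hk : ∀ v, N.nextKmap d m (ε, I, v, q) = N.nextKmap d m (ε, I, 0, q) := fun _ => rfl
  simp only [hk]
  rw [intervalIntegral.integral_sub (by simp) (hcc.intervalIntegrable _ _),
    intervalIntegral.integral_const]
  have : N.nextKmap d m (ε, I, 0, q) = (2 * Real.pi)⁻¹ *
      ∫ u in (-Real.pi)..Real.pi, N.coeffMap d m (ε, I, u, q) := rfl
  rw [this]
  simp only [smul_eq_mul]
  field_simp
  ring

theorem Smap_step (m : ℕ) (z : E5) :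
    (N.step d m).Smap z = N.Smap z + z.1 ^ m * N.nextSmap d m z := rfl

theorem Kmap_step (m : ℕ) (z : E5) :
    (N.step d m).Kmap z = N.Kmap z + z.1 ^ (m + 1) * N.nextKmap d m z := rfl

end NormalForm
open NormalForm

/-! ### The iterates and the order of their residual. -/

variable {d : ℝ → ℝ}

theorem pol_Kmap_zero (d : ℝ → ℝ) : Pol d (iterate d 0).Kmap :=
  ((((Pol.act d).pow 2).mul ((Pol.widthInv d).pow 2)).const_mul (Real.pi ^ 2)
    |>.add ((Pol.mom d).pow 2) |>.sub (Pol.const 1)).congr fun z _ => by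
      simp only [Kmap, iterate]; ring

theorem pol_iterate (hd : Profile d) (m : ℕ) :
    Pol d (iterate d m).Smap ∧ Pol d (iterate d m).Kmap := by
  induction m with
  | zero => exact ⟨Pol.const 0, pol_Kmap_zero d⟩
  | succ m ih =>
    exact ⟨ih.1.add ((Pol.eps.pow m).mul (pol_nextSmap hd ih.1 ih.2 m)),
      ih.2.add ((Pol.eps.pow (m + 1)).mul (pol_nextKmap hd ih.1 ih.2 m))⟩

theorem Smap_iterate_periodic (hd : Profile d) (m : ℕ) {ε I : ℝ} (hI : 0 < I) (q : ℝ × ℝ) :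
    (iterate d m).Smap (ε, I, Real.pi, q) = (iterate d m).Smap (ε, I, -Real.pi, q) := by
  induction m with
  | zero => rfl
  | succ m ih =>
    simp only [iterate, Smap_step, ih]
    rw [nextSmap_periodic hd (pol_iterate hd m).1 (pol_iterate hd m).2 m hI]

/-- Later steps change `S` only by terms of order `ε ^ m`. -/
theorem Smap_iterate_add (hd : Profile d) (m n : ℕ) : ∃ G, Pol d G ∧
    ∀ z, (iterate d (m + n)).Smap z = (iterate d m).Smap z + z.1 ^ m * G z := by
  induction n with
  | zero => exact ⟨_, Pol.const 0, fun z => by simp⟩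
  | succ n ih =>
    obtain ⟨G, hG, h⟩ := ih
    refine ⟨_, hG.add ((Pol.eps.pow n).mul (pol_nextSmap hd (pol_iterate hd (m + n)).1
      (pol_iterate hd (m + n)).2 (m + n))), fun z => ?_⟩
    rw [← add_assoc, iterate, Smap_step, h]; ring

/-- `K` is a perturbation of `𝓗₀` of relative size `ε`; used to read off the velocities of the slow
motion from the explicit `𝓗₀`. -/
theorem Kmap_iterate (hd : Profile d) (m : ℕ) : ∃ G, Pol d G ∧
    ∀ z, (iterate d m).Kmap z = (iterate d 0).Kmap z + z.1 * G z := by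
  induction m with
  | zero => exact ⟨_, Pol.const 0, fun z => by simp⟩
  | succ m ih =>
    obtain ⟨G, hG, h⟩ := ih
    refine ⟨_, hG.add ((Pol.eps.pow m).mul (pol_nextKmap hd (pol_iterate hd m).1
      (pol_iterate hd m).2 m)), fun z => ?_⟩
    change (iterate d m).Kmap z + z.1 ^ (m + 1) * nextKmap d m (iterate d m) z = _
    rw [h]; ring

theorem pd_step (hd : Profile d) (m : ℕ) {N : NormalForm} (hS : Pol d N.Smap)
    (hK : Pol d N.Kmap) {v : E5} (hv : v.1 = 0) {z : E5} (hz : 0 < z.2.1) :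
    pd v (N.step d m).Smap z = pd v N.Smap z + z.1 ^ m * pd v (N.nextSmap d m) z := by
  have h1 := ((hS.contDiffAt hd hz).differentiableAt (by simp))
  have h2 := (((pol_nextSmap hd hS hK m).contDiffAt hd hz).differentiableAt (by simp))
  have h3 : DifferentiableAt ℝ (fun z : E5 => z.1 ^ m) z := by fun_prop
  have f1 : fderiv ℝ (fun z : E5 => z.1 ^ m) z v = 0 := by
    refine (fderiv_comp_coord (g := fun x => x ^ m) coordε (by fun_prop) v).trans ?_
    simp [coordε, hv]
  have : (N.step d m).Smap = fun z => N.Smap z + z.1 ^ m * N.nextSmap d m z := rfl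
  rw [this]
  simp only [pd]
  rw [fderiv_fun_add h1 (h3.fun_mul h2), fderiv_fun_mul h3 h2]
  simp [f1]

theorem norm_vX : ‖vX‖ = 1 := by simp [vX, Prod.norm_def]

theorem norm_shiftMap_sub (Q Q' : E5 → ℝ) (z : E5) :
    ‖shiftMap Q z - shiftMap Q' z‖ = z.1 ^ 2 * |Q z - Q' z| := by
  have : shiftMap Q z - shiftMap Q' z = (z.1 ^ 2 * (Q z - Q' z)) • vX := by
    simp only [shiftMap, vX]
    ext <;> simp
    ring
  rw [this, norm_smul, norm_vX, mul_one, norm_mul, Real.norm_eq_abs, Real.norm_eq_abs,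
    abs_of_nonneg (sq_nonneg _)]

/-- The terms of order `ε ^ (m + 2)` in the change of `Hmap` caused by one step. -/
def stepErr (d : ℝ → ℝ) (m : ℕ) (N : NormalForm) (z : E5) : ℝ :=
  Real.pi ^ 2 * (d z.2.2.2.2)⁻¹ ^ 2 *
      (2 * (pd vu N.Smap z * pd vu (N.nextSmap d m) z) +
        z.1 ^ m * pd vu (N.nextSmap d m) z ^ 2) +
    (pd vX (N.nextSmap d m) z - pd vu (N.nextSmap d m) z *
        (deriv d z.2.2.2.2 * (d z.2.2.2.2)⁻¹ * z.2.2.1)) *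
      (z.2.2.2.1 + z.1 ^ 2 * pd vX N.Smap z +
          (z.2.2.2.1 + z.1 ^ 2 * pd vX (N.step d m).Smap z) -
        z.1 * ((z.2.1 + z.1 * pd vu N.Smap z + (z.2.1 + z.1 * pd vu (N.step d m).Smap z)) *
          (deriv d z.2.2.2.2 * (d z.2.2.2.2)⁻¹ * z.2.2.1)))

theorem pol_stepErr (hd : Profile d) (m : ℕ) {N : NormalForm} (hS : Pol d N.Smap)
    (hK : Pol d N.Kmap) : Pol d (stepErr d m N) := by
  have hs := pol_nextSmap hd hS hK m
  have hS' : Pol d (N.step d m).Smap := hS.add ((Pol.eps.pow m).mul hs)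
  have a := (Pol.act d).add (Pol.eps.mul (hS.pd hd vu))
  have b := (Pol.mom d).add ((Pol.eps.pow 2).mul (hS.pd hd vX))
  have a' := (Pol.act d).add (Pol.eps.mul (hS'.pd hd vu))
  have b' := (Pol.mom d).add ((Pol.eps.pow 2).mul (hS'.pd hd vX))
  have g := ((Pol.slope d).mul (Pol.widthInv d)).mul Pol.phase
  exact ((((((Pol.widthInv d).pow 2).const_mul (Real.pi ^ 2)).mul
    (((hS.pd hd vu).mul (hs.pd hd vu)).const_mul 2 |>.add
      ((Pol.eps.pow m).mul ((hs.pd hd vu).pow 2)))).add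
    (((hs.pd hd vX).sub ((hs.pd hd vu).mul g)).mul
      ((b.add b').sub (Pol.eps.mul ((a.add a').mul g))))))

/-- The new term shifts the action by `ε ^ (m + 1) ∂S_{m+1}/∂φ` and the momentum by a term of order
`ε ^ (m + 2)`. The linear effect of the former, with the frequency `2 π² I / d²`, is `𝓗_{m+1} -
coeff` by the choice of `S_{m+1}`; all else goes into `stepErr`. Since the Hamiltonian is quadratic
in the shifted variables, this is an exact identity. -/
theorem Hmap_step (hd : Profile d) (m : ℕ) {N : NormalForm} (hS : Pol d N.Smap)
    (hK : Pol d N.Kmap) {z : E5} (hz : 0 < z.2.1) :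
    Hmap d ((N.step d m).oldPoint z) = Hmap d (N.oldPoint z) +
      z.1 ^ (m + 1) * (N.nextKmap d m z - N.coeffMap d m z) + z.1 ^ (m + 2) * stepErr d m N z := by
  have hdp := hd.d_pos z.2.2.2.2
  have pu := pd_step hd m hS hK (v := vu) rfl hz
  have pX := pd_step hd m hS hK (v := vX) rfl hz
  have hω : Real.pi ^ 2 * 2 * z.2.1 * (d z.2.2.2.2)⁻¹ ^ 2 * pd vu (N.nextSmap d m) z =
      N.nextKmap d m z - N.coeffMap d m z := by
    rw [pd_nextSmap hd hS hK m hz, slopeS]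
    have := Real.pi_pos
    field_simp
  rw [← hω]
  simp only [Hmap, hamiltonian, oldPoint, stepErr, pu, pX, div_eq_mul_inv]
  generalize pd vu (N.nextSmap d m) z = su
  generalize pd vX (N.nextSmap d m) z = sX
  generalize pd vu N.Smap z = Su
  generalize pd vX N.Smap z = SX
  generalize d z.2.2.2.2 = D
  generalize deriv d z.2.2.2.2 = D'
  rw [inv_pow]
  ring

/-- A change of `S` alters the point where `K` is evaluated, but only through a displacement
carrying the factor `ε²`. -/
theorem abs_sub_le_of_shiftMap {f : E5 → ℝ} {B A e : ℝ} {Q Q' : E5 → ℝ} {ρ : ℝ}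
    (hB : ∀ z ∈ Dom ρ, ∀ w ∈ Dom ρ, |f z - f w| ≤ B * ‖z - w‖) {z : E5} (hz : z ∈ Dom ρ)
    (hA : |Q z - Q' z| ≤ e * A) (he : 0 ≤ e) :
    |f (shiftMap Q z) - f (shiftMap Q' z)| ≤ |B| * |A| * (z.1 ^ 2 * e) := by
  refine (hB _ (show shiftMap _ z ∈ Dom ρ from hz) _ (show shiftMap _ z ∈ Dom ρ from hz)).trans ?_
  rw [norm_shiftMap_sub]
  have h1 : |Q z - Q' z| ≤ e * |A| :=
    hA.trans (mul_le_mul_of_nonneg_left (le_abs_self _) he)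
  calc B * (z.1 ^ 2 * |Q z - Q' z|) ≤ |B| * (z.1 ^ 2 * (e * |A|)) :=
        mul_le_mul (le_abs_self _) (mul_le_mul_of_nonneg_left h1 (sq_nonneg _)) (by positivity)
          (abs_nonneg _)
    _ = _ := by ring

/-- The residual starts with `coeff * ε ^ (m + 1)`. The change of the Hamiltonian replaces `coeff`
by `𝓗_{m+1}`, and the new term of `K` cancels that; the altered evaluation points of `K` cost at
least one further power of `ε`. -/
theorem isOrder_step (hd : Profile d) (m : ℕ) {N : NormalForm} (hS : Pol d N.Smap)
    (hK : Pol d N.Kmap) (h : Shf.IsOrder (N.Rmap d) (m + 1)) :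
    Shf.IsOrder ((N.step d m).Rmap d) (m + 2) := by
  intro ρ hρ
  have hs := pol_nextSmap hd hS hK m
  have hk := pol_nextKmap hd hS hK m
  have hQ := hS.pd hd vp
  have hS' : Pol d (N.step d m).Smap := hS.add ((Pol.eps.pow m).mul hs)
  obtain ⟨B1, hB1⟩ := (shf_Rmap hd hS hK).taylor hd hQ (m + 2) hρ
  obtain ⟨B2, hB2⟩ := (Shf.pol (Q := fun _ => 0) hK).lipschitz hd (Pol.const 0) hρ
  obtain ⟨B3, hB3⟩ := (Shf.pol (Q := fun _ => 0) hk).lipschitz hd (Pol.const 0) hρ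
  obtain ⟨B4, hB4⟩ := (hs.pd hd vp).bounded hd hρ
  obtain ⟨B5, hB5⟩ := (hS'.pd hd vp).bounded hd hρ
  obtain ⟨B6, hB6⟩ := (pol_stepErr hd m hS hK).bounded hd hρ
  refine ⟨B1 + |B2| * |B4| + |B3| * |B5| + B6, fun z hz h0 => ?_⟩
  have hz' := act_pos_of_mem hρ hz
  have t1 := hB1 z hz h0
  rw [Finset.sum_range_succ, Finset.sum_eq_zero (fun i hi => by
    rw [(shf_Rmap hd hS hK).pd_iter_eq_zero hd hQ h (Finset.mem_range.1 hi) hz']; simp), zero_add,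
    ← coeffMap_eq hd hS hK m hz'] at t1
  have e1 := Rmap_eq hd hS hz'
  have e2 := Rmap_eq hd hS' hz'
  have e3 := Hmap_step hd m hS hK hz'
  have t2 : |N.Kmap (shiftMap (pd vp (N.step d m).Smap) z) - N.Kmap (shiftMap (pd vp N.Smap) z)|
      ≤ |B2| * |B4| * z.1 ^ (m + 2) := by
    refine (abs_sub_le_of_shiftMap hB2 hz (e := z.1 ^ m) (A := B4) ?_ (by positivity)).trans
      (le_of_eq (by ring))
    rw [pd_step hd m hS hK (v := vp) rfl hz', add_sub_cancel_left, abs_mul,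
      abs_of_nonneg (pow_nonneg h0 _)]
    exact mul_le_mul_of_nonneg_left (hB4 z hz) (by positivity)
  have t3 : |z.1 ^ (m + 1) * (N.nextKmap d m (shiftMap (pd vp (N.step d m).Smap) z)
      - N.nextKmap d m z)| ≤ |B3| * |B5| * z.1 ^ (m + 2) := by
    have h1 := abs_sub_le_of_shiftMap hB3 hz (Q := pd vp (N.step d m).Smap) (Q' := fun _ => 0)
      (e := 1) (A := B5) (by simpa using hB5 z hz) zero_le_one
    have : shiftMap (fun _ => 0) z = z := by simp [shiftMap]
    rw [this] at h1
    have hz1 : z.1 ≤ 1 := (le_abs_self _).trans hz.1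
    rw [abs_mul, abs_of_nonneg (pow_nonneg h0 _)]
    calc z.1 ^ (m + 1) * _ ≤ z.1 ^ (m + 1) * (|B3| * |B5| * (z.1 ^ 2 * 1)) :=
          mul_le_mul_of_nonneg_left h1 (by positivity)
      _ = z.1 * (|B3| * |B5| * z.1 ^ (m + 2)) := by ring
      _ ≤ _ := mul_le_of_le_one_left (by positivity) hz1
  have t6 : |z.1 ^ (m + 2) * stepErr d m N z| ≤ B6 * z.1 ^ (m + 2) := by
    rw [abs_mul, abs_of_nonneg (pow_nonneg h0 _), mul_comm]
    exact mul_le_mul_of_nonneg_right (hB6 z hz) (by positivity)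
  -- The four groups are the Taylor remainder, the displaced old `K`, the displaced new term, and
  -- the remainder of `Hmap_step`; each is bounded by a multiple of `ε ^ (m + 2)`.
  have main : (N.step d m).Rmap d z = (N.Rmap d z - N.coeffMap d m z * z.1 ^ (m + 1))
      - (N.Kmap (shiftMap (pd vp (N.step d m).Smap) z) - N.Kmap (shiftMap (pd vp N.Smap) z))
      - z.1 ^ (m + 1) * (N.nextKmap d m (shiftMap (pd vp (N.step d m).Smap) z)
        - N.nextKmap d m z) + z.1 ^ (m + 2) * stepErr d m N z := by
    rw [e2, e1, e3, Kmap_step]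
    simp only [shiftMap]
    ring
  rw [main]
  refine (abs_add_le _ _).trans ?_
  have s1 := abs_sub (N.Rmap d z - N.coeffMap d m z * z.1 ^ (m + 1))
    (N.Kmap (shiftMap (pd vp (N.step d m).Smap) z) - N.Kmap (shiftMap (pd vp N.Smap) z))
  have s2 := abs_sub (N.Rmap d z - N.coeffMap d m z * z.1 ^ (m + 1) -
    (N.Kmap (shiftMap (pd vp (N.step d m).Smap) z) - N.Kmap (shiftMap (pd vp N.Smap) z)))
    (z.1 ^ (m + 1) * (N.nextKmap d m (shiftMap (pd vp (N.step d m).Smap) z)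
        - N.nextKmap d m z))
  linarith

/-- With `S = 0` the residual is the expansion of the square in the Hamiltonian, explicitly
divisible by `ε`; every step gains one order. -/
theorem isOrder_iterate (hd : Profile d) (m : ℕ) :
    Shf.IsOrder ((iterate d m).Rmap d) (m + 1) := by
  induction m with
  | zero =>
    intro ρ hρ
    have g := (Pol.act d).mul (((Pol.slope d).mul (Pol.widthInv d)).mul Pol.phase)
    obtain ⟨B, hB⟩ := ((g.mul (Pol.mom d)).const_mul (-2) |>.add
      (Pol.eps.mul (g.pow 2))).bounded hd hρ
    refine ⟨B, fun z hz h0 => ?_⟩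
    have hz' := act_pos_of_mem hρ hz
    have e := Rmap_eq hd (pol_iterate hd 0).1 hz'
    have h0' : ∀ v : E5, pd v (iterate d 0).Smap z = 0 := by
      intro v
      have : (iterate d 0).Smap = fun _ => 0 := rfl
      rw [this]; simp [pd]
    have : (iterate d 0).Rmap d z = z.1 * (-2 * (z.2.1 * (deriv d z.2.2.2.2 * (d z.2.2.2.2)⁻¹ *
        z.2.2.1) * z.2.2.2.1) + z.1 * (z.2.1 * (deriv d z.2.2.2.2 * (d z.2.2.2.2)⁻¹ *
        z.2.2.1)) ^ 2) := by
      rw [e]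
      simp only [oldPoint, shiftMap, h0', mul_zero, add_zero]
      simp only [Hmap, hamiltonian, Kmap, iterate]
      ring
    rw [this, abs_mul, abs_of_nonneg h0, zero_add, pow_one, mul_comm]
    exact mul_le_mul_of_nonneg_right (hB z hz) h0
  | succ m ih => exact isOrder_step hd m (pol_iterate hd m).1 (pol_iterate hd m).2 ih


/-! ### Uniform bounds for a fixed order -/

def dirs : Set E5 := {vε, vI, vu, vp, vX}

theorem finite_dirs : dirs.Finite := by unfold dirs; exact Set.toFinite _

@[simp] theorem vε_mem : vε ∈ dirs := by simp [dirs]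
@[simp] theorem vI_mem : vI ∈ dirs := by simp [dirs]
@[simp] theorem vu_mem : vu ∈ dirs := by simp [dirs]
@[simp] theorem vp_mem : vp ∈ dirs := by simp [dirs]
@[simp] theorem vX_mem : vX ∈ dirs := by simp [dirs]

/-- A common bound `B` in `Dom ρ` for the functions of the normal form after `m` steps. -/
structure NFBound (d : ℝ → ℝ) (m : ℕ) (ρ B : ℝ) : Prop where
  one_le : 1 ≤ B
  S1 : ∀ v ∈ dirs, ∀ z ∈ Dom ρ, |pd v (iterate d m).Smap z| ≤ B
  S2 : ∀ v ∈ dirs, ∀ w ∈ dirs, ∀ z ∈ Dom ρ, |pd w (pd v (iterate d m).Smap) z| ≤ B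
  S1_lip : ∀ v ∈ dirs, ∀ z ∈ Dom ρ, ∀ w ∈ Dom ρ,
    |pd v (iterate d m).Smap z - pd v (iterate d m).Smap w| ≤ B * ‖z - w‖
  H_lip : ∀ z ∈ Dom ρ, ∀ w ∈ Dom ρ, |Hmap d z - Hmap d w| ≤ B * ‖z - w‖
  H1_lip : ∀ v ∈ dirs, ∀ z ∈ Dom ρ, ∀ w ∈ Dom ρ, |pd v (Hmap d) z - pd v (Hmap d) w| ≤ B * ‖z - w‖
  K_lip : ∀ z ∈ Dom ρ, ∀ w ∈ Dom ρ,
    |(iterate d m).Kmap z - (iterate d m).Kmap w| ≤ B * ‖z - w‖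
  K1 : ∀ v ∈ dirs, ∀ z ∈ Dom ρ, |pd v (iterate d m).Kmap z| ≤ B
  K1_lip : ∀ v ∈ dirs, ∀ z ∈ Dom ρ, ∀ w ∈ Dom ρ,
    |pd v (iterate d m).Kmap z - pd v (iterate d m).Kmap w| ≤ B * ‖z - w‖
  R : ∀ z ∈ Dom ρ, 0 ≤ z.1 → |(iterate d m).Rmap d z| ≤ B * z.1 ^ (m + 1)
  R1 : ∀ v ∈ dirs, v.1 = 0 → ∀ z ∈ Dom ρ, 0 ≤ z.1 →
    |pd v ((iterate d m).Rmap d) z| ≤ B * z.1 ^ (m + 1)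
  K_sub : ∀ z ∈ Dom ρ, 0 ≤ z.1 → |(iterate d m).Kmap z - (iterate d 0).Kmap z| ≤ B * z.1
  K1_sub : ∀ v ∈ dirs, v.1 = 0 → ∀ z ∈ Dom ρ, 0 ≤ z.1 →
    |pd v (iterate d m).Kmap z - pd v (iterate d 0).Kmap z| ≤ B * z.1

theorem pol_Hmap (d : ℝ → ℝ) : Pol d (Hmap d) := by
  have a := Pol.act d
  have b := Pol.mom d
  refine ((((a.pow 2).mul ((Pol.widthInv d).pow 2)).const_mul (Real.pi ^ 2)).add
    ((b.sub (Pol.eps.mul ((a.mul ((Pol.slope d).mul (Pol.widthInv d))).mul Pol.phase))).pow 2)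
    |>.sub (Pol.const 1)).congr fun z _ => ?_
  simp only [Hmap, hamiltonian]
  ring

section Eventually
variable {d : ℝ → ℝ} {ρ : ℝ}

theorem eventually_bound (hd : Profile d) (hρ : 0 < ρ) {Q f : E5 → ℝ} (hf : Shf d Q f) :
    ∀ᶠ B in atTop, ∀ z ∈ Dom ρ, |f z| ≤ B := by
  obtain ⟨B, hB⟩ := hf.bounded hd hρ
  filter_upwards [eventually_ge_atTop B] with A hA z hz using (hB z hz).trans hA

theorem eventually_lipschitz (hd : Profile d) (hρ : 0 < ρ) {f : E5 → ℝ} (hf : Pol d f) :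
    ∀ᶠ B in atTop, ∀ z ∈ Dom ρ, ∀ w ∈ Dom ρ, |f z - f w| ≤ B * ‖z - w‖ := by
  obtain ⟨B, hB⟩ := (Shf.pol (Q := fun _ => 0) hf).lipschitz hd (Pol.const 0) hρ
  filter_upwards [eventually_ge_atTop B] with A hA z hz w hw using
    (hB z hz w hw).trans (mul_le_mul_of_nonneg_right hA (norm_nonneg _))

theorem eventually_order (hρ : 0 < ρ) {f : E5 → ℝ} {n : ℕ} (hf : Shf.IsOrder f n) :
    ∀ᶠ B in atTop, ∀ z ∈ Dom ρ, 0 ≤ z.1 → |f z| ≤ B * z.1 ^ n := by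
  obtain ⟨B, hB⟩ := hf ρ hρ
  filter_upwards [eventually_ge_atTop B] with A hA z hz h0 using
    (hB z hz h0).trans (mul_le_mul_of_nonneg_right hA (pow_nonneg h0 _))

theorem isOrder_K_sub (hd : Profile d) (m : ℕ) :
    Shf.IsOrder (fun z => (iterate d m).Kmap z - (iterate d 0).Kmap z) 1 := by
  intro ρ hρ
  obtain ⟨G, hG, h⟩ := Kmap_iterate hd m
  obtain ⟨B, hB⟩ := hG.bounded hd hρ
  refine ⟨B, fun z hz h0 => ?_⟩
  simp only [h, add_sub_cancel_left]
  rw [abs_mul, abs_of_nonneg h0, pow_one, mul_comm]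
  exact mul_le_mul_of_nonneg_right (hB z hz) h0

/-- Every bound persists when `B` grows, so finitely many of them can be met by one constant; the
filter `atTop` organizes this. -/
theorem eventually_NFBound (hd : Profile d) (m : ℕ) (hρ : 0 < ρ) :
    ∀ᶠ B in atTop, NFBound d m ρ B := by
  obtain ⟨hS, hK⟩ := pol_iterate hd m
  have hQ := hS.pd hd vp
  have P : ∀ {f : E5 → ℝ}, Pol d f → Shf d (fun _ => 0) f := fun h => .pol h
  have hfin := finite_dirs
  have hKs : Shf d (fun _ => 0) (fun z => (iterate d m).Kmap z - (iterate d 0).Kmap z) :=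
    P (hK.sub (pol_Kmap_zero d))
  filter_upwards [eventually_ge_atTop 1,
    (eventually_all_finite hfin).2 fun v _ => eventually_bound hd hρ (P (hS.pd hd v)),
    (eventually_all_finite hfin).2 fun v _ => (eventually_all_finite hfin).2 fun w _ =>
      eventually_bound hd hρ (P ((hS.pd hd v).pd hd w)),
    (eventually_all_finite hfin).2 fun v _ => eventually_lipschitz hd hρ (hS.pd hd v),
    eventually_lipschitz hd hρ (pol_Hmap d),
    (eventually_all_finite hfin).2 fun v _ => eventually_lipschitz hd hρ ((pol_Hmap d).pd hd v),
    eventually_lipschitz hd hρ hK,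
    (eventually_all_finite hfin).2 fun v _ => eventually_bound hd hρ (P (hK.pd hd v)),
    (eventually_all_finite hfin).2 fun v _ => eventually_lipschitz hd hρ (hK.pd hd v),
    eventually_order hρ (isOrder_iterate hd m),
    (eventually_all_finite hfin).2 fun v _ => show ∀ᶠ B in atTop, v.1 = 0 → ∀ z ∈ Dom ρ, 0 ≤ z.1 →
      |pd v ((iterate d m).Rmap d) z| ≤ B * z.1 ^ (m + 1) from by
        by_cases hv : v.1 = 0
        · filter_upwards [eventually_order hρ
            ((isOrder_iterate hd m).pd hd hQ (shf_Rmap hd hS hK) hv)] with B hB _ using hB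
        · exact Eventually.of_forall fun B h => absurd h hv,
    eventually_order hρ (isOrder_K_sub hd m),
    (eventually_all_finite hfin).2 fun v _ => show ∀ᶠ B in atTop, v.1 = 0 → ∀ z ∈ Dom ρ, 0 ≤ z.1 →
      |pd v (fun z => (iterate d m).Kmap z - (iterate d 0).Kmap z) z| ≤ B * z.1 ^ 1 from by
        by_cases hv : v.1 = 0
        · filter_upwards [eventually_order hρ
            ((isOrder_K_sub hd m).pd hd (Pol.const 0) hKs hv)] with B hB _ using hB
        · exact Eventually.of_forall fun B h => absurd h hv]
    with B h1 h2 h3 h4 h6 h7 h8 h9 h10 h11 h12 h13 h14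
  refine ⟨h1, h2, h3, h4, h6, h7, h8, h9, h10, h11, h12, by simpa using h13, ?_⟩
  intro v hv h0 z hz hz0
  have := h14 v hv h0 z hz hz0
  have hz' := act_pos_of_mem hρ hz
  simp only [pd] at this ⊢
  rw [fderiv_fun_sub ((hK.contDiffAt hd hz').differentiableAt (by simp))
    (((pol_Kmap_zero d).contDiffAt hd hz').differentiableAt (by simp))] at this
  simpa using this

end Eventually

theorem norm_E5_le (z : E5) :
    ‖z‖ ≤ |z.1| + |z.2.1| + |z.2.2.1| + |z.2.2.2.1| + |z.2.2.2.2| := by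
  have := abs_nonneg z.1
  have := abs_nonneg z.2.1
  have := abs_nonneg z.2.2.1
  have := abs_nonneg z.2.2.2.1
  have := abs_nonneg z.2.2.2.2
  simp only [Prod.norm_def, Real.norm_eq_abs]
  refine max_le (by linarith) (max_le (by linarith) (max_le (by linarith)
    (max_le (by linarith) (by linarith))))

theorem norm_mk_sub_mk_le (ε I u p X I' u' p' X' : ℝ) :
    ‖((ε, I, u, p, X) : E5) - (ε, I', u', p', X')‖ ≤
      |I - I'| + |u - u'| + |p - p'| + |X - X'| := by
  simpa using norm_E5_le (((ε, I, u, p, X) : E5) - (ε, I', u', p', X'))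

/-! ### The differentiated residual identity -/

/-- The chain rule applied to `R = H ∘ oldPoint - K ∘ shiftMap`. Both the mixed point and its old
counterpart must have positive action, where these functions are differentiable. It links Hamilton's
equations of `H` to those of `K`. -/
theorem pd_Rmap_eq {d : ℝ → ℝ} (hd : Profile d) {N : NormalForm} (hS : Pol d N.Smap)
    (hK : Pol d N.Kmap) {z : E5} (hz : 0 < z.2.1) (hz' : 0 < (N.oldPoint z).2.1) {v : E5}
    (hv : v.1 = 0) :
    pd v (N.Rmap d) z = pd v (Hmap d) (N.oldPoint z)
      + z.1 * pd v (pd vu N.Smap) z * pd vI (Hmap d) (N.oldPoint z)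
      + z.1 ^ 2 * pd v (pd vX N.Smap) z * pd vp (Hmap d) (N.oldPoint z)
      - pd v N.Kmap (shiftMap (pd vp N.Smap) z)
      - z.1 ^ 2 * pd v (pd vp N.Smap) z * pd vX N.Kmap (shiftMap (pd vp N.Smap) z) := by
  have hc : HasDerivAt (fun t : ℝ => z + t • v) v 0 := by
    simpa using ((hasDerivAt_id (0 : ℝ)).smul_const v).const_add z
  have h0 : z + (0 : ℝ) • v = z := by simp
  have along : ∀ {f : E5 → ℝ}, DifferentiableAt ℝ f z →
      HasDerivAt (fun t : ℝ => f (z + t • v)) (pd v f z) 0 := by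
    intro f hf
    have := hasDerivAt_comp_curve (G := f) (c := fun t : ℝ => z + t • v) (t := 0)
      (by rw [h0]; exact hf) hc
    rwa [h0] at this
  have diff : ∀ {f : E5 → ℝ}, Pol d f → DifferentiableAt ℝ f z := fun h =>
    (h.contDiffAt hd hz).differentiableAt (by simp)
  have hR := along (((shf_Rmap hd hS hK).differentiableAt hd (hS.pd hd vp) hz))
  have hz1 : HasDerivAt (fun t : ℝ => (z + t • v).1) 0 0 := by
    have : (fun t : ℝ => (z + t • v).1) = fun _ => z.1 := by funext t; simp [hv]
    rw [this]; exact hasDerivAt_const _ _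
  have hz2 : HasDerivAt (fun t : ℝ => (z + t • v).2.1) v.2.1 0 := along coordI.differentiableAt
    |>.congr_deriv (congrArg (fun l : E5 →L[ℝ] ℝ => l v) (coordI.fderiv (x := z)))
  have hz3 : HasDerivAt (fun t : ℝ => (z + t • v).2.2.1) v.2.2.1 0 :=
    along coordu.differentiableAt
      |>.congr_deriv (congrArg (fun l : E5 →L[ℝ] ℝ => l v) (coordu.fderiv (x := z)))
  have hz4 : HasDerivAt (fun t : ℝ => (z + t • v).2.2.2.1) v.2.2.2.1 0 :=
    along coordp.differentiableAt
      |>.congr_deriv (congrArg (fun l : E5 →L[ℝ] ℝ => l v) (coordp.fderiv (x := z)))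
  have hz5 : HasDerivAt (fun t : ℝ => (z + t • v).2.2.2.2) v.2.2.2.2 0 :=
    along coordX.differentiableAt
      |>.congr_deriv (congrArg (fun l : E5 →L[ℝ] ℝ => l v) (coordX.fderiv (x := z)))
  have hold : HasDerivAt (fun t : ℝ => N.oldPoint (z + t • v))
      (0, v.2.1 + z.1 * pd v (pd vu N.Smap) z, v.2.2.1,
        v.2.2.2.1 + z.1 ^ 2 * pd v (pd vX N.Smap) z, v.2.2.2.2) 0 := by
    have a := hz2.add (hz1.mul (along (diff (hS.pd hd vu))))
    have b := hz4.add ((hz1.pow 2).mul (along (diff (hS.pd hd vX))))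
    refine (hz1.prodMk (a.prodMk (hz3.prodMk (b.prodMk hz5)))).congr_deriv ?_
    simp
  have hsh : HasDerivAt (fun t : ℝ => shiftMap (pd vp N.Smap) (z + t • v))
      (0, v.2.1, v.2.2.1, v.2.2.2.1, v.2.2.2.2 + z.1 ^ 2 * pd v (pd vp N.Smap) z) 0 := by
    have b := hz5.add ((hz1.pow 2).mul (along (diff (hS.pd hd vp))))
    refine (hz1.prodMk (hz2.prodMk (hz3.prodMk (hz4.prodMk b)))).congr_deriv ?_
    simp
  have hH := hasDerivAt_comp_curve (G := Hmap d) (c := fun t : ℝ => N.oldPoint (z + t • v))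
    (t := 0) (by
      rw [h0]
      exact ((pol_Hmap d).contDiffAt hd hz').differentiableAt (by simp)) hold
  have hKK := hasDerivAt_comp_curve (G := N.Kmap)
    (c := fun t : ℝ => shiftMap (pd vp N.Smap) (z + t • v)) (t := 0) (by
      rw [h0]
      exact (hK.contDiffAt hd (z := shiftMap (pd vp N.Smap) z) hz).differentiableAt (by simp)) hsh
  rw [h0] at hH hKK
  have hev : (fun t : ℝ => N.Rmap d (z + t • v)) =ᶠ[𝓝 0] fun t =>
      Hmap d (N.oldPoint (z + t • v)) - N.Kmap (shiftMap (pd vp N.Smap) (z + t • v)) := by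
    have : ∀ᶠ t : ℝ in 𝓝 0, z + t • v ∈ {z : E5 | 0 < z.2.1} := by
      refine hc.continuousAt.eventually_mem (isOpen_actPos.mem_nhds ?_)
      rw [h0]; exact hz
    filter_upwards [this] with t ht using Rmap_eq hd hS ht
  have := hR.unique ((hH.sub hKK).congr_of_eventuallyEq hev)
  rw [this, fderiv_expand, fderiv_expand]
  have e1 : pd v (Hmap d) (N.oldPoint z) = v.2.1 * pd vI (Hmap d) (N.oldPoint z)
      + v.2.2.1 * pd vu (Hmap d) (N.oldPoint z) + v.2.2.2.1 * pd vp (Hmap d) (N.oldPoint z)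
      + v.2.2.2.2 * pd vX (Hmap d) (N.oldPoint z) := by
    rw [pd, fderiv_expand, hv]; ring
  have e2 : pd v N.Kmap (shiftMap (pd vp N.Smap) z) =
      v.2.1 * pd vI N.Kmap (shiftMap (pd vp N.Smap) z)
      + v.2.2.1 * pd vu N.Kmap (shiftMap (pd vp N.Smap) z)
      + v.2.2.2.1 * pd vp N.Kmap (shiftMap (pd vp N.Smap) z)
      + v.2.2.2.2 * pd vX N.Kmap (shiftMap (pd vp N.Smap) z) := by
    rw [pd, fderiv_expand, hv]; ring
  rw [e1, e2]
  ring

theorem pd_vu_Kmap (N : NormalForm) {z : E5} (h : DifferentiableAt ℝ N.Kmap z) :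
    pd vu N.Kmap z = 0 := by
  have h1 := hasDerivAt_comp_curve (G := N.Kmap) (c := fun s => (z.1, z.2.1, s, z.2.2.2))
    (t := z.2.2.1) h ((hasDerivAt_const _ _).prodMk ((hasDerivAt_const _ _).prodMk
      ((hasDerivAt_id _).prodMk (hasDerivAt_const _ _))))
  exact h1.unique (hasDerivAt_const z.2.2.1 (N.Kmap z))

/-! ### Differentiability of implicitly defined curves -/

/-- The map `W ↦ W + g W` has an invertible derivative, so a continuous solution of `W + g W = z` is
locally its inverse applied to `z`. The relation between the two velocities gives the derivative of
the implicitly defined momentum. -/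
theorem exists_hasDerivWithinAt_of_add {E : Type*} [NormedAddCommGroup E] [NormedSpace ℝ E]
    [CompleteSpace E] {g : E → E} {g' : E →L[ℝ] E} {W : ℝ → E} {z' : E} {A : Set ℝ} {t : ℝ}
    (hg : HasStrictFDerivAt g g' (W t)) (hg' : ‖g'‖ < 1)
    (hW : ContinuousWithinAt W A t)
    (hz : HasDerivWithinAt (fun s => W s + g (W s)) z' A t) :
    ∃ W', HasDerivWithinAt W W' A t ∧ W' + g' W' = z' := by
  let e : E ≃L[ℝ] E := ContinuousLinearEquiv.ofUnit (Units.oneSub (-g') (by rwa [norm_neg]))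
  have he : (e : E →L[ℝ] E) = ContinuousLinearMap.id ℝ E + g' := by
    ext x
    change (1 - -g') x = _
    simp
  have hf : HasStrictFDerivAt (fun x => x + g x) (e : E →L[ℝ] E) (W t) := by
    rw [he]; exact (hasStrictFDerivAt_id _).add hg
  have h1 := hf.to_localInverse
  have h2 := hf.eventually_left_inverse
  have h3 := h1.hasFDerivAt.comp_hasDerivWithinAt t hz
  refine ⟨_, h3.congr_of_eventuallyEq (f₁ := W) ?_ h2.self_of_nhds.symm, ?_⟩
  · filter_upwards [hW.eventually h2] with s hs using hs.symm
  · change e.symm z' + g' (e.symm z') = z'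
    have : (e : E →L[ℝ] E) (e.symm z') = z' := e.apply_symm_apply z'
    rw [he] at this
    simpa using this


/-! ### Solving the implicit equations -/

section Solve
variable {d : ℝ → ℝ} {m : ℕ} {ρ B ε : ℝ}

theorem NFBound.pos (hB : NFBound d m ρ B) : 0 < B := zero_lt_one.trans_le hB.one_le

theorem eps_le_of_small (hB : NFBound d m ρ B) (hε : 0 < ε) (hs : 10 * B * ε ≤ 1) : ε ≤ 1 / 10 := by
  nlinarith [hB.one_le]

/-- The Lipschitz constant `ε² B` of the correction is at most `1/2` and is absorbed. The remaining
term compares the correction at the same momentum, which later allows a comparison across the jump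
of `u`. -/
theorem stable_mom (hB : NFBound d m ρ B) (hε : 0 < ε) (hs : 10 * B * ε ≤ 1)
    {J u p X b J' u' p' X' b' : ℝ}
    (h1 : (ε, J, u, p, X) ∈ Dom ρ) (h3 : (ε, J, u, p', X) ∈ Dom ρ)
    (e1 : p + ε ^ 2 * pd vX (iterate d m).Smap (ε, J, u, p, X) = b)
    (e2 : p' + ε ^ 2 * pd vX (iterate d m).Smap (ε, J', u', p', X') = b') :
    |p - p'| ≤ 2 * |b - b'| + 2 * ε ^ 2 * |pd vX (iterate d m).Smap (ε, J, u, p', X) -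
      pd vX (iterate d m).Smap (ε, J', u', p', X')| := by
  have hB1 := hB.one_le
  have hε1 := eps_le_of_small hB hε hs
  have k := (hB.S1_lip vX vX_mem _ h1 _ h3).trans
    (mul_le_mul_of_nonneg_left (norm_mk_sub_mk_le ε J u p X J u p' X) hB.pos.le)
  simp only [sub_self, abs_zero, zero_add, add_zero] at k
  have hεB : ε ^ 2 * B ≤ 1 / 2 := by nlinarith
  have e : p - p' = (b - b') - ε ^ 2 * (pd vX (iterate d m).Smap (ε, J, u, p, X) -
      pd vX (iterate d m).Smap (ε, J, u, p', X)) - ε ^ 2 * (pd vX (iterate d m).Smap (ε, J, u, p', X) -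
      pd vX (iterate d m).Smap (ε, J', u', p', X')) := by linear_combination e1 - e2
  have k1 : |p - p'| ≤ |b - b'| + ε ^ 2 * (B * |p - p'|) + ε ^ 2 *
      |pd vX (iterate d m).Smap (ε, J, u, p', X) - pd vX (iterate d m).Smap (ε, J', u', p', X')| := by
    conv_lhs => rw [e]
    refine (abs_sub _ _).trans (add_le_add ((abs_sub _ _).trans (add_le_add le_rfl ?_)) ?_)
    · rw [abs_mul, abs_of_nonneg (sq_nonneg ε)]
      exact mul_le_mul_of_nonneg_left k (sq_nonneg _)
    · rw [abs_mul, abs_of_nonneg (sq_nonneg ε)]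
  nlinarith [abs_nonneg (p - p'), mul_le_mul_of_nonneg_right hεB (abs_nonneg (p - p'))]

/-- Both corrections have Lipschitz constants at most `1/10`, so the near-identity equations are
solved stably. This yields uniqueness of the image and turns errors in the equations into errors of
the improved variables. -/
theorem stable_image (hB : NFBound d m ρ B) (hε : 0 < ε) (hs : 10 * B * ε ≤ 1)
    {u X J p I b J' p' I' b' : ℝ}
    (h1 : (ε, J, u, p, X) ∈ Dom ρ) (h2 : (ε, J', u, p', X) ∈ Dom ρ)
    (e1 : J + ε * pd vu (iterate d m).Smap (ε, J, u, p, X) = I)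
    (e2 : p + ε ^ 2 * pd vX (iterate d m).Smap (ε, J, u, p, X) = b)
    (e3 : J' + ε * pd vu (iterate d m).Smap (ε, J', u, p', X) = I')
    (e4 : p' + ε ^ 2 * pd vX (iterate d m).Smap (ε, J', u, p', X) = b') :
    |J - J'| + |p - p'| ≤ 2 * (|I - I'| + |b - b'|) := by
  have hB1 := hB.one_le
  have hε1 := eps_le_of_small hB hε hs
  have k1 := (hB.S1_lip vX vX_mem _ h1 _ h2).trans
    (mul_le_mul_of_nonneg_left (norm_mk_sub_mk_le ε J u p X J' u p' X) hB.pos.le)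
  have k2 := (hB.S1_lip vu vu_mem _ h1 _ h2).trans
    (mul_le_mul_of_nonneg_left (norm_mk_sub_mk_le ε J u p X J' u p' X) hB.pos.le)
  simp only [sub_self, abs_zero, add_zero] at k1 k2
  set s := |J - J'| + |p - p'| with hsdef
  have hs0 : 0 ≤ s := by positivity
  have hεB : ε ^ 2 * B ≤ 1 / 10 := by nlinarith
  have hεB' : ε * B ≤ 1 / 10 := by linarith
  have a1 : |J - J'| ≤ |I - I'| + ε * (B * s) := by
    have e : J - J' = (I - I') - ε * (pd vu (iterate d m).Smap (ε, J, u, p, X) -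
      pd vu (iterate d m).Smap (ε, J', u, p', X)) := by linear_combination e1 - e3
    rw [e]
    refine (abs_sub _ _).trans (add_le_add le_rfl ?_)
    rw [abs_mul, abs_of_pos hε]
    exact mul_le_mul_of_nonneg_left k2 hε.le
  have a2 : |p - p'| ≤ |b - b'| + ε ^ 2 * (B * s) := by
    have e : p - p' = (b - b') - ε ^ 2 * (pd vX (iterate d m).Smap (ε, J, u, p, X) -
      pd vX (iterate d m).Smap (ε, J', u, p', X)) := by linear_combination e2 - e4
    rw [e]
    refine (abs_sub _ _).trans (add_le_add le_rfl ?_)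
    rw [abs_mul, abs_of_nonneg (sq_nonneg ε)]
    exact mul_le_mul_of_nonneg_left k1 (sq_nonneg _)
  have a3 : ε * (B * s) ≤ 1 / 10 * s := by
    rw [← mul_assoc]; exact mul_le_mul_of_nonneg_right hεB' hs0
  have a4 : ε ^ 2 * (B * s) ≤ 1 / 10 * s := by
    rw [← mul_assoc]; exact mul_le_mul_of_nonneg_right hεB hs0
  linarith [abs_nonneg (I - I'), abs_nonneg (b - b')]

/-- The left side differs from `p` by at most `ε² B ≤ 1`, so it brackets `b` on an interval of
radius one. -/
theorem exists_mom (hd : Profile d) (hρ : 0 < ρ) (hB : NFBound d m ρ B) (hε : 0 < ε)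
    (hs : 10 * B * ε ≤ 1) {J u b X : ℝ}
    (h : ∀ p ∈ Icc (b - 1) (b + 1), (ε, J, u, p, X) ∈ Dom ρ) :
    ∃ p ∈ Icc (b - 1) (b + 1), p + ε ^ 2 * pd vX (iterate d m).Smap (ε, J, u, p, X) = b ∧
      |p - b| ≤ ε ^ 2 * B := by
  have hB1 := hB.one_le
  have hε1 := eps_le_of_small hB hε hs
  have hεB : ε ^ 2 * B ≤ 1 := by nlinarith
  have bd : ∀ p ∈ Icc (b - 1) (b + 1),
      |ε ^ 2 * pd vX (iterate d m).Smap (ε, J, u, p, X)| ≤ ε ^ 2 * B := by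
    intro p hp
    rw [abs_mul, abs_of_nonneg (sq_nonneg ε)]
    exact mul_le_mul_of_nonneg_left (hB.S1 vX vX_mem _ (h p hp)) (sq_nonneg _)
  have hc : ContinuousOn (fun p => p + ε ^ 2 * pd vX (iterate d m).Smap (ε, J, u, p, X))
      (Icc (b - 1) (b + 1)) := by
    refine continuousOn_id.add (continuousOn_const.mul fun p hp => ?_)
    exact (ContinuousAt.comp (f := fun p : ℝ => ((ε, J, u, p, X) : E5))
      (g := pd vX (iterate d m).Smap) (((pol_iterate hd m).1.pd hd vX).contDiffAt hd
        (act_pos_of_mem hρ (h p hp))).continuousAt (by fun_prop)).continuousWithinAt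
  have hl : b - 1 ∈ Icc (b - 1) (b + 1) := ⟨le_rfl, by linarith⟩
  have hr : b + 1 ∈ Icc (b - 1) (b + 1) := ⟨by linarith, le_rfl⟩
  obtain ⟨p, hp, hpe⟩ := intermediate_value_Icc (by linarith) hc
    (show b ∈ Icc _ _ from ⟨by linarith [(abs_le.1 (bd _ hl)).2], by linarith [(abs_le.1 (bd _ hr)).1]⟩)
  refine ⟨p, hp, hpe, ?_⟩
  have := bd p hp
  simp only at hpe
  rw [show p - b = -(ε ^ 2 * pd vX (iterate d m).Smap (ε, J, u, p, X)) by linarith, abs_neg]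
  exact this

/-- The two equations are solved one after the other: for each action the momentum equation has a
solution depending on it Lipschitz continuously, and substituting it leaves a scalar equation for
the intermediate value theorem. -/
theorem exists_image (hd : Profile d) (hρ : 0 < ρ) (hB : NFBound d m ρ B) (hε : 0 < ε)
    (hs : 10 * B * ε ≤ 1) {I u b X h : ℝ} (hh : ε * B ≤ h)
    (hD : ∀ J ∈ Icc (I - h) (I + h), ∀ p ∈ Icc (b - 1) (b + 1), (ε, J, u, p, X) ∈ Dom ρ) :
    ∃ J p, J + ε * pd vu (iterate d m).Smap (ε, J, u, p, X) = I ∧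
      p + ε ^ 2 * pd vX (iterate d m).Smap (ε, J, u, p, X) = b ∧
      |J - I| ≤ ε * B ∧ |p - b| ≤ ε ^ 2 * B ∧ (ε, J, u, p, X) ∈ Dom ρ := by
  have hB1 := hB.one_le
  have hε1 := eps_le_of_small hB hε hs
  have hh0 : 0 < h := (mul_pos hε hB.pos).trans_le hh
  choose! q hq hqe hqb using fun J hJ => exists_mom hd hρ hB hε hs (hD J hJ)
  have hDq : ∀ J ∈ Icc (I - h) (I + h), (ε, J, u, q J, X) ∈ Dom ρ := fun J hJ =>
    hD J hJ _ (hq J hJ)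
  have hlip : ∀ J ∈ Icc (I - h) (I + h), ∀ J' ∈ Icc (I - h) (I + h), |q J - q J'| ≤ |J - J'| := by
    intro J hJ J' hJ'
    have h3 := hD J hJ _ (hq J' hJ')
    have := stable_mom hB hε hs (hDq J hJ) h3 (hqe J hJ) (hqe J' hJ')
    have k := (hB.S1_lip vX vX_mem _ h3 _ (hDq J' hJ')).trans
      (mul_le_mul_of_nonneg_left (norm_mk_sub_mk_le ε J u (q J') X J' u (q J') X) hB.pos.le)
    simp only [sub_self, abs_zero, add_zero, mul_zero, zero_add] at k this
    refine this.trans ?_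
    have hεB : 2 * ε ^ 2 * B ≤ 1 := by nlinarith
    calc 2 * ε ^ 2 * _ ≤ 2 * ε ^ 2 * (B * |J - J'|) := by gcongr
      _ = (2 * ε ^ 2 * B) * |J - J'| := by ring
      _ ≤ _ := mul_le_of_le_one_left (abs_nonneg _) hεB
  have bd : ∀ J ∈ Icc (I - h) (I + h),
      |ε * pd vu (iterate d m).Smap (ε, J, u, q J, X)| ≤ ε * B := by
    intro J hJ
    rw [abs_mul, abs_of_pos hε]
    exact mul_le_mul_of_nonneg_left (hB.S1 vu vu_mem _ (hDq J hJ)) hε.le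
  have hqc : ContinuousOn q (Icc (I - h) (I + h)) := by
    have : LipschitzOnWith 1 q (Icc (I - h) (I + h)) :=
      LipschitzOnWith.of_dist_le_mul fun J hJ J' hJ' => by
        simpa [Real.dist_eq] using hlip J hJ J' hJ'
    exact this.continuousOn
  have hc : ContinuousOn (fun J => J + ε * pd vu (iterate d m).Smap (ε, J, u, q J, X))
      (Icc (I - h) (I + h)) := by
    refine continuousOn_id.add (continuousOn_const.mul fun J hJ => ?_)
    refine ContinuousAt.comp_continuousWithinAt (f := fun J : ℝ => ((ε, J, u, q J, X) : E5))
      (g := pd vu (iterate d m).Smap) (((pol_iterate hd m).1.pd hd vu).contDiffAt hd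
        (act_pos_of_mem hρ (hDq J hJ))).continuousAt ?_
    exact continuousWithinAt_const.prodMk (continuousWithinAt_id.prodMk
      (continuousWithinAt_const.prodMk ((hqc J hJ).prodMk continuousWithinAt_const)))
  have hl : I - h ∈ Icc (I - h) (I + h) := ⟨le_rfl, by linarith⟩
  have hr : I + h ∈ Icc (I - h) (I + h) := ⟨by linarith, le_rfl⟩
  obtain ⟨J, hJ, hJe⟩ := intermediate_value_Icc (by linarith) hc
    (show I ∈ Icc _ _ from ⟨by linarith [(abs_le.1 (bd _ hl)).2], by linarith [(abs_le.1 (bd _ hr)).1]⟩)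
  simp only at hJe
  refine ⟨J, q J, hJe, hqe J hJ, ?_, hqb J hJ, hDq J hJ⟩
  rw [show J - I = -(ε * pd vu (iterate d m).Smap (ε, J, u, q J, X)) by linarith, abs_neg]
  exact bd J hJ

/-! ### The motion in mixed variables -/

/-- The common shape of the three errors in `exists_deriv_mixed`: the differentiated residual, the
effects of evaluating `H` at an action off by `E`, and the error `w` of the momentum equation. -/
theorem abs_error_le {B η E ε R a b c δ₁ δ₂ δ₃ w : ℝ} (hB : 1 ≤ B) (hε : 0 < ε) (hε1 : ε ≤ 1)
    (hη : 0 ≤ η) (hE : 0 ≤ E) (hR : |R| ≤ B * η) (h1 : |δ₁| ≤ B * E) (h2 : |δ₂| ≤ B * E)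
    (h3 : |δ₃| ≤ B * E) (ha : |a| ≤ B) (hb : |b| ≤ B) (hc : |c| ≤ B)
    (hw : |w| ≤ 6 * B ^ 2 * (η + E)) :
    |R + δ₁ + ε * a * δ₂ + ε ^ 2 * b * δ₃ + ε * c * w| ≤ 10 * B ^ 3 * (η + E) := by
  have hB0 : 0 < B := by linarith
  have k : ∀ x y e M : ℝ, 0 ≤ e → e ≤ 1 → |x| ≤ B → |y| ≤ M → |e * x * y| ≤ B * M := by
    intro x y e M he0 he hx hy
    have hM := (abs_nonneg y).trans hy
    rw [abs_mul, abs_mul, abs_of_nonneg he0]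
    calc e * |x| * |y| ≤ 1 * B * M := by gcongr
      _ = _ := by ring
  have k2 := k a δ₂ ε _ hε.le hε1 ha h2
  have k3 := k b δ₃ (ε ^ 2) _ (sq_nonneg _) (pow_le_one₀ hε.le hε1) hb h3
  have k4 := k c w ε _ hε.le hε1 hc hw
  have s := (abs_add_le (R + δ₁ + ε * a * δ₂ + ε ^ 2 * b * δ₃) (ε * c * w)).trans
    (add_le_add ((abs_add_le _ _).trans (add_le_add ((abs_add_le _ _).trans
      (add_le_add (abs_add_le _ _) le_rfl)) le_rfl)) le_rfl)
  have hB2 : B ≤ B ^ 3 := by nlinarith [sq_nonneg (B - 1)]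
  have hB3 : B ^ 2 ≤ B ^ 3 := by nlinarith [sq_nonneg B]
  have m1 := mul_le_mul_of_nonneg_right hB2 hη
  have m2 := mul_le_mul_of_nonneg_right hB2 hE
  have m3 := mul_le_mul_of_nonneg_right hB3 hE
  have m4 : 0 ≤ B ^ 3 * η := by positivity
  nlinarith

set_option maxHeartbeats 1600000 in
/-- Along a Hamiltonian curve, the mixed variables with the new action frozen at `J` move as
prescribed by `K`, up to the error `E` of the frozen action. -/
theorem exists_deriv_mixed (hd : Profile d) (hρ : 0 < ρ) (hB : NFBound d m ρ B) (hε : 0 < ε)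
    (hs : 10 * B * ε ≤ 1) {A : Set ℝ} {t J : ℝ} {I u P X q : ℝ → ℝ} (ht : t ∈ A)
    (hqc : ContinuousWithinAt q A t)
    (hq : ∀ s ∈ A, q s + ε ^ 2 * pd vX (iterate d m).Smap (ε, J, u s, q s, X s) = P s)
    (hI : HasDerivWithinAt I (-pd vu (Hmap d) (ε, I t, u t, P t, X t)) A t)
    (hu : HasDerivWithinAt u (pd vI (Hmap d) (ε, I t, u t, P t, X t)) A t)
    (hP : HasDerivWithinAt P (-(ε * pd vX (Hmap d) (ε, I t, u t, P t, X t))) A t)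
    (hX : HasDerivWithinAt X (ε * pd vp (Hmap d) (ε, I t, u t, P t, X t)) A t)
    (hζ : (ε, J, u t, q t, X t) ∈ Dom ρ) (ha : (ε, I t, u t, P t, X t) ∈ Dom ρ)
    (ho : (iterate d m).oldPoint (ε, J, u t, q t, X t) ∈ Dom ρ) :
    let S := (iterate d m).Smap
    let ζ : ℝ → E5 := fun s => (ε, J, u s, q s, X s)
    let σ := shiftMap (pd vp S) (ζ t)
    let err := ε ^ (m + 1) + |I t - J - ε * pd vu S (ζ t)|
    ∃ q' E' φ' Y' : ℝ, HasDerivWithinAt q q' A t ∧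
      HasDerivWithinAt (fun s => I s - J - ε * pd vu S (ζ s)) E' A t ∧
      HasDerivWithinAt (fun s => u s + ε * pd vI S (ζ s)) φ' A t ∧
      HasDerivWithinAt (fun s => X s + ε ^ 2 * pd vp S (ζ s)) Y' A t ∧
      |q' + ε * pd vX (iterate d m).Kmap σ| ≤ ε * (10 * B ^ 3 * err) ∧
      |E'| ≤ 10 * B ^ 3 * err ∧
      |φ' - pd vI (iterate d m).Kmap σ| ≤ 10 * B ^ 3 * err ∧
      |Y' - ε * pd vp (iterate d m).Kmap σ| ≤ ε * (10 * B ^ 3 * err) := by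
  intro S ζ σ err
  obtain ⟨hS, hK⟩ := pol_iterate hd m
  have hB1 := hB.one_le
  have hε1 := eps_le_of_small hB hε hs
  have hJ : 0 < J := act_pos_of_mem hρ hζ
  set a : E5 := (ε, I t, u t, P t, X t) with hadef
  set o : E5 := (iterate d m).oldPoint (ζ t) with hodef
  -- differentiability of `q`
  have hdX : DifferentiableAt ℝ (pd vX S) (ζ t) :=
    ((hS.pd hd vX).contDiffAt hd hJ).differentiableAt (by simp)
  have hg : HasStrictFDerivAt (fun z : E5 => (ε ^ 2 * pd vX S z) • vp)
      ((ε ^ 2 • fderiv ℝ (pd vX S) (ζ t)).smulRight vp) (ζ t) :=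
    (((((hS.pd hd vX).contDiffAt hd hJ).hasStrictFDerivAt (by simp)).const_mul (ε ^ 2)).smul_const
      vp)
  have hnorm : ‖(ε ^ 2 • fderiv ℝ (pd vX S) (ζ t)).smulRight vp‖ < 1 := by
    have h1 : ‖fderiv ℝ (pd vX S) (ζ t)‖ ≤ 5 * B := by
      refine ContinuousLinearMap.opNorm_le_bound _ (by linarith) fun y => ?_
      rw [fderiv_expand, Real.norm_eq_abs]
      have n1 : |y.1| ≤ ‖y‖ := norm_fst_le y
      have m1 : ‖y.2‖ ≤ ‖y‖ := norm_snd_le y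
      have n2 : |y.2.1| ≤ ‖y‖ := (norm_fst_le y.2).trans m1
      have m2 : ‖y.2.2‖ ≤ ‖y‖ := (norm_snd_le y.2).trans m1
      have n3 : |y.2.2.1| ≤ ‖y‖ := (norm_fst_le y.2.2).trans m2
      have m3 : ‖y.2.2.2‖ ≤ ‖y‖ := (norm_snd_le y.2.2).trans m2
      have n4 : |y.2.2.2.1| ≤ ‖y‖ := (norm_fst_le y.2.2.2).trans m3
      have n5 : |y.2.2.2.2| ≤ ‖y‖ := (norm_snd_le y.2.2.2).trans m3
      have k : ∀ a b : ℝ, |a| ≤ ‖y‖ → |b| ≤ B → |a * b| ≤ ‖y‖ * B := by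
        intro a b ha hb
        rw [abs_mul]
        exact mul_le_mul ha hb (abs_nonneg _) (norm_nonneg _)
      have k1 := k _ _ n1 (hB.S2 vX vX_mem vε vε_mem _ hζ)
      have k2 := k _ _ n2 (hB.S2 vX vX_mem vI vI_mem _ hζ)
      have k3 := k _ _ n3 (hB.S2 vX vX_mem vu vu_mem _ hζ)
      have k4 := k _ _ n4 (hB.S2 vX vX_mem vp vp_mem _ hζ)
      have k5 := k _ _ n5 (hB.S2 vX vX_mem vX vX_mem _ hζ)
      refine (abs_add_le _ _).trans ((add_le_add ((abs_add_le _ _).trans (add_le_add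
        ((abs_add_le _ _).trans (add_le_add (abs_add_le _ _) le_rfl)) le_rfl)) le_rfl).trans ?_)
      linarith
    have hvp : ‖vp‖ = 1 := by simp [vp, Prod.norm_def]
    rw [ContinuousLinearMap.norm_smulRight_apply, hvp, mul_one, norm_smul, Real.norm_eq_abs,
      abs_of_nonneg (sq_nonneg ε)]
    calc ε ^ 2 * _ ≤ ε ^ 2 * (5 * B) := mul_le_mul_of_nonneg_left h1 (sq_nonneg _)
      _ < 1 := by nlinarith
  have hζc : ContinuousWithinAt ζ A t :=
    continuousWithinAt_const.prodMk (continuousWithinAt_const.prodMk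
      (hu.continuousWithinAt.prodMk (hqc.prodMk hX.continuousWithinAt)))
  -- The momentum equation reads `ζ + g(ζ) = (ε, J, u, P, X)` with `g` acting on the momentum
  -- component only; the right side is differentiable by Hamilton's equations.
  have hz : HasDerivWithinAt (fun s => ζ s + (ε ^ 2 * pd vX S (ζ s)) • vp)
      (0, 0, pd vI (Hmap d) a, -(ε * pd vX (Hmap d) a), ε * pd vp (Hmap d) a) A t := by
    have h1 := (hasDerivWithinAt_const t A ε).prodMk ((hasDerivWithinAt_const t A J).prodMk
      (hu.prodMk (hP.prodMk hX)))
    have e : ∀ s ∈ A, ζ s + (ε ^ 2 * pd vX S (ζ s)) • vp = (ε, J, u s, P s, X s) := by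
      intro s hs
      rw [← hq s hs]
      simp [ζ, vp, S]
    exact h1.congr e (e t ht)
  obtain ⟨W', hW', hWe⟩ := exists_hasDerivWithinAt_of_add hg hnorm hζc hz
  -- components of the velocity
  have c1 : W'.1 = 0 := by simpa [vp] using congrArg (fun z : E5 => z.1) hWe
  have c2 : W'.2.1 = 0 := by simpa [vp] using congrArg (fun z : E5 => z.2.1) hWe
  have c3 : W'.2.2.1 = pd vI (Hmap d) a := by
    simpa [vp] using congrArg (fun z : E5 => z.2.2.1) hWe
  have c4 : W'.2.2.2.1 + ε ^ 2 * fderiv ℝ (pd vX S) (ζ t) W' = -(ε * pd vX (Hmap d) a) := by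
    simpa [vp] using congrArg (fun z : E5 => z.2.2.2.1) hWe
  have c5 : W'.2.2.2.2 = ε * pd vp (Hmap d) a := by
    simpa [vp] using congrArg (fun z : E5 => z.2.2.2.2) hWe
  have hq' : HasDerivWithinAt q W'.2.2.2.1 A t :=
    (coordp.hasFDerivAt (x := ζ t)).comp_hasDerivWithinAt t hW'
  have along : ∀ v : E5, HasDerivWithinAt (fun s => pd v S (ζ s))
      (W'.2.2.1 * pd vu (pd v S) (ζ t) + W'.2.2.2.1 * pd vp (pd v S) (ζ t)
        + W'.2.2.2.2 * pd vX (pd v S) (ζ t)) A t := by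
    intro v
    have := (((hS.pd hd v).contDiffAt hd hJ).differentiableAt
      (by simp)).hasFDerivAt.comp_hasDerivWithinAt t hW'
    refine this.congr_deriv ?_
    rw [fderiv_expand, c1, c2]; ring
  have comm : ∀ v w : E5, pd v (pd w S) (ζ t) = pd w (pd v S) (ζ t) := fun v w =>
    (Shf.pol (Q := fun _ => 0) hS).pd_comm hd (Pol.const 0) hJ v w
  -- errors
  have hδ : ∀ v ∈ dirs, |pd v (Hmap d) a - pd v (Hmap d) o| ≤
      B * |I t - J - ε * pd vu S (ζ t)| := by
    intro v hv
    refine (hB.H1_lip v hv _ ha _ ho).trans (mul_le_mul_of_nonneg_left ?_ hB.pos.le)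
    have := norm_mk_sub_mk_le ε (I t) (u t) (P t) (X t) (J + ε * pd vu S (ζ t)) (u t) (P t) (X t)
    simp only [sub_self, abs_zero, add_zero] at this
    have ho' : o = (ε, J + ε * pd vu S (ζ t), u t, P t, X t) := by
      rw [hodef, ← hq t ht]; rfl
    rw [ho']
    refine this.trans (le_of_eq ?_)
    congr 1; ring
  have hη : 0 ≤ ε ^ (m + 1) := by positivity
  have hE : 0 ≤ |I t - J - ε * pd vu S (ζ t)| := abs_nonneg _
  have hopos : 0 < o.2.1 := act_pos_of_mem hρ ho
  have rid := fun (v : E5) (hv : v.1 = 0) => pd_Rmap_eq hd hS hK (z := ζ t) hJ hopos hv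
  have hR1 := fun (v : E5) (hv : v ∈ dirs) (h0 : v.1 = 0) => hB.R1 v hv h0 (ζ t) hζ hε.le
  have ridX := rid vX rfl
  have ridu := rid vu rfl
  have ridI := rid vI rfl
  have ridp := rid vp rfl
  have hRX := hR1 vX (by simp) rfl
  have hRu := hR1 vu (by simp) rfl
  have hRI := hR1 vI (by simp) rfl
  have hRp := hR1 vp (by simp) rfl
  rw [pd_vu_Kmap _ ((hK.contDiffAt hd (z := shiftMap (pd vp (iterate d m).Smap) (ζ t))
    hJ).differentiableAt (by simp))] at ridu
  have s2 : ∀ v ∈ dirs, ∀ w ∈ dirs, |pd w (pd v S) (ζ t)| ≤ B :=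
    fun v hv w hw => hB.S2 v hv w hw _ hζ
  change pd vX ((iterate d m).Rmap d) (ζ t) = pd vX (Hmap d) o
      + ε * pd vX (pd vu S) (ζ t) * pd vI (Hmap d) o
      + ε ^ 2 * pd vX (pd vX S) (ζ t) * pd vp (Hmap d) o - pd vX (iterate d m).Kmap σ
      - ε ^ 2 * pd vX (pd vp S) (ζ t) * pd vX (iterate d m).Kmap σ at ridX
  change pd vu ((iterate d m).Rmap d) (ζ t) = pd vu (Hmap d) o
      + ε * pd vu (pd vu S) (ζ t) * pd vI (Hmap d) o
      + ε ^ 2 * pd vu (pd vX S) (ζ t) * pd vp (Hmap d) o - 0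
      - ε ^ 2 * pd vu (pd vp S) (ζ t) * pd vX (iterate d m).Kmap σ at ridu
  change pd vI ((iterate d m).Rmap d) (ζ t) = pd vI (Hmap d) o
      + ε * pd vI (pd vu S) (ζ t) * pd vI (Hmap d) o
      + ε ^ 2 * pd vI (pd vX S) (ζ t) * pd vp (Hmap d) o - pd vI (iterate d m).Kmap σ
      - ε ^ 2 * pd vI (pd vp S) (ζ t) * pd vX (iterate d m).Kmap σ at ridI
  change pd vp ((iterate d m).Rmap d) (ζ t) = pd vp (Hmap d) o
      + ε * pd vp (pd vu S) (ζ t) * pd vI (Hmap d) o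
      + ε ^ 2 * pd vp (pd vX S) (ζ t) * pd vp (Hmap d) o - pd vp (iterate d m).Kmap σ
      - ε ^ 2 * pd vp (pd vp S) (ζ t) * pd vX (iterate d m).Kmap σ at ridp
  change |_| ≤ B * ε ^ (m + 1) at hRX hRu hRI hRp
  rw [fderiv_expand, c1, c2, c3, c5] at c4
  set δu := pd vu (Hmap d) a - pd vu (Hmap d) o
  set δI := pd vI (Hmap d) a - pd vI (Hmap d) o
  set δp := pd vp (Hmap d) a - pd vp (Hmap d) o
  set δX := pd vX (Hmap d) a - pd vX (Hmap d) o
  have hδu : |δu| ≤ _ := hδ vu vu_mem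
  have hδI : |δI| ≤ _ := hδ vI vI_mem
  have hδp : |δp| ≤ _ := hδ vp vp_mem
  have hδX : |δX| ≤ _ := hδ vX vX_mem
  set w := W'.2.2.2.1 + ε * pd vX (iterate d m).Kmap σ with hw
  -- The differentiated momentum equation minus `ε` times the `X`-derivative of the residual
  -- identity: the main terms cancel, and only the residual and the differences of derivatives of
  -- `H` remain.
  have eqw : w * (1 + ε ^ 2 * pd vp (pd vX S) (ζ t)) = -(ε * (pd vX ((iterate d m).Rmap d) (ζ t)
      + δX + ε * pd vu (pd vX S) (ζ t) * δI + ε ^ 2 * pd vX (pd vX S) (ζ t) * δp)) := by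
    rw [ridX, hw]
    rw [comm vX vu, comm vX vp]
    simp only [δX, δI, δp]
    linear_combination c4
  have hwb : |w| ≤ ε * (6 * B ^ 2 * err) := by
    have k1 : |w| * (1 / 2) ≤ |w| * |1 + ε ^ 2 * pd vp (pd vX S) (ζ t)| := by
      refine mul_le_mul_of_nonneg_left ?_ (abs_nonneg _)
      have h1 : |ε ^ 2 * pd vp (pd vX S) (ζ t)| ≤ 1 / 2 := by
        rw [abs_mul, abs_of_nonneg (sq_nonneg ε)]
        calc ε ^ 2 * _ ≤ ε ^ 2 * B :=
              mul_le_mul_of_nonneg_left (s2 vX vX_mem vp vp_mem) (sq_nonneg _)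
          _ ≤ 1 / 2 := by nlinarith
      have := (abs_le.1 h1).1
      refine le_trans ?_ (le_abs_self _)
      linarith
    rw [← abs_mul, eqw, abs_neg, abs_mul, abs_of_pos hε] at k1
    have k2 : |pd vX ((iterate d m).Rmap d) (ζ t)
        + δX + ε * pd vu (pd vX S) (ζ t) * δI + ε ^ 2 * pd vX (pd vX S) (ζ t) * δp| ≤
        3 * B ^ 2 * err := by
      have j : ∀ x y e : ℝ, 0 ≤ e → e ≤ 1 → |x| ≤ B → |y| ≤ B * |I t - J - ε * pd vu S (ζ t)| →
          |e * x * y| ≤ B * (B * |I t - J - ε * pd vu S (ζ t)|) := by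
        intro x y e he0 he hx hy
        rw [abs_mul, abs_mul, abs_of_nonneg he0]
        calc e * |x| * |y| ≤ 1 * B * (B * |I t - J - ε * pd vu S (ζ t)|) := by gcongr
          _ = _ := by ring
      have j1 := j _ _ ε hε.le (by linarith) (s2 vX vX_mem vu vu_mem) hδI
      have j2 := j _ _ (ε ^ 2) (sq_nonneg _) (by nlinarith) (s2 vX vX_mem vX vX_mem) hδp
      refine (abs_add_le _ _).trans ((add_le_add ((abs_add_le _ _).trans
        (add_le_add (abs_add_le _ _) le_rfl)) le_rfl).trans ?_)
      have hBB : B ≤ B ^ 2 := by nlinarith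
      have m1 := mul_le_mul_of_nonneg_right hBB hη
      have m2 := mul_le_mul_of_nonneg_right hBB hE
      have m3 : 0 ≤ B ^ 2 * ε ^ (m + 1) := by positivity
      have e : 3 * B ^ 2 * err = 3 * (B ^ 2 * ε ^ (m + 1)) +
        3 * (B ^ 2 * |I t - J - ε * pd vu S (ζ t)|) := by simp only [err]; ring
      rw [e]
      linarith
    have k3 := mul_le_mul_of_nonneg_left k2 hε.le
    linarith
  have herr : 0 ≤ err := add_nonneg hη hE
  have hwb' : |w| ≤ 6 * B ^ 2 * err := hwb.trans
    (mul_le_of_le_one_left (by positivity) (by linarith))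
  refine ⟨W'.2.2.2.1, _, _, _, hq', (hI.sub_const J).sub ((along vu).const_mul ε),
    hu.add ((along vI).const_mul ε), hX.add ((along vp).const_mul (ε ^ 2)), ?_, ?_, ?_, ?_⟩
  · refine hwb.trans (mul_le_mul_of_nonneg_left (mul_le_mul_of_nonneg_right ?_ herr) hε.le)
    nlinarith [sq_nonneg B]
  -- The velocity of the action error is minus the `u`-derivative of the residual, up to the errors
  -- `δ` and `w`. `K` enters only through `w`, because it does not depend on the phase.
  · have e : -pd vu (Hmap d) a - ε * (W'.2.2.1 * pd vu (pd vu S) (ζ t) +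
        W'.2.2.2.1 * pd vp (pd vu S) (ζ t) + W'.2.2.2.2 * pd vX (pd vu S) (ζ t)) =
        -(pd vu ((iterate d m).Rmap d) (ζ t) + δu + ε * pd vu (pd vu S) (ζ t) * δI
          + ε ^ 2 * pd vu (pd vX S) (ζ t) * δp + ε * pd vu (pd vp S) (ζ t) * w) := by
      rw [ridu, c3, c5, comm vX vu, comm vp vu]
      simp only [δu, δI, δp, hw]
      ring
    rw [e, abs_neg]
    exact abs_error_le hB1 hε (by linarith) hη hE hRu hδu hδI hδp (s2 vu (by simp) vu (by simp))
      (s2 vX (by simp) vu (by simp)) (s2 vp (by simp) vu (by simp)) hwb'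
  · have e : pd vI (Hmap d) a + ε * (W'.2.2.1 * pd vu (pd vI S) (ζ t) +
        W'.2.2.2.1 * pd vp (pd vI S) (ζ t) + W'.2.2.2.2 * pd vX (pd vI S) (ζ t))
          - pd vI (iterate d m).Kmap σ =
        (pd vI ((iterate d m).Rmap d) (ζ t) + δI + ε * pd vI (pd vu S) (ζ t) * δI
          + ε ^ 2 * pd vI (pd vX S) (ζ t) * δp + ε * pd vI (pd vp S) (ζ t) * w) := by
      rw [ridI, c3, c5, comm vX vI, comm vp vI, comm vu vI]
      simp only [δI, δp, hw]
      ring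
    rw [e]
    exact abs_error_le hB1 hε (by linarith) hη hE hRI hδI hδI hδp (s2 vu (by simp) vI (by simp))
      (s2 vX (by simp) vI (by simp)) (s2 vp (by simp) vI (by simp)) hwb'
  · have e : ε * pd vp (Hmap d) a + ε ^ 2 * (W'.2.2.1 * pd vu (pd vp S) (ζ t) +
        W'.2.2.2.1 * pd vp (pd vp S) (ζ t) + W'.2.2.2.2 * pd vX (pd vp S) (ζ t))
          - ε * pd vp (iterate d m).Kmap σ =
        ε * (pd vp ((iterate d m).Rmap d) (ζ t) + δp + ε * pd vp (pd vu S) (ζ t) * δI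
          + ε ^ 2 * pd vp (pd vX S) (ζ t) * δp + ε * pd vp (pd vp S) (ζ t) * w) := by
      rw [ridp, c3, c5, comm vX vp, comm vu vp]
      simp only [δI, δp, hw]
      ring
    rw [e, abs_mul, abs_of_pos hε]
    refine mul_le_mul_of_nonneg_left ?_ hε.le
    exact abs_error_le hB1 hε (by linarith) hη hE hRp hδp hδI hδp (s2 vu (by simp) vp (by simp))
      (s2 vX (by simp) vp (by simp)) (s2 vp (by simp) vp (by simp)) hwb'

end Solve


/-! ### Rays -/

/-! ### Partial derivatives of the exact Hamiltonian. -/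

section HmapDeriv
variable {d : ℝ → ℝ}

theorem Profile.differentiable (hd : Profile d) : Differentiable ℝ d :=
  hd.smooth.differentiable (by simp)

theorem Profile.differentiable_deriv (hd : Profile d) : Differentiable ℝ (deriv d) := by
  have := (hd.contDiff_iteratedDeriv 1).differentiable (by simp)
  rwa [iteratedDeriv_one] at this

theorem differentiableAt_Hmap (hd : Profile d) {z : E5} (hz : 0 < z.2.1) :
    DifferentiableAt ℝ (Hmap d) z :=
  ((pol_Hmap d).contDiffAt hd hz).differentiableAt (by simp)

theorem pd_vI_Hmap (hd : Profile d) {ε I u p X : ℝ} (hI : 0 < I) :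
    pd vI (Hmap d) (ε, I, u, p, X) = 2 * Real.pi ^ 2 * I / d X ^ 2 -
      2 * (p - ε * (I * deriv d X / d X) * u) * (ε * (deriv d X / d X) * u) := by
  have h1 := hasDerivAt_comp_curve (G := Hmap d) (c := fun s => (ε, s, u, p, X)) (t := I)
    (differentiableAt_Hmap hd hI)
    ((hasDerivAt_const _ _).prodMk ((hasDerivAt_id _).prodMk (hasDerivAt_const _ _)))
  have h2 : HasDerivAt (fun s => Real.pi ^ 2 * s ^ 2 / d X ^ 2 +
      (p - ε * (s * deriv d X / d X) * u) ^ 2 - 1) (Real.pi ^ 2 * (2 * I) / d X ^ 2 +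
      2 * (p - ε * (I * deriv d X / d X) * u) * (-(ε * (1 * deriv d X / d X) * u))) I := by
    have a := (((hasDerivAt_id I).pow 2).const_mul (Real.pi ^ 2)).div_const (d X ^ 2)
    have b := ((((((hasDerivAt_id I).mul_const (deriv d X)).div_const (d X)).const_mul
      ε).mul_const u).const_sub p).pow 2
    refine ((a.add b).sub_const 1).congr_deriv ?_
    simp
  exact (h1.unique h2).trans (by ring)

theorem pd_vu_Hmap (hd : Profile d) {ε I u p X : ℝ} (hI : 0 < I) :
    pd vu (Hmap d) (ε, I, u, p, X) =
      -(2 * (p - ε * (I * deriv d X / d X) * u) * (ε * (I * deriv d X / d X))) := by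
  have h1 := hasDerivAt_comp_curve (G := Hmap d) (c := fun s => (ε, I, s, p, X)) (t := u)
    (differentiableAt_Hmap hd hI)
    ((hasDerivAt_const _ _).prodMk ((hasDerivAt_const _ _).prodMk
      ((hasDerivAt_id _).prodMk (hasDerivAt_const _ _))))
  have h2 : HasDerivAt (fun s => Real.pi ^ 2 * I ^ 2 / d X ^ 2 +
      (p - ε * (I * deriv d X / d X) * s) ^ 2 - 1)
      (2 * (p - ε * (I * deriv d X / d X) * u) * (-(ε * (I * deriv d X / d X) * 1))) u := by
    have b := (((hasDerivAt_id u).const_mul (ε * (I * deriv d X / d X))).const_sub p).pow 2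
    refine ((b.const_add (Real.pi ^ 2 * I ^ 2 / d X ^ 2)).sub_const 1).congr_deriv ?_
    simp
  exact (h1.unique h2).trans (by ring)

theorem pd_vp_Hmap (hd : Profile d) {ε I u p X : ℝ} (hI : 0 < I) :
    pd vp (Hmap d) (ε, I, u, p, X) = 2 * (p - ε * (I * deriv d X / d X) * u) := by
  have h1 := hasDerivAt_comp_curve (G := Hmap d) (c := fun s => (ε, I, u, s, X)) (t := p)
    (differentiableAt_Hmap hd hI)
    ((hasDerivAt_const _ _).prodMk ((hasDerivAt_const _ _).prodMk
      ((hasDerivAt_const _ _).prodMk ((hasDerivAt_id _).prodMk (hasDerivAt_const _ _)))))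
  have h2 : HasDerivAt (fun s => Real.pi ^ 2 * I ^ 2 / d X ^ 2 +
      (s - ε * (I * deriv d X / d X) * u) ^ 2 - 1)
      (2 * (p - ε * (I * deriv d X / d X) * u)) p := by
    have b := ((hasDerivAt_id p).sub_const (ε * (I * deriv d X / d X) * u)).pow 2
    refine ((b.const_add (Real.pi ^ 2 * I ^ 2 / d X ^ 2)).sub_const 1).congr_deriv ?_
    simp
  exact h1.unique h2

theorem pd_vX_Hmap (hd : Profile d) {ε I u p X : ℝ} (hI : 0 < I) :
    pd vX (Hmap d) (ε, I, u, p, X) = -(2 * Real.pi ^ 2 * I ^ 2 * deriv d X / d X ^ 3) -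
      2 * (p - ε * (I * deriv d X / d X) * u) *
        (ε * (I * (deriv (deriv d) X * d X - deriv d X ^ 2) / d X ^ 2) * u) := by
  have h1 := hasDerivAt_comp_curve (G := Hmap d) (c := fun s => (ε, I, u, p, s)) (t := X)
    (differentiableAt_Hmap hd hI)
    ((hasDerivAt_const _ _).prodMk ((hasDerivAt_const _ _).prodMk
      ((hasDerivAt_const _ _).prodMk ((hasDerivAt_const _ _).prodMk (hasDerivAt_id _)))))
  have hX := (hd.d_pos X).ne'
  have e1 := (hd.differentiable X).hasDerivAt
  have e2 := (hd.differentiable_deriv X).hasDerivAt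
  have h2 : HasDerivAt (fun s => Real.pi ^ 2 * I ^ 2 / d s ^ 2 +
      (p - ε * (I * deriv d s / d s) * u) ^ 2 - 1)
      ((0 * d X ^ 2 - Real.pi ^ 2 * I ^ 2 * (2 * d X * deriv d X)) / (d X ^ 2) ^ 2 +
      2 * (p - ε * (I * deriv d X / d X) * u) * (-(ε * ((I * deriv (deriv d) X * d X -
        I * deriv d X * deriv d X) / d X ^ 2) * u))) X := by
    have a := (hasDerivAt_const X (Real.pi ^ 2 * I ^ 2)).div (e1.pow 2) (pow_ne_zero 2 hX)
    have b := (((((e2.const_mul I).div e1 hX).const_mul ε).mul_const u).const_sub p).pow 2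
    refine ((a.add b).sub_const 1).congr_deriv ?_
    simp
  refine (h1.unique h2).trans ?_
  field_simp
  ring

end HmapDeriv

/-- The phase in `[-π, π]`. -/
def uRay (d : ℝ → ℝ) (ε x y py : ℝ) : ℝ :=
  (if 0 < py then 1 else -1) * (Real.pi * (y / d (ε * x)))

/-- The momentum `p̂_x`. -/
def pHat (d : ℝ → ℝ) (ε x y px py : ℝ) : ℝ :=
  px + ε * (action d ε x py * deriv d (ε * x) / d (ε * x)) * uRay d ε x y py

/-- The point `(ε, I, u, p̂_x, X)`. -/
def statePt (d : ℝ → ℝ) (ε x y px py : ℝ) : E5 :=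
  (ε, action d ε x py, uRay d ε x y py, pHat d ε x y px py, ε * x)

/-! ### Action-angle variables of a state and Hamilton's equations in them. -/

section State
variable {d : ℝ → ℝ} {ε x y px py : ℝ}

theorem action_pos (hd : Profile d) (hpy : py ≠ 0) : 0 < action d ε x py := by
  unfold action
  have := hd.d_pos (ε * x)
  have := abs_pos.2 hpy
  have := Real.pi_pos
  positivity

theorem sign_mul_abs (py : ℝ) : (if 0 < py then (1 : ℝ) else -1) * |py| = py := by
  split_ifs with h
  · rw [abs_of_pos h, one_mul]
  · rw [abs_of_nonpos (not_lt.1 h)]; ring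

/-- The sign of `p_y`, the absolute value in the action and the factor `π` cancel in this product.
This makes `p̂_x` a smooth expression in `p_y y`. -/
theorem action_mul_uRay (hd : Profile d) : action d ε x py * uRay d ε x y py = py * y := by
  have := (hd.d_pos (ε * x)).ne'
  have h := sign_mul_abs py
  unfold action uRay
  calc _ = ((if 0 < py then (1 : ℝ) else -1) * |py|) * y := by field_simp
    _ = _ := by rw [h]

theorem pHat_eq (hd : Profile d) :
    pHat d ε x y px py = px + ε * (deriv d (ε * x) / d (ε * x)) * (py * y) := by
  have h := action_mul_uRay (ε := ε) (x := x) (y := y) (py := py) hd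
  unfold pHat
  linear_combination (ε * (deriv d (ε * x) / d (ε * x))) * h

theorem pHat_sub : pHat d ε x y px py -
    ε * (action d ε x py * deriv d (ε * x) / d (ε * x)) * uRay d ε x y py = px := by
  rw [pHat]; ring

theorem Hmap_statePt (hd : Profile d) : Hmap d (statePt d ε x y px py) = px ^ 2 + py ^ 2 - 1 := by
  have := (hd.d_pos (ε * x)).ne'
  simp only [Hmap, statePt, hamiltonian, pHat_sub]
  rw [action, div_pow, mul_pow, sq_abs]
  field_simp
  ring

/-- Hamilton's equations along a straight segment. -/
theorem hasDerivAt_state (hd : Profile d) (hpy : py ≠ 0) {X Y : ℝ → ℝ} {t : ℝ}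
    (hX : HasDerivAt X (2 * px) t) (hY : HasDerivAt Y (2 * py) t) :
    HasDerivAt (fun s => action d ε (X s) py)
      (-pd vu (Hmap d) (statePt d ε (X t) (Y t) px py)) t ∧
    HasDerivAt (fun s => uRay d ε (X s) (Y s) py)
      (pd vI (Hmap d) (statePt d ε (X t) (Y t) px py)) t ∧
    HasDerivAt (fun s => pHat d ε (X s) (Y s) px py)
      (-(ε * pd vX (Hmap d) (statePt d ε (X t) (Y t) px py))) t ∧
    HasDerivAt (fun s => ε * X s) (ε * pd vp (Hmap d) (statePt d ε (X t) (Y t) px py)) t := by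
  have hI : 0 < action d ε (X t) py := action_pos hd hpy
  have hdp := (hd.d_pos (ε * X t)).ne'
  have hpi := Real.pi_ne_zero
  unfold statePt
  rw [pd_vu_Hmap hd hI, pd_vI_Hmap hd hI, pd_vX_Hmap hd hI, pd_vp_Hmap hd hI, pHat_sub]
  have hεX := hX.const_mul ε
  have e1 := ((hd.differentiable (ε * X t)).hasDerivAt).comp t hεX
  have e2 := ((hd.differentiable_deriv (ε * X t)).hasDerivAt).comp t hεX
  have hsq : (if 0 < py then (1 : ℝ) else -1) * (if 0 < py then (1 : ℝ) else -1) = 1 := by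
    split_ifs <;> norm_num
  have hab := sign_mul_abs py
  set σ : ℝ := if 0 < py then (1 : ℝ) else -1 with hσ
  have habs : |py| = σ * py := by
    conv_rhs => rw [← hab]
    rw [← mul_assoc, hsq, one_mul]
  refine ⟨?_, ?_, ?_, ?_⟩
  · refine ((e1.const_mul |py|).div_const Real.pi).congr_deriv ?_
    unfold action
    field_simp
  · refine (((hY.div e1 hdp).const_mul Real.pi).const_mul σ).congr_deriv ?_
    simp only [Function.comp_apply]
    rw [action, uRay, ← hσ, habs]
    field_simp
  · have : (fun s => pHat d ε (X s) (Y s) px py) = fun s =>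
        px + ε * (deriv d (ε * X s) / d (ε * X s)) * (py * Y s) := by
      funext s; exact pHat_eq hd
    rw [this]
    refine ((((e2.div e1 hdp).const_mul ε).mul (hY.const_mul py)).const_add px).congr_deriv ?_
    have h1 : ∀ g, ε * (action d ε (X t) py * g / d (ε * X t) ^ 2) * uRay d ε (X t) (Y t) py =
        ε * g / d (ε * X t) ^ 2 * (py * Y t) := by
      intro g
      have h := action_mul_uRay (ε := ε) (x := X t) (y := Y t) (py := py) hd
      linear_combination (ε * g / d (ε * X t) ^ 2) * h
    rw [h1, action, div_pow, mul_pow, sq_abs]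
    simp only [Function.comp_apply, Pi.div_apply]
    field_simp
    ring
  · refine hεX.congr_deriv (by ring)

end State

/-! ### Geometry of the walls and flights between reflections. -/

/-- Bounds for the geometry of the waveguide. -/
structure Geom (d : ℝ → ℝ) (a c₀ D₀ D₁ : ℝ) : Prop where
  prof : Profile d
  a_pos : 0 < a
  c₀_pos : 0 < c₀
  lower : ∀ X, c₀ ≤ d X
  upper : ∀ X, d X ≤ D₀
  slope : ∀ X, |deriv d X| ≤ D₁
  one_le : 1 ≤ D₁

namespace Geom
variable {d : ℝ → ℝ} {a c₀ D₀ D₁ : ℝ}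

theorem D₀_pos (G : Geom d a c₀ D₀ D₁) : 0 < D₀ := G.c₀_pos.trans_le ((G.lower 0).trans (G.upper 0))

theorem abs_d_sub_le (G : Geom d a c₀ D₀ D₁) (X X' : ℝ) : |d X - d X'| ≤ D₁ * |X - X'| := by
  have := Convex.norm_image_sub_le_of_norm_deriv_le (f := d) (C := D₁) (s := univ)
    (fun x _ => G.prof.differentiable x) (fun x _ => G.slope x) convex_univ (mem_univ X')
    (mem_univ X)
  simpa [Real.norm_eq_abs] using this

end Geom

theorem exists_geom {d : ℝ → ℝ} (hd : Profile d) {a : ℝ} (ha : 0 < a) :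
    ∃ c₀ D₀ D₁, Geom d a c₀ D₀ D₁ := by
  obtain ⟨c, hc, h⟩ := hd.pos
  obtain ⟨B0, hB0⟩ := hd.bounded 0
  obtain ⟨B1, hB1⟩ := hd.bounded 1
  refine ⟨c, B0, max 1 B1, hd, ha, hc, h, fun X => ?_, fun X => ?_, le_max_left _ _⟩
  · have := hB0 X
    rw [iteratedDeriv_zero] at this
    exact (le_abs_self _).trans this
  · have := hB1 X
    rw [iteratedDeriv_one] at this
    exact this.trans (le_max_right _ _)

section Ray
variable {d : ℝ → ℝ} {a c₀ D₀ D₁ ε T : ℝ} {x y px py : ℝ → ℝ}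

theorem IsRay.abs_px_le (h : IsRay d ε T x y px py) {t : ℝ} (ht : t ∈ Icc 0 T) : |px t| ≤ 1 := by
  have := h.level t ht
  rw [← sq_le_one_iff_abs_le_one]
  nlinarith [sq_nonneg (py t)]

theorem IsRay.abs_py_le (h : IsRay d ε T x y px py) {t : ℝ} (ht : t ∈ Icc 0 T) : |py t| ≤ 1 := by
  have := h.level t ht
  rw [← sq_le_one_iff_abs_le_one]
  nlinarith [sq_nonneg (px t)]

theorem abs_slope_le (G : Geom d a c₀ D₀ D₁) (hε : 0 < ε) (X : ℝ) :
    |ε * deriv d X| ≤ ε * D₁ := by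
  rw [abs_mul, abs_of_pos hε]
  exact mul_le_mul_of_nonneg_left (G.slope X) hε.le

/-- The direction of motion at the walls. -/
theorem IsRay.direction (h : IsRay d ε T x y px py) (G : Geom d a c₀ D₀ D₁) (hε : 0 < ε)
    {t c : ℝ} (ht : t ∈ Icc 0 T) (hc : c ≤ |py t|) (hs : D₁ * ε < c) :
    (0 < py t → y t < d (ε * x t)) ∧ (py t < 0 → 0 < y t) := by
  constructor
  · intro hpos
    refine lt_of_le_of_ne (h.inside t ht).2 fun he => ?_
    have h1 := h.upper_outgoing t ht he
    rw [abs_of_pos hpos] at hc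
    have h2 := abs_slope_le G hε (ε * x t)
    have h3 := h.abs_px_le ht
    have h4 : ε * deriv d (ε * x t) * px t ≤ ε * D₁ * 1 := by
      refine (le_abs_self _).trans ?_
      rw [abs_mul]
      exact mul_le_mul h2 h3 (abs_nonneg _) ((abs_nonneg _).trans h2)
    linarith
  · intro hneg
    refine lt_of_le_of_ne (h.inside t ht).1 fun he => ?_
    have := h.lower_outgoing t ht he.symm
    linarith

theorem abs_uRay_le (hd : Profile d) {x y py : ℝ} (h0 : 0 ≤ y) (h1 : y ≤ d (ε * x)) :
    |uRay d ε x y py| ≤ Real.pi := by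
  have hp := hd.d_pos (ε * x)
  have h2 : y / d (ε * x) ≤ 1 := (div_le_one hp).2 h1
  have h3 : 0 ≤ y / d (ε * x) := div_nonneg h0 hp.le
  have h4 : |(if 0 < py then (1 : ℝ) else -1)| = 1 := by split_ifs <;> simp
  rw [uRay, abs_mul, h4, one_mul, abs_of_nonneg (mul_nonneg Real.pi_pos.le h3)]
  exact mul_le_of_le_one_right Real.pi_pos.le h2

theorem abs_pHat_le (G : Geom d a c₀ D₀ D₁) (hε : 0 < ε) (hs : D₁ * ε ≤ 1) {x y px py : ℝ}
    (h0 : 0 ≤ y) (h1 : y ≤ d (ε * x)) (hpx : |px| ≤ 1) (hpy : |py| ≤ 1) :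
    |pHat d ε x y px py| ≤ 2 := by
  have hp := G.prof.d_pos (ε * x)
  rw [pHat_eq G.prof]
  have h2 : |y / d (ε * x)| ≤ 1 := by
    rw [abs_of_nonneg (div_nonneg h0 hp.le)]; exact (div_le_one hp).2 h1
  have e : ε * (deriv d (ε * x) / d (ε * x)) * (py * y) =
      (ε * deriv d (ε * x)) * (py * (y / d (ε * x))) := by ring
  have h3 : |(ε * deriv d (ε * x)) * (py * (y / d (ε * x)))| ≤ 1 := by
    rw [abs_mul, abs_mul py]
    have h5 := (abs_slope_le G hε (ε * x)).trans ((mul_comm _ _).trans_le hs)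
    exact mul_le_one₀ h5 (by positivity) (mul_le_one₀ hpy (abs_nonneg _) h2)
  rw [e]
  have := abs_add_le px ((ε * deriv d (ε * x)) * (py * (y / d (ε * x))))
  linarith

theorem action_le (G : Geom d a c₀ D₀ D₁) {x py : ℝ} (hpy : |py| ≤ 1) :
    action d ε x py ≤ D₀ := by
  have hp := G.prof.d_pos (ε * x)
  rw [action, div_le_iff₀ Real.pi_pos]
  calc |py| * d (ε * x) ≤ 1 * D₀ := mul_le_mul hpy (G.upper _) hp.le zero_le_one
    _ ≤ D₀ * Real.pi := by nlinarith [Real.pi_gt_three, G.D₀_pos]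

theorem py_ge_of_action (G : Geom d a c₀ D₀ D₁) {x py b : ℝ}
    (h : b ≤ action d ε x py) : Real.pi * b / D₀ ≤ |py| := by
  rw [action, le_div_iff₀ Real.pi_pos] at h
  rw [div_le_iff₀ G.D₀_pos]
  calc Real.pi * b = b * Real.pi := mul_comm _ _
    _ ≤ |py| * d (ε * x) := h
    _ ≤ _ := mul_le_mul_of_nonneg_left (G.upper _) (abs_nonneg _)

theorem abs_action_sub_le (G : Geom d a c₀ D₀ D₁) (hε : 0 < ε) {x x' py : ℝ} (hpy : |py| ≤ 1) :
    |action d ε x py - action d ε x' py| ≤ D₁ * (ε * |x - x'|) := by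
  have h1 := G.abs_d_sub_le (ε * x) (ε * x')
  rw [← mul_sub, abs_mul, abs_of_pos hε] at h1
  have e : action d ε x py - action d ε x' py = |py| / Real.pi * (d (ε * x) - d (ε * x')) := by
    unfold action; ring
  rw [e, abs_mul, abs_of_nonneg (by positivity)]
  have h2 : |py| / Real.pi ≤ 1 := by
    rw [div_le_one Real.pi_pos]; linarith [Real.pi_gt_three]
  calc _ ≤ 1 * (D₁ * (ε * |x - x'|)) := mul_le_mul h2 h1 (abs_nonneg _) zero_le_one
    _ = _ := one_mul _

/-- The Lipschitz constant of the phase along a flight. -/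
def phaseRate (c₀ D₀ D₁ : ℝ) : ℝ := 4 * (2 / c₀ + D₀ * (D₁ * 2) / c₀ ^ 2)

theorem abs_uRay_sub_le (G : Geom d a c₀ D₀ D₁) (hε : 0 < ε) (hε1 : ε ≤ 1) {x x' y y' py τ : ℝ}
    (h0 : 0 ≤ y') (h1 : y' ≤ D₀) (hx : |x - x'| ≤ 2 * τ) (hy : |y - y'| ≤ 2 * τ) :
    |uRay d ε x y py - uRay d ε x' y' py| ≤ phaseRate c₀ D₀ D₁ * τ := by
  have hp := G.prof.d_pos (ε * x)
  have hp' := G.prof.d_pos (ε * x')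
  have hc := G.c₀_pos
  have hτ : 0 ≤ τ := by linarith [abs_nonneg (x - x')]
  have h2 := G.abs_d_sub_le (ε * x') (ε * x)
  rw [← mul_sub, abs_mul, abs_of_pos hε, abs_sub_comm x' x] at h2
  have h3 : |d (ε * x') - d (ε * x)| ≤ D₁ * 2 * τ := by
    refine h2.trans ?_
    have hD := G.one_le
    calc D₁ * (ε * |x - x'|) ≤ D₁ * (1 * (2 * τ)) := by gcongr
      _ = _ := by ring
  have h4 : |(if 0 < py then (1 : ℝ) else -1)| = 1 := by split_ifs <;> simp
  have e : uRay d ε x y py - uRay d ε x' y' py = (if 0 < py then 1 else -1) * (Real.pi *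
      ((y - y') / d (ε * x) + y' * (d (ε * x') - d (ε * x)) / (d (ε * x) * d (ε * x')))) := by
    unfold uRay
    field_simp
    ring
  rw [e, abs_mul, h4, one_mul, abs_mul, abs_of_pos Real.pi_pos, phaseRate, mul_assoc]
  refine mul_le_mul Real.pi_le_four ?_ (abs_nonneg _) (by norm_num)
  rw [add_mul]
  refine (abs_add_le _ _).trans (add_le_add ?_ ?_)
  · rw [abs_div, abs_of_pos hp]
    calc |y - y'| / d (ε * x) ≤ (2 * τ) / c₀ := div_le_div₀ (by positivity) hy hc (G.lower _)
      _ = _ := by ring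
  · rw [abs_div, abs_mul, abs_of_nonneg h0, abs_of_pos (mul_pos hp hp')]
    have hD := G.D₀_pos
    have hD1 := G.one_le
    calc y' * |d (ε * x') - d (ε * x)| / (d (ε * x) * d (ε * x')) ≤
        (D₀ * (D₁ * 2 * τ)) / (c₀ * c₀) := by
          refine div_le_div₀ (by positivity) ?_ (by positivity) ?_
          · exact mul_le_mul h1 h3 (abs_nonneg _) hD.le
          · exact mul_le_mul (G.lower _) (G.lower _) hc.le hp.le
      _ = _ := by ring

/-- The pair `s < t` bounds a flight without reflections in between. -/
structure Flight (d : ℝ → ℝ) (ε : ℝ) (x y px py : ℝ → ℝ) (s t : ℝ) : Prop where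
  lt : s < t
  inner : ∀ τ ∈ Ico s t, x τ = x s + 2 * (τ - s) * px s ∧ y τ = y s + 2 * (τ - s) * py s ∧
    px τ = px s ∧ py τ = py s
  x_end : x t = x s + 2 * (t - s) * px s
  y_end : y t = y s + 2 * (t - s) * py s
  final : (px t = px s ∧ py t = py s) ∨ (y t = 0 ∧ px t = px s ∧ py t = - py s) ∨
      (y t = d (ε * x t) ∧
        px t = px s + 2 * (ε * deriv d (ε * x t)) *
          ((py s - ε * deriv d (ε * x t) * px s) / (1 + (ε * deriv d (ε * x t)) ^ 2)) ∧
        py t = py s - 2 *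
          ((py s - ε * deriv d (ε * x t) * px s) / (1 + (ε * deriv d (ε * x t)) ^ 2)))

theorem Flight.x_eq {s t : ℝ} (h : Flight d ε x y px py s t) {τ : ℝ} (hτ : τ ∈ Icc s t) :
    x τ = x s + 2 * (τ - s) * px s := by
  rcases eq_or_lt_of_le hτ.2 with he | he
  · rw [he]; exact h.x_end
  · exact (h.inner τ ⟨hτ.1, he⟩).1

theorem Flight.y_eq {s t : ℝ} (h : Flight d ε x y px py s t) {τ : ℝ} (hτ : τ ∈ Icc s t) :
    y τ = y s + 2 * (τ - s) * py s := by
  rcases eq_or_lt_of_le hτ.2 with he | he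
  · rw [he]; exact h.y_end
  · exact (h.inner τ ⟨hτ.1, he⟩).2.1

theorem IsRay.exists_flights (h : IsRay d ε T x y px py) : ∃ R : Finset ℝ, ∀ s t : ℝ, 0 ≤ s →
    s < t → t ≤ T → (∀ q ∈ R, q ∉ Ioo s t) → Flight d ε x y px py s t := by
  obtain ⟨R, hR⟩ := h.motion
  refine ⟨R, fun s t hs hst ht hq => ?_⟩
  obtain ⟨e1, e2, e3, e4⟩ := hR s t hs hst ht hq
  refine ⟨hst, ?_, e1, e2, ?_⟩
  · intro τ hτ
    rcases eq_or_lt_of_le hτ.1 with he | he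
    · subst he; simp
    · obtain ⟨f1, f2, f3, -⟩ := hR s τ hs he (hτ.2.le.trans ht)
        fun q hqR hq' => hq q hqR ⟨hq'.1, hq'.2.trans hτ.2⟩
      exact ⟨f1, f2, f3 fun hτR => hq τ hτR ⟨he, hτ.2⟩⟩
  · by_cases htR : t ∈ R
    · exact Or.inr (e4 htR)
    · exact Or.inl (e3 htR)

/-- After every time there is a flight. -/
theorem IsRay.exists_flight (h : IsRay d ε T x y px py) {s : ℝ} (hs : s ∈ Ico 0 T) :
    ∃ t ≤ T, Flight d ε x y px py s t := by
  obtain ⟨R, hR⟩ := h.exists_flights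
  have hev : ∀ᶠ t in 𝓝[>] s, ∀ q ∈ R, q ∉ Ioo s t := by
    refine (Finset.eventually_all R).2 fun q _ => ?_
    rcases le_or_gt q s with hq | hq
    · exact Eventually.of_forall fun t ht => absurd ht.1 (not_lt.2 hq)
    · filter_upwards [Ioo_mem_nhdsGT hq] with t ht hq' using absurd hq'.2 (not_lt.2 ht.2.le)
  obtain ⟨t, ht, htT⟩ := (hev.and (Ioo_mem_nhdsGT hs.2)).exists
  exact ⟨t, htT.2.le, hR s t hs.1 htT.1 htT.2.le ht⟩

/-- A property of times that is carried along flights holds at all times. -/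
theorem IsRay.induction (h : IsRay d ε T x y px py) {Q : ℝ → Prop} (h0 : Q 0)
    (hstep : ∀ s t, 0 ≤ s → t ≤ T → Flight d ε x y px py s t → Q s → Q t) :
    ∀ t ∈ Icc 0 T, Q t := by
  obtain ⟨R, hflight⟩ := h.exists_flights
  -- Strong induction on the number of reflection times in `(0, t)`.
  suffices H : ∀ n : ℕ, ∀ t ∈ Icc 0 T, (R.filter fun q => q ∈ Ioo 0 t).card = n → Q t from
    fun t ht => H _ t ht rfl
  intro n
  induction n using Nat.strong_induction_on with
  | _ n ih =>
    intro t ht hn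
    rcases eq_or_lt_of_le ht.1 with he | h0t
    · rwa [← he]
    rcases (R.filter fun q => q ∈ Ioo 0 t).eq_empty_or_nonempty with hemp | hne
    · refine hstep 0 t le_rfl ht.2 (hflight 0 t le_rfl h0t ht.2 fun q hq hq' => ?_) h0
      have : q ∈ R.filter fun q => q ∈ Ioo 0 t := Finset.mem_filter.2 ⟨hq, hq'⟩
      rw [hemp] at this
      simp at this
    · set q := (R.filter fun q => q ∈ Ioo 0 t).max' hne with hqdef
      have hqm := Finset.max'_mem _ hne
      rw [← hqdef, Finset.mem_filter] at hqm
      obtain ⟨hqR, hq0, hqt⟩ := hqm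
      have hlt : (R.filter fun q' => q' ∈ Ioo 0 q).card < n := by
        rw [← hn]
        refine Finset.card_lt_card ⟨fun r hr => ?_, fun hsub => ?_⟩
        · rw [Finset.mem_filter] at hr ⊢
          exact ⟨hr.1, hr.2.1, hr.2.2.trans hqt⟩
        · have := hsub (Finset.mem_filter.2 ⟨hqR, hq0, hqt⟩)
          rw [Finset.mem_filter] at this
          exact lt_irrefl _ this.2.2
      -- After the last reflection time `q` before `t` there is a single flight, and fewer
      -- reflection times precede `q`.
      refine hstep q t hq0.le ht.2 (hflight q t hq0.le hqt ht.2 fun r hr hr' => ?_)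
        (ih _ hlt q ⟨hq0.le, hqt.le.trans ht.2⟩ rfl)
      have := Finset.le_max' (R.filter fun q => q ∈ Ioo 0 t) r
        (Finset.mem_filter.2 ⟨hr, hq0.trans hr'.1, hr'.2⟩)
      rw [← hqdef] at this
      exact absurd hr'.1 (not_lt.2 this)

/-- The state at the end of a flight: either it continues the flight, or the upper wall was hit. -/
theorem Flight.end_state (G : Geom d a c₀ D₀ D₁) (h : IsRay d ε T x y px py) (hε : 0 < ε)
    {s t c : ℝ} (hs0 : 0 ≤ s) (htT : t ≤ T) (hf : Flight d ε x y px py s t)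
    (hc0 : 0 < c) (hc : c ≤ |py s|) (hs : 4 * D₁ * ε < c) :
    statePt d ε (x t) (y t) (px t) (py t) = statePt d ε (x t) (y t) (px s) (py s) ∨
    (uRay d ε (x t) (y t) (py s) = Real.pi ∧ uRay d ε (x t) (y t) (py t) = -Real.pi ∧
      pHat d ε (x t) (y t) (px t) (py t) = pHat d ε (x t) (y t) (px s) (py s) ∧
      |action d ε (x t) (py t) - action d ε (x t) (py s)| ≤ 2 * D₀ * D₁ * ε) := by
  have hsI : s ∈ Icc 0 T := ⟨hs0, hf.lt.le.trans htT⟩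
  have hdp := G.prof.d_pos (ε * x t)
  have hlt := hf.lt
  rcases hf.final with ⟨e1, e2⟩ | ⟨ey, e1, e2⟩ | ⟨ey, e1, e2⟩
  · left; rw [e1, e2]
  · left
    unfold statePt pHat uRay action
    rw [e1, e2, ey, abs_neg]
    simp
  · right
    have hsl := abs_slope_le G hε (ε * x t)
    have hpxs := h.abs_px_le hsI
    -- A ray going down with `|p_y| ≥ c` recedes from the upper wall faster than the wall, of slope
    -- at most `ε D₁`, can descend; so the upper wall is hit only on the way up.
    have hpos : 0 < py s := by
      by_contra hneg
      rw [abs_of_nonpos (not_lt.1 hneg)] at hc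
      have h1 := (h.inside s hsI).2
      have h2 := hf.y_end
      have h3 := G.abs_d_sub_le (ε * x s) (ε * x t)
      have h4 : |ε * x s - ε * x t| ≤ ε * (2 * (t - s)) := by
        rw [hf.x_end, show ε * x s - ε * (x s + 2 * (t - s) * px s) =
          -(ε * (2 * (t - s)) * px s) by ring, abs_neg, abs_mul,
          abs_of_pos (show 0 < ε * (2 * (t - s)) by have := sub_pos.2 hlt; positivity)]
        exact mul_le_of_le_one_right (by have := sub_pos.2 hlt; positivity) hpxs
      have h5 : d (ε * x s) - d (ε * x t) ≤ D₁ * (ε * (2 * (t - s))) :=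
        (le_abs_self _).trans (h3.trans (mul_le_mul_of_nonneg_left h4 (by linarith [G.one_le])))
      have h6 : 0 < (t - s) := sub_pos.2 hlt
      nlinarith [mul_pos h6 hc0, mul_lt_mul_of_pos_left hs h6,
        mul_le_mul_of_nonneg_left hc h6.le, mul_pos (mul_pos h6 hε) (by linarith [G.one_le] : 0 < D₁)]
    rw [abs_of_pos hpos] at hc
    set δ := ε * deriv d (ε * x t) with hδ
    have hq : 0 < 1 + δ ^ 2 := by positivity
    have hpy1 := (le_abs_self _).trans (h.abs_py_le hsI)
    have hδ1 : |δ| ≤ 1 := by linarith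
    -- The wall is nearly horizontal, so the reflection reverses `p_y` up to a multiple of the
    -- slope. This gives both the sign of the new `p_y` and the size of the jump of the action.
    have hsum : |py t + py s| ≤ 4 * |δ| := by
      have e : py t + py s = (2 * δ * (δ * py s + px s)) / (1 + δ ^ 2) := by
        rw [e2]; field_simp; ring
      rw [e, abs_div, abs_of_pos hq, div_le_iff₀ hq, abs_mul, abs_mul]
      have h1 : |δ * py s + px s| ≤ 2 := by
        refine (abs_add_le _ _).trans ?_
        rw [abs_mul]
        have := mul_le_one₀ hδ1 (abs_nonneg _) (h.abs_py_le hsI)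
        linarith
      have h2 : |(2 : ℝ)| = 2 := abs_two
      rw [h2]
      nlinarith [abs_nonneg δ, sq_nonneg δ, mul_le_mul_of_nonneg_left h1 (abs_nonneg δ),
        mul_nonneg (abs_nonneg δ) (sq_nonneg δ)]
    have hneg : py t < 0 := by
      have := (abs_le.1 hsum).2
      nlinarith
    refine ⟨?_, ?_, ?_, ?_⟩
    · rw [uRay, if_pos hpos, ey, div_self hdp.ne']; ring
    · rw [uRay, if_neg (not_lt.2 hneg.le), ey, div_self hdp.ne']; ring
    · rw [pHat_eq G.prof, pHat_eq G.prof, ey]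
      -- At `y = d` the momentum `p̂_x` equals `p_x + δ p_y`, an unnormalized tangential component,
      -- which specular reflection preserves.
      have k : ∀ q : ℝ, ε * (deriv d (ε * x t) / d (ε * x t)) * (q * d (ε * x t)) = δ * q := by
        intro q; rw [hδ]; field_simp
      rw [k, k, e1, e2]; ring
    · have e : action d ε (x t) (py t) - action d ε (x t) (py s) =
          -((py t + py s) * (d (ε * x t) / Real.pi)) := by
        unfold action; rw [abs_of_pos hpos, abs_of_neg hneg]; ring
      have hd2 : d (ε * x t) / Real.pi ≤ D₀ / 2 := by
        refine div_le_div₀ G.D₀_pos.le (G.upper _) (by norm_num) (by linarith [Real.pi_gt_three])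
      rw [e, abs_neg, abs_mul, abs_of_pos (div_pos hdp Real.pi_pos)]
      calc |py t + py s| * (d (ε * x t) / Real.pi) ≤ (4 * (ε * D₁)) * (D₀ / 2) := by
            refine mul_le_mul (hsum.trans (by linarith)) hd2 (by positivity) ?_
            have := G.one_le
            positivity
        _ = _ := by ring

end Ray


/-! ### Conservation of the improved action -/

/-- A lower bound for `|p_y|`. -/
def pyMin (a D₀ : ℝ) : ℝ := Real.pi * (a / 2) / D₀

/-- The bounds and the smallness of `ε` used below. -/
structure Small (d : ℝ → ℝ) (a c₀ D₀ D₁ : ℝ) (m : ℕ) (ρ B ε : ℝ) : Prop where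
  geom : Geom d a c₀ D₀ D₁
  nf : NFBound d m ρ B
  ρ_ge : 8 ≤ ρ
  ρ_a : 4 / a ≤ ρ
  ρ_D : 3 * D₀ ≤ ρ
  ε_pos : 0 < ε
  -- `s1` solves the implicit equations stably; `s2` bounds the shift between old and new action;
  -- `s3` makes the walls flat compared with `|p_y|`; `s4` bounds `p̂_x`; `s5` and `s6` bound the
  -- change of the action during a flight and at an upper reflection; `s7` keeps `∂H/∂I` away from
  -- zero.
  s1 : 10 * B * ε ≤ 1
  s2 : B * ε ≤ a / 16
  s3 : 4 * D₁ * ε < pyMin a D₀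
  s4 : D₁ * ε ≤ 1
  s5 : D₁ * (ε * (D₀ / pyMin a D₀)) ≤ a / 16
  s6 : 2 * D₀ * D₁ * ε ≤ a / 16
  s7 : ε * (D₁ * 4 / c₀ * (4 + D₁ * 4 / c₀ * (6 * D₀))) ≤ Real.pi ^ 2 * a / (4 * D₀ ^ 2)

theorem eventually_mul_le (M : ℝ) {b : ℝ} (hb : 0 < b) : ∀ᶠ ε : ℝ in 𝓝[>] 0, M * ε ≤ b := by
  have : Tendsto (fun ε : ℝ => M * ε) (𝓝 0) (𝓝 (M * 0)) :=
    (continuous_const.mul continuous_id).tendsto 0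
  rw [mul_zero] at this
  exact ((this.eventually (gt_mem_nhds hb)).filter_mono nhdsWithin_le_nhds).mono fun _ h => h.le

section
variable {d : ℝ → ℝ} {a c₀ D₀ D₁ : ℝ}

theorem Geom.pyMin_pos (G : Geom d a c₀ D₀ D₁) : 0 < pyMin a D₀ := by
  have := G.D₀_pos
  have := G.a_pos
  have := Real.pi_pos
  unfold pyMin; positivity

/-- The radius of the region of bounded variables. -/
def radius (a D₀ : ℝ) : ℝ := 8 + 4 / a + 3 * D₀

theorem Geom.radius_pos (G : Geom d a c₀ D₀ D₁) : 0 < radius a D₀ := by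
  have := G.D₀_pos
  have := G.a_pos
  unfold radius; positivity

theorem eventually_small (G : Geom d a c₀ D₀ D₁) {m : ℕ} {B : ℝ}
    (hB : NFBound d m (radius a D₀) B) :
    ∀ᶠ ε : ℝ in 𝓝[>] 0, Small d a c₀ D₀ D₁ m (radius a D₀) B ε := by
  have hD := G.D₀_pos
  have ha := G.a_pos
  have hc := G.pyMin_pos
  have hpi := Real.pi_pos
  filter_upwards [eventually_mul_le (10 * B) one_pos, eventually_mul_le B (b := a / 16) (by positivity),
    eventually_mul_le (4 * D₁) (half_pos hc), eventually_mul_le D₁ one_pos,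
    eventually_mul_le (D₁ * (D₀ / pyMin a D₀)) (b := a / 16) (by positivity),
    eventually_mul_le (2 * D₀ * D₁) (b := a / 16) (by positivity),
    eventually_mul_le (D₁ * 4 / c₀ * (4 + D₁ * 4 / c₀ * (6 * D₀)))
      (b := Real.pi ^ 2 * a / (4 * D₀ ^ 2)) (by positivity), self_mem_nhdsWithin]
    with ε h1 h2 h3 h4 h5 h6 h7 h8
  refine ⟨G, hB, ?_, ?_, ?_, h8, h1, h2, by linarith, h4, ?_, h6, by linarith⟩
  · have : 0 < 4 / a := by positivity
    unfold radius; linarith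
  · unfold radius; linarith
  · have : 0 < 4 / a := by positivity
    unfold radius; linarith
  · calc _ = D₁ * (D₀ / pyMin a D₀) * ε := by ring
      _ ≤ _ := h5

variable {m : ℕ} {ρ B ε : ℝ}

theorem Small.ρ_pos (hS : Small d a c₀ D₀ D₁ m ρ B ε) : 0 < ρ := by linarith [hS.ρ_ge]

theorem Small.ε_le (hS : Small d a c₀ D₀ D₁ m ρ B ε) : ε ≤ 1 / 10 :=
  eps_le_of_small hS.nf hS.ε_pos hS.s1

theorem Small.mem_Dom (hS : Small d a c₀ D₀ D₁ m ρ B ε) {I u p X : ℝ} (h1 : a / 4 ≤ I)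
    (h2 : I ≤ 3 * D₀) (hu : |u| ≤ Real.pi) (hp : |p| ≤ 8) : (ε, I, u, p, X) ∈ Dom ρ := by
  have ha := hS.geom.a_pos
  refine ⟨?_, ?_, h2.trans hS.ρ_D, ?_, hp.trans hS.ρ_ge⟩
  · change |ε| ≤ 1
    rw [abs_of_pos hS.ε_pos]; linarith [hS.ε_le]
  · refine le_trans ?_ h1
    refine inv_le_of_inv_le₀ (by positivity) ?_
    rw [inv_div]; exact hS.ρ_a
  · exact hu.trans (Real.pi_le_four.trans (by linarith [hS.ρ_ge]))

/-- The difference quotient of `H` in `I` is `π² (I₁ + I₂) / d²` plus terms of order `ε`, of which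
`s7` absorbs at most half the lower bound. Thus the energy determines the action after a reflection.
-/
theorem Small.action_lower (hS : Small d a c₀ D₀ D₁ m ρ B ε) {I₁ I₂ u P X : ℝ}
    (h1 : a / 4 ≤ I₁) (h2 : a / 4 ≤ I₂) (h3 : I₁ ≤ 3 * D₀) (h4 : I₂ ≤ 3 * D₀)
    (hu : |u| ≤ Real.pi) (hP : |P| ≤ 2) :
    Real.pi ^ 2 * a / (4 * D₀ ^ 2) * |I₁ - I₂| ≤
      |Hmap d (ε, I₁, u, P, X) - Hmap d (ε, I₂, u, P, X)| := by
  have hG := hS.geom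
  have hD := hG.D₀_pos
  have ha := hG.a_pos
  have hd := hG.prof.d_pos X
  have hpi := Real.pi_pos
  have hε := hS.ε_pos
  set g := deriv d X / d X * u with hg
  have e : Hmap d (ε, I₁, u, P, X) - Hmap d (ε, I₂, u, P, X) =
      (Real.pi ^ 2 * (I₁ + I₂) / d X ^ 2 - ε * (g * (2 * P - ε * g * (I₁ + I₂)))) * (I₁ - I₂) := by
    simp only [Hmap, hamiltonian, hg]
    ring
  rw [e, abs_mul]
  refine mul_le_mul_of_nonneg_right ?_ (abs_nonneg _)
  refine le_trans ?_ (le_abs_self _)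
  have k1 : Real.pi ^ 2 * (a / 2) / D₀ ^ 2 ≤ Real.pi ^ 2 * (I₁ + I₂) / d X ^ 2 := by
    refine div_le_div₀ (mul_nonneg (by positivity) (by linarith)) ?_ (by positivity)
      (pow_le_pow_left₀ hd.le (hG.upper X) 2)
    exact mul_le_mul_of_nonneg_left (by linarith) (by positivity)
  have hκ : |g| ≤ D₁ * 4 / c₀ := by
    rw [hg, abs_mul, abs_div, abs_of_pos hd]
    have h5 := hu.trans Real.pi_le_four
    have h6 := hG.slope X
    have h7 := hG.c₀_pos
    calc |deriv d X| / d X * |u| ≤ D₁ / c₀ * 4 := by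
          refine mul_le_mul (div_le_div₀ (by linarith [hG.one_le]) h6 h7 (hG.lower X)) h5
            (abs_nonneg _) (div_nonneg (by linarith [hG.one_le]) h7.le)
      _ = _ := by ring
  have hκ0 := (abs_nonneg g).trans hκ
  have k2 : |g * (2 * P - ε * g * (I₁ + I₂))| ≤ D₁ * 4 / c₀ * (4 + D₁ * 4 / c₀ * (6 * D₀)) := by
    rw [abs_mul]
    refine mul_le_mul hκ ?_ (abs_nonneg _) hκ0
    refine (abs_sub _ _).trans (add_le_add ?_ ?_)
    · rw [abs_mul, abs_two]; linarith
    · rw [abs_mul, abs_mul, abs_of_pos hε, abs_of_pos (show 0 < I₁ + I₂ by linarith)]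
      calc ε * |g| * (I₁ + I₂) ≤ 1 * (D₁ * 4 / c₀) * (6 * D₀) := by
            have := hS.ε_le
            gcongr
            · linarith
            · linarith
            · linarith
        _ = _ := by ring
  have k3 := mul_le_mul_of_nonneg_left ((le_abs_self _).trans k2) hε.le
  have k4 := hS.s7
  have e2 : Real.pi ^ 2 * (a / 2) / D₀ ^ 2 = 2 * (Real.pi ^ 2 * a / (4 * D₀ ^ 2)) := by
    field_simp; norm_num
  linarith

/-- The generating function and its derivatives in `I`, `p`, `X` agree at the two ends of the
period. -/
theorem pd_Smap_periodic (hd : Profile d) (m : ℕ) {v : E5} (hv : v = vI ∨ v = vp ∨ v = vX)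
    {ε I : ℝ} (hI : 0 < I) (q : ℝ × ℝ) :
    pd v (iterate d m).Smap (ε, I, Real.pi, q) = pd v (iterate d m).Smap (ε, I, -Real.pi, q) := by
  have hS := (pol_iterate hd m).1
  -- The equality of `S` at `u = π` and `u = -π` holds for all nearby values of the other variables,
  -- so it can be differentiated along a curve in them.
  have key : ∀ (c : ℝ → ℝ × ℝ × ℝ) (c' : ℝ × ℝ × ℝ) (t : ℝ), HasDerivAt c c' t →
      c t = (I, q) → v = (0, c'.1, 0, c'.2) →
      pd v (iterate d m).Smap (ε, I, Real.pi, q) = pd v (iterate d m).Smap (ε, I, -Real.pi, q) := by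
    intro c c' t hc hct hv
    have h1 : HasDerivAt (fun s => (c s).1) c'.1 t :=
      (ContinuousLinearMap.fst ℝ ℝ (ℝ × ℝ)).hasFDerivAt.comp_hasDerivAt t hc
    have h2 : HasDerivAt (fun s => (c s).2) c'.2 t :=
      (ContinuousLinearMap.snd ℝ ℝ (ℝ × ℝ)).hasFDerivAt.comp_hasDerivAt t hc
    have hu : ∀ u : ℝ, HasDerivAt (fun s => (iterate d m).Smap (ε, (c s).1, u, (c s).2))
        (pd v (iterate d m).Smap (ε, I, u, q)) t := by
      intro u
      have h3 := hasDerivAt_comp_curve (G := (iterate d m).Smap)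
        (c := fun s => (ε, (c s).1, u, (c s).2)) (t := t)
        ((hS.contDiffAt hd (by simp only [hct]; exact hI)).differentiableAt (by simp))
        ((hasDerivAt_const _ _).prodMk (h1.prodMk ((hasDerivAt_const _ _).prodMk h2)))
      rw [← hv] at h3
      simp only [hct] at h3
      exact h3
    refine (hu Real.pi).unique ((hu (-Real.pi)).congr_of_eventuallyEq ?_)
    have : ∀ᶠ s in 𝓝 t, 0 < (c s).1 := by
      refine h1.continuousAt.eventually_const_lt ?_
      simpa only [hct] using hI
    filter_upwards [this] with s hs using Smap_iterate_periodic hd m hs _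
  rcases hv with rfl | rfl | rfl
  · exact key (fun s => (s, q)) (1, 0, 0) I ((hasDerivAt_id I).prodMk (hasDerivAt_const _ _)) rfl rfl
  · exact key (fun s => (I, s, q.2)) (0, 1, 0) q.1 ((hasDerivAt_const _ _).prodMk
      ((hasDerivAt_id _).prodMk (hasDerivAt_const _ _))) rfl rfl
  · exact key (fun s => (I, q.1, s)) (0, 0, 1) q.2 ((hasDerivAt_const _ _).prodMk
      ((hasDerivAt_const _ _).prodMk (hasDerivAt_id _))) rfl rfl

theorem continuousWithinAt_of_abs_sub_le {q h : ℝ → ℝ} {A : Set ℝ} {t : ℝ}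
    (hc : ContinuousWithinAt h A t) (h0 : h t = 0) (hq : ∀ s ∈ A, |q s - q t| ≤ h s) :
    ContinuousWithinAt q A t := by
  rw [ContinuousWithinAt, tendsto_iff_dist_tendsto_zero]
  have hc' : Tendsto h (𝓝[A] t) (𝓝 0) := by rw [← h0]; exact hc
  refine squeeze_zero' (Eventually.of_forall fun s => dist_nonneg) ?_ hc'
  filter_upwards [self_mem_nhdsWithin] with s hs using by simpa [Real.dist_eq] using hq s hs

/-- The longest possible flight. -/
def flightMax (a D₀ : ℝ) : ℝ := D₀ / (2 * pyMin a D₀)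

/-- The rate of the change of the improved action. -/
def actionRate (a D₀ B : ℝ) : ℝ := 10 * B ^ 3 * Real.exp (10 * B ^ 3 * flightMax a D₀)

/-- From `exp s - 1 ≤ s exp s`. With zero initial error the bound is linear in the elapsed time,
which is what lets errors of arbitrarily subdivided flights add up. -/
theorem gronwall_zero_le {K η L x : ℝ} (hK : 0 < K) (hη : 0 ≤ η) (hx : 0 ≤ x) (hxL : x ≤ L) :
    gronwallBound 0 K (K * η) x ≤ K * Real.exp (K * L) * η * x := by
  rw [gronwallBound_of_K_ne_0 hK.ne']
  simp only [zero_mul, zero_add, mul_div_cancel_left₀ _ hK.ne']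
  have h1 : Real.exp (K * x) - 1 ≤ K * x * Real.exp (K * x) := by
    have h2 := Real.add_one_le_exp (-(K * x))
    have h3 := mul_le_mul_of_nonneg_right h2 (Real.exp_pos (K * x)).le
    rw [← Real.exp_add, neg_add_cancel, Real.exp_zero] at h3
    linarith
  have h4 : Real.exp (K * x) ≤ Real.exp (K * L) :=
    Real.exp_le_exp.2 (mul_le_mul_of_nonneg_left hxL hK.le)
  calc η * (Real.exp (K * x) - 1) ≤ η * (K * x * Real.exp (K * L)) :=
        mul_le_mul_of_nonneg_left (h1.trans (mul_le_mul_of_nonneg_left h4 (by positivity))) hη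
    _ = _ := by ring

variable {T : ℝ} {x y px py : ℝ → ℝ}

/-- The vertical displacement of a flight is at most `D₀`, and its vertical speed at least `2 *
pyMin a D₀`. -/
theorem Small.flight_length (hS : Small d a c₀ D₀ D₁ m ρ B ε) (hr : IsRay d ε T x y px py)
    {s t : ℝ} (hs0 : 0 ≤ s) (htT : t ≤ T) (hf : Flight d ε x y px py s t)
    (hpy : pyMin a D₀ ≤ |py s|) : t - s ≤ flightMax a D₀ := by
  have hc := hS.geom.pyMin_pos
  have h1 := hr.inside s ⟨hs0, hf.lt.le.trans htT⟩
  have h2 := hr.inside t ⟨hs0.trans hf.lt.le, htT⟩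
  have h3 := hS.geom.upper (ε * x s)
  have h4 := hS.geom.upper (ε * x t)
  have h5 : |2 * (t - s) * py s| ≤ D₀ := by
    rw [show 2 * (t - s) * py s = y t - y s by rw [hf.y_end]; ring, abs_le]
    constructor <;> linarith
  rw [abs_mul, abs_of_pos (by linarith [hf.lt])] at h5
  rw [flightMax, le_div_iff₀ (by positivity)]
  have := mul_le_mul_of_nonneg_left hpy (show 0 ≤ 2 * (t - s) by linarith [hf.lt])
  linarith

/-- The state during a flight. -/
theorem Small.flight_state (hS : Small d a c₀ D₀ D₁ m ρ B ε) (hr : IsRay d ε T x y px py)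
    {s t : ℝ} (hs0 : 0 ≤ s) (htT : t ≤ T) (hf : Flight d ε x y px py s t)
    (hI : 3 * a / 4 ≤ action d ε (x s) (py s)) {τ : ℝ} (hτ : τ ∈ Icc s t) :
    11 * a / 16 ≤ action d ε (x τ) (py s) ∧ action d ε (x τ) (py s) ≤ D₀ ∧
      |uRay d ε (x τ) (y τ) (py s)| ≤ Real.pi ∧ |pHat d ε (x τ) (y τ) (px s) (py s)| ≤ 2 := by
  have hG := hS.geom
  have ha := hG.a_pos
  have hsI : s ∈ Icc 0 T := ⟨hs0, hf.lt.le.trans htT⟩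
  have hτI : τ ∈ Icc 0 T := ⟨hs0.trans hτ.1, hτ.2.trans htT⟩
  have hpy1 := hr.abs_py_le hsI
  have hc : pyMin a D₀ ≤ |py s| := py_ge_of_action (ε := ε) (x := x s) hG (by linarith)
  refine ⟨?_, action_le hG hpy1, abs_uRay_le hG.prof (hr.inside τ hτI).1 (hr.inside τ hτI).2,
    abs_pHat_le hG hS.ε_pos hS.s4 (hr.inside τ hτI).1 (hr.inside τ hτI).2 (hr.abs_px_le hsI) hpy1⟩
  have h1 := abs_action_sub_le hG hS.ε_pos (x := x τ) (x' := x s) hpy1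
  have h2 : |x τ - x s| ≤ D₀ / pyMin a D₀ := by
    rw [hf.x_eq hτ, add_sub_cancel_left, abs_mul]
    have h3 := hS.flight_length hr hs0 htT hf hc
    have h4 : |2 * (τ - s)| ≤ D₀ / pyMin a D₀ := by
      rw [abs_of_nonneg (by linarith [hτ.1])]
      rw [flightMax, mul_comm, ← div_div] at h3
      have := hτ.2
      linarith
    calc _ ≤ D₀ / pyMin a D₀ * 1 := mul_le_mul h4 (hr.abs_px_le hsI) (abs_nonneg _)
          ((abs_nonneg _).trans h4)
      _ = _ := mul_one _
  have h5 : D₁ * (ε * |x τ - x s|) ≤ a / 16 := by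
    refine le_trans ?_ hS.s5
    have := hG.one_le
    have := hS.ε_pos
    gcongr
  have := (abs_le.1 (h1.trans h5)).1
  linarith

/-- Along a flight the frozen new action stays accurate to order `ε ^ (m + 1)`. -/
theorem Small.flight_error (hS : Small d a c₀ D₀ D₁ m ρ B ε) (hr : IsRay d ε T x y px py)
    {s t : ℝ} (hs0 : 0 ≤ s) (htT : t ≤ T) (hf : Flight d ε x y px py s t)
    (hI : 3 * a / 4 ≤ action d ε (x s) (py s)) {J p₀ : ℝ}
    (hD : (ε, J, uRay d ε (x s) (y s) (py s), p₀, ε * x s) ∈ Dom ρ)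
    (hJI : |J - action d ε (x s) (py s)| ≤ ε * B)
    (e1 : J + ε * pd vu (iterate d m).Smap (ε, J, uRay d ε (x s) (y s) (py s), p₀, ε * x s) =
      action d ε (x s) (py s))
    (e2 : p₀ + ε ^ 2 * pd vX (iterate d m).Smap (ε, J, uRay d ε (x s) (y s) (py s), p₀, ε * x s) =
      pHat d ε (x s) (y s) (px s) (py s)) :
    ∃ q, |q - pHat d ε (x t) (y t) (px s) (py s)| ≤ 1 ∧
      q + ε ^ 2 * pd vX (iterate d m).Smap (ε, J, uRay d ε (x t) (y t) (py s), q, ε * x t) =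
        pHat d ε (x t) (y t) (px s) (py s) ∧
      |action d ε (x t) (py s) - J - ε * pd vu (iterate d m).Smap
        (ε, J, uRay d ε (x t) (y t) (py s), q, ε * x t)| ≤
          actionRate a D₀ B * ε ^ (m + 1) * (t - s) := by
  have hG := hS.geom
  have hd := hG.prof
  have ha := hG.a_pos
  have hε := hS.ε_pos
  have hB := hS.nf
  have hB0 := hB.pos
  have hlt := hf.lt
  have hsI : s ∈ Icc 0 T := ⟨hs0, hlt.le.trans htT⟩
  have hc : pyMin a D₀ ≤ |py s| := py_ge_of_action (ε := ε) (x := x s) hG (by linarith)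
  have hpy0 : py s ≠ 0 := by
    intro h; rw [h, abs_zero] at hc; linarith [hG.pyMin_pos]
  have hst := fun τ hτ => hS.flight_state hr hs0 htT hf hI (τ := τ) hτ
  have hs_mem : s ∈ Icc s t := ⟨le_rfl, hlt.le⟩
  have ht_mem : t ∈ Icc s t := ⟨hlt.le, le_rfl⟩
  obtain ⟨hJl, hJu⟩ : a / 2 ≤ J ∧ J ≤ 2 * D₀ := by
    have h1 := abs_le.1 hJI
    have h2 := hS.s2
    have h3 := (hst s hs_mem).2.1
    constructor
    · linarith [h1.1]
    · linarith [h1.2, (hst s hs_mem).1]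
  have hD0 := hG.D₀_pos
  -- the smooth continuation of the flight
  set Xf : ℝ → ℝ := fun τ => x s + 2 * (τ - s) * px s with hXf
  set Yf : ℝ → ℝ := fun τ => y s + 2 * (τ - s) * py s with hYf
  have hXe : ∀ τ ∈ Icc s t, Xf τ = x τ := fun τ hτ => (hf.x_eq hτ).symm
  have hYe : ∀ τ ∈ Icc s t, Yf τ = y τ := fun τ hτ => (hf.y_eq hτ).symm
  have hXd : ∀ τ, HasDerivAt Xf (2 * px s) τ := fun τ => by
    refine ((((hasDerivAt_id τ).sub_const s).const_mul 2).mul_const (px s)).const_add (x s)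
      |>.congr_deriv (by ring)
  have hYd : ∀ τ, HasDerivAt Yf (2 * py s) τ := fun τ => by
    refine ((((hasDerivAt_id τ).sub_const s).const_mul 2).mul_const (py s)).const_add (y s)
      |>.congr_deriv (by ring)
  set I : ℝ → ℝ := fun τ => action d ε (Xf τ) (py s) with hIdef
  set u : ℝ → ℝ := fun τ => uRay d ε (Xf τ) (Yf τ) (py s) with hudef
  set P : ℝ → ℝ := fun τ => pHat d ε (Xf τ) (Yf τ) (px s) (py s) with hPdef
  set X : ℝ → ℝ := fun τ => ε * Xf τ with hXdef
  have hder := fun τ => hasDerivAt_state (ε := ε) hd hpy0 (hXd τ) (hYd τ)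
  have hst' : ∀ τ ∈ Icc s t, 11 * a / 16 ≤ I τ ∧ I τ ≤ D₀ ∧ |u τ| ≤ Real.pi ∧ |P τ| ≤ 2 := by
    intro τ hτ
    simp only [hIdef, hudef, hPdef, hXe τ hτ, hYe τ hτ]
    exact hst τ hτ
  have hbox : ∀ τ ∈ Icc s t, ∀ p ∈ Icc (P τ - 1) (P τ + 1), ∀ τ' ∈ Icc s t,
      (ε, J, u τ', p, X τ') ∈ Dom ρ := by
    intro τ hτ p hp τ' hτ'
    refine hS.mem_Dom (by linarith) (by linarith) (hst' τ' hτ').2.2.1 ?_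
    have := abs_le.1 (hst' τ hτ).2.2.2
    rw [abs_le]; constructor <;> linarith [hp.1, hp.2]
  choose! q hq hqe hqb using fun τ (hτ : τ ∈ Icc s t) =>
    exists_mom hd hS.ρ_pos hB hε hS.s1 (fun p hp => hbox τ hτ p hp τ hτ)
  -- The selected solution of the momentum equation agrees with the given one at the start, by
  -- stability.
  have hqs : q s = p₀ := by
    have hu0 : (ε, J, u s, p₀, X s) ∈ Dom ρ := by
      simpa [hudef, hXdef, hXe s hs_mem, hYe s hs_mem] using hD
    have := stable_mom hB hε hS.s1 (hbox s hs_mem _ (hq s hs_mem) s hs_mem) hu0 (hqe s hs_mem)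
      (show p₀ + ε ^ 2 * pd vX (iterate d m).Smap (ε, J, u s, p₀, X s) = P s by
        simpa [hudef, hXdef, hPdef, hXe s hs_mem, hYe s hs_mem] using e2)
    simp only [sub_self, abs_zero, mul_zero, add_zero] at this
    exact sub_eq_zero.1 (abs_nonpos_iff.1 this)
  have hqc : ∀ τ ∈ Icc s t, ContinuousWithinAt q (Icc s t) τ := by
    intro τ hτ
    obtain ⟨d1, d2, d3, d4⟩ := hder τ
    have hc1 : ContinuousAt (fun r => (ε, J, u r, q τ, X r)) τ :=
      continuousAt_const.prodMk (continuousAt_const.prodMk (d2.continuousAt.prodMk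
        (continuousAt_const.prodMk d4.continuousAt)))
    have hc2 : ContinuousAt (fun r => pd vX (iterate d m).Smap (ε, J, u r, q τ, X r)) τ :=
      ContinuousAt.comp (f := fun r => ((ε, J, u r, q τ, X r) : E5))
        (g := pd vX (iterate d m).Smap) (((pol_iterate hd m).1.pd hd vX).contDiffAt hd
          (act_pos_of_mem hS.ρ_pos (hbox τ hτ _ (hq τ hτ) τ hτ))).continuousAt hc1
    refine continuousWithinAt_of_abs_sub_le (h := fun r => 2 * |P r - P τ| + 2 * ε ^ 2 *
      |pd vX (iterate d m).Smap (ε, J, u r, q τ, X r) -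
        pd vX (iterate d m).Smap (ε, J, u τ, q τ, X τ)|) ?_ (by simp) ?_
    · have d3' : ContinuousAt P τ := d3.continuousAt
      exact ((continuousAt_const.mul (d3'.sub continuousAt_const).abs).add
        (continuousAt_const.mul (hc2.sub continuousAt_const).abs)).continuousWithinAt
    · intro r hr'
      exact stable_mom hB hε hS.s1 (hbox r hr' _ (hq r hr') r hr') (hbox τ hτ _ (hq τ hτ) r hr')
        (hqe r hr') (hqe τ hτ)
  have hold : ∀ τ ∈ Icc s t, (iterate d m).oldPoint (ε, J, u τ, q τ, X τ) ∈ Dom ρ := by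
    intro τ hτ
    have h1 : (iterate d m).oldPoint (ε, J, u τ, q τ, X τ) =
        (ε, J + ε * pd vu (iterate d m).Smap (ε, J, u τ, q τ, X τ), u τ, P τ, X τ) := by
      rw [← hqe τ hτ]; rfl
    have h2 : |ε * pd vu (iterate d m).Smap (ε, J, u τ, q τ, X τ)| ≤ a / 16 := by
      rw [abs_mul, abs_of_pos hε]
      refine le_trans ?_ hS.s2
      rw [mul_comm]
      exact mul_le_mul_of_nonneg_right (hB.S1 vu vu_mem _ (hbox τ hτ _ (hq τ hτ) τ hτ)) hε.le
    have h3 := abs_le.1 h2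
    rw [h1]
    refine hS.mem_Dom (by linarith) ?_ (hst' τ hτ).2.2.1 (by linarith [(hst' τ hτ).2.2.2])
    have := (hst' s hs_mem).1
    have := (hst' s hs_mem).2.1
    linarith
  have key : ∀ τ ∈ Icc s t, ∃ E', HasDerivWithinAt (fun r => I r - J - ε *
      pd vu (iterate d m).Smap (ε, J, u r, q r, X r)) E' (Icc s t) τ ∧
      |E'| ≤ 10 * B ^ 3 * (ε ^ (m + 1) + |I τ - J - ε *
        pd vu (iterate d m).Smap (ε, J, u τ, q τ, X τ)|) := by
    intro τ hτ
    obtain ⟨d1, d2, d3, d4⟩ := hder τ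
    obtain ⟨-, E', -, -, -, hE', -, -, -, hb, -⟩ := exists_deriv_mixed hd hS.ρ_pos hB hε hS.s1 hτ
      (hqc τ hτ) hqe d1.hasDerivWithinAt d2.hasDerivWithinAt d3.hasDerivWithinAt
      d4.hasDerivWithinAt (hbox τ hτ _ (hq τ hτ) τ hτ)
      (hS.mem_Dom (by linarith [(hst' τ hτ).1]) (by linarith [(hst' τ hτ).2.1])
        (hst' τ hτ).2.2.1 (by linarith [(hst' τ hτ).2.2.2])) (hold τ hτ)
    exact ⟨E', hE', hb⟩
  choose! E' hE' hEb using key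
  set E : ℝ → ℝ := fun r => I r - J - ε * pd vu (iterate d m).Smap (ε, J, u r, q r, X r) with hE
  have hEs : E s = 0 := by
    simp only [hE, hqs]
    have : (ε, J, u s, p₀, X s) = (ε, J, uRay d ε (x s) (y s) (py s), p₀, ε * x s) := by
      simp [hudef, hXdef, hXe s hs_mem, hYe s hs_mem]
    rw [this]
    have h2 : I s = action d ε (x s) (py s) := by simp [hIdef, hXe s hs_mem]
    rw [h2]; linarith
  have hK : 0 < 10 * B ^ 3 := by positivity
  -- The action error starts from zero, since `(J, p₀)` solves both equations at time `s`; its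
  -- derivative is bounded by `10 B³ (ε ^ (m + 1) + |E|)`.
  have hgr := norm_le_gronwallBound_of_norm_deriv_right_le (f := E) (f' := E') (δ := 0)
    (K := 10 * B ^ 3) (ε := 10 * B ^ 3 * ε ^ (m + 1)) (a := s) (b := t)
    (fun τ hτ => (hE' τ hτ).continuousWithinAt)
    (fun τ hτ => (hE' τ ⟨hτ.1, hτ.2.le⟩).mono_of_mem_nhdsWithin (Icc_mem_nhdsGE_of_mem hτ))
    (by rw [hEs, norm_zero])
    (fun τ hτ => by
      rw [Real.norm_eq_abs, Real.norm_eq_abs]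
      exact (hEb τ ⟨hτ.1, hτ.2.le⟩).trans (le_of_eq (by ring))) t ht_mem
  have hlen := hS.flight_length hr hs0 htT hf hc
  have hfin := hgr.trans (gronwall_zero_le hK (by positivity) (by linarith) hlen)
  have eX : X t = ε * x t := by simp only [hXdef, hXe t ht_mem]
  have eu : u t = uRay d ε (x t) (y t) (py s) := by simp only [hudef, hXe t ht_mem, hYe t ht_mem]
  have eP : P t = pHat d ε (x t) (y t) (px s) (py s) := by
    simp only [hPdef, hXe t ht_mem, hYe t ht_mem]
  have eI : I t = action d ε (x t) (py s) := by simp only [hIdef, hXe t ht_mem]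
  refine ⟨q t, ?_, ?_, ?_⟩
  · rw [← eP, abs_le]; constructor <;> linarith [(hq t ht_mem).1, (hq t ht_mem).2]
  · rw [← eX, ← eu, ← eP]; exact hqe t ht_mem
  · rw [← eX, ← eu, ← eI]; exact hfin

/-- The image of the state of a ray: the solution of the implicit equations near the state. -/
structure ImageAt (d : ℝ → ℝ) (m : ℕ) (ρ B ε : ℝ) (I u P X J p : ℝ) : Prop where
  mem : (ε, J, u, p, X) ∈ Dom ρ
  act : J + ε * pd vu (iterate d m).Smap (ε, J, u, p, X) = I
  mom : p + ε ^ 2 * pd vX (iterate d m).Smap (ε, J, u, p, X) = P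
  act_le : |J - I| ≤ ε * B
  mom_le : |p - P| ≤ ε ^ 2 * B

/-- The search radius `a / 4` for the action exceeds `ε B` and keeps the candidates at least `a /
4`, inside `Dom`. -/
theorem Small.exists_imageAt (hS : Small d a c₀ D₀ D₁ m ρ B ε) {I u P X : ℝ}
    (h1 : a / 2 ≤ I) (h2 : I ≤ D₀) (hu : |u| ≤ Real.pi) (hP : |P| ≤ 2) :
    ∃ J p, ImageAt d m ρ B ε I u P X J p := by
  have ha := hS.geom.a_pos
  obtain ⟨J, p, e1, e2, e3, e4, e5⟩ := exists_image hS.geom.prof hS.ρ_pos hS.nf hS.ε_pos hS.s1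
    (I := I) (u := u) (b := P) (X := X) (h := a / 4) (by linarith [hS.s2])
    (fun J hJ p hp => hS.mem_Dom (by linarith [hJ.1]) (by linarith [hJ.2]) hu
      (by have := abs_le.1 hP; rw [abs_le]; constructor <;> linarith [hp.1, hp.2]))
  exact ⟨J, p, e5, e1, e2, e3, e4⟩

/-- The constant in the estimate of the change of the improved action. -/
def jumpRate (a D₀ B : ℝ) : ℝ := 2 * actionRate a D₀ B +
  2 * ((B * (actionRate a D₀ B * flightMax a D₀) + 2 * B) / (Real.pi ^ 2 * a / (4 * D₀ ^ 2)))

theorem actionRate_pos (B : ℝ) (hB : 0 < B) : 0 < actionRate a D₀ B := by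
  unfold actionRate; positivity

theorem Small.jumpRate_pos (hS : Small d a c₀ D₀ D₁ m ρ B ε) : 0 < jumpRate a D₀ B := by
  have := hS.geom.D₀_pos
  have := hS.geom.a_pos
  have := hS.geom.pyMin_pos
  have := hS.nf.pos
  have := actionRate_pos (a := a) (D₀ := D₀) B this
  have := Real.pi_pos
  unfold jumpRate flightMax; positivity

/-- The change of the improved action during a flight, including its final reflection. -/
theorem Small.flight_step (hS : Small d a c₀ D₀ D₁ m ρ B ε) (hr : IsRay d ε T x y px py)
    {s t : ℝ} (hs0 : 0 ≤ s) (htT : t ≤ T) (hf : Flight d ε x y px py s t)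
    (hI : 3 * a / 4 ≤ action d ε (x s) (py s)) {J p : ℝ}
    (hJ : ImageAt d m ρ B ε (action d ε (x s) (py s)) (uRay d ε (x s) (y s) (py s))
      (pHat d ε (x s) (y s) (px s) (py s)) (ε * x s) J p) :
    a / 2 ≤ action d ε (x t) (py t) ∧ ∃ J' p', ImageAt d m ρ B ε (action d ε (x t) (py t))
      (uRay d ε (x t) (y t) (py t)) (pHat d ε (x t) (y t) (px t) (py t)) (ε * x t) J' p' ∧
      |J' - J| ≤ jumpRate a D₀ B * ε ^ (m + 1) * ((phaseRate c₀ D₀ D₁ + 1) * (t - s) -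
        (uRay d ε (x t) (y t) (py t) - uRay d ε (x s) (y s) (py s))) := by
  have hG := hS.geom
  have hd := hG.prof
  have ha := hG.a_pos
  have hε := hS.ε_pos
  have hB := hS.nf
  have hB0 := hB.pos
  have hlt := hf.lt
  have hsI : s ∈ Icc 0 T := ⟨hs0, hlt.le.trans htT⟩
  have htI : t ∈ Icc 0 T := ⟨hs0.trans hlt.le, htT⟩
  have hs_mem : s ∈ Icc s t := ⟨le_rfl, hlt.le⟩
  have ht_mem : t ∈ Icc s t := ⟨hlt.le, le_rfl⟩
  have hc : pyMin a D₀ ≤ |py s| := py_ge_of_action (ε := ε) (x := x s) hG (by linarith)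
  obtain ⟨q, hq1, hqe, hqE⟩ := hS.flight_error hr hs0 htT hf hI hJ.mem hJ.act_le hJ.act hJ.mom
  obtain ⟨g1, g2, g3, g4⟩ := hS.flight_state hr hs0 htT hf hI ht_mem
  obtain ⟨k1, k2, k3, k4⟩ := hS.flight_state hr hs0 htT hf hI hs_mem
  have hA0 := actionRate_pos (a := a) (D₀ := D₀) B hB0
  have hη : 0 < ε ^ (m + 1) := by positivity
  have hlen := hS.flight_length hr hs0 htT hf hc
  have hF0 : 0 ≤ flightMax a D₀ := by linarith
  have hcH : 0 < Real.pi ^ 2 * a / (4 * D₀ ^ 2) := by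
    have := hG.D₀_pos
    have := Real.pi_pos
    positivity
  set cH := Real.pi ^ 2 * a / (4 * D₀ ^ 2) with hcHdef
  obtain ⟨hJl, hJu⟩ : a / 2 ≤ J ∧ J ≤ 2 * D₀ := by
    have h1 := abs_le.1 hJ.act_le
    have h2 := hS.s2
    constructor <;> linarith [h1.1, h1.2]
  have hq3 : |q| ≤ 8 := by
    have := abs_sub_abs_le_abs_sub q (pHat d ε (x t) (y t) (px s) (py s))
    linarith
  have hpys := hr.abs_py_le hsI
  have hjdef : jumpRate a D₀ B = 2 * actionRate a D₀ B +
    2 * ((B * (actionRate a D₀ B * flightMax a D₀) + 2 * B) / cH) := rfl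
  have hjr : 2 * actionRate a D₀ B ≤ jumpRate a D₀ B := by
    have : 0 ≤ 2 * ((B * (actionRate a D₀ B * flightMax a D₀) + 2 * B) / cH) := by positivity
    linarith
  have hjr2 : 2 * ((B * (actionRate a D₀ B * flightMax a D₀) + 2 * B) / cH) ≤ jumpRate a D₀ B := by
    linarith
  have hj0 := hS.jumpRate_pos
  have hus : |uRay d ε (x t) (y t) (py s) - uRay d ε (x s) (y s) (py s)| ≤
      phaseRate c₀ D₀ D₁ * (t - s) := by
    have hy0 := hr.inside s hsI
    refine abs_uRay_sub_le hG hε (by linarith [hS.ε_le]) hy0.1 (hy0.2.trans (hG.upper _)) ?_ ?_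
    · rw [hf.x_end, add_sub_cancel_left, abs_mul, abs_of_pos (by linarith)]
      exact mul_le_of_le_one_right (by linarith) (hr.abs_px_le hsI)
    · rw [hf.y_end, add_sub_cancel_left, abs_mul, abs_of_pos (by linarith)]
      exact mul_le_of_le_one_right (by linarith) hpys
  rcases hf.end_state hG hr hε hs0 htT hG.pyMin_pos hc hS.s3 with he | ⟨hu1, hu2, hp2, hI2⟩
  · -- the flight is continued smoothly
    have e1 : action d ε (x t) (py t) = action d ε (x t) (py s) := congrArg (fun z : E5 => z.2.1) he
    have e2 : uRay d ε (x t) (y t) (py t) = uRay d ε (x t) (y t) (py s) :=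
      congrArg (fun z : E5 => z.2.2.1) he
    have e3 : pHat d ε (x t) (y t) (px t) (py t) = pHat d ε (x t) (y t) (px s) (py s) :=
      congrArg (fun z : E5 => z.2.2.2.1) he
    rw [e1, e2, e3]
    refine ⟨by linarith, ?_⟩
    obtain ⟨J', p', hJ'⟩ := hS.exists_imageAt (X := ε * x t) (by linarith) g2 g3 g4
    refine ⟨J', p', hJ', ?_⟩
    have hst := stable_image hB hε hS.s1 hJ'.mem
      (hS.mem_Dom (X := ε * x t) (by linarith) (by linarith) g3 hq3) hJ'.act hJ'.mom rfl hqe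
    rw [sub_self, abs_zero, add_zero] at hst
    have h1 : |J' - J| ≤ 2 * (actionRate a D₀ B * ε ^ (m + 1) * (t - s)) := by
      refine le_trans ?_ (mul_le_mul_of_nonneg_left hqE zero_le_two)
      rw [← sub_sub] at hst
      linarith [abs_nonneg (p' - q)]
    -- Without an upper reflection `u` grows by at most `phaseRate * (t - s)`, so the budget in the
    -- conclusion is at least `t - s`.
    have h2 := (abs_le.1 hus).2
    calc |J' - J| ≤ 2 * (actionRate a D₀ B * ε ^ (m + 1) * (t - s)) := h1
      _ = 2 * actionRate a D₀ B * (ε ^ (m + 1) * (t - s)) := by ring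
      _ ≤ jumpRate a D₀ B * (ε ^ (m + 1) * (t - s)) :=
          mul_le_mul_of_nonneg_right hjr (mul_nonneg hη.le (by linarith))
      _ = jumpRate a D₀ B * ε ^ (m + 1) * (t - s) := by ring
      _ ≤ _ := mul_le_mul_of_nonneg_left (by linarith) (by positivity)
  · -- reflection at the upper wall
    have hlow : a / 2 ≤ action d ε (x t) (py t) := by
      have := (abs_le.1 (hI2.trans hS.s6)).1
      linarith
    refine ⟨hlow, ?_⟩
    have hIt := action_le (ε := ε) hG (x := x t) (hr.abs_py_le htI)
    rw [hp2, hu2]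
    rw [hu1] at hqe hqE hus
    have hpi : |(-Real.pi)| ≤ Real.pi := by rw [abs_neg, abs_of_pos Real.pi_pos]
    have hpi' : |Real.pi| ≤ Real.pi := by rw [abs_of_pos Real.pi_pos]
    obtain ⟨J', p', hJ'⟩ := hS.exists_imageAt (X := ε * x t) hlow hIt hpi g4
    refine ⟨J', p', hJ', ?_⟩
    have hJ0 : 0 < J := by linarith
    set P := pHat d ε (x t) (y t) (px s) (py s) with hP
    have hm1 : (ε, J, Real.pi, q, ε * x t) ∈ Dom ρ :=
      hS.mem_Dom (by linarith) (by linarith) hpi' hq3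
    have hm2 : (ε, J, -Real.pi, q, ε * x t) ∈ Dom ρ :=
      hS.mem_Dom (by linarith) (by linarith) hpi hq3
    have hSX := pd_Smap_periodic hd m (Or.inr (Or.inr rfl)) (ε := ε) hJ0 (q, ε * x t)
    have hSp := pd_Smap_periodic hd m (Or.inr (Or.inl rfl)) (ε := ε) hJ0 (q, ε * x t)
    have hqe' := hqe
    rw [hSX] at hqe'
    have hSn := (pol_iterate hd m).1
    have r1 := Rmap_eq hd hSn (z := (ε, J, Real.pi, q, ε * x t)) hJ0
    have r2 := Rmap_eq hd hSn (z := (ε, J, -Real.pi, q, ε * x t)) hJ0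
    set S1 := pd vu (iterate d m).Smap (ε, J, Real.pi, q, ε * x t) with hS1
    set S2 := pd vu (iterate d m).Smap (ε, J, -Real.pi, q, ε * x t) with hS2
    have o1 : (iterate d m).oldPoint (ε, J, Real.pi, q, ε * x t) =
        (ε, J + ε * S1, Real.pi, P, ε * x t) := by rw [← hqe]; rfl
    have o2 : (iterate d m).oldPoint (ε, J, -Real.pi, q, ε * x t) =
        (ε, J + ε * S2, -Real.pi, P, ε * x t) := by rw [← hqe']; rfl
    -- `K` ignores the phase and `∂S/∂p` agrees at `±π`, so the residual identities before and after
    -- the reflection contain the same value of `K`.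
    have hKe : (iterate d m).Kmap (shiftMap (pd vp (iterate d m).Smap) (ε, J, Real.pi, q, ε * x t))
        = (iterate d m).Kmap (shiftMap (pd vp (iterate d m).Smap) (ε, J, -Real.pi, q, ε * x t)) := by
      simp only [shiftMap, Kmap, hSp]
    rw [o1, hKe] at r1
    rw [o2] at r2
    have b1 := hB.R _ hm1 hε.le
    have b2 := hB.R _ hm2 hε.le
    have hb1 : |ε * S1| ≤ a / 16 := by
      rw [abs_mul, abs_of_pos hε]
      refine le_trans ?_ hS.s2
      rw [mul_comm]; exact mul_le_mul_of_nonneg_right (hB.S1 vu vu_mem _ hm1) hε.le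
    have hb2 : |ε * S2| ≤ a / 16 := by
      rw [abs_mul, abs_of_pos hε]
      refine le_trans ?_ hS.s2
      rw [mul_comm]; exact mul_le_mul_of_nonneg_right (hB.S1 vu vu_mem _ hm2) hε.le
    have l1 := abs_le.1 hb1
    have l2 := abs_le.1 hb2
    -- The states just before and just after the reflection both have zero energy.
    have hpre : Hmap d (ε, action d ε (x t) (py s), Real.pi, P, ε * x t) = 0 := by
      have := Hmap_statePt (ε := ε) (x := x t) (y := y t) (px := px s) (py := py s) hd
      rw [statePt, hu1, ← hP] at this
      rw [this]; exact hr.level s hsI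
    have hpost : Hmap d (ε, action d ε (x t) (py t), -Real.pi, P, ε * x t) = 0 := by
      have := Hmap_statePt (ε := ε) (x := x t) (y := y t) (px := px t) (py := py t) hd
      rw [statePt, hu2, hp2] at this
      rw [this]; exact hr.level t htI
    have hlip := hB.H_lip (ε, J + ε * S1, Real.pi, P, ε * x t)
      (hS.mem_Dom (by linarith) (by linarith) hpi' (by linarith))
      (ε, action d ε (x t) (py s), Real.pi, P, ε * x t)
      (hS.mem_Dom (by linarith) (by linarith) hpi' (by linarith))
    rw [hpre, sub_zero] at hlip
    have hn := norm_mk_sub_mk_le ε (J + ε * S1) Real.pi P (ε * x t) (action d ε (x t) (py s))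
      Real.pi P (ε * x t)
    simp only [sub_self, abs_zero, add_zero] at hn
    have hn2 : |J + ε * S1 - action d ε (x t) (py s)| ≤
        actionRate a D₀ B * ε ^ (m + 1) * flightMax a D₀ := by
      rw [abs_sub_comm, ← sub_sub]
      exact hqE.trans (mul_le_mul_of_nonneg_left hlen (by positivity))
    have hH1 : |Hmap d (ε, J + ε * S1, Real.pi, P, ε * x t)| ≤
        B * (actionRate a D₀ B * ε ^ (m + 1) * flightMax a D₀) :=
      hlip.trans (mul_le_mul_of_nonneg_left (hn.trans hn2) hB0.le)
    -- Eliminating `K` transfers the small energy of the predicted state from `u = π` to `u = -π`,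
    -- at the cost of two residuals.
    have hH2 : |Hmap d (ε, J + ε * S2, -Real.pi, P, ε * x t)| ≤
        (B * (actionRate a D₀ B * flightMax a D₀) + 2 * B) * ε ^ (m + 1) := by
      have e : Hmap d (ε, J + ε * S2, -Real.pi, P, ε * x t) =
          Hmap d (ε, J + ε * S1, Real.pi, P, ε * x t) -
          (iterate d m).Rmap d (ε, J, Real.pi, q, ε * x t) +
          (iterate d m).Rmap d (ε, J, -Real.pi, q, ε * x t) := by linarith
      rw [e]
      refine (abs_add_le _ _).trans ((add_le_add ((abs_sub _ _).trans (add_le_add hH1 b1))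
        b2).trans (le_of_eq (by simp only; ring)))
    have hlow2 := hS.action_lower (I₁ := action d ε (x t) (py t)) (I₂ := J + ε * S2) (u := -Real.pi)
      (P := P) (X := ε * x t) (by linarith) (by linarith) (by linarith) (by linarith) hpi g4
    rw [hpost, zero_sub, abs_neg] at hlow2
    have hfin : |action d ε (x t) (py t) - (J + ε * S2)| ≤
        (B * (actionRate a D₀ B * flightMax a D₀) + 2 * B) / cH * ε ^ (m + 1) := by
      rw [div_mul_eq_mul_div, le_div_iff₀ hcH, mul_comm]
      exact hlow2.trans hH2
    have hst := stable_image hB hε hS.s1 hJ'.mem hm2 hJ'.act hJ'.mom rfl hqe'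
    rw [sub_self, abs_zero, add_zero] at hst
    have h1 : |J' - J| ≤ jumpRate a D₀ B * ε ^ (m + 1) * 1 := by
      rw [mul_one]
      refine le_trans ?_ (mul_le_mul_of_nonneg_right hjr2 hη.le)
      linarith [abs_nonneg (p' - q)]
    -- The drop of `u` by `2π` makes the budget at least one, which pays for the jump of the
    -- improved action however short the flight is.
    refine h1.trans (mul_le_mul_of_nonneg_left ?_ (by positivity))
    have h2 := (abs_le.1 hus).2
    have h3 := Real.pi_gt_three
    linarith

/-- The improved action of order `m` along a ray. -/
theorem Small.conservation (hS : Small d a c₀ D₀ D₁ m ρ B ε) (hr : IsRay d ε T x y px py)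
    (hT : 0 ≤ T) (h0 : a ≤ action d ε (x 0) (py 0))
    (hsm : jumpRate a D₀ B * ε ^ (m + 1) * ((phaseRate c₀ D₀ D₁ + 1) * T + 8) ≤ a / 16) {J₀ p₀ : ℝ}
    (hJ₀ : ImageAt d m ρ B ε (action d ε (x 0) (py 0)) (uRay d ε (x 0) (y 0) (py 0))
      (pHat d ε (x 0) (y 0) (px 0) (py 0)) (ε * x 0) J₀ p₀) :
    ∀ t ∈ Icc 0 T, 3 * a / 4 ≤ action d ε (x t) (py t) ∧
      ∃ J p, ImageAt d m ρ B ε (action d ε (x t) (py t)) (uRay d ε (x t) (y t) (py t))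
        (pHat d ε (x t) (y t) (px t) (py t)) (ε * x t) J p ∧
      |J - J₀| ≤ jumpRate a D₀ B * ε ^ (m + 1) * ((phaseRate c₀ D₀ D₁ + 1) * T + 8) := by
  have hG := hS.geom
  have hj0 := hS.jumpRate_pos
  have hε := hS.ε_pos
  have hph : 0 ≤ phaseRate c₀ D₀ D₁ := by
    have := hG.c₀_pos
    have := hG.D₀_pos
    have := hG.one_le
    unfold phaseRate; positivity
  have hu : ∀ t ∈ Icc 0 T, |uRay d ε (x t) (y t) (py t)| ≤ 4 := fun t ht =>
    (abs_uRay_le hG.prof (hr.inside t ht).1 (hr.inside t ht).2).trans Real.pi_le_four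
  have h0T : (0 : ℝ) ∈ Icc 0 T := ⟨le_rfl, hT⟩
  -- The boundary terms `u(0)` and `u(t)` contribute at most `4` each, since `π ≤ 4`.
  have hbound : ∀ t ∈ Icc 0 T, ((phaseRate c₀ D₀ D₁ + 1) * t - (uRay d ε (x t) (y t) (py t) -
      uRay d ε (x 0) (y 0) (py 0))) ≤ (phaseRate c₀ D₀ D₁ + 1) * T + 8 := by
    intro t ht
    have h1 := abs_le.1 (hu t ht)
    have h2 := abs_le.1 (hu 0 h0T)
    have := mul_le_mul_of_nonneg_left ht.2 (show 0 ≤ phaseRate c₀ D₀ D₁ + 1 by linarith)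
    linarith [h1.1, h2.2]
  have hcl : 0 ≤ jumpRate a D₀ B * ε ^ (m + 1) := by positivity
  have hlow : ∀ {t J p : ℝ}, ImageAt d m ρ B ε (action d ε (x t) (py t))
      (uRay d ε (x t) (y t) (py t)) (pHat d ε (x t) (y t) (px t) (py t)) (ε * x t) J p →
      |J - J₀| ≤ a / 16 → 3 * a / 4 ≤ action d ε (x t) (py t) := by
    intro t J p hJ hle
    have h1 := abs_le.1 hJ.act_le
    have h2 := abs_le.1 hJ₀.act_le
    have h3 := abs_le.1 hle
    have := hS.s2
    have := hG.a_pos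
    linarith [h1.1, h1.2, h2.1, h2.2, h3.1]
  -- The bound is phrased with the net change of `u` so that it telescopes over flights; reflections
  -- need not be counted. The smallness `hsm` closes the bootstrap by keeping the action above
  -- `3a/4`.
  have main := hr.induction (Q := fun t => ∃ J p, ImageAt d m ρ B ε (action d ε (x t) (py t))
      (uRay d ε (x t) (y t) (py t)) (pHat d ε (x t) (y t) (px t) (py t)) (ε * x t) J p ∧
      |J - J₀| ≤ jumpRate a D₀ B * ε ^ (m + 1) * ((phaseRate c₀ D₀ D₁ + 1) * t -
        (uRay d ε (x t) (y t) (py t) - uRay d ε (x 0) (y 0) (py 0))))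
    ⟨J₀, p₀, hJ₀, by simp⟩ ?_
  · intro t ht
    obtain ⟨J, p, hJ, hle⟩ := main t ht
    have hle' := hle.trans (mul_le_mul_of_nonneg_left (hbound t ht) hcl)
    exact ⟨hlow hJ (hle'.trans hsm), J, p, hJ, hle'⟩
  · rintro s t hs0 htT hf ⟨J, p, hJ, hle⟩
    have hsI : s ∈ Icc 0 T := ⟨hs0, hf.lt.le.trans htT⟩
    have hle' := hle.trans (mul_le_mul_of_nonneg_left (hbound s hsI) hcl)
    obtain ⟨-, J', p', hJ', hle2⟩ := hS.flight_step hr hs0 htT hf (hlow hJ (hle'.trans hsm)) hJ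
    refine ⟨J', p', hJ', ?_⟩
    have e : J' - J₀ = (J' - J) + (J - J₀) := by ring
    rw [e]
    refine (abs_add_le _ _).trans ((add_le_add hle2 hle).trans (le_of_eq ?_))
    ring

end


/-! ### Consequences of the conservation -/

theorem pd_Smap_iterate_add (hd : Profile d) (m n : ℕ) : ∃ G, Pol d G ∧
    ∀ v : E5, v.1 = 0 → ∀ z : E5, 0 < z.2.1 →
      pd v (iterate d (m + n)).Smap z = pd v (iterate d m).Smap z + z.1 ^ m * pd v G z := by
  obtain ⟨G, hG, h⟩ := Smap_iterate_add hd m n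
  refine ⟨G, hG, fun v hv z hz => ?_⟩
  have h1 := (((pol_iterate hd m).1.contDiffAt hd hz).differentiableAt (by simp))
  have h2 := ((hG.contDiffAt hd hz).differentiableAt (by simp))
  have h3 : DifferentiableAt ℝ (fun z : E5 => z.1 ^ m) z := by fun_prop
  have f1 : fderiv ℝ (fun z : E5 => z.1 ^ m) z v = 0 := by
    refine (fderiv_comp_coord (g := fun x => x ^ m) coordε (by fun_prop) v).trans ?_
    simp [coordε, hv]
  have : (iterate d (m + n)).Smap = fun z => (iterate d m).Smap z + z.1 ^ m * G z := funext h
  rw [this]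
  simp only [pd]
  rw [fderiv_fun_add h1 (h3.fun_mul h2), fderiv_fun_mul h3 h2]
  simp [f1]

/-- The constant in the estimate of the drift of the improved action. -/
def driftRate (a c₀ D₀ D₁ B L : ℝ) : ℝ :=
  8 * B + jumpRate a D₀ B * ((phaseRate c₀ D₀ D₁ + 1) * L + 8)

/-- The bounds and the smallness of `ε` for the order `m` on times up to `L ε⁻ᵏ`. -/
structure Tame (d : ℝ → ℝ) (a c₀ D₀ D₁ : ℝ) (m k : ℕ) (L ρ B ε : ℝ) : Prop where
  small : Small d a c₀ D₀ D₁ m ρ B ε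
  small_add : Small d a c₀ D₀ D₁ (m + k) ρ B ε
  L_pos : 0 < L
  diff : ∀ v ∈ dirs, v.1 = 0 → ∀ z ∈ Dom ρ, 0 ≤ z.1 →
    |pd v (iterate d (m + k)).Smap z - pd v (iterate d m).Smap z| ≤ B * z.1 ^ m
  drift : driftRate a c₀ D₀ D₁ B L * ε ≤ a / 16

section
variable {d : ℝ → ℝ} {a c₀ D₀ D₁ : ℝ}

theorem exists_tame (G : Geom d a c₀ D₀ D₁) (m k : ℕ) {L : ℝ} (hL : 0 < L) :
    ∃ B, ∀ᶠ ε : ℝ in 𝓝[>] 0, Tame d a c₀ D₀ D₁ m k L (radius a D₀) B ε := by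
  have hd := G.prof
  have hρ := G.radius_pos
  obtain ⟨F, hF, h⟩ := pd_Smap_iterate_add hd m k
  obtain ⟨B, h1, h2, h3⟩ := ((eventually_NFBound hd m hρ).and ((eventually_NFBound hd (m + k) hρ).and
    ((eventually_all_finite finite_dirs).2 fun v _ =>
      eventually_bound hd hρ (Shf.pol (Q := fun _ => 0) (hF.pd hd v))))).exists
  refine ⟨B, ?_⟩
  filter_upwards [eventually_small G h1, eventually_small G h2,
    eventually_mul_le (driftRate a c₀ D₀ D₁ B L) (b := a / 16) (by linarith [G.a_pos])]
    with ε e1 e2 e3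
  refine ⟨e1, e2, hL, fun v hv hv0 z hz hz0 => ?_, e3⟩
  rw [h v hv0 z (act_pos_of_mem hρ hz), add_sub_cancel_left, abs_mul, abs_of_nonneg (pow_nonneg hz0 _),
    mul_comm]
  exact mul_le_mul_of_nonneg_right (h3 v hv z hz) (pow_nonneg hz0 _)

variable {m k : ℕ} {L ρ B ε T : ℝ} {x y px py Φ : ℝ → ℝ}

theorem Geom.phaseRate_nonneg (hG : Geom d a c₀ D₀ D₁) : 0 ≤ phaseRate c₀ D₀ D₁ := by
  have := hG.c₀_pos
  have := hG.D₀_pos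
  have := hG.one_le
  unfold phaseRate; positivity

theorem Small.pow_le (hS : Small d a c₀ D₀ D₁ m ρ B ε) {i j : ℕ} (h : i ≤ j) : ε ^ j ≤ ε ^ i :=
  pow_le_pow_of_le_one hS.ε_pos.le (by linarith [hS.ε_le]) h

theorem Tame.time_le (hS : Tame d a c₀ D₀ D₁ m k L ρ B ε) (hT : T ≤ L * ε ^ (-(k : ℤ))) :
    ε ^ k * T ≤ L := by
  have hε := hS.small.ε_pos
  rw [zpow_neg, zpow_natCast, ← div_eq_mul_inv, le_div_iff₀ (by positivity)] at hT
  rwa [mul_comm]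

theorem Tame.drift_le (hS : Tame d a c₀ D₀ D₁ m k L ρ B ε) (hT : ε ^ k * T ≤ L) :
    jumpRate a D₀ B * ε ^ (m + k + 1) * ((phaseRate c₀ D₀ D₁ + 1) * T + 8) ≤
      jumpRate a D₀ B * ((phaseRate c₀ D₀ D₁ + 1) * L + 8) * ε ^ (m + 1) := by
  have hε := hS.small.ε_pos
  have hε1 := hS.small.ε_le
  have hph := hS.small.geom.phaseRate_nonneg
  have hj := hS.small.jumpRate_pos
  have e : jumpRate a D₀ B * ε ^ (m + k + 1) * ((phaseRate c₀ D₀ D₁ + 1) * T + 8) =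
      jumpRate a D₀ B * ((phaseRate c₀ D₀ D₁ + 1) * (ε ^ k * T) + 8 * ε ^ k) * ε ^ (m + 1) := by ring
  rw [e]
  have h1 : ε ^ k ≤ 1 := pow_le_one₀ hε.le (by linarith)
  gcongr
  linarith

/-- The improved action of order `m + k` drifts by `O(ε ^ (m + k + 1))` per unit time, hence by `O(ε
^ (m + 1))` over the whole interval. At each of the two end times it differs by `O(ε ^ (m + 1))`
from that of order `m`. -/
theorem Tame.image_at (hS : Tame d a c₀ D₀ D₁ m k L ρ B ε) (hr : IsRay d ε T x y px py)
    (hT0 : 0 ≤ T) (hT : ε ^ k * T ≤ L) (h0 : a ≤ action d ε (x 0) (py 0)) {t : ℝ}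
    (ht : t ∈ Icc 0 T) : 3 * a / 4 ≤ action d ε (x t) (py t) ∧
      ∀ J₀ p₀ J p, ImageAt d m ρ B ε (action d ε (x 0) (py 0)) (uRay d ε (x 0) (y 0) (py 0))
        (pHat d ε (x 0) (y 0) (px 0) (py 0)) (ε * x 0) J₀ p₀ →
      ImageAt d m ρ B ε (action d ε (x t) (py t)) (uRay d ε (x t) (y t) (py t))
        (pHat d ε (x t) (y t) (px t) (py t)) (ε * x t) J p →
      |J - J₀| ≤ driftRate a c₀ D₀ D₁ B L * ε ^ (m + 1) := by
  have hs := hS.small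
  have hG := hs.geom
  have hε := hs.ε_pos
  have hB0 := hs.nf.pos
  have h0T : (0 : ℝ) ∈ Icc 0 T := ⟨le_rfl, hT0⟩
  have ha := hG.a_pos
  have hdr := hS.drift_le hT
  have hdr0 : 0 ≤ jumpRate a D₀ B * ((phaseRate c₀ D₀ D₁ + 1) * L + 8) := by
    have := hs.jumpRate_pos
    have := hG.phaseRate_nonneg
    have := hS.L_pos
    positivity
  have hpow : ε ^ (m + 1) ≤ ε := by simpa using hs.pow_le (i := 1) (j := m + 1) (by omega)
  have hsm : jumpRate a D₀ B * ε ^ (m + k + 1) * ((phaseRate c₀ D₀ D₁ + 1) * T + 8) ≤ a / 16 := by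
    refine hdr.trans (le_trans ?_ hS.drift)
    unfold driftRate
    refine mul_le_mul (by linarith) hpow (by positivity) (by linarith)
  obtain ⟨I0, q0, hI0⟩ := hS.small_add.exists_imageAt (X := ε * x 0)
    (show a / 2 ≤ action d ε (x 0) (py 0) by linarith)
    (action_le hG (hr.abs_py_le h0T)) (abs_uRay_le hG.prof (hr.inside 0 h0T).1 (hr.inside 0 h0T).2)
    (abs_pHat_le hG hε hs.s4 (hr.inside 0 h0T).1 (hr.inside 0 h0T).2 (hr.abs_px_le h0T)
      (hr.abs_py_le h0T))
  obtain ⟨hlow, It, qt, hIt, hle⟩ := hS.small_add.conservation hr hT0 h0 hsm hI0 t ht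
  refine ⟨hlow, fun J₀ p₀ J p hJ0 hJ => ?_⟩
  -- An image of order `m + k` solves the equations of order `m` up to `B ε ^ (m + 1)` in each; the
  -- stability factor `2` gives `4 B`.
  have key : ∀ {I u P X J p J' p' : ℝ}, ImageAt d m ρ B ε I u P X J p →
      ImageAt d (m + k) ρ B ε I u P X J' p' → |J - J'| ≤ 4 * B * ε ^ (m + 1) := by
    intro I u P X J p J' p' h1 h2
    have g1 := hS.diff vu vu_mem rfl _ h2.mem hε.le
    have g2 := hS.diff vX vX_mem rfl _ h2.mem hε.le
    have hst := stable_image hs.nf hε hs.s1 h1.mem h2.mem h1.act h1.mom rfl rfl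
    have e1 : |I - (J' + ε * pd vu (iterate d m).Smap (ε, J', u, p', X))| ≤ B * ε ^ (m + 1) := by
      rw [← h2.act, show ∀ A B' : ℝ, J' + ε * A - (J' + ε * B') = ε * (A - B') by intros; ring,
        abs_mul, abs_of_pos hε, pow_succ, ← mul_assoc, mul_comm]
      exact mul_le_mul_of_nonneg_right g1 hε.le
    have e2 : |P - (p' + ε ^ 2 * pd vX (iterate d m).Smap (ε, J', u, p', X))| ≤ B * ε ^ (m + 1) := by
      rw [← h2.mom, show ∀ A B' : ℝ, p' + ε ^ 2 * A - (p' + ε ^ 2 * B') = ε * (ε * (A - B')) by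
        intros; ring, abs_mul, abs_mul, abs_of_pos hε]
      have h3 : ε * |pd vX (iterate d (m + k)).Smap (ε, J', u, p', X) -
          pd vX (iterate d m).Smap (ε, J', u, p', X)| ≤ B * ε ^ m :=
        (mul_le_of_le_one_left (abs_nonneg _) (by linarith [hs.ε_le])).trans g2
      calc _ ≤ ε * (B * ε ^ m) := mul_le_mul_of_nonneg_left h3 hε.le
        _ = _ := by ring
    linarith [abs_nonneg (p - p')]
  have k1 := key hJ0 hI0
  have k2 := key hJ hIt
  have e : J - J₀ = (J - It) + (It - I0) + (I0 - J₀) := by ring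
  rw [abs_sub_comm] at k1
  rw [e]
  refine (abs_add_le _ _).trans ((add_le_add ((abs_add_le _ _).trans (add_le_add k2
    (hle.trans hdr))) k1).trans (le_of_eq ?_))
  unfold driftRate; ring

/-- The sawtooth of the phase along the ray. -/
theorem sawtooth_eq (hd : Profile d) (hr : IsRay d ε T x y px py) {t : ℝ}
    (ht : t ∈ Icc 0 T) (hpy : py t ≠ 0)
    (hdir : (0 < py t → y t < d (ε * x t)) ∧ (py t < 0 → 0 < y t)) {φ : ℝ} {n : ℤ}
    (hφ : φ = phase d ε (x t) (y t) (py t) + 2 * Real.pi * n) :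
    sawtooth φ = uRay d ε (x t) (y t) (py t) := by
  have hdp := hd.d_pos (ε * x t)
  have hpi := Real.pi_pos
  have hy := hr.inside t ht
  unfold sawtooth uRay
  unfold phase at hφ
  rw [toIcoMod_eq_iff]
  rcases lt_or_gt_of_ne hpy with h | h
  · have h1 : 0 < y t / d (ε * x t) := div_pos (hdir.2 h) hdp
    have h2 : y t / d (ε * x t) ≤ 1 := (div_le_one hdp).2 hy.2
    rw [if_neg (not_lt.2 h.le)] at hφ ⊢
    refine ⟨⟨by nlinarith, by nlinarith⟩, n + 1, ?_⟩
    rw [hφ, zsmul_eq_mul]; push_cast; ring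
  · have h1 : 0 ≤ y t / d (ε * x t) := div_nonneg hy.1 hdp.le
    have h2 : y t / d (ε * x t) < 1 := (div_lt_one hdp).2 (hdir.1 h)
    rw [if_pos h] at hφ ⊢
    refine ⟨⟨by nlinarith, by nlinarith⟩, n, ?_⟩
    rw [hφ, zsmul_eq_mul]; ring

theorem abs_sawtooth_le (φ : ℝ) : |sawtooth φ| ≤ Real.pi := by
  have := toIcoMod_mem_Ico Real.two_pi_pos (-Real.pi) φ
  unfold sawtooth
  rw [abs_le]; constructor <;> linarith [this.1, this.2]

/-- The properties of the state at one time. -/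
structure GoodState (d : ℝ → ℝ) (a D₀ ε x y px py : ℝ) : Prop where
  act_ge : 3 * a / 4 ≤ action d ε x py
  act_le : action d ε x py ≤ D₀
  phase_le : |uRay d ε x y py| ≤ Real.pi
  mom_le : |pHat d ε x y px py| ≤ 2
  level : Hmap d (statePt d ε x y px py) = 0
  gap_nonneg : 0 ≤ gap d (action d ε x py) (ε * x)
  py_ne : py ≠ 0

/-- The gap at the current action equals `1 - p_y²`, so a ray never enters a forbidden region of its
own current potential. -/
theorem Tame.goodState (hS : Tame d a c₀ D₀ D₁ m k L ρ B ε) (hr : IsRay d ε T x y px py)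
    (hT0 : 0 ≤ T) (hT : ε ^ k * T ≤ L) (h0 : a ≤ action d ε (x 0) (py 0)) {t : ℝ}
    (ht : t ∈ Icc 0 T) : GoodState d a D₀ ε (x t) (y t) (px t) (py t) := by
  have hs := hS.small
  have hG := hs.geom
  have hI := (hS.image_at hr hT0 hT h0 ht).1
  have hin := hr.inside t ht
  have hpx := hr.abs_px_le ht
  have hpy := hr.abs_py_le ht
  have hlev := hr.level t ht
  refine ⟨hI, action_le hG hpy, abs_uRay_le hG.prof hin.1 hin.2,
    abs_pHat_le hG hs.ε_pos hs.s4 hin.1 hin.2 hpx hpy, (Hmap_statePt hG.prof).trans hlev, ?_, ?_⟩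
  · have hdp := (hG.prof.d_pos (ε * x t)).ne'
    have e : gap d (action d ε (x t) (py t)) (ε * x t) = 1 - py t ^ 2 := by
      unfold gap action
      rw [← sq_abs (py t)]
      have := Real.pi_ne_zero
      field_simp
    rw [e]; nlinarith [sq_nonneg (px t)]
  · intro h
    rw [action, h, abs_zero, zero_mul, zero_div] at hI
    linarith [hG.a_pos]

theorem Tame.sawtooth_phase (hS : Tame d a c₀ D₀ D₁ m k L ρ B ε) (hr : IsRay d ε T x y px py)
    (hT0 : 0 ≤ T) (hT : ε ^ k * T ≤ L) (h0 : a ≤ action d ε (x 0) (py 0))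
    (hΦ : IsPhaseLift d ε T x y py Φ) {t : ℝ} (ht : t ∈ Icc 0 T) :
    sawtooth (Φ t) = uRay d ε (x t) (y t) (py t) := by
  have hs := hS.small
  have hG := hs.geom
  have hg := hS.goodState hr hT0 hT h0 ht
  obtain ⟨n, hn⟩ := hΦ.2 t ht
  have hc : pyMin a D₀ ≤ |py t| := py_ge_of_action (ε := ε) (x := x t) hG
    (by linarith [hG.a_pos, hg.act_ge])
  refine sawtooth_eq hG.prof hr ht hg.py_ne (hr.direction hG hs.ε_pos ht hc ?_) hn
  have := hs.s3
  have := mul_pos (zero_lt_one.trans_le hG.one_le) hs.ε_pos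
  linarith

theorem rayPoint_eq {t : ℝ} (h : sawtooth (Φ t) = uRay d ε (x t) (y t) (py t)) :
    rayPoint d ε x px py Φ t =
      ⟨action d ε (x t) (py t), Φ t, pHat d ε (x t) (y t) (px t) (py t), x t⟩ := by
  unfold rayPoint pHat
  rw [h]

/-- The change of variables near a state of the ray. -/
theorem Small.isImage_iff (hS : Small d a c₀ D₀ D₁ m ρ B ε) {z w : Point} (haD : a ≤ D₀)
    (h1 : 3 * a / 4 ≤ z.I) (h2 : z.I ≤ D₀) (hp : |z.p| ≤ 2) :
    IsImage d (m + 1) ε a z w ↔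
      ImageAt d m ρ B ε z.I (sawtooth z.φ) z.p (ε * z.x) w.I w.p ∧
      w.φ = z.φ + ε * pd vI (iterate d m).Smap (ε, w.I, sawtooth z.φ, w.p, ε * z.x) ∧
      w.x = z.x + ε * pd vp (iterate d m).Smap (ε, w.I, sawtooth z.φ, w.p, ε * z.x) := by
  have hd := hS.geom.prof
  have ha := hS.geom.a_pos
  have hε := hS.ε_pos
  have hSm := (pol_iterate hd m).1
  have eq1 := fun h : 0 < w.I =>
    dI_eq hd hSm (z := (ε, w.I, sawtooth z.φ, w.p, ε * z.x)) h
  have eq2 := fun h : 0 < w.I =>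
    dφ_eq hd hSm (z := (ε, w.I, sawtooth z.φ, w.p, ε * z.x)) h
  have eq3 := fun h : 0 < w.I =>
    dp_eq hd hSm (z := (ε, w.I, sawtooth z.φ, w.p, ε * z.x)) h
  have eq4 := fun h : 0 < w.I =>
    dX_eq hd hSm (z := (ε, w.I, sawtooth z.φ, w.p, ε * z.x)) h
  have hN : normalForm d (m + 1) = iterate d m := rfl
  unfold IsImage IsChange
  rw [hN]
  simp only at eq1 eq2 eq3 eq4
  have hpu := abs_le.1 hp
  constructor
  · rintro ⟨⟨e1, e2, e3, e4⟩, b1, b2⟩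
    have hb1 := abs_le.1 b1
    have hb2 := abs_le.1 b2
    have hw : 0 < w.I := by linarith [hb1.1]
    rw [eq1 hw] at e2
    rw [eq2 hw] at e1
    rw [eq3 hw] at e4
    rw [eq4 hw] at e3
    have hm : (ε, w.I, sawtooth z.φ, w.p, ε * z.x) ∈ Dom ρ :=
      hS.mem_Dom (by linarith [hb1.1]) (by linarith [hb1.2]) (abs_sawtooth_le _)
        (by rw [abs_le]; constructor <;> linarith [hb2.1, hb2.2])
    refine ⟨⟨hm, e1.symm, e3.symm, ?_, ?_⟩, e2, e4⟩
    · rw [e1, sub_add_cancel_left, abs_neg, abs_mul, abs_of_pos hε]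
      exact mul_le_mul_of_nonneg_left (hS.nf.S1 vu vu_mem _ hm) hε.le
    · rw [e3, sub_add_cancel_left, abs_neg, abs_mul, abs_of_pos (by positivity)]
      exact mul_le_mul_of_nonneg_left (hS.nf.S1 vX vX_mem _ hm) (by positivity)
  · rintro ⟨h, e2, e4⟩
    have hw : 0 < w.I := act_pos_of_mem hS.ρ_pos h.mem
    rw [eq1 hw, eq2 hw, eq3 hw, eq4 hw]
    refine ⟨⟨h.act.symm, e2, h.mom.symm, e4⟩, h.act_le.trans ?_, h.mom_le.trans ?_⟩
    · linarith [hS.s2, mul_comm ε B]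
    · have := hS.s1
      have := hS.ε_le
      have : 0 < ε * B := mul_pos hε hS.nf.pos
      nlinarith

theorem Small.existsUnique_image (hS : Small d a c₀ D₀ D₁ m ρ B ε) {z : Point} (haD : a ≤ D₀)
    (h1 : 3 * a / 4 ≤ z.I) (h2 : z.I ≤ D₀) (hp : |z.p| ≤ 2) :
    ∃! w, IsImage d (m + 1) ε a z w := by
  obtain ⟨J, p, h⟩ := hS.exists_imageAt (u := sawtooth z.φ) (X := ε * z.x)
    (by linarith [hS.geom.a_pos]) h2 (abs_sawtooth_le _) hp
  refine ⟨⟨J, z.φ + ε * pd vI (iterate d m).Smap (ε, J, sawtooth z.φ, p, ε * z.x), p,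
    z.x + ε * pd vp (iterate d m).Smap (ε, J, sawtooth z.φ, p, ε * z.x)⟩,
    (hS.isImage_iff haD h1 h2 hp).2 ⟨h, rfl, rfl⟩, fun w hw => ?_⟩
  obtain ⟨h', e1, e2⟩ := (hS.isImage_iff haD h1 h2 hp).1 hw
  have hst := stable_image hS.nf hS.ε_pos hS.s1 h'.mem h.mem h'.act h'.mom h.act h.mom
  rw [sub_self, sub_self, abs_zero, add_zero, mul_zero] at hst
  have g1 : w.I = J := by
    have : |w.I - J| = 0 := le_antisymm (by linarith [abs_nonneg (w.p - p)]) (abs_nonneg _)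
    linarith [abs_eq_zero.1 this]
  have g2 : w.p = p := by
    have : |w.p - p| = 0 := le_antisymm (by linarith [abs_nonneg (w.I - J)]) (abs_nonneg _)
    linarith [abs_eq_zero.1 this]
  rw [g1, g2] at e1 e2
  ext
  · exact g1
  · exact e1
  · exact g2
  · exact e2

end

/-- The original action is an adiabatic invariant on all power-law time scales. -/
theorem action_conservation (hd : Profile d) (r : ℕ) {a L : ℝ} (ha : 0 < a) (hL : 0 < L) :
    ∃ C > 0, ∀ᶠ ε : ℝ in 𝓝[>] 0, ∀ T : ℝ, 0 ≤ T → T ≤ L * ε ^ (-(r : ℤ)) →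
      ∀ x y px py : ℝ → ℝ, IsRay d ε T x y px py → a ≤ action d ε (x 0) (py 0) →
      ∀ t ∈ Icc 0 T, |action d ε (x t) (py t) - action d ε (x 0) (py 0)| ≤ C * ε := by
  obtain ⟨c₀, D₀, D₁, G⟩ := exists_geom hd ha
  -- Order `m = 0` with `k = r`: the procedure is run to order `r` to control the drift, and only
  -- the crude comparison of order `ε` with the original action is kept.
  obtain ⟨B, hB⟩ := exists_tame G 0 r hL
  refine ⟨max 1 (2 * B + driftRate a c₀ D₀ D₁ B L), by positivity, ?_⟩
  filter_upwards [hB] with ε hS T hT0 hT x y px py hr h0 t ht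
  have hT' := hS.time_le hT
  have h0T : (0 : ℝ) ∈ Icc 0 T := ⟨le_rfl, hT0⟩
  have g0 := hS.goodState hr hT0 hT' h0 h0T
  have gt := hS.goodState hr hT0 hT' h0 ht
  obtain ⟨J₀, p₀, hJ₀⟩ := hS.small.exists_imageAt (X := ε * x 0) (by linarith [g0.act_ge]) g0.act_le
    g0.phase_le g0.mom_le
  obtain ⟨J, p, hJ⟩ := hS.small.exists_imageAt (X := ε * x t) (by linarith [gt.act_ge]) gt.act_le
    gt.phase_le gt.mom_le
  have h1 := (hS.image_at hr hT0 hT' h0 ht).2 _ _ _ _ hJ₀ hJ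
  have h2 := hJ₀.act_le
  have h3 := hJ.act_le
  have hε := hS.small.ε_pos
  rw [zero_add, pow_one] at h1
  have h4 : (2 * B + driftRate a c₀ D₀ D₁ B L) * ε ≤ max 1 (2 * B + driftRate a c₀ D₀ D₁ B L) * ε :=
    mul_le_mul_of_nonneg_right (le_max_right _ _) hε.le
  refine le_trans ?_ h4
  rw [abs_le] at *
  constructor <;> linarith [h1.1, h1.2, h2.1, h2.2, h3.1, h3.2]


/-! ### The slow variables with frozen action -/

theorem sawtooth_add_int (φ : ℝ) : ∃ n : ℤ, φ = sawtooth φ + 2 * Real.pi * n := by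
  refine ⟨toIcoDiv Real.two_pi_pos (-Real.pi) φ, ?_⟩
  have := toIcoMod_add_toIcoDiv_zsmul Real.two_pi_pos (-Real.pi) φ
  rw [zsmul_eq_mul] at this
  unfold sawtooth
  linarith

/-- A function on `[-π, π]` with equal end values gives a Lipschitz function of the phase. -/
theorem abs_comp_sawtooth_sub_le {g : ℝ → ℝ} {B : ℝ}
    (hg : ∀ u ∈ Icc (-Real.pi) Real.pi, ∀ v ∈ Icc (-Real.pi) Real.pi, |g u - g v| ≤ B * |u - v|)
    (hper : g Real.pi = g (-Real.pi)) (φ φ' : ℝ) :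
    |g (sawtooth φ) - g (sawtooth φ')| ≤ B * |φ - φ'| := by
  wlog h : φ ≤ φ' generalizing φ φ'
  · rw [abs_sub_comm, abs_sub_comm φ]
    exact this φ' φ (le_of_not_ge h)
  have hpi := Real.pi_pos
  have m1 := toIcoMod_mem_Ico Real.two_pi_pos (-Real.pi) φ
  have m2 := toIcoMod_mem_Ico Real.two_pi_pos (-Real.pi) φ'
  change sawtooth φ ∈ _ at m1
  change sawtooth φ' ∈ _ at m2
  obtain ⟨n, hn⟩ := sawtooth_add_int φ
  obtain ⟨n', hn'⟩ := sawtooth_add_int φ'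
  have k1 : sawtooth φ ∈ Icc (-Real.pi) Real.pi := ⟨m1.1, by linarith [m1.2]⟩
  have k2 : sawtooth φ' ∈ Icc (-Real.pi) Real.pi := ⟨m2.1, by linarith [m2.2]⟩
  have hπ : Real.pi ∈ Icc (-Real.pi) Real.pi := ⟨by linarith, le_rfl⟩
  have hπ' : -Real.pi ∈ Icc (-Real.pi) Real.pi := ⟨le_rfl, by linarith⟩
  have hB : 0 ≤ B := by
    have := (abs_nonneg _).trans (hg _ hπ _ hπ')
    exact nonneg_of_mul_nonneg_left this (by rw [sub_neg_eq_add, abs_of_pos] <;> linarith)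
  have hbase := hg _ k1 _ k2
  -- Phases at least a full turn apart are handled by the bound on `[-π, π]`; closer ones lie on the
  -- same branch of the sawtooth or on adjacent branches.
  rcases le_or_gt (2 * Real.pi) (φ' - φ) with hbig | hsmall
  · refine hbase.trans (mul_le_mul_of_nonneg_left ?_ hB)
    rw [abs_sub_comm φ, abs_of_nonneg (show 0 ≤ φ' - φ by linarith), abs_le]
    constructor <;> linarith [m1.1, m1.2, m2.1, m2.2]
  · have hlt1 : (n' : ℝ) - n < 2 := by
      have : 2 * Real.pi * ((n' : ℝ) - n) < 2 * Real.pi * 2 := by linarith [m1.1, m1.2, m2.1, m2.2]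
      exact lt_of_mul_lt_mul_left this (by linarith)
    have hlt2 : -1 < (n' : ℝ) - n := by
      have : 2 * Real.pi * (-1) < 2 * Real.pi * ((n' : ℝ) - n) := by
        linarith [m1.1, m1.2, m2.1, m2.2]
      exact lt_of_mul_lt_mul_left this (by linarith)
    have hcases : n' = n ∨ n' = n + 1 := by
      have a1 : n' - n < 2 := by exact_mod_cast hlt1
      have a2 : -1 < n' - n := by exact_mod_cast hlt2
      omega
    rcases hcases with he | he
    · rw [he] at hn'
      have e : φ - φ' = sawtooth φ - sawtooth φ' := by linarith
      rw [e]; exact hbase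
    · have hn'' : φ' = sawtooth φ' + 2 * Real.pi * (n + 1) := by rw [he] at hn'; push_cast at hn'; exact hn'
      -- One jump lies between the phases; the path runs up to `π` and continues from `-π`, where
      -- `g` has the same value.
      have a1 := hg _ k1 _ hπ
      have a2 := hg _ hπ' _ k2
      rw [abs_of_nonpos (show sawtooth φ - Real.pi ≤ 0 by linarith [m1.2])] at a1
      rw [abs_of_nonpos (show -Real.pi - sawtooth φ' ≤ 0 by linarith [m2.1])] at a2
      have e : g (sawtooth φ) - g (sawtooth φ') =
          (g (sawtooth φ) - g Real.pi) + (g (-Real.pi) - g (sawtooth φ')) := by rw [hper]; ring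
      rw [e, abs_of_nonpos (show φ - φ' ≤ 0 by linarith)]
      refine (abs_add_le _ _).trans ((add_le_add a1 a2).trans (le_of_eq ?_))
      rw [← mul_add]
      congr 1
      linarith

/-- `K` is invariant under translations in the phase, so its derivatives may be evaluated at phase
`0`. -/
theorem pd_Kmap_phase (N : NormalForm) (v : E5) (ε I u p X : ℝ) :
    pd v N.Kmap (ε, I, u, p, X) = pd v N.Kmap (ε, I, 0, p, X) := by
  have h : N.Kmap = fun z => N.Kmap (z + (0, 0, u, 0, 0)) := by
    funext z
    simp [Kmap]
  have h2 := fderiv_comp_add_right (𝕜 := ℝ) (f := N.Kmap) (x := ((ε, I, 0, p, X) : E5)) (0, 0, u, 0, 0)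
  rw [← h] at h2
  unfold pd
  rw [h2]
  simp

section
variable {d : ℝ → ℝ} {a c₀ D₀ D₁ : ℝ} {m k : ℕ} {L ρ B ε T : ℝ} {x y px py Φ : ℝ → ℝ}

/-- The derivatives of the generating function are Lipschitz along the phase circle. -/
theorem Small.abs_pd_sawtooth_sub_le (hS : Small d a c₀ D₀ D₁ m ρ B ε) {v : E5}
    (hv : v = vI ∨ v = vp ∨ v = vX) {J φ q X φ' q' X' : ℝ} (h1 : a / 4 ≤ J) (h2 : J ≤ 3 * D₀)
    (hq : |q| ≤ 8) (hq' : |q'| ≤ 8) :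
    |pd v (iterate d m).Smap (ε, J, sawtooth φ, q, X) -
      pd v (iterate d m).Smap (ε, J, sawtooth φ', q', X')| ≤
      B * (|φ - φ'| + |q - q'| + |X - X'|) := by
  have hvd : v ∈ dirs := by rcases hv with rfl | rfl | rfl <;> simp
  have hJ : 0 < J := by linarith [hS.geom.a_pos]
  have hu : ∀ u ∈ Icc (-Real.pi) Real.pi, |u| ≤ Real.pi := fun u hu => abs_le.2 hu
  have k1 := abs_comp_sawtooth_sub_le (B := B)
    (g := fun u => pd v (iterate d m).Smap (ε, J, u, q, X)) (fun u h u' h' => by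
      have := hS.nf.S1_lip v hvd _ (hS.mem_Dom (X := X) h1 h2 (hu u h) hq) _
        (hS.mem_Dom (X := X) h1 h2 (hu u' h') hq)
      refine this.trans (mul_le_mul_of_nonneg_left ?_ hS.nf.pos.le)
      have := norm_mk_sub_mk_le ε J u q X J u' q X
      simp only [sub_self, abs_zero, zero_add, add_zero] at this
      exact this)
    (pd_Smap_periodic hS.geom.prof m hv hJ (q, X)) φ φ'
  have k2 := (hS.nf.S1_lip v hvd _ (hS.mem_Dom (X := X) h1 h2 (abs_sawtooth_le φ') hq) _
        (hS.mem_Dom (X := X') h1 h2 (abs_sawtooth_le φ') hq')).trans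
      (mul_le_mul_of_nonneg_left (norm_mk_sub_mk_le ε J (sawtooth φ') q X J (sawtooth φ') q' X')
        hS.nf.pos.le)
  simp only [sub_self, abs_zero, zero_add] at k1 k2
  refine (abs_sub_le _ (pd v (iterate d m).Smap (ε, J, sawtooth φ', q, X)) _).trans
    ((add_le_add k1 k2).trans (le_of_eq ?_))
  ring

theorem ContinuousOn.union_Icc {f : ℝ → ℝ} {s t : ℝ} (hs : 0 ≤ s) (hst : s ≤ t)
    (h1 : ContinuousOn f (Icc 0 s)) (h2 : ContinuousOn f (Icc s t)) : ContinuousOn f (Icc 0 t) := by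
  rw [← Icc_union_Icc_eq_Icc hs hst]
  exact h1.union_of_isClosed h2 isClosed_Icc isClosed_Icc

theorem IsRay.continuousOn_x (hr : IsRay d ε T x y px py) (hT : 0 ≤ T) : ContinuousOn x (Icc 0 T) := by
  refine hr.induction (Q := fun t => ContinuousOn x (Icc 0 t)) (by simp) ?_ T ⟨hT, le_rfl⟩
  intro s t hs htT hf h
  refine ContinuousOn.union_Icc hs hf.lt.le h ?_
  have : ContinuousOn (fun τ => x s + 2 * (τ - s) * px s) (Icc s t) := by fun_prop
  exact this.congr fun τ hτ => hf.x_eq hτ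

/-- Unlike `p_x` and the action, `p̂_x` passes continuously through reflections; on a flight it is a
smooth function of time. -/
theorem Tame.continuousOn_mom (hS : Tame d a c₀ D₀ D₁ m k L ρ B ε) (hr : IsRay d ε T x y px py)
    (hT0 : 0 ≤ T) (hT : ε ^ k * T ≤ L) (h0 : a ≤ action d ε (x 0) (py 0)) :
    ContinuousOn (fun t => pHat d ε (x t) (y t) (px t) (py t)) (Icc 0 T) := by
  have hG := hS.small.geom
  refine hr.induction (Q := fun t => ContinuousOn (fun t => pHat d ε (x t) (y t) (px t) (py t))
    (Icc 0 t)) (by simp) ?_ T ⟨hT0, le_rfl⟩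
  intro s t hs htT hf h
  refine ContinuousOn.union_Icc hs hf.lt.le h ?_
  have hsI : s ∈ Icc 0 T := ⟨hs, hf.lt.le.trans htT⟩
  have hg := hS.goodState hr hT0 hT h0 hsI
  have hc : pyMin a D₀ ≤ |py s| := py_ge_of_action (ε := ε) (x := x s) hG
    (by linarith [hG.a_pos, hg.act_ge])
  have h1 : ContinuousOn (fun τ => pHat d ε (x s + 2 * (τ - s) * px s) (y s + 2 * (τ - s) * py s)
      (px s) (py s)) (Icc s t) := by
    intro τ _
    refine ContinuousAt.continuousWithinAt (HasDerivAt.continuousAt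
      (hasDerivAt_state (ε := ε) hG.prof hg.py_ne (X := fun τ => x s + 2 * (τ - s) * px s)
        (Y := fun τ => y s + 2 * (τ - s) * py s) (t := τ) ?_ ?_).2.2.1)
    · exact ((((hasDerivAt_id τ).sub_const s).const_mul 2).mul_const (px s)).const_add (x s)
        |>.congr_deriv (by ring)
    · exact ((((hasDerivAt_id τ).sub_const s).const_mul 2).mul_const (py s)).const_add (y s)
        |>.congr_deriv (by ring)
  refine h1.congr fun τ hτ => ?_
  rcases eq_or_lt_of_le hτ.2 with he | he
  · subst he
    simp only [← hf.x_end, ← hf.y_end]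
    rcases hf.end_state hG hr hS.small.ε_pos hs htT hG.pyMin_pos hc hS.small.s3 with he | he
    · exact congrArg (fun z : E5 => z.2.2.2.1) he
    · exact he.2.2.1
  · obtain ⟨e1, e2, e3, e4⟩ := hf.inner τ ⟨hτ.1, he⟩
    simp only [e1, e2, e3, e4]

/-- The point of the mixed variables with frozen action. -/
def mixedPt (ε J : ℝ) (Φ q x : ℝ → ℝ) (t : ℝ) : E5 := (ε, J, sawtooth (Φ t), q t, ε * x t)

/-- The new phase, in the mixed variables. -/
def slowPhase (d : ℝ → ℝ) (m : ℕ) (ε J : ℝ) (Φ q x : ℝ → ℝ) (t : ℝ) : ℝ :=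
  Φ t + ε * pd vI (iterate d m).Smap (mixedPt ε J Φ q x t)

/-- The new slow coordinate, in the mixed variables. -/
def slowX (d : ℝ → ℝ) (m : ℕ) (ε J : ℝ) (Φ q x : ℝ → ℝ) (t : ℝ) : ℝ :=
  ε * x t + ε ^ 2 * pd vp (iterate d m).Smap (mixedPt ε J Φ q x t)

/-- The new momentum `q` for the frozen action `J`, with accuracy `e`. -/
structure SlowCurve (d : ℝ → ℝ) (m : ℕ) (ρ ε T e J : ℝ) (I P Φ x q : ℝ → ℝ) : Prop where
  mem : ∀ t ∈ Icc 0 T, mixedPt ε J Φ q x t ∈ Dom ρ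
  q_le : ∀ t ∈ Icc 0 T, |q t| ≤ 3
  mom : ∀ t ∈ Icc 0 T, q t + ε ^ 2 * pd vX (iterate d m).Smap (mixedPt ε J Φ q x t) = P t
  act : ∀ t ∈ Icc 0 T, |I t - J - ε * pd vu (iterate d m).Smap (mixedPt ε J Φ q x t)| ≤ e
  level : ∀ t ∈ Icc 0 T, |(iterate d m).Kmap (ε, J, 0, q t, slowX d m ε J Φ q x t)| ≤ e
  cont_q : ContinuousOn q (Icc 0 T)
  cont_phase : ContinuousOn (slowPhase d m ε J Φ q x) (Icc 0 T)
  cont_X : ContinuousOn (slowX d m ε J Φ q x) (Icc 0 T)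
  deriv : ∀ t ∈ Ico 0 T, ∃ q' φ' Y' : ℝ, HasDerivWithinAt q q' (Ici t) t ∧
    HasDerivWithinAt (slowPhase d m ε J Φ q x) φ' (Ici t) t ∧
    HasDerivWithinAt (slowX d m ε J Φ q x) Y' (Ici t) t ∧
    |q' + ε * pd vX (iterate d m).Kmap (ε, J, 0, q t, slowX d m ε J Φ q x t)| ≤ ε * e ∧
    |φ' - pd vI (iterate d m).Kmap (ε, J, 0, q t, slowX d m ε J Φ q x t)| ≤ e ∧
    |Y' - ε * pd vp (iterate d m).Kmap (ε, J, 0, q t, slowX d m ε J Φ q x t)| ≤ ε * e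

/-- The accuracy of the slow curve. -/
def slowRate (a c₀ D₀ D₁ B L : ℝ) : ℝ := 10 * B ^ 3 * (1 + 2 * driftRate a c₀ D₀ D₁ B L)

theorem Tame.driftRate_pos (hS : Tame d a c₀ D₀ D₁ m k L ρ B ε) :
    0 < driftRate a c₀ D₀ D₁ B L := by
  have := hS.small.jumpRate_pos
  have := hS.small.geom.phaseRate_nonneg
  have := hS.L_pos
  have := hS.small.nf.pos
  unfold driftRate; positivity

/-- Values in `2πℤ` that change by less than `2π` do not change. Hence, to the right of `t`, the
lifted phase moves exactly like `u`. -/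
theorem phase_sub_eventually {u : ℝ → ℝ} {t t' : ℝ} (htt : t < t')
    (hΦ : ContinuousWithinAt Φ (Ici t) t) (hu : ContinuousWithinAt u (Ici t) t)
    (h : ∀ s ∈ Ico t t', ∃ n : ℤ, Φ s = u s + 2 * Real.pi * n) :
    ∀ᶠ s in 𝓝[Ici t] t, Φ s = u s + (Φ t - u t) := by
  have hc := (hΦ.sub hu)
  have h1 := Metric.continuousWithinAt_iff'.1 hc (2 * Real.pi) Real.two_pi_pos
  filter_upwards [h1, Ico_mem_nhdsGE htt] with s hs hst
  obtain ⟨n, hn⟩ := h s hst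
  obtain ⟨n', hn'⟩ := h t ⟨le_rfl, htt⟩
  have e : Φ s - u s - (Φ t - u t) = 2 * Real.pi * ((n - n' : ℤ) : ℝ) := by
    rw [hn, hn']; push_cast; ring
  rw [Real.dist_eq] at hs
  simp only [Pi.sub_apply] at hs
  rw [e, abs_mul, abs_of_pos Real.two_pi_pos] at hs
  have h3 : |((n - n' : ℤ) : ℝ)| < 1 := by
    by_contra hcon
    have := mul_le_mul_of_nonneg_left (not_lt.1 hcon) Real.two_pi_pos.le
    linarith
  have h4 : n - n' = 0 := by
    rw [← Int.cast_abs] at h3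
    have : |n - n'| < 1 := by exact_mod_cast h3
    exact Int.abs_lt_one_iff.1 this
  rw [h4, Int.cast_zero, mul_zero] at e
  linarith

/-- Freezing the action at `J` leaves one equation for `q`, involving only `∂S/∂X`. That function is
continuous around the phase circle, so `q` is continuous across reflections, whereas the actual
action jumps. The price is the action error, which `Tame.image_at` bounds at all times. One-sided
derivatives from the right suffice for Gronwall's inequality and avoid the reflection times. -/
theorem Tame.exists_slowCurve (hS : Tame d a c₀ D₀ D₁ m k L ρ B ε) (hr : IsRay d ε T x y px py)
    (hT0 : 0 ≤ T) (hT : ε ^ k * T ≤ L) (h0 : a ≤ action d ε (x 0) (py 0))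
    (hΦ : IsPhaseLift d ε T x y py Φ) {J p₀ : ℝ}
    (hJ : ImageAt d m ρ B ε (action d ε (x 0) (py 0)) (uRay d ε (x 0) (y 0) (py 0))
      (pHat d ε (x 0) (y 0) (px 0) (py 0)) (ε * x 0) J p₀) :
    ∃ q, SlowCurve d m ρ ε T (slowRate a c₀ D₀ D₁ B L * ε ^ (m + 1)) J
      (fun t => action d ε (x t) (py t)) (fun t => pHat d ε (x t) (y t) (px t) (py t)) Φ x q := by
  have hs := hS.small
  have hG := hs.geom
  have hd := hG.prof
  have ha := hG.a_pos
  have hε := hs.ε_pos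
  have hε1 := hs.ε_le
  have hB := hs.nf
  have hB0 := hB.pos
  have hB1 := hB.one_le
  have h0T : (0 : ℝ) ∈ Icc 0 T := ⟨le_rfl, hT0⟩
  have hgood := fun t ht => hS.goodState hr hT0 hT h0 (t := t) ht
  have hsaw := fun t ht => hS.sawtooth_phase hr hT0 hT h0 hΦ (t := t) ht
  have hdr := hS.driftRate_pos
  set κ := driftRate a c₀ D₀ D₁ B L with hκ
  have hη : 0 < ε ^ (m + 1) := by positivity
  obtain ⟨hJl, hJu⟩ : a / 2 ≤ J ∧ J ≤ 2 * D₀ := by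
    have h1 := abs_le.1 hJ.act_le
    have h2 := hs.s2
    have g0 := hgood 0 h0T
    constructor
    · linarith [h1.1, g0.act_ge]
    · linarith [h1.2, g0.act_le, g0.act_ge]
  have hD0 := hG.D₀_pos
  have hJpos : 0 < J := by linarith
  have hmem : ∀ {u p X : ℝ}, |u| ≤ Real.pi → |p| ≤ 8 → (ε, J, u, p, X) ∈ Dom ρ := fun hu hp =>
    hs.mem_Dom (by linarith) (by linarith) hu hp
  set P : ℝ → ℝ := fun t => pHat d ε (x t) (y t) (px t) (py t) with hP
  have hPle : ∀ t ∈ Icc 0 T, |P t| ≤ 2 := fun t ht => (hgood t ht).mom_le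
  choose! q hq hqe hqb using fun t (ht : t ∈ Icc 0 T) => exists_mom hd hs.ρ_pos hB hε hs.s1
    (J := J) (u := sawtooth (Φ t)) (b := P t) (X := ε * x t) (fun p hp =>
      hmem (abs_sawtooth_le _) (by
        have := abs_le.1 (hPle t ht); rw [abs_le]; constructor <;> linarith [hp.1, hp.2]))
  have hq3 : ∀ t ∈ Icc 0 T, |q t| ≤ 3 := fun t ht => by
    have := abs_le.1 (hPle t ht); rw [abs_le]
    constructor <;> linarith [(hq t ht).1, (hq t ht).2]
  have hqm : ∀ t ∈ Icc 0 T, mixedPt ε J Φ q x t ∈ Dom ρ := fun t ht =>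
    hmem (abs_sawtooth_le _) (by linarith [hq3 t ht])
  have hx := hr.continuousOn_x hT0
  have hPc : ContinuousOn P (Icc 0 T) := hS.continuousOn_mom hr hT0 hT h0
  -- continuity
  have hqc : ContinuousOn q (Icc 0 T) := by
    intro t ht
    refine continuousWithinAt_of_abs_sub_le (h := fun s => 2 * |P s - P t| + 2 * ε ^ 2 *
      (B * (|Φ s - Φ t| + |q t - q t| + |ε * x s - ε * x t|))) ?_ (by simp) ?_
    · have c1 := (hPc t ht).sub (continuousWithinAt_const (b := P t))
      have c2 := (hΦ.1 t ht).sub (continuousWithinAt_const (b := Φ t))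
      have c3 := ((hx t ht).const_smul ε).sub (continuousWithinAt_const (b := ε * x t))
      exact (c1.abs.const_smul (2 : ℝ)).add (((c2.abs.add continuousWithinAt_const).add
        c3.abs).const_smul B |>.const_smul (2 * ε ^ 2))
    · intro s hs'
      have h1 := stable_mom hB hε hs.s1 (hqm s hs') (hmem (abs_sawtooth_le (Φ s))
        (by linarith [hq3 t ht])) (hqe s hs') (hqe t ht)
      have h2 := hs.abs_pd_sawtooth_sub_le (v := vX) (Or.inr (Or.inr rfl)) (φ := Φ s) (φ' := Φ t)
        (X := ε * x s) (X' := ε * x t) (q := q t) (q' := q t)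
        (show a / 4 ≤ J by linarith) (by linarith) (by linarith [hq3 t ht]) (by linarith [hq3 t ht])
      exact h1.trans (add_le_add le_rfl (mul_le_mul_of_nonneg_left h2 (by positivity)))
  have hGc : ∀ v : E5, v = vI ∨ v = vp ∨ v = vX → ContinuousOn (fun t =>
      pd v (iterate d m).Smap (mixedPt ε J Φ q x t)) (Icc 0 T) := by
    intro v hv t ht
    refine continuousWithinAt_of_abs_sub_le (h := fun s =>
      B * (|Φ s - Φ t| + |q s - q t| + |ε * x s - ε * x t|)) ?_ (by simp) ?_
    · have c1 := (hqc t ht).sub (continuousWithinAt_const (b := q t))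
      have c2 := (hΦ.1 t ht).sub (continuousWithinAt_const (b := Φ t))
      have c3 := ((hx t ht).const_smul ε).sub (continuousWithinAt_const (b := ε * x t))
      exact ((c2.abs.add c1.abs).add c3.abs).const_smul B
    · intro s hs'
      exact hs.abs_pd_sawtooth_sub_le hv (show a / 4 ≤ J by linarith) (by linarith)
        (by linarith [hq3 s hs']) (by linarith [hq3 t ht])
  -- the error of the action
  have hact : ∀ t ∈ Icc 0 T, |action d ε (x t) (py t) - J -
      ε * pd vu (iterate d m).Smap (mixedPt ε J Φ q x t)| ≤ 2 * κ * ε ^ (m + 1) := by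
    intro t ht
    have hg := hgood t ht
    obtain ⟨J', p', h'⟩ := hs.exists_imageAt (X := ε * x t) (by linarith [hg.act_ge]) hg.act_le
      hg.phase_le hg.mom_le
    have h1 := (hS.image_at hr hT0 hT h0 ht).2 _ _ _ _ hJ h'
    rw [← hκ] at h1
    rw [← hsaw t ht] at h'
    have hp' : |p'| ≤ 8 := by
      have := abs_le.1 hg.mom_le
      have := abs_le.1 h'.mom_le
      have : ε ^ 2 * B ≤ 1 := by nlinarith [hs.s1]
      rw [abs_le]; constructor <;> linarith
    have h2 := stable_mom hB hε hs.s1 (hqm t ht) (hmem (abs_sawtooth_le (Φ t)) hp') (hqe t ht) h'.mom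
    rw [sub_self, abs_zero, mul_zero, zero_add] at h2
    have h3 := (hB.S1_lip vX vX_mem _ (hmem (X := ε * x t) (abs_sawtooth_le (Φ t)) hp') _
      h'.mem).trans (mul_le_mul_of_nonneg_left (norm_mk_sub_mk_le ε J _ p' _ J' _ p' _) hB0.le)
    have h4 := (hB.S1_lip vu vu_mem _ h'.mem _ (hqm t ht)).trans
      (mul_le_mul_of_nonneg_left (norm_mk_sub_mk_le ε J' _ p' _ J _ (q t) _) hB0.le)
    simp only [sub_self, abs_zero, add_zero] at h3 h4
    rw [abs_sub_comm J J'] at h3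
    rw [abs_sub_comm p' (q t)] at h4
    have hεB : ε * B ≤ 1 / 10 := by linarith [hs.s1]
    have h5 : |q t - p'| ≤ |J' - J| := by
      refine h2.trans ?_
      calc _ ≤ 2 * ε ^ 2 * (B * |J' - J|) := mul_le_mul_of_nonneg_left h3 (by positivity)
        _ = (2 * ε) * (ε * B) * |J' - J| := by ring
        _ ≤ 1 * (1 / 10) * |J' - J| := by gcongr; linarith
        _ ≤ _ := by linarith [abs_nonneg (J' - J)]
    have h6 : |action d ε (x t) (py t) - J -
        ε * pd vu (iterate d m).Smap (mixedPt ε J Φ q x t)| ≤ |J' - J| + ε * (B * (|J' - J| +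
          |q t - p'|)) := by
      rw [← h'.act, show ∀ A A' : ℝ, J' + ε * A - J - ε * A' = (J' - J) + ε * (A - A') by
        intros; ring]
      refine (abs_add_le _ _).trans (add_le_add le_rfl ?_)
      rw [abs_mul, abs_of_pos hε]
      exact mul_le_mul_of_nonneg_left h4 hε.le
    have h7 : ε * (B * (|J' - J| + |q t - p'|)) ≤ |J' - J| := by
      calc _ = (ε * B) * (|J' - J| + |q t - p'|) := by ring
        _ ≤ (1 / 10) * (|J' - J| + |J' - J|) := by gcongr
        _ ≤ _ := by linarith [abs_nonneg (J' - J)]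
    linarith
  have hold : ∀ t ∈ Icc 0 T, (iterate d m).oldPoint (mixedPt ε J Φ q x t) =
      (ε, J + ε * pd vu (iterate d m).Smap (mixedPt ε J Φ q x t), sawtooth (Φ t), P t, ε * x t) := by
    intro t ht
    rw [← hqe t ht]; rfl
  have hsuB : ∀ t ∈ Icc 0 T, |ε * pd vu (iterate d m).Smap (mixedPt ε J Φ q x t)| ≤ a / 16 := by
    intro t ht
    rw [abs_mul, abs_of_pos hε]
    refine le_trans ?_ hs.s2
    rw [mul_comm]; exact mul_le_mul_of_nonneg_right (hB.S1 vu vu_mem _ (hqm t ht)) hε.le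
  have holdm : ∀ t ∈ Icc 0 T, (iterate d m).oldPoint (mixedPt ε J Φ q x t) ∈ Dom ρ := by
    intro t ht
    rw [hold t ht]
    have := abs_le.1 (hsuB t ht)
    have hg := hgood 0 h0T
    have := hg.act_ge
    have := hg.act_le
    exact hs.mem_Dom (by linarith) (by linarith) (abs_sawtooth_le _) (by linarith [hPle t ht])
  have hstm : ∀ t ∈ Icc 0 T, (ε, action d ε (x t) (py t), sawtooth (Φ t), P t, ε * x t) ∈ Dom ρ :=
    fun t ht => hs.mem_Dom (by linarith [(hgood t ht).act_ge]) (by linarith [(hgood t ht).act_le])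
      (abs_sawtooth_le _) (by linarith [hPle t ht])
  have hsl : B * (1 + 2 * κ) ≤ slowRate a c₀ D₀ D₁ B L := by
    unfold slowRate
    have : B ≤ 10 * B ^ 3 := by nlinarith [sq_nonneg B, mul_self_nonneg (B - 1)]
    exact mul_le_mul_of_nonneg_right this (by positivity)
  have hσ : ∀ t, shiftMap (pd vp (iterate d m).Smap) (mixedPt ε J Φ q x t) =
      (ε, J, sawtooth (Φ t), q t, slowX d m ε J Φ q x t) := fun t => rfl
  refine ⟨q, hqm, hq3, hqe, fun t ht => (hact t ht).trans ?_, fun t ht => ?_, hqc, ?_, ?_, ?_⟩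
  · refine mul_le_mul_of_nonneg_right (le_trans ?_ hsl) hη.le
    nlinarith
  -- The ray has zero energy. Replacing its action by the prediction from `J`, and `H` by `K` plus
  -- the residual, costs `O(ε ^ (m + 1))` each.
  · have r1 := Rmap_eq hd (pol_iterate hd m).1 (z := mixedPt ε J Φ q x t) hJpos
    have b1 := hB.R _ (hqm t ht) hε.le
    have hlip := hB.H_lip _ (holdm t ht) _ (hstm t ht)
    have hlev := (hgood t ht).level
    rw [statePt, ← hsaw t ht] at hlev
    change Hmap d (ε, action d ε (x t) (py t), sawtooth (Φ t), P t, ε * x t) = 0 at hlev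
    rw [hlev, sub_zero] at hlip
    have hn := norm_mk_sub_mk_le ε (J + ε * pd vu (iterate d m).Smap (mixedPt ε J Φ q x t))
      (sawtooth (Φ t)) (P t) (ε * x t) (action d ε (x t) (py t)) (sawtooth (Φ t)) (P t) (ε * x t)
    simp only [sub_self, abs_zero, add_zero] at hn
    rw [← hold t ht, abs_sub_comm, ← sub_sub] at hn
    have h1 := hlip.trans (mul_le_mul_of_nonneg_left (hn.trans (hact t ht)) hB0.le)
    have e : (iterate d m).Kmap (ε, J, 0, q t, slowX d m ε J Φ q x t) =
        Hmap d ((iterate d m).oldPoint (mixedPt ε J Φ q x t)) -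
          (iterate d m).Rmap d (mixedPt ε J Φ q x t) := by
      rw [r1, hσ]; simp only [Kmap]; ring
    rw [e]
    refine (abs_sub _ _).trans ((add_le_add h1 b1).trans ?_)
    change B * (2 * κ * ε ^ (m + 1)) + B * ε ^ (m + 1) ≤ _
    have := mul_le_mul_of_nonneg_right hsl hη.le
    linarith
  · exact hΦ.1.add ((hGc vI (Or.inl rfl)).const_smul ε)
  · exact (hx.const_smul ε).add ((hGc vp (Or.inr (Or.inl rfl))).const_smul (ε ^ 2))
  · intro t ht
    have htI : t ∈ Icc 0 T := ⟨ht.1, ht.2.le⟩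
    obtain ⟨t', ht'T, hf⟩ := hr.exists_flight ht
    have hg := hgood t htI
    set Xf : ℝ → ℝ := fun τ => x t + 2 * (τ - t) * px t with hXf
    set Yf : ℝ → ℝ := fun τ => y t + 2 * (τ - t) * py t with hYf
    have hXd : HasDerivAt Xf (2 * px t) t :=
      ((((hasDerivAt_id t).sub_const t).const_mul 2).mul_const (px t)).const_add (x t)
        |>.congr_deriv (by ring)
    have hYd : HasDerivAt Yf (2 * py t) t :=
      ((((hasDerivAt_id t).sub_const t).const_mul 2).mul_const (py t)).const_add (y t)
        |>.congr_deriv (by ring)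
    have hXt : Xf t = x t := by simp [hXf]
    have hYt : Yf t = y t := by simp [hYf]
    have hsub : ∀ s ∈ Ico t t', s ∈ Icc 0 T := fun s hs' =>
      ⟨ht.1.trans hs'.1, hs'.2.le.trans ht'T⟩
    set uf : ℝ → ℝ := fun s => uRay d ε (Xf s) (Yf s) (py t) with huf
    have hin : ∀ s ∈ Ico t t', Xf s = x s ∧ uf s = sawtooth (Φ s) ∧
        pHat d ε (Xf s) (Yf s) (px t) (py t) = P s ∧
        action d ε (Xf s) (py t) = action d ε (x s) (py s) := by
      intro s hs'
      obtain ⟨e1, e2, e3, e4⟩ := hf.inner s hs'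
      rw [hsaw s (hsub s hs')]
      simp only [hP, huf, hXf, hYf, e1, e2, e3, e4, and_self]
    have htm : t ∈ Ico t t' := ⟨le_rfl, hf.lt⟩
    obtain ⟨i1, i2, i3, i4⟩ := hin t htm
    obtain ⟨s1, s2, s3, s4⟩ := hasDerivAt_state (ε := ε) hd hg.py_ne hXd hYd
    have hst : statePt d ε (Xf t) (Yf t) (px t) (py t) =
        (ε, action d ε (Xf t) (py t), uf t, pHat d ε (Xf t) (Yf t) (px t) (py t), ε * Xf t) := rfl
    rw [hst] at s1 s2 s3 s4
    have hζ : ∀ s ∈ Ico t t', mixedPt ε J Φ q x s = (ε, J, uf s, q s, ε * Xf s) := by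
      intro s hs'
      obtain ⟨j1, j2, j3, j4⟩ := hin s hs'
      rw [mixedPt, j1, j2]
    -- Only the flight that starts at `t` is used, with the momentum after a possible reflection at
    -- `t`; there the state is a smooth curve.
    obtain ⟨q', E', φ', Y', d1, d2, d3, d4, b1, b2, b3, b4⟩ := exists_deriv_mixed hd hs.ρ_pos hB hε
      hs.s1 (A := Ico t t') (J := J) (q := q) (I := fun s => action d ε (Xf s) (py t)) (u := uf)
      (P := fun s => pHat d ε (Xf s) (Yf s) (px t) (py t)) (X := fun s => ε * Xf s) htm
      ((hqc t htI).mono hsub) (fun s hs' => by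
        obtain ⟨j1, j2, j3, j4⟩ := hin s hs'
        have := hqe s (hsub s hs')
        simp only [← hζ s hs', j3]; exact this) s1.hasDerivWithinAt s2.hasDerivWithinAt
      s3.hasDerivWithinAt s4.hasDerivWithinAt (by rw [← hζ t htm]; exact hqm t htI)
      (by rw [i3, i4, i2, i1]; exact hstm t htI) (by rw [← hζ t htm]; exact holdm t htI)
    have hnh : Ico t t' ∈ 𝓝[Ici t] t := Ico_mem_nhdsGE hf.lt
    beta_reduce at b1 b3 b4
    rw [← hζ t htm, hσ, pd_Kmap_phase, i4] at b1 b3 b4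
    have herr : 10 * B ^ 3 * (ε ^ (m + 1) + |action d ε (x t) (py t) - J -
        ε * pd vu (iterate d m).Smap (mixedPt ε J Φ q x t)|) ≤
        slowRate a c₀ D₀ D₁ B L * ε ^ (m + 1) := by
      calc _ ≤ 10 * B ^ 3 * (ε ^ (m + 1) + 2 * κ * ε ^ (m + 1)) :=
            mul_le_mul_of_nonneg_left (add_le_add le_rfl (hact t htI)) (by positivity)
        _ = _ := by unfold slowRate; ring
    refine ⟨q', φ', Y', d1.mono_of_mem_nhdsWithin hnh, ?_, ?_,
      b1.trans (mul_le_mul_of_nonneg_left herr hε.le), b3.trans herr,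
      b4.trans (mul_le_mul_of_nonneg_left herr hε.le)⟩
    · have hΦt : ContinuousWithinAt Φ (Ici t) t :=
        (hΦ.1 t htI).mono_of_mem_nhdsWithin (mem_of_superset hnh hsub)
      -- Near `t` from the right, `slowPhase` and the curve differentiated in `d3` differ by a
      -- constant.
      have hev := phase_sub_eventually hf.lt hΦt s2.continuousAt.continuousWithinAt (fun s hs' => by
        obtain ⟨n, hn⟩ := sawtooth_add_int (Φ s)
        exact ⟨n, by change Φ s = uf s + _; rw [(hin s hs').2.1]; exact hn⟩)
      refine ((d3.mono_of_mem_nhdsWithin hnh).add_const (Φ t - uf t)).congr_of_eventuallyEq ?_ ?_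
      · filter_upwards [hev, hnh] with s e1 e2
        rw [slowPhase, hζ s e2, e1]
        ring
      · rw [slowPhase, hζ t htm]
        ring
    · refine (d4.mono_of_mem_nhdsWithin hnh).congr_of_eventuallyEq ?_ ?_
      · filter_upwards [hnh] with s e2
        rw [slowX, hζ s e2, (hin s e2).1]
      · simp only [slowX, hζ t htm, i1]

end


/-! ### Shadowing for Hamiltonian systems with one degree of freedom -/

/-- Bounds for a Hamiltonian `k` with the partial derivatives `kp`, `kX`, and for the frequency
`G`. -/
structure SlowField (k G kp kX : ℝ → ℝ → ℝ) (M : ℝ) : Prop where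
  one_le : 1 ≤ M
  bound_G : ∀ p X, |p| ≤ 4 → |G p X| ≤ M
  bound_p : ∀ p X, |p| ≤ 4 → |kp p X| ≤ M
  bound_X : ∀ p X, |p| ≤ 4 → |kX p X| ≤ M
  lip_G : ∀ p X p' X', |p| ≤ 4 → |p'| ≤ 4 → |G p X - G p' X'| ≤ M * (|p - p'| + |X - X'|)
  lip_p : ∀ p X p' X', |p| ≤ 4 → |p'| ≤ 4 → |kp p X - kp p' X'| ≤ M * (|p - p'| + |X - X'|)
  lip_X : ∀ p X p' X', |p| ≤ 4 → |p'| ≤ 4 → |kX p X - kX p' X'| ≤ M * (|p - p'| + |X - X'|)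
  taylor : ∀ p X p' X', |p| ≤ 4 → |p'| ≤ 4 →
    |k p X - k p' X' - (kp p X * (p - p') + kX p X * (X - X'))| ≤ M * (|p - p'| + |X - X'|) ^ 2

/-- A solution, up to the error `e`, of `p' = -kX`, `X' = kp`, `φ' = G` on `[0, T]`. -/
structure Approx (G kp kX : ℝ → ℝ → ℝ) (e T : ℝ) (p X φ : ℝ → ℝ) : Prop where
  p_le : ∀ t ∈ Icc 0 T, |p t| ≤ 4
  cont_p : ContinuousOn p (Icc 0 T)
  cont_X : ContinuousOn X (Icc 0 T)
  cont_φ : ContinuousOn φ (Icc 0 T)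
  deriv : ∀ t ∈ Ico 0 T, ∃ p' X' φ' : ℝ, HasDerivWithinAt p p' (Ici t) t ∧
    HasDerivWithinAt X X' (Ici t) t ∧ HasDerivWithinAt φ φ' (Ici t) t ∧
    |p' + kX (p t) (X t)| ≤ e ∧ |X' - kp (p t) (X t)| ≤ e ∧ |φ' - G (p t) (X t)| ≤ e

theorem gronwallBound_le {δ K e x Λ : ℝ} (hK : 1 ≤ K) (hδ : 0 ≤ δ) (he : 0 ≤ e)
    (hx : K * x ≤ Λ) : gronwallBound δ K e x ≤ Real.exp Λ * (δ + e) := by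
  rw [gronwallBound_of_K_ne_0 (by linarith)]
  have h1 := Real.exp_le_exp.2 hx
  have h2 := Real.exp_pos (K * x)
  have h3 : e / K ≤ e := div_le_self he hK
  have h4 : 0 ≤ e / K := div_nonneg he (by linarith)
  have h5 : δ * Real.exp (K * x) ≤ δ * Real.exp Λ := mul_le_mul_of_nonneg_left h1 hδ
  have h6 : e / K * (Real.exp (K * x) - 1) ≤ e * Real.exp Λ := by
    calc _ ≤ e / K * Real.exp (K * x) := mul_le_mul_of_nonneg_left (by linarith) h4
      _ ≤ e * Real.exp Λ := mul_le_mul h3 h1 h2.le he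
  simp only
  linarith

section
variable {k G kp kX : ℝ → ℝ → ℝ} {M e e' T T' : ℝ} {p X φ q Y ψ : ℝ → ℝ}

theorem hasDerivWithinAt_shift {f : ℝ → ℝ} {f' c s : ℝ}
    (h : HasDerivWithinAt f f' (Ici (c + s)) (c + s)) :
    HasDerivWithinAt (fun s => f (c + s)) f' (Ici s) s := by
  have h2 : HasDerivWithinAt (fun s : ℝ => c + s) 1 (Ici s) s :=
    (hasDerivWithinAt_id s (Ici s)).const_add c
  have := HasDerivWithinAt.comp s h h2 (fun u hu => mem_Ici.2 (add_le_add le_rfl (mem_Ici.1 hu)))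
  rw [mul_one] at this
  exact this

theorem continuousOn_shift {f : ℝ → ℝ} {c l : ℝ} (h : ContinuousOn f (Icc 0 T)) (hc : 0 ≤ c)
    (hl : c + l ≤ T) : ContinuousOn (fun s => f (c + s)) (Icc 0 l) :=
  h.comp (by fun_prop) fun s hs => ⟨by linarith [hs.1], by linarith [hs.2]⟩

/-- Two approximate solutions stay close on bounded times. -/
theorem Approx.close (hF : SlowField k G kp kX M) (h : Approx G kp kX e T q Y φ)
    (h' : Approx G kp kX e' T' p X ψ) (he : 0 ≤ e) (he' : 0 ≤ e') {τ θ l δ : ℝ} (hτ : 0 ≤ τ) (hθ : 0 ≤ θ)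
    (hl0 : 0 ≤ l) (hl : l ≤ 2) (hτl : τ + l ≤ T) (hθl : θ + l ≤ T') (hp : |q τ - p θ| ≤ δ)
    (hX : |Y τ - X θ| ≤ δ) :
    |q (τ + l) - p (θ + l)| ≤ Real.exp (4 * M) * (δ + (e + e')) ∧
    |Y (τ + l) - X (θ + l)| ≤ Real.exp (4 * M) * (δ + (e + e')) ∧
    |(φ (τ + l) - ψ (θ + l)) - (φ τ - ψ θ)| ≤ Real.exp (4 * M) * (δ + (e + e')) := by
  have hM := hF.one_le
  have hδ : 0 ≤ δ := (abs_nonneg _).trans hp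
  choose! q1 Y1 φ1 a1 a2 a3 a4 a5 a6 using h.deriv
  choose! p1 X1 ψ1 b1 b2 b3 b4 b5 b6 using h'.deriv
  have mτ : ∀ s ∈ Ico 0 l, τ + s ∈ Ico 0 T := fun s hs => ⟨by linarith [hs.1], by linarith [hs.2]⟩
  have mθ : ∀ s ∈ Ico 0 l, θ + s ∈ Ico 0 T' := fun s hs => ⟨by linarith [hs.1], by linarith [hs.2]⟩
  have key := norm_le_gronwallBound_of_norm_deriv_right_le
    (f := fun s => (q (τ + s) - p (θ + s), Y (τ + s) - X (θ + s),
      (φ (τ + s) - ψ (θ + s)) - (φ τ - ψ θ)))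
    (f' := fun s => (q1 (τ + s) - p1 (θ + s), Y1 (τ + s) - X1 (θ + s), φ1 (τ + s) - ψ1 (θ + s)))
    (δ := δ) (K := 2 * M) (ε := e + e') (a := 0) (b := l) ?_ ?_ ?_ ?_ l ⟨hl0, le_rfl⟩
  · have h2 := key.trans (gronwallBound_le (Λ := 4 * M) (by linarith) hδ (by linarith)
      (by rw [sub_zero]; nlinarith))
    exact ⟨(norm_fst_le _).trans h2, ((norm_fst_le _).trans (norm_snd_le _)).trans h2,
      ((norm_snd_le _).trans (norm_snd_le _)).trans h2⟩
  · exact ((continuousOn_shift h.cont_p hτ hτl).sub (continuousOn_shift h'.cont_p hθ hθl)).prodMk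
      (((continuousOn_shift h.cont_X hτ hτl).sub (continuousOn_shift h'.cont_X hθ hθl)).prodMk
      (((continuousOn_shift h.cont_φ hτ hτl).sub (continuousOn_shift h'.cont_φ hθ hθl)).sub continuousOn_const))
  · intro s hs
    have m1 := mτ s hs
    have m2 := mθ s hs
    exact ((hasDerivWithinAt_shift (a1 _ m1)).sub (hasDerivWithinAt_shift (b1 _ m2))).prodMk (((hasDerivWithinAt_shift (a2 _ m1)).sub (hasDerivWithinAt_shift (b2 _ m2))).prodMk
      (((hasDerivWithinAt_shift (a3 _ m1)).sub (hasDerivWithinAt_shift (b3 _ m2))).sub_const _))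
  · simp only [add_zero, sub_self]
    rw [Prod.norm_def, Prod.norm_def]
    simp only [norm_zero, Real.norm_eq_abs]
    exact max_le hp (max_le hX hδ)
  · intro s hs
    have m1 := mτ s hs
    have m2 := mθ s hs
    have n1 := h.p_le _ ⟨m1.1, m1.2.le⟩
    have n2 := h'.p_le _ ⟨m2.1, m2.2.le⟩
    set f : ℝ × ℝ × ℝ := (q (τ + s) - p (θ + s), Y (τ + s) - X (θ + s),
      (φ (τ + s) - ψ (θ + s)) - (φ τ - ψ θ)) with hf
    have hn1 : |q (τ + s) - p (θ + s)| ≤ ‖f‖ := norm_fst_le f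
    have hn2 : |Y (τ + s) - X (θ + s)| ≤ ‖f‖ := (norm_fst_le f.2).trans (norm_snd_le f)
    have hsum : M * (|q (τ + s) - p (θ + s)| + |Y (τ + s) - X (θ + s)|) ≤ 2 * M * ‖f‖ := by
      have := mul_le_mul_of_nonneg_left (add_le_add hn1 hn2) (show 0 ≤ M by linarith)
      linarith
    have tri : ∀ u v a b : ℝ, |u - a| ≤ e → |v - b| ≤ e' → |a - b| ≤ 2 * M * ‖f‖ →
        |u - v| ≤ 2 * M * ‖f‖ + (e + e') := by
      intro u v a b h1 h2 h3
      rw [abs_le] at *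
      constructor <;> linarith [h1.1, h1.2, h2.1, h2.2, h3.1, h3.2]
    have r1 := tri (q1 (τ + s)) (p1 (θ + s)) (-kX (q (τ + s)) (Y (τ + s)))
      (-kX (p (θ + s)) (X (θ + s))) (by rw [sub_neg_eq_add]; exact a4 _ m1)
      (by rw [sub_neg_eq_add]; exact b4 _ m2)
      (by rw [← neg_sub', abs_neg]; exact (hF.lip_X _ _ _ _ n1 n2).trans hsum)
    have r2 := tri _ _ _ _ (a5 _ m1) (b5 _ m2) ((hF.lip_p _ _ _ _ n1 n2).trans hsum)
    have r3 := tri _ _ _ _ (a6 _ m1) (b6 _ m2) ((hF.lip_G _ _ _ _ n1 n2).trans hsum)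
    rw [Prod.norm_def, Prod.norm_def]
    exact max_le r1 (max_le r2 r3)

/-- The velocities are bounded. -/
theorem Approx.lipschitz (hF : SlowField k G kp kX M) (h : Approx G kp kX e T q Y φ) {s t : ℝ}
    (hs : s ∈ Icc 0 T) (ht : t ∈ Icc 0 T) : |q t - q s| ≤ (M + e) * |t - s| ∧
      |Y t - Y s| ≤ (M + e) * |t - s| ∧ |φ t - φ s| ≤ (M + e) * |t - s| := by
  wlog hst : s ≤ t generalizing s t
  · have := this ht hs (le_of_not_ge hst)
    rwa [abs_sub_comm (q t), abs_sub_comm (Y t), abs_sub_comm (φ t), abs_sub_comm t]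
  choose! q1 Y1 φ1 a1 a2 a3 a4 a5 a6 using h.deriv
  have hsub : Icc s t ⊆ Icc 0 T := Icc_subset_Icc hs.1 ht.2
  have hsub' : Ico s t ⊆ Ico 0 T := Ico_subset_Ico hs.1 ht.2
  have tri : ∀ u a : ℝ, |u - a| ≤ e → |a| ≤ M → |u| ≤ M + e := by
    intro u a h1 h2
    rw [abs_le] at *
    constructor <;> linarith [h1.1, h1.2, h2.1, h2.2]
  have hle : ∀ u ∈ Ico s t, |q u| ≤ 4 := fun u hu => h.p_le u (hsub ⟨hu.1, hu.2.le⟩)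
  rw [abs_of_nonneg (show 0 ≤ t - s by linarith)]
  have ht' : t ∈ Icc s t := ⟨hst, le_rfl⟩
  refine ⟨norm_image_sub_le_of_norm_deriv_right_le_segment (h.cont_p.mono hsub)
      (fun u hu => a1 u (hsub' hu)) (fun u hu => tri _ (-kX (q u) (Y u)) ?_ ?_) t ht',
    norm_image_sub_le_of_norm_deriv_right_le_segment (h.cont_X.mono hsub)
      (fun u hu => a2 u (hsub' hu)) (fun u hu => tri _ _ (a5 u (hsub' hu))
        (hF.bound_p _ _ (hle u hu))) t ht',
    norm_image_sub_le_of_norm_deriv_right_le_segment (h.cont_φ.mono hsub)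
      (fun u hu => a3 u (hsub' hu)) (fun u hu => tri _ _ (a6 u (hsub' hu))
        (hF.bound_G _ _ (hle u hu))) t ht'⟩
  · rw [sub_neg_eq_add]; exact a4 u (hsub' hu)
  · rw [abs_neg]; exact hF.bound_X _ _ (hle u hu)

theorem abs_sub_sub_mul_le {f f' : ℝ → ℝ} {s t c K : ℝ} (hst : s ≤ t)
    (hf : ContinuousOn f (Icc s t)) (hf' : ∀ u ∈ Ico s t, HasDerivWithinAt f (f' u) (Ici u) u)
    (hb : ∀ u ∈ Ico s t, |f' u - c| ≤ K) : |f t - f s - (t - s) * c| ≤ K * (t - s) := by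
  have := norm_image_sub_le_of_norm_deriv_right_le_segment (f := fun u => f u - u * c)
    (f' := fun u => f' u - c) (hf.sub (by fun_prop))
    (fun u hu => (hf' u hu).sub (by
      simpa using ((hasDerivWithinAt_id u (Ici u)).mul_const c))) hb t ⟨hst, le_rfl⟩
  rw [Real.norm_eq_abs] at this
  rwa [show f t - t * c - (f s - s * c) = f t - f s - (t - s) * c by ring] at this

/-- Second-order expansion of an exact solution. -/
theorem Approx.second_order (hF : SlowField k G kp kX M) (h : Approx G kp kX 0 T p X ψ) {s t : ℝ}
    (hs : s ∈ Icc 0 T) (ht : t ∈ Icc 0 T) :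
    |p t - p s + (t - s) * kX (p s) (X s)| ≤ 2 * M ^ 2 * (t - s) ^ 2 ∧
    |X t - X s - (t - s) * kp (p s) (X s)| ≤ 2 * M ^ 2 * (t - s) ^ 2 := by
  choose! p1 X1 φ1 a1 a2 a3 a4 a5 a6 using h.deriv
  have hM := hF.one_le
  -- The base point `w` may be either end of the interval, so forward and backward expansions are
  -- covered together.
  have gen : ∀ a b w : ℝ, a ≤ b → a ∈ Icc 0 T → b ∈ Icc 0 T → w ∈ Icc a b →
      |p b - p a + (b - a) * kX (p w) (X w)| ≤ 2 * M ^ 2 * (b - a) ^ 2 ∧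
      |X b - X a - (b - a) * kp (p w) (X w)| ≤ 2 * M ^ 2 * (b - a) ^ 2 := by
    intro a b w hab ha hb hw
    have hsub : Icc a b ⊆ Icc 0 T := Icc_subset_Icc ha.1 hb.2
    have hsub' : Ico a b ⊆ Ico 0 T := Ico_subset_Ico ha.1 hb.2
    have hl : ∀ u ∈ Ico a b, M * (|p u - p w| + |X u - X w|) ≤ 2 * M ^ 2 * (b - a) := by
      intro u hu
      obtain ⟨l1, l2, -⟩ := h.lipschitz hF (hsub hw) (hsub ⟨hu.1, hu.2.le⟩)
      rw [add_zero] at l1 l2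
      have h3 : |u - w| ≤ b - a := by
        rw [abs_le]; constructor <;> linarith [hu.1, hu.2, hw.1, hw.2]
      have h4 := mul_le_mul_of_nonneg_left h3 (show 0 ≤ M by linarith)
      calc _ ≤ M * (M * (b - a) + M * (b - a)) :=
            mul_le_mul_of_nonneg_left (by linarith) (by linarith)
        _ = _ := by ring
    have e : 2 * M ^ 2 * (b - a) ^ 2 = 2 * M ^ 2 * (b - a) * (b - a) := by ring
    rw [e]
    have hwT := hsub hw
    constructor
    · have := abs_sub_sub_mul_le (c := -kX (p w) (X w)) hab (h.cont_p.mono hsub)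
        (fun u hu => a1 u (hsub' hu)) (K := 2 * M ^ 2 * (b - a)) (fun u hu => by
          have g1 := abs_nonpos_iff.1 (a4 u (hsub' hu))
          rw [show p1 u = -kX (p u) (X u) by linarith, ← neg_sub', abs_neg]
          exact (hF.lip_X _ _ _ _ (h.p_le _ (hsub ⟨hu.1, hu.2.le⟩)) (h.p_le _ hwT)).trans (hl u hu))
      rwa [mul_neg, sub_neg_eq_add] at this
    · exact abs_sub_sub_mul_le hab (h.cont_X.mono hsub)
        (fun u hu => a2 u (hsub' hu)) (K := 2 * M ^ 2 * (b - a)) (fun u hu => by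
          have g1 := abs_nonpos_iff.1 (a5 u (hsub' hu))
          rw [show X1 u = kp (p u) (X u) by linarith]
          exact (hF.lip_p _ _ _ _ (h.p_le _ (hsub ⟨hu.1, hu.2.le⟩)) (h.p_le _ hwT)).trans (hl u hu))
  rcases le_total s t with hst | hst
  · exact gen s t s hst hs ht ⟨le_rfl, hst⟩
  · obtain ⟨g1, g2⟩ := gen t s s hst ht hs ⟨hst, le_rfl⟩
    constructor
    · rw [show p t - p s + (t - s) * kX (p s) (X s) = -(p s - p t + (s - t) * kX (p s) (X s)) by ring,
        abs_neg, show (t - s) ^ 2 = (s - t) ^ 2 by ring]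
      exact g1
    · rw [show X t - X s - (t - s) * kp (p s) (X s) = -(X s - X t - (s - t) * kp (p s) (X s)) by ring,
        abs_neg, show (t - s) ^ 2 = (s - t) ^ 2 by ring]
      exact g2

/-- The constants of the shadowing estimate; `lam` is the inverse square of the lower bound for
the velocity. -/
def trackDist (M lam : ℝ) : ℝ := 2 * M * lam + 1

/-- The distance reached from `trackDist` within at most two units of time: Gronwall with constant
`2 M` gives `exp (4 * M)`, and the summand `1` is the defect of the equation. All these constants
multiply the error `e`. -/
def stepDist (M lam : ℝ) : ℝ := Real.exp (4 * M) * (trackDist M lam + 1)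

/-- Bound for the correction of the clock at the end of a unit step. -/
def stepShift (M lam : ℝ) : ℝ := 2 * M * stepDist M lam * lam

/-- Growth per unit step of the phase discrepancy: what accumulates during the step, plus what the
clock correction causes at phase speed `M`. It also dominates the growth of the clock shift. -/
def trackRate (M lam : ℝ) : ℝ := stepDist M lam + M * stepShift M lam

/-- The first three terms collect the quadratic errors in `correction_le`; `stepShift` keeps the
clock correction below one; the final `1` gives `e ≤ 1`. -/
def errorFactor (M lam : ℝ) : ℝ := 4 * M ^ 2 * stepDist M lam ^ 2 * lam +
  2 * M * stepDist M lam * stepShift M lam + 2 * M ^ 2 * stepShift M lam ^ 2 + stepShift M lam + 1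

/-- One partial step, plus the accumulated clock shift, which enters through the velocities of both
curves and once more through the tracked phase error. -/
def shadowRate (M lam : ℝ) : ℝ := stepDist M lam + (2 * M + 2) * trackRate M lam

/-- The component across the level is `O(e)` by conservation of energy, and the other terms are
quadratic in `e`. This restores the distance `trackDist`, which does not depend on the constant `C`
of the preceding step, so no growth accumulates. -/
theorem correction_le {M lam C σ e g n s w r c D : ℝ} (hM0 : 0 < M) (he : 0 ≤ e)
    (hσ : 0 ≤ σ)
    (hsm : (4 * M ^ 2 * C ^ 2 * lam + 2 * M * C * σ + 2 * M ^ 2 * σ ^ 2 + σ + 1) * e ≤ 1)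
    (hg : |g| ≤ 2 * e + 4 * M * C ^ 2 * e ^ 2) (hn0 : 0 ≤ n) (hn : n ≤ lam) (hs : |s| ≤ σ * e)
    (hw : |w| ≤ M * (2 * (C * e))) (hr : |r| ≤ 2 * M ^ 2 * s ^ 2) (hc : |c| ≤ M)
    (hD : D = c * (g * n) + s * w + r) : |D| ≤ trackDist M lam * e := by
  have hss : s ^ 2 ≤ (σ * e) ^ 2 := by
    rw [← sq_abs s]; exact pow_le_pow_left₀ (abs_nonneg _) hs 2
  have g1 : |c * (g * n)| ≤ M * ((2 * e + 4 * M * C ^ 2 * e ^ 2) * lam) := by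
    rw [abs_mul, abs_mul, abs_of_nonneg hn0]
    exact mul_le_mul hc (mul_le_mul hg hn hn0 (by positivity)) (by positivity) hM0.le
  have g2 : |s * w| ≤ σ * e * (M * (2 * (C * e))) := by
    rw [abs_mul]; exact mul_le_mul hs hw (abs_nonneg _) (by positivity)
  have g3 : |r| ≤ 2 * M ^ 2 * (σ * e) ^ 2 :=
    hr.trans (mul_le_mul_of_nonneg_left hss (by positivity))
  have g4 := mul_le_mul_of_nonneg_right hsm he
  rw [hD]
  refine (abs_add_le _ _).trans ((add_le_add ((abs_add_le _ _).trans (add_le_add g1 g2)) g3).trans ?_)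
  have : 0 ≤ σ * e * e + e * e := by positivity
  unfold trackDist
  linarith

/-- The correction of the time of the exact solution. -/
theorem Approx.correct (hF : SlowField k G kp kX M) (h' : Approx G kp kX 0 T' p X ψ) {lam θ q₁ Y₁ : ℝ}
    (he : 0 ≤ e) (hlam : 1 ≤ lam) (hsm : errorFactor M lam * e ≤ 1) (hθ : 1 ≤ θ) (hθ' : θ + 1 ≤ T')
    (hq : |q₁| ≤ 4) (hlow : 1 ≤ lam * (kp q₁ Y₁ ^ 2 + kX q₁ Y₁ ^ 2))
    (h1 : |q₁ - p θ| ≤ stepDist M lam * e) (h2 : |Y₁ - X θ| ≤ stepDist M lam * e)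
    (hk : |k q₁ Y₁| ≤ e) (hk' : |k (p θ) (X θ)| ≤ e) :
    ∃ s, |s| ≤ stepShift M lam * e ∧ |s| ≤ 1 ∧ |q₁ - p (θ + s)| ≤ trackDist M lam * e ∧
      |Y₁ - X (θ + s)| ≤ trackDist M lam * e := by
  have hM := hF.one_le
  have hlam0 : 0 < lam := by linarith
  have hM0 : 0 < M := by linarith
  have hθI : θ ∈ Icc 0 T' := ⟨by linarith, by linarith⟩
  set C := stepDist M lam with hC
  have hC0 : 0 ≤ C := by
    have := Real.exp_pos (4 * M)
    rw [hC]; unfold stepDist trackDist; positivity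
  set σ := stepShift M lam with hσ
  have hσe : σ = 2 * M * C * lam := rfl
  have hσ0 : 0 ≤ σ := by rw [hσe]; positivity
  set a := kp q₁ Y₁ with ha
  set b := kX q₁ Y₁ with hb
  set N := a ^ 2 + b ^ 2 with hN
  have hN0 : 0 < N := by
    by_contra hcon
    have := mul_nonpos_of_nonneg_of_nonpos hlam0.le (not_lt.1 hcon)
    linarith
  have hNi : N⁻¹ ≤ lam := by
    rw [inv_le_iff_one_le_mul₀ hN0]; exact hlow
  have haM : |a| ≤ M := hF.bound_p _ _ hq
  have hbM : |b| ≤ M := hF.bound_X _ _ hq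
  set hp := q₁ - p θ with hhp
  set hX := Y₁ - X θ with hhX
  -- `(a, b)` is the gradient of `k` and `(-b, a)` the flow direction; `s` is the coordinate of the
  -- discrepancy along the flow.
  set s := (-b * hp + a * hX) * N⁻¹ with hs
  have hNi0 : 0 ≤ N⁻¹ := by positivity
  have hCe : 0 ≤ C * e := by positivity
  have hsb : |s| ≤ σ * e := by
    rw [hs, abs_mul, abs_of_nonneg hNi0]
    have g1 : |-b * hp + a * hX| ≤ M * (C * e) + M * (C * e) := by
      refine (abs_add_le _ _).trans (add_le_add ?_ ?_)
      · rw [abs_mul, abs_neg]; exact mul_le_mul hbM h1 (abs_nonneg _) hM0.le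
      · rw [abs_mul]; exact mul_le_mul haM h2 (abs_nonneg _) hM0.le
    calc _ ≤ (M * (C * e) + M * (C * e)) * lam := mul_le_mul g1 hNi hNi0 (by positivity)
      _ = _ := by rw [hσe]; ring
  have hE : errorFactor M lam = 4 * M ^ 2 * C ^ 2 * lam + 2 * M * C * σ + 2 * M ^ 2 * σ ^ 2 + σ + 1 :=
    rfl
  have hs1 : |s| ≤ 1 := by
    refine hsb.trans (le_trans (mul_le_mul_of_nonneg_right ?_ he) hsm)
    rw [hE]
    have : 0 ≤ 4 * M ^ 2 * C ^ 2 * lam + 2 * M * C * σ + 2 * M ^ 2 * σ ^ 2 := by positivity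
    linarith
  have hs2 := abs_le.1 hs1
  have hθs : θ + s ∈ Icc 0 T' := ⟨by linarith, by linarith⟩
  obtain ⟨t1, t2⟩ := h'.second_order hF hθI hθs
  rw [add_sub_cancel_left] at t1 t2
  have hp4 := h'.p_le θ hθI
  have hTay := hF.taylor q₁ Y₁ (p θ) (X θ) hq hp4
  have hsum : |hp| + |hX| ≤ 2 * (C * e) := by linarith
  -- The component along the gradient is, to first order, a difference of energies, both of which
  -- are at most `e`.
  have hg : |a * hp + b * hX| ≤ 2 * e + 4 * M * C ^ 2 * e ^ 2 := by
    have g1 : M * (|hp| + |hX|) ^ 2 ≤ M * (2 * (C * e)) ^ 2 :=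
      mul_le_mul_of_nonneg_left (pow_le_pow_left₀ (by positivity) hsum 2) hM0.le
    have g2 := abs_le.1 (hTay.trans g1)
    have g3 := abs_le.1 hk
    have g4 := abs_le.1 hk'
    have e1 : M * (2 * (C * e)) ^ 2 = 4 * M * C ^ 2 * e ^ 2 := by ring
    rw [e1] at g2
    rw [abs_le]
    constructor <;> linarith [g2.1, g2.2, g3.1, g3.2, g4.1, g4.2]
  have hNN : N * N⁻¹ = 1 := mul_inv_cancel₀ hN0.ne'
  have hlipX := (hF.lip_X q₁ Y₁ (p θ) (X θ) hq hp4).trans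
    (mul_le_mul_of_nonneg_left hsum hM0.le)
  have hlipp := (hF.lip_p q₁ Y₁ (p θ) (X θ) hq hp4).trans
    (mul_le_mul_of_nonneg_left hsum hM0.le)
  have hsm' := hsm
  rw [hE] at hsm'
  refine ⟨s, hsb, hs1, ?_, ?_⟩
  · have e1 : q₁ - p (θ + s) = a * ((a * hp + b * hX) * N⁻¹) + s * (-(b - kX (p θ) (X θ))) +
        -(p (θ + s) - p θ + s * kX (p θ) (X θ)) := by
      rw [show q₁ - p (θ + s) = hp - (p (θ + s) - p θ) by rw [hhp]; ring]
      -- Removing the flow component of the discrepancy leaves its projection on the gradient.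
      have e2 : hp + s * b = a * ((a * hp + b * hX) * N⁻¹) := by
        rw [hs]
        linear_combination (-hp) * hNN + hp * N⁻¹ * hN
      linear_combination e2
    exact correction_le hM0 he hσ0 hsm' hg hNi0 hNi hsb (by rw [abs_neg]; exact hlipX)
      (by rw [abs_neg]; exact t1) haM e1
  · have e1 : Y₁ - X (θ + s) = b * ((a * hp + b * hX) * N⁻¹) + s * (a - kp (p θ) (X θ)) +
        -(X (θ + s) - X θ - s * kp (p θ) (X θ)) := by
      rw [show Y₁ - X (θ + s) = hX - (X (θ + s) - X θ) by rw [hhX]; ring]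
      have e2 : hX - s * a = b * ((a * hp + b * hX) * N⁻¹) := by
        rw [hs]
        linear_combination (-hX) * hNN + hX * N⁻¹ * hN
      linear_combination e2
    exact correction_le hM0 he hσ0 hsm' hg hNi0 hNi hsb hlipp
      (by rw [abs_neg]; exact t2) hbM e1

/-- An approximate solution that does not slow down stays close to the exact solution with the
same initial values, with an error that grows linearly in time. -/
theorem shadowing (hF : SlowField k G kp kX M) {lam : ℝ} (he : 0 ≤ e) (hlam : 1 ≤ lam)
    (hsm : errorFactor M lam * e ≤ 1) (h : Approx G kp kX e T q Y φ)
    (h' : Approx G kp kX 0 T p X ψ) (hlow : ∀ t ∈ Icc 0 T, 1 ≤ lam * (kp (q t) (Y t) ^ 2 +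
      kX (q t) (Y t) ^ 2)) (hk : ∀ t ∈ Icc 0 T, |k (q t) (Y t)| ≤ e)
    (hk' : ∀ t ∈ Icc 0 T, |k (p t) (X t)| ≤ e) (i1 : q 0 = p 0) (i2 : Y 0 = X 0) (i3 : φ 0 = ψ 0) :
    ∀ t ∈ Icc 0 T, |q t - p t| ≤ shadowRate M lam * e * (1 + T) ∧
      |Y t - X t| ≤ shadowRate M lam * e * (1 + T) ∧ |φ t - ψ t| ≤ shadowRate M lam * e * (1 + T) := by
  have hM := hF.one_le
  have hM0 : 0 < M := by linarith
  have hlam0 : 0 < lam := by linarith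
  have hC₀ : 0 ≤ trackDist M lam := by unfold trackDist; positivity
  have hCdef : stepDist M lam = Real.exp (4 * M) * (trackDist M lam + 1) := rfl
  have hC : 0 ≤ stepDist M lam := by rw [hCdef]; positivity
  have hσ : 0 ≤ stepShift M lam := by unfold stepShift; positivity
  set C := stepDist M lam with hCs
  set σ := stepShift M lam with hσs
  set R := trackRate M lam with hRs
  have hR : R = C + M * σ := rfl
  have hR0 : 0 ≤ R := by rw [hR]; positivity
  have hσR : σ ≤ R := by rw [hR]; nlinarith
  have he1 : e ≤ 1 := by
    have hE : errorFactor M lam = 4 * M ^ 2 * C ^ 2 * lam + 2 * M * C * σ + 2 * M ^ 2 * σ ^ 2 + σ + 1 :=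
      rfl
    have : 0 ≤ (4 * M ^ 2 * C ^ 2 * lam + 2 * M * C * σ + 2 * M ^ 2 * σ ^ 2 + σ) * e := by positivity
    rw [hE] at hsm
    nlinarith
  have close : ∀ {τ θ l : ℝ}, 0 ≤ τ → 0 ≤ θ → 0 ≤ l → l ≤ 2 → τ + l ≤ T → θ + l ≤ T →
      |q τ - p θ| ≤ trackDist M lam * e → |Y τ - X θ| ≤ trackDist M lam * e →
      |q (τ + l) - p (θ + l)| ≤ C * e ∧ |Y (τ + l) - X (θ + l)| ≤ C * e ∧
      |(φ (τ + l) - ψ (θ + l)) - (φ τ - ψ θ)| ≤ C * e := by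
    intro τ θ l g1 g2 g3 g4 g5 g6 g7 g8
    have e1 : C * e = Real.exp (4 * M) * (trackDist M lam * e + (e + 0)) := by rw [hCdef]; ring
    rw [e1]
    exact h.close hF h' he le_rfl g1 g2 g3 g4 g5 g6 g7 g8
  -- The exact solution exists only on `[0, T]`, while its clock `θ` may run ahead of `τ`. A step
  -- uses one unit of time and a correction of at most one, so tracking stops as soon as less than
  -- two units remain for `θ`.
  have track : ∀ n : ℕ, (n : ℝ) ≤ T → ∃ τ θ : ℝ, 0 ≤ τ ∧ τ ≤ n ∧ θ ∈ Icc 0 T ∧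
      (τ = n ∨ T - θ < 2) ∧ |q τ - p θ| ≤ trackDist M lam * e ∧
      |Y τ - X θ| ≤ trackDist M lam * e ∧ |θ - τ| ≤ R * e * τ ∧ |φ τ - ψ θ| ≤ R * e * τ := by
    intro n
    induction n with
    | zero =>
      intro hT
      rw [Nat.cast_zero] at hT
      refine ⟨0, 0, le_rfl, by simp, ⟨le_rfl, hT⟩, Or.inl (by simp), ?_, ?_, by simp, ?_⟩
      · rw [i1, sub_self, abs_zero]; positivity
      · rw [i2, sub_self, abs_zero]; positivity
      · rw [i3, sub_self, abs_zero]; simp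
    | succ n ih =>
      intro hT
      push_cast at hT ⊢
      obtain ⟨τ, θ, g1, g2, g3, g4, g5, g6, g7, g8⟩ := ih (by linarith)
      -- Once tracking has stopped, the old pair of times is kept.
      by_cases hend : T - θ < 2
      · exact ⟨τ, θ, g1, by linarith, g3, Or.inr hend, g5, g6, g7, g8⟩
      have hτn : τ = n := g4.resolve_right hend
      rw [not_lt] at hend
      obtain ⟨c1, c2, c3⟩ := close g1 g3.1 zero_le_one one_le_two (by linarith) (by linarith) g5 g6
      have hτT : τ + 1 ∈ Icc 0 T := ⟨by linarith, by linarith⟩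
      have hθT : θ + 1 ∈ Icc 0 T := ⟨by linarith [g3.1], by linarith⟩
      obtain ⟨s, s1, s2, s3, s4⟩ := h'.correct hF he hlam hsm (by linarith [g3.1]) (by linarith)
        (h.p_le _ hτT) (hlow _ hτT) c1 c2 (hk _ hτT) (hk' _ hθT)
      have s5 := abs_le.1 s2
      have hθs : θ + 1 + s ∈ Icc 0 T := ⟨by linarith [g3.1], by linarith⟩
      refine ⟨τ + 1, θ + 1 + s, by linarith, by linarith, hθs, Or.inl (by rw [hτn]), s3, s4, ?_, ?_⟩
      · have : |θ + 1 + s - (τ + 1)| ≤ |θ - τ| + |s| := by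
          rw [show θ + 1 + s - (τ + 1) = (θ - τ) + s by ring]; exact abs_add_le _ _
        have := mul_le_mul_of_nonneg_right hσR he
        linarith
      · have l3 := (h'.lipschitz hF hθT hθs).2.2
        rw [add_sub_cancel_left, add_zero] at l3
        have l4 : |ψ (θ + 1 + s) - ψ (θ + 1)| ≤ M * (σ * e) :=
          l3.trans (mul_le_mul_of_nonneg_left s1 hM0.le)
        have e1 : φ (τ + 1) - ψ (θ + 1 + s) = (φ τ - ψ θ) +
          ((φ (τ + 1) - ψ (θ + 1)) - (φ τ - ψ θ)) - (ψ (θ + 1 + s) - ψ (θ + 1)) := by ring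
        rw [e1]
        refine (abs_sub _ _).trans ((add_le_add ((abs_add_le _ _).trans (add_le_add g8 c3))
          l4).trans (le_of_eq ?_))
        rw [hR]; ring
  intro t ht
  have hT0 : 0 ≤ T := ht.1.trans ht.2
  have hn := Nat.floor_le ht.1
  have hn' := Nat.lt_floor_add_one t
  obtain ⟨τ, θ, g1, g2, g3, g4, g5, g6, g7, g8⟩ := track ⌊t⌋₊ (hn.trans ht.2)
  have hτt : τ ≤ t := g2.trans hn
  have hReT : R * e * τ ≤ R * e * T :=
    mul_le_mul_of_nonneg_left (hτt.trans ht.2) (by positivity)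
  have hτT : τ ∈ Icc 0 T := ⟨g1, hτt.trans ht.2⟩
  have hsh : shadowRate M lam * e * (1 + T) = C * e + (2 * M + 2) * (R * e * T) +
      (C * e * T + (2 * M + 2) * (R * e)) := by
    have : shadowRate M lam = C + (2 * M + 2) * R := rfl
    rw [this]; ring
  have hrest : 0 ≤ C * e * T + (2 * M + 2) * (R * e) := by positivity
  rw [hsh]
  have hReT0 : 0 ≤ R * e * T := by positivity
  -- the time for which both curves are followed
  suffices H : ∃ l, 0 ≤ l ∧ l ≤ 2 ∧ τ + l ≤ t ∧ θ + l ≤ T ∧ |θ + l - t| ≤ R * e * T ∧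
      |τ + l - t| ≤ R * e * T ∧ (τ + l = t ∨ (t - (τ + l)) + |θ + l - t| ≤ R * e * T) by
    obtain ⟨l, l0, l2, l3, l4, l5, l6, l7⟩ := H
    obtain ⟨c1, c2, c3⟩ := close g1 g3.1 l0 l2 (l3.trans ht.2) l4 g5 g6
    have hθl : θ + l ∈ Icc 0 T := ⟨by linarith [g3.1], l4⟩
    have hτl : τ + l ∈ Icc 0 T := ⟨by linarith, l3.trans ht.2⟩
    obtain ⟨v1, v2, v3⟩ := h'.lipschitz hF ht hθl
    obtain ⟨w1, w2, w3⟩ := h.lipschitz hF hτl ht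
    rw [add_zero] at v1 v2 v3
    have hv : M * |θ + l - t| ≤ M * (R * e * T) := mul_le_mul_of_nonneg_left l5 hM0.le
    have hw : (M + e) * |t - (τ + l)| ≤ (M + 1) * (R * e * T) := by
      rw [abs_sub_comm]
      exact mul_le_mul (by linarith) l6 (abs_nonneg _) (by linarith)
    have tri : ∀ A B A' B' : ℝ, |A' - B'| ≤ C * e → |B' - B| ≤ M * |θ + l - t| →
        |A - A'| ≤ (M + e) * |t - (τ + l)| → |A - B| ≤ C * e + (2 * M + 1) * (R * e * T) := by
      intro A B A' B' z1 z2 z3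
      rw [abs_le] at *
      constructor <;> linarith [z1.1, z1.2, z2.1, z2.2, z3.1, z3.2]
    refine ⟨(tri _ _ _ _ c1 v1 w1).trans ?_, (tri _ _ _ _ c2 v2 w2).trans ?_, ?_⟩
    · linarith
    · linarith
    · have z := abs_le.1 c3
      have z2 := abs_le.1 v3
      have z3 := abs_le.1 w3
      have z4 := abs_le.1 g8
      rw [abs_le]
      constructor <;> linarith [z.1, z.2, z2.1, z2.2, z3.1, z3.2, z4.1, z4.2]
  have hθτ := abs_le.1 (g7.trans hReT)
  have h2 : t - τ ≤ 2 ∨ T - θ < 2 := by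
    rcases g4 with g4 | g4
    · left; rw [g4]; linarith
    · right; exact g4
  -- Either both curves can be followed up to time `t` of the first, or the exact one reaches `T`
  -- before that; the time then left over is at most the accumulated clock shift.
  rcases le_total (t - τ) (T - θ) with hc | hc
  · refine ⟨t - τ, by linarith, ?_, by linarith, by linarith, ?_, ?_, Or.inl (by ring)⟩
    · rcases h2 with h2 | h2 <;> linarith
    · rw [show θ + (t - τ) - t = θ - τ by ring]; exact g7.trans hReT
    · rw [show τ + (t - τ) - t = 0 by ring, abs_zero]; exact hReT0
  · refine ⟨T - θ, by linarith [g3.2], ?_, by linarith, by linarith, ?_, ?_, Or.inr ?_⟩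
    · rcases h2 with h2 | h2 <;> linarith
    · rw [show θ + (T - θ) - t = T - t by ring, abs_of_nonneg (by linarith [ht.2])]
      linarith [hθτ.2]
    · rw [abs_of_nonpos (by linarith)]
      linarith [hθτ.2, ht.2]
    · rw [show θ + (T - θ) - t = T - t by ring, abs_of_nonneg (by linarith [ht.2])]
      linarith [hθτ.2]

end


/-! ### The slow motion does not stop -/

section Barrier
variable {g g' : ℝ → ℝ} {M δ : ℝ}

theorem le_deriv_of_le {X₁ h : ℝ} (hg : HasDerivAt g (g' X₁) X₁) (hh : 0 < h) (h0 : g X₁ = 0)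
    (hle : ∀ X ∈ Icc X₁ (X₁ + h), δ * (X - X₁) ≤ g X) : δ ≤ g' X₁ := by
  have h1 := (hasDerivWithinAt_iff_tendsto_slope' (s := Ioi X₁) (by simp)).1
    (hg.hasDerivWithinAt (s := Ioi X₁))
  refine ge_of_tendsto h1 ?_
  filter_upwards [Ioo_mem_nhdsGT (show X₁ < X₁ + h by linarith)] with X hX
  rw [slope_def_field, h0, sub_zero, le_div_iff₀ (by linarith [hX.1])]
  exact hle X ⟨hX.1.le, hX.2.le⟩

theorem mul_le_sub_of_le_deriv {a b c : ℝ} (hab : a ≤ b)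
    (hg : ∀ X ∈ Icc a b, HasDerivAt g (g' X) X) (hc : ∀ X ∈ Icc a b, c ≤ g' X) :
    c * (b - a) ≤ g b - g a := by
  rcases eq_or_lt_of_le hab with he | hlt
  · rw [he]; simp
  obtain ⟨ξ, hξ, he⟩ := exists_hasDerivAt_eq_slope g g' hlt
    (fun X hX => (hg X hX).continuousAt.continuousWithinAt) (fun X hX => hg X ⟨hX.1.le, hX.2.le⟩)
  rw [eq_div_iff (by linarith)] at he
  rw [← he]
  exact mul_le_mul_of_nonneg_right (hc ξ ⟨hξ.1.le, hξ.2.le⟩) (by linarith)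

/-- At the turning point `g' ≥ δ`, hence `g' ≥ δ / 2` within distance `δ / (2 M)`. So `g` becomes
too negative at `X₁ - δ / (2 M)` for an admissible path to reach that point, and the path is either
near `X₁`, where `g'` is large, or well inside. -/
theorem left_barrier (hg : ∀ X, HasDerivAt g (g' X) X) (hM : 0 < M)
    (hlip : ∀ X Y, |g' X - g' Y| ≤ M * |X - Y|) (hδ : 0 < δ) {X₁ h T : ℝ} (hh : 0 < h)
    (h0 : g X₁ = 0) (hle : ∀ X ∈ Icc X₁ (X₁ + h), δ * (X - X₁) ≤ g X) {X : ℝ → ℝ}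
    (hX : ContinuousOn X (Icc 0 T)) (hX0 : X₁ ≤ X 0)
    (hlow : ∀ t ∈ Icc 0 T, -(δ * (δ / (2 * M)) / 4) ≤ g (X t)) :
    ∀ t ∈ Icc 0 T, X₁ + δ / (2 * M) ≤ X t ∨ δ / 2 ≤ g' (X t) := by
  have hd := le_deriv_of_le (hg X₁) hh h0 hle
  set κ := δ / (2 * M) with hκ
  have hκ0 : 0 < κ := by positivity
  have hMκ : M * κ = δ / 2 := by rw [hκ]; field_simp
  have hnear : ∀ Y, |Y - X₁| ≤ κ → δ / 2 ≤ g' Y := by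
    intro Y hY
    have h1 := (hlip Y X₁).trans (mul_le_mul_of_nonneg_left hY hM.le)
    have := (abs_le.1 h1).1
    linarith
  -- This is twice as negative as the path allows, which leaves room for the drift of the action.
  have hval : g (X₁ - κ) ≤ -(δ / 2 * κ) := by
    have := mul_le_sub_of_le_deriv (g := g) (g' := g') (c := δ / 2) (show X₁ - κ ≤ X₁ by linarith)
      (fun Y _ => hg Y) (fun Y hY => hnear Y (by rw [abs_le]; constructor <;> linarith [hY.1, hY.2]))
    rw [h0] at this
    linarith
  intro t ht
  have hgt : X₁ - κ < X t := by
    by_contra hcon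
    obtain ⟨s, hs, hse⟩ := intermediate_value_Icc' ht.1 (hX.mono (Icc_subset_Icc le_rfl ht.2))
      (show X₁ - κ ∈ Icc (X t) (X 0) from ⟨not_lt.1 hcon, by linarith⟩)
    have := hlow s ⟨hs.1, hs.2.trans ht.2⟩
    rw [hse] at this
    have : 0 < δ * κ := by positivity
    linarith
  rcases le_or_gt (X₁ + κ) (X t) with h1 | h1
  · exact Or.inl h1
  · exact Or.inr (hnear _ (by rw [abs_le]; constructor <;> linarith))

/-- The mirror image of `left_barrier` under `X ↦ -X`. -/
theorem right_barrier (hg : ∀ X, HasDerivAt g (g' X) X) (hM : 0 < M)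
    (hlip : ∀ X Y, |g' X - g' Y| ≤ M * |X - Y|) (hδ : 0 < δ) {X₁ h T : ℝ} (hh : 0 < h)
    (h0 : g X₁ = 0) (hle : ∀ X ∈ Icc (X₁ - h) X₁, δ * (X₁ - X) ≤ g X) {X : ℝ → ℝ}
    (hX : ContinuousOn X (Icc 0 T)) (hX0 : X 0 ≤ X₁)
    (hlow : ∀ t ∈ Icc 0 T, -(δ * (δ / (2 * M)) / 4) ≤ g (X t)) :
    ∀ t ∈ Icc 0 T, X t ≤ X₁ - δ / (2 * M) ∨ δ / 2 ≤ -g' (X t) := by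
  intro t ht
  have := left_barrier (g := fun X => g (-X)) (g' := fun X => -g' (-X)) (X₁ := -X₁) (h := h) (T := T)
    (X := fun t => -X t) (fun Y => by
      have := (hg (-Y)).comp Y (hasDerivAt_neg Y)
      rwa [mul_neg, mul_one] at this) hM (fun Y Z => by
      rw [← neg_sub', abs_neg]
      refine (hlip _ _).trans (le_of_eq ?_)
      rw [← neg_sub', abs_neg]) hδ hh (by simpa using h0) (fun Y hY => by
      have := hle (-Y) ⟨by linarith [hY.2], by linarith [hY.1]⟩
      refine le_trans (le_of_eq ?_) this
      ring) hX.neg (by simpa using hX0) (fun t ht => by simpa using hlow t ht) t ht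
  simp only [neg_neg] at this
  rcases this with h | h
  · left; linarith
  · right; exact h

/-- The margin in the estimate of the slow velocity. -/
def slowMargin (δ M : ℝ) : ℝ := δ * min (δ / (2 * M)) 1 / 4

theorem slowMargin_pos (hδ : 0 < δ) (hM : 0 < M) : 0 < slowMargin δ M := by
  unfold slowMargin; positivity

/-- Along an admissible path in a nondegenerate potential well the potential energy gap or its
derivative is bounded away from zero. -/
theorem gap_or_deriv (hg : ∀ X, HasDerivAt g (g' X) X) (hM : 0 < M)
    (hlip : ∀ X Y, |g' X - g' Y| ≤ M * |X - Y|) (hδ : 0 < δ) {T : ℝ} {X : ℝ → ℝ}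
    (hX : ContinuousOn X (Icc 0 T))
    (hcond : (∀ X, δ ≤ g X) ∨
      (∃ X₁, X₁ ≤ X 0 ∧ g X₁ = 0 ∧ ∀ X, X₁ ≤ X → δ * min (X - X₁) 1 ≤ g X) ∨
      (∃ X₁, X 0 ≤ X₁ ∧ g X₁ = 0 ∧ ∀ X, X ≤ X₁ → δ * min (X₁ - X) 1 ≤ g X) ∨
      (∃ X₁ X₂, X₁ < X₂ ∧ X₁ ≤ X 0 ∧ X 0 ≤ X₂ ∧ g X₁ = 0 ∧ g X₂ = 0 ∧
        ∀ X, X₁ ≤ X → X ≤ X₂ → δ * min (X - X₁) (X₂ - X) ≤ g X))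
    (hlow : ∀ t ∈ Icc 0 T, -slowMargin δ M ≤ g (X t)) :
    ∀ t ∈ Icc 0 T, slowMargin δ M ≤ g (X t) ∨ slowMargin δ M ≤ |g' (X t)| := by
  intro t ht
  set κ := δ / (2 * M) with hκ
  have hκ0 : 0 < κ := by positivity
  have hmin0 : 0 < min κ 1 := lt_min hκ0 one_pos
  have hS : slowMargin δ M = δ * min κ 1 / 4 := rfl
  have hp : 0 < δ * min κ 1 := by positivity
  have hle1 : δ * min κ 1 ≤ δ * 1 := mul_le_mul_of_nonneg_left (min_le_right _ _) hδ.le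
  have hle2 : δ * min κ 1 ≤ δ * κ := mul_le_mul_of_nonneg_left (min_le_left _ _) hδ.le
  have hlow' : ∀ t ∈ Icc 0 T, -(δ * κ / 4) ≤ g (X t) := fun t ht => by
    have := hlow t ht; rw [hS] at this; linarith
  have hder : ∀ {v : ℝ}, δ / 2 ≤ v → slowMargin δ M ≤ v := fun h => by rw [hS]; linarith
  have hbig : ∀ {v w : ℝ}, δ * w ≤ v → min κ 1 ≤ w → slowMargin δ M ≤ v := fun h hw => by
    have := mul_le_mul_of_nonneg_left hw hδ.le
    rw [hS]; linarith
  rcases hcond with h | ⟨X₁, h1, h2, h3⟩ | ⟨X₁, h1, h2, h3⟩ | ⟨X₁, X₂, h0, h1, h2, h3, h4, h5⟩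
  · left; rw [hS]; linarith [h (X t)]
  · rcases left_barrier hg hM hlip hδ one_pos h2 (fun Y hY => by
      have := h3 Y hY.1; rwa [min_eq_left (by linarith [hY.2])] at this) hX h1 hlow' t ht with h | h
    · exact Or.inl (hbig (h3 _ (by linarith)) (min_le_min_right 1 (by linarith)))
    · exact Or.inr ((hder h).trans (le_abs_self _))
  · rcases right_barrier hg hM hlip hδ one_pos h2 (fun Y hY => by
      have := h3 Y hY.2; rwa [min_eq_left (by linarith [hY.1])] at this) hX h1 hlow' t ht with h | h
    · exact Or.inl (hbig (h3 _ (by linarith)) (min_le_min_right 1 (by linarith)))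
    · exact Or.inr ((hder h).trans (neg_le_abs _))
  · rcases left_barrier hg hM hlip hδ (show 0 < (X₂ - X₁) / 2 by linarith) h3 (fun Y hY => by
      have := h5 Y hY.1 (by linarith [hY.2]); rwa [min_eq_left (by linarith [hY.2])] at this)
      hX h1 hlow' t ht with h | h
    · rcases right_barrier hg hM hlip hδ (show 0 < (X₂ - X₁) / 2 by linarith) h4 (fun Y hY => by
        have := h5 Y (by linarith [hY.1]) hY.2; rwa [min_eq_right (by linarith [hY.1])] at this)
        hX h2 hlow' t ht with h' | h'
      · refine Or.inl (hbig (h5 _ (by linarith) (by linarith)) (le_min ?_ ?_))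
        · exact (min_le_left _ _).trans (by linarith)
        · exact (min_le_left _ _).trans (by linarith)
      · exact Or.inr ((hder h').trans (neg_le_abs _))
    · exact Or.inr ((hder h).trans (le_abs_self _))

end Barrier

/-- On the interval of radius `2 e / c` the derivative keeps its sign and size `c / 2`, so `f`
changes by `e` on either side of `x` and takes the value zero. -/
theorem exists_root {f f' : ℝ → ℝ} {x c e M : ℝ} (hc : 0 < c) (he : 0 ≤ e)
    (hf : ∀ y, |y - x| ≤ 1 → HasDerivAt f (f' y) y)
    (hlip : ∀ y, |y - x| ≤ 1 → |f' y - f' x| ≤ M * |y - x|) (hM : 0 ≤ M) (hcf : c ≤ |f' x|)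
    (hx : |f x| ≤ e) (h1 : 2 * e / c ≤ 1) (h2 : M * (2 * e / c) ≤ c / 2) :
    ∃ y, f y = 0 ∧ |y - x| ≤ 2 * e / c := by
  wlog hpos : c ≤ f' x generalizing f f'
  · have hneg : c ≤ -f' x := by
      rcases le_abs.1 hcf with h | h
      · exact absurd h hpos
      · exact h
    obtain ⟨y, hy, hyx⟩ := this (f := fun y => -f y) (f' := fun y => -f' y)
      (fun y hy => (hf y hy).fun_neg) (fun y hy => by rw [← neg_sub', abs_neg]; exact hlip y hy)
      (by rwa [abs_neg]) (by rwa [abs_neg]) hneg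
    exact ⟨y, neg_eq_zero.1 hy, hyx⟩
  set r := 2 * e / c with hr
  have hr0 : 0 ≤ r := by positivity
  have hcr : c / 2 * r = e := by rw [hr]; field_simp
  have hin : ∀ {y}, |y - x| ≤ r → c / 2 ≤ f' y := fun {y} hy => by
    have h3 := (hlip y (hy.trans h1)).trans (mul_le_mul_of_nonneg_left hy hM)
    linarith [(abs_le.1 (h3.trans h2)).1]
  have hx' := abs_le.1 hx
  have g1 := mul_le_sub_of_le_deriv (g := f) (g' := f') (c := c / 2) (show x ≤ x + r by linarith)
    (fun y hy => hf y (by rw [abs_le]; constructor <;> linarith [hy.1, hy.2]))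
    (fun y hy => hin (by rw [abs_le]; constructor <;> linarith [hy.1, hy.2]))
  have g2 := mul_le_sub_of_le_deriv (g := f) (g' := f') (c := c / 2) (show x - r ≤ x by linarith)
    (fun y hy => hf y (by rw [abs_le]; constructor <;> linarith [hy.1, hy.2]))
    (fun y hy => hin (by rw [abs_le]; constructor <;> linarith [hy.1, hy.2]))
  rw [add_sub_cancel_left, hcr] at g1
  rw [sub_sub_cancel, hcr] at g2
  obtain ⟨y, hy, hye⟩ := intermediate_value_Icc (show x - r ≤ x + r by linarith)
    (f := f) (fun y hy => (hf y (by rw [abs_le]; constructor <;> linarith [hy.1, hy.2])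
      ).continuousAt.continuousWithinAt)
    (show (0 : ℝ) ∈ Icc (f (x - r)) (f (x + r)) from ⟨by linarith, by linarith⟩)
  exact ⟨y, hye, by rw [abs_le]; constructor <;> linarith [hy.1, hy.2]⟩


/-! ### The averaged Hamiltonian as a slow field -/

section
variable {d : ℝ → ℝ} {a c₀ D₀ D₁ : ℝ} {m k : ℕ} {L ρ B ε T : ℝ} {x y px py Φ : ℝ → ℝ}

/-- The derivative of the averaged Hamiltonian. -/
def kDer (d : ℝ → ℝ) (m : ℕ) (v : E5) (ε J p X : ℝ) : ℝ := pd v (iterate d m).Kmap (ε, J, 0, p, X)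

theorem hasDerivAt_K (hd : Profile d) (m : ℕ) {ε J p X : ℝ} (hJ : 0 < J) :
    HasDerivAt (fun J => (iterate d m).K ε J p X) (kDer d m vI ε J p X) J ∧
    HasDerivAt (fun p => (iterate d m).K ε J p X) (kDer d m vp ε J p X) p ∧
    HasDerivAt (fun X => (iterate d m).K ε J p X) (kDer d m vX ε J p X) X := by
  have h : DifferentiableAt ℝ (iterate d m).Kmap (ε, J, 0, p, X) :=
    ((pol_iterate hd m).2.contDiffAt hd hJ).differentiableAt (by simp)
  refine ⟨?_, ?_, ?_⟩
  · exact hasDerivAt_comp_curve (G := (iterate d m).Kmap) (c := fun s => (ε, s, 0, p, X)) (t := J) h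
      ((hasDerivAt_const _ _).prodMk ((hasDerivAt_id _).prodMk (hasDerivAt_const _ _)))
  · exact hasDerivAt_comp_curve (G := (iterate d m).Kmap) (c := fun s => (ε, J, 0, s, X)) (t := p) h
      ((hasDerivAt_const _ _).prodMk ((hasDerivAt_const _ _).prodMk ((hasDerivAt_const _ _).prodMk
        ((hasDerivAt_id _).prodMk (hasDerivAt_const _ _)))))
  · exact hasDerivAt_comp_curve (G := (iterate d m).Kmap) (c := fun s => (ε, J, 0, p, s)) (t := X) h
      ((hasDerivAt_const _ _).prodMk ((hasDerivAt_const _ _).prodMk ((hasDerivAt_const _ _).prodMk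
        ((hasDerivAt_const _ _).prodMk (hasDerivAt_id _)))))

/-- The chain rule for the averaged Hamiltonian with fixed action. -/
theorem hasDerivWithinAt_K (hd : Profile d) (m : ℕ) {ε J p' X' t : ℝ} (hJ : 0 < J) {A : Set ℝ}
    {p X : ℝ → ℝ} (hp : HasDerivWithinAt p p' A t) (hX : HasDerivWithinAt X X' A t) :
    HasDerivWithinAt (fun t => (iterate d m).K ε J (p t) (X t))
      (p' * kDer d m vp ε J (p t) (X t) + X' * kDer d m vX ε J (p t) (X t)) A t := by
  have h : DifferentiableAt ℝ (iterate d m).Kmap (ε, J, 0, p t, X t) :=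
    ((pol_iterate hd m).2.contDiffAt hd hJ).differentiableAt (by simp)
  have h2 := h.hasFDerivAt.comp_hasDerivWithinAt t ((hasDerivWithinAt_const t A ε).prodMk
    ((hasDerivWithinAt_const t A J).prodMk ((hasDerivWithinAt_const t A (0 : ℝ)).prodMk
      (hp.prodMk hX))))
  refine h2.congr_deriv ?_
  rw [fderiv_expand]
  simp [kDer]

/-- The Taylor bound follows by comparing the derivative along the segment between the two points
with its value at one end; the strip `|p| ≤ 4` is convex. -/
theorem Small.slowField (hS : Small d a c₀ D₀ D₁ m ρ B ε) {J : ℝ} (h1 : a / 4 ≤ J)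
    (h2 : J ≤ 3 * D₀) : SlowField ((iterate d m).K ε J) (kDer d m vI ε J) (kDer d m vp ε J)
      (kDer d m vX ε J) B := by
  have hB := hS.nf
  have hB0 := hB.pos
  have hJ : 0 < J := by linarith [hS.geom.a_pos]
  have hmem : ∀ {p X : ℝ}, |p| ≤ 4 → (ε, J, 0, p, X) ∈ Dom ρ := fun hp =>
    hS.mem_Dom h1 h2 (by rw [abs_zero]; exact Real.pi_pos.le) (by linarith)
  have lip : ∀ v ∈ dirs, ∀ p X p' X' : ℝ, |p| ≤ 4 → |p'| ≤ 4 →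
      |kDer d m v ε J p X - kDer d m v ε J p' X'| ≤ B * (|p - p'| + |X - X'|) := by
    intro v hv p X p' X' hp hp'
    refine (hB.K1_lip v hv _ (hmem hp) _ (hmem hp')).trans (mul_le_mul_of_nonneg_left ?_ hB0.le)
    simp
  refine ⟨hB.one_le, fun p X hp => hB.K1 vI (by simp) _ (hmem hp),
    fun p X hp => hB.K1 vp (by simp) _ (hmem hp), fun p X hp => hB.K1 vX (by simp) _ (hmem hp),
    lip vI (by simp), lip vp (by simp), lip vX (by simp), fun p X p' X' hp hp' => ?_⟩
  have hpath : ∀ s ∈ Icc (0 : ℝ) 1, |p' + s * (p - p')| ≤ 4 := by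
    intro s hs
    have g1 := abs_le.1 hp
    have g2 := abs_le.1 hp'
    rw [abs_le]
    constructor <;> nlinarith [hs.1, hs.2]
  have hderiv : ∀ s : ℝ, HasDerivWithinAt
      (fun s => (iterate d m).K ε J (p' + s * (p - p')) (X' + s * (X - X')))
      ((p - p') * kDer d m vp ε J (p' + s * (p - p')) (X' + s * (X - X')) +
        (X - X') * kDer d m vX ε J (p' + s * (p - p')) (X' + s * (X - X'))) (Ici s) s := by
    intro s
    exact hasDerivWithinAt_K hS.geom.prof m hJ
      ((((hasDerivWithinAt_id s _).mul_const (p - p')).const_add p').congr_deriv (one_mul _))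
      ((((hasDerivWithinAt_id s _).mul_const (X - X')).const_add X').congr_deriv (one_mul _))
  have hcont : ContinuousOn (fun s => (iterate d m).K ε J (p' + s * (p - p')) (X' + s * (X - X')))
      (Icc 0 1) := by
    intro s _
    refine ContinuousAt.continuousWithinAt ?_
    exact (ContinuousAt.comp (f := fun s : ℝ => ((ε, J, 0, p' + s * (p - p'), X' + s * (X - X')) : E5))
      (g := (iterate d m).Kmap) (((pol_iterate hS.geom.prof m).2.contDiffAt hS.geom.prof
        hJ).continuousAt) (by fun_prop))
  have h0 : 0 ≤ |p - p'| + |X - X'| := by positivity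
  have key := abs_sub_sub_mul_le (c := (p - p') * kDer d m vp ε J p X + (X - X') * kDer d m vX ε J p X)
    (K := B * (|p - p'| + |X - X'|) ^ 2) zero_le_one hcont (fun s _ => hderiv s) (fun s hs => by
      have l1 := lip vp (by simp) _ (X' + s * (X - X')) p X (hpath s ⟨hs.1, hs.2.le⟩) hp
      have l2 := lip vX (by simp) _ (X' + s * (X - X')) p X (hpath s ⟨hs.1, hs.2.le⟩) hp
      have d1 : |p' + s * (p - p') - p| ≤ |p - p'| := by
        rw [show p' + s * (p - p') - p = (s - 1) * (p - p') by ring, abs_mul]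
        refine mul_le_of_le_one_left (abs_nonneg _) ?_
        rw [abs_le]; constructor <;> linarith [hs.1, hs.2]
      have d2 : |X' + s * (X - X') - X| ≤ |X - X'| := by
        rw [show X' + s * (X - X') - X = (s - 1) * (X - X') by ring, abs_mul]
        refine mul_le_of_le_one_left (abs_nonneg _) ?_
        rw [abs_le]; constructor <;> linarith [hs.1, hs.2]
      have l3 := mul_le_mul_of_nonneg_left (add_le_add d1 d2) hB0.le
      rw [show ∀ A A' C C' : ℝ, (p - p') * A + (X - X') * C - ((p - p') * A' + (X - X') * C') =
        (p - p') * (A - A') + (X - X') * (C - C') by intros; ring]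
      refine (abs_add_le _ _).trans ?_
      rw [abs_mul, abs_mul]
      have m1 := mul_le_mul_of_nonneg_left (l1.trans l3) (abs_nonneg (p - p'))
      have m2 := mul_le_mul_of_nonneg_left (l2.trans l3) (abs_nonneg (X - X'))
      refine (add_le_add m1 m2).trans (le_of_eq ?_)
      ring)
  simp only [sub_zero, one_mul, mul_one, zero_mul, add_zero, add_sub_cancel] at key
  rw [mul_comm (kDer d m vp ε J p X), mul_comm (kDer d m vX ε J p X)]
  exact key

theorem K_zero (ε J p X : ℝ) : (iterate d 0).K ε J p X = p ^ 2 - gap d J X := by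
  simp only [iterate, gap]; ring

theorem hasDerivAt_gap (hd : Profile d) (ε p : ℝ) {J X : ℝ} (hJ : 0 < J) :
    HasDerivAt (gap d J) (-kDer d 0 vX ε J p X) X := by
  have h := (hasDerivAt_K (ε := ε) (p := p) (X := X) hd 0 hJ).2.2
  simp only [K_zero] at h
  have h2 := h.const_sub (p ^ 2)
  simpa using h2

theorem kDer_zero_p (hd : Profile d) (ε p : ℝ) {J X : ℝ} (hJ : 0 < J) : kDer d 0 vp ε J p X = 2 * p := by
  have h := (hasDerivAt_K (ε := ε) (p := p) (X := X) hd 0 hJ).2.1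
  simp only [K_zero] at h
  have h2 : HasDerivAt (fun p : ℝ => p ^ 2 - gap d J X) (2 * p) p := by
    simpa using (hasDerivAt_pow 2 p).sub_const (gap d J X)
  exact h.unique h2

/-- Lower bounds for the velocities of the slow motion. -/
def speedMin (δ B₀ : ℝ) : ℝ := min (slowMargin δ B₀) 1 / 4

/-- The smallness of `ε` used for the slow motion. -/
structure Slow (d : ℝ → ℝ) (a c₀ D₀ D₁ : ℝ) (m k : ℕ) (L ρ B B₀ δ ε : ℝ) : Prop where
  tame : Tame d a c₀ D₀ D₁ m k L ρ B ε
  nf₀ : NFBound d 0 ρ B₀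
  δ_pos : 0 < δ
  -- `t1` lets the initial action replace the current one in the gap; `t2` lets `𝓗₀` with the
  -- initial action replace `K` with `J` in the velocity bounds; `t3` is the smallness for
  -- shadowing; `t4` and `t5` are those for `exists_root`; `t6` keeps the energy below one.
  t1 : B₀ * (2 * B + driftRate a c₀ D₀ D₁ B L) * ε ≤ slowMargin δ B₀
  t2 : (2 * B₀ * B + B + slowRate a c₀ D₀ D₁ B L) * ε ≤ speedMin δ B₀
  t3 : errorFactor B (1 / speedMin δ B₀ ^ 2) * slowRate a c₀ D₀ D₁ B L * ε ≤ 1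
  t4 : 2 * slowRate a c₀ D₀ D₁ B L / speedMin δ B₀ * ε ≤ 1
  t5 : B * (2 * slowRate a c₀ D₀ D₁ B L / speedMin δ B₀) * ε ≤ speedMin δ B₀ / 2
  t6 : slowRate a c₀ D₀ D₁ B L * ε ≤ 1

variable {B₀ δ : ℝ}

theorem speedMin_pos (hδ : 0 < δ) (hB : 0 < B₀) : 0 < speedMin δ B₀ := by
  have := slowMargin_pos hδ hB
  unfold speedMin; positivity

theorem Tame.slowRate_pos (hS : Tame d a c₀ D₀ D₁ m k L ρ B ε) : 0 < slowRate a c₀ D₀ D₁ B L := by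
  have := hS.driftRate_pos
  have := hS.small.nf.pos
  unfold slowRate; positivity

theorem Tame.action_close (hS : Tame d a c₀ D₀ D₁ m k L ρ B ε) (hr : IsRay d ε T x y px py)
    (hT0 : 0 ≤ T) (hT : ε ^ k * T ≤ L) (h0 : a ≤ action d ε (x 0) (py 0)) {t : ℝ}
    (ht : t ∈ Icc 0 T) : |action d ε (x t) (py t) - action d ε (x 0) (py 0)| ≤
      (2 * B + driftRate a c₀ D₀ D₁ B L) * ε := by
  have h0T : (0 : ℝ) ∈ Icc 0 T := ⟨le_rfl, hT0⟩
  have g0 := hS.goodState hr hT0 hT h0 h0T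
  have gt := hS.goodState hr hT0 hT h0 ht
  have ha := hS.small.geom.a_pos
  obtain ⟨J₀, p₀, hJ₀⟩ := hS.small.exists_imageAt (X := ε * x 0) (by linarith [g0.act_ge]) g0.act_le
    g0.phase_le g0.mom_le
  obtain ⟨J, p, hJ⟩ := hS.small.exists_imageAt (X := ε * x t) (by linarith [gt.act_ge]) gt.act_le
    gt.phase_le gt.mom_le
  have h1 := (hS.image_at hr hT0 hT h0 ht).2 _ _ _ _ hJ₀ hJ
  have h2 := hJ₀.act_le
  have h3 := hJ.act_le
  have h4 : driftRate a c₀ D₀ D₁ B L * ε ^ (m + 1) ≤ driftRate a c₀ D₀ D₁ B L * ε :=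
    mul_le_mul_of_nonneg_left (by simpa using hS.small.pow_le (i := 1) (j := m + 1) (by omega))
      hS.driftRate_pos.le
  rw [abs_le] at *
  constructor <;> linarith [h1.1, h1.2, h2.1, h2.2, h3.1, h3.2]

/-- The slow motion does not stop. -/
theorem Slow.speed (hS : Slow d a c₀ D₀ D₁ m k L ρ B B₀ δ ε) (hr : IsRay d ε T x y px py)
    (hT0 : 0 ≤ T) (hT : ε ^ k * T ≤ L) (h0 : a ≤ action d ε (x 0) (py 0))
    (hslow : SlowCondition d δ (action d ε (x 0) (py 0)) (ε * x 0)) {J : ℝ}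
    (h1 : a / 2 ≤ J) (h2 : J ≤ 2 * D₀) (hJ : |J - action d ε (x 0) (py 0)| ≤ ε * B)
    {I P q : ℝ → ℝ}
    (hq : SlowCurve d m ρ ε T (slowRate a c₀ D₀ D₁ B L * ε ^ (m + 1)) J I P Φ x q) :
    ∀ t ∈ Icc 0 T, speedMin δ B₀ ≤ |kDer d m vp ε J (q t) (slowX d m ε J Φ q x t)| ∨
      speedMin δ B₀ ≤ |kDer d m vX ε J (q t) (slowX d m ε J Φ q x t)| := by
  have hs := hS.tame.small
  have hG := hs.geom
  have hd := hG.prof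
  have hε := hs.ε_pos
  have ha := hG.a_pos
  have hB0 := hS.nf₀.pos
  have hBp := hs.nf.pos
  have hD0 := hG.D₀_pos
  have h0T : (0 : ℝ) ∈ Icc 0 T := ⟨le_rfl, hT0⟩
  set I₀ := action d ε (x 0) (py 0) with hI0
  have g0 := hS.tame.goodState hr hT0 hT h0 h0T
  have hI0p : 0 < I₀ := by linarith
  have hJp : 0 < J := by linarith
  have hmem : ∀ {K p X : ℝ}, a / 4 ≤ K → K ≤ 3 * D₀ → |p| ≤ 8 → (ε, K, 0, p, X) ∈ Dom ρ :=
    fun h h' hp => hs.mem_Dom h h' (by rw [abs_zero]; exact Real.pi_pos.le) hp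
  have hgap : ∀ K X K' X' : ℝ, a / 4 ≤ K → K ≤ 3 * D₀ → a / 4 ≤ K' → K' ≤ 3 * D₀ →
      |gap d K X - gap d K' X'| ≤ B₀ * (|K - K'| + |X - X'|) := by
    intro K X K' X' k1 k2 k3 k4
    have hz : |(0 : ℝ)| ≤ 8 := by simp
    have := hS.nf₀.K_lip _ (hmem (X := X) k1 k2 hz) _ (hmem (X := X') k3 k4 hz)
    change |(iterate d 0).K ε K 0 X - (iterate d 0).K ε K' 0 X'| ≤ _ at this
    rw [K_zero, K_zero, abs_sub_comm] at this
    have e : gap d K X - gap d K' X' = 0 ^ 2 - gap d K' X' - (0 ^ 2 - gap d K X) := by ring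
    rw [e]
    refine this.trans (mul_le_mul_of_nonneg_left ?_ hB0.le)
    simp
  have hgap' : ∀ K X K' X' : ℝ, a / 4 ≤ K → K ≤ 3 * D₀ → a / 4 ≤ K' → K' ≤ 3 * D₀ →
      |(-kDer d 0 vX ε K 0 X) - (-kDer d 0 vX ε K' 0 X')| ≤ B₀ * (|K - K'| + |X - X'|) := by
    intro K X K' X' k1 k2 k3 k4
    have hz : |(0 : ℝ)| ≤ 8 := by simp
    have := hS.nf₀.K1_lip vX (by simp) _ (hmem (X := X) k1 k2 hz) _ (hmem (X := X') k3 k4 hz)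
    rw [← neg_sub', abs_neg]
    refine this.trans (mul_le_mul_of_nonneg_left ?_ hB0.le)
    simp
  have hI0r : a / 4 ≤ I₀ ∧ I₀ ≤ 3 * D₀ := ⟨by linarith, by linarith [g0.act_le]⟩
  -- The gap is nonnegative for the action at time `t`; passing to the initial action costs a
  -- multiple of `ε`.
  have hlow : ∀ t ∈ Icc 0 T, -slowMargin δ B₀ ≤ gap d I₀ (ε * x t) := by
    intro t ht
    have gt := hS.tame.goodState hr hT0 hT h0 ht
    have e1 := hgap I₀ (ε * x t) (action d ε (x t) (py t)) (ε * x t) hI0r.1 hI0r.2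
      (by linarith [gt.act_ge]) (by linarith [gt.act_le])
    rw [sub_self, abs_zero, add_zero, abs_sub_comm I₀] at e1
    have e2 := e1.trans (mul_le_mul_of_nonneg_left (hS.tame.action_close hr hT0 hT h0 ht) hB0.le)
    rw [← mul_assoc] at e2
    have e3 := (abs_le.1 (e2.trans hS.t1)).1
    linarith [gt.gap_nonneg]
  have hmain := gap_or_deriv (g := gap d I₀) (g' := fun X => -kDer d 0 vX ε I₀ 0 X) (M := B₀)
    (X := fun t => ε * x t) (fun X => hasDerivAt_gap hd ε 0 hI0p) hB0 (fun X Y => by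
      have := hgap' I₀ X I₀ Y hI0r.1 hI0r.2 hI0r.1 hI0r.2
      rwa [sub_self, abs_zero, zero_add] at this) hS.δ_pos
    ((hr.continuousOn_x hT0).const_smul ε) hslow hlow
  intro t ht
  set Y := slowX d m ε J Φ q x t with hY
  have hYx : |Y - ε * x t| ≤ ε * B := by
    rw [hY, slowX, add_sub_cancel_left, abs_mul, abs_of_nonneg (sq_nonneg ε)]
    have := mul_le_mul_of_nonneg_left (hs.nf.S1 vp (by simp) _ (hq.mem t ht)) (sq_nonneg ε)
    refine this.trans ?_
    have : ε ^ 2 ≤ ε := by have := hs.pow_le (i := 1) (j := 2) (by omega); simpa using this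
    exact mul_le_mul_of_nonneg_right this hBp.le
  have hJr : a / 4 ≤ J ∧ J ≤ 3 * D₀ := ⟨by linarith, by linarith⟩
  have hsum : B₀ * (|J - I₀| + |Y - ε * x t|) ≤ 2 * B₀ * B * ε := by
    have := mul_le_mul_of_nonneg_left (add_le_add hJ hYx) hB0.le
    linarith
  have d1 := abs_le.1 ((hgap J Y I₀ (ε * x t) hJr.1 hJr.2 hI0r.1 hI0r.2).trans hsum)
  have d2 := abs_le.1 ((hgap' J Y I₀ (ε * x t) hJr.1 hJr.2 hI0r.1 hI0r.2).trans hsum)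
  have hq8 : |q t| ≤ 8 := by linarith [hq.q_le t ht]
  have hm := hmem (X := Y) hJr.1 hJr.2 hq8
  have hlev := abs_le.1 (hq.level t ht)
  have hk0 := abs_le.1 (hs.nf.K_sub _ hm hε.le)
  have hkp := abs_le.1 (hs.nf.K1_sub vp (by simp) rfl _ hm hε.le)
  have hkX := abs_le.1 (hs.nf.K1_sub vX (by simp) rfl _ hm hε.le)
  change -(B * ε) ≤ (iterate d m).Kmap (ε, J, 0, q t, Y) - (iterate d 0).K ε J (q t) Y ∧
    (iterate d m).Kmap (ε, J, 0, q t, Y) - (iterate d 0).K ε J (q t) Y ≤ B * ε at hk0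
  change -(B * ε) ≤ kDer d m vp ε J (q t) Y - kDer d 0 vp ε J (q t) Y ∧
    kDer d m vp ε J (q t) Y - kDer d 0 vp ε J (q t) Y ≤ B * ε at hkp
  change -(B * ε) ≤ kDer d m vX ε J (q t) Y - kDer d 0 vX ε J (q t) Y ∧
    kDer d m vX ε J (q t) Y - kDer d 0 vX ε J (q t) Y ≤ B * ε at hkX
  rw [K_zero] at hk0
  rw [kDer_zero_p hd ε _ hJp] at hkp
  -- In `𝓗₀ = p² - gap` the force does not depend on the momentum.
  have hX0 : kDer d 0 vX ε J (q t) Y = kDer d 0 vX ε J 0 Y := by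
    have := (hasDerivAt_gap hd ε (q t) (X := Y) hJp).unique (hasDerivAt_gap hd ε 0 hJp)
    linarith
  rw [hX0] at hkX
  have hpow : slowRate a c₀ D₀ D₁ B L * ε ^ (m + 1) ≤ slowRate a c₀ D₀ D₁ B L * ε :=
    mul_le_mul_of_nonneg_left (by simpa using hs.pow_le (i := 1) (j := m + 1) (by omega))
      hS.tame.slowRate_pos.le
  have ht2 := hS.t2
  set κ := min (slowMargin δ B₀) 1 with hκ
  have hκ0 : 0 < κ := lt_min (slowMargin_pos hS.δ_pos hB0) one_pos
  have hκ1 : κ ≤ 1 := min_le_right _ _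
  have hκ2 : κ ≤ slowMargin δ B₀ := min_le_left _ _
  have hsp : speedMin δ B₀ = κ / 4 := rfl
  rw [hsp] at ht2 ⊢
  have hsl0 := mul_pos hS.tame.slowRate_pos hε
  have hBε := mul_pos hBp hε
  have hBBε : 0 < 2 * B₀ * B * ε := by positivity
  -- Near the zero level `q²` is close to the gap, so a large gap gives a large velocity; otherwise
  -- the force is large.
  rcases hmain t ht with h | h
  · left
    have hq2 : κ / 4 ≤ q t ^ 2 := by
      linarith [hk0.1, hk0.2, hlev.1, hlev.2, d1.1]
    have hq3 : κ / 2 ≤ |q t| := by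
      refine abs_le_of_sq_le_sq' ?_ (abs_nonneg _) |>.2
      rw [sq_abs]; nlinarith
    have : |2 * q t| - |kDer d m vp ε J (q t) Y - 2 * q t| ≤ |kDer d m vp ε J (q t) Y| := by
      have := abs_sub_abs_le_abs_sub (2 * q t) (2 * q t - kDer d m vp ε J (q t) Y)
      rw [sub_sub_cancel, abs_sub_comm (2 * q t)] at this
      linarith
    have h5 : |kDer d m vp ε J (q t) Y - 2 * q t| ≤ B * ε := abs_le.2 hkp
    rw [abs_mul, abs_two] at this
    linarith
  · right
    have h5 : |kDer d m vX ε J (q t) Y - (kDer d 0 vX ε I₀ 0 (ε * x t))| ≤ B * ε + 2 * B₀ * B * ε := by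
      rw [abs_le]
      constructor <;> linarith [hkX.1, hkX.2, d2.1, d2.2]
    have := abs_sub_abs_le_abs_sub (kDer d 0 vX ε I₀ 0 (ε * x t)) (kDer d m vX ε J (q t) Y)
    rw [abs_sub_comm] at this
    simp only [abs_neg] at h
    linarith

/-- Near the slow curve there is a point on the zero level of the averaged Hamiltonian. -/
theorem Slow.exists_level (hS : Slow d a c₀ D₀ D₁ m k L ρ B B₀ δ ε) {J : ℝ} (h1 : a / 4 ≤ J)
    (h2 : J ≤ 3 * D₀) {p X : ℝ} (hp : |p| ≤ 3)
    (hk : |(iterate d m).K ε J p X| ≤ slowRate a c₀ D₀ D₁ B L * ε ^ (m + 1))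
    (hsp : speedMin δ B₀ ≤ |kDer d m vp ε J p X| ∨ speedMin δ B₀ ≤ |kDer d m vX ε J p X|) :
    ∃ p' X', (iterate d m).K ε J p' X' = 0 ∧
      |p - p'| ≤ 2 * slowRate a c₀ D₀ D₁ B L / speedMin δ B₀ * ε ^ (m + 1) ∧
      |X - X'| ≤ 2 * slowRate a c₀ D₀ D₁ B L / speedMin δ B₀ * ε ^ (m + 1) := by
  have hs := hS.tame.small
  have hd := hs.geom.prof
  have hε := hs.ε_pos
  have hB := hs.nf.pos
  have hJ : 0 < J := by linarith [hs.geom.a_pos]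
  have hc := speedMin_pos hS.δ_pos hS.nf₀.pos
  have hR := hS.tame.slowRate_pos
  have hF := hs.slowField h1 h2
  have hp4 : |p| ≤ 4 := by linarith
  set c := speedMin δ B₀
  set R := slowRate a c₀ D₀ D₁ B L
  have hpow : ε ^ (m + 1) ≤ ε := by simpa using hs.pow_le (i := 1) (j := m + 1) (by omega)
  have e1 : 2 * (R * ε ^ (m + 1)) / c = 2 * R / c * ε ^ (m + 1) := by ring
  have hle : 2 * R / c * ε ^ (m + 1) ≤ 2 * R / c * ε := mul_le_mul_of_nonneg_left hpow (by positivity)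
  have g1 : 2 * (R * ε ^ (m + 1)) / c ≤ 1 := by rw [e1]; exact hle.trans hS.t4
  have g2 : B * (2 * (R * ε ^ (m + 1)) / c) ≤ c / 2 := by
    rw [e1]
    refine (mul_le_mul_of_nonneg_left hle hB.le).trans ?_
    rw [← mul_assoc]; exact hS.t5
  have hη : 0 ≤ R * ε ^ (m + 1) := by positivity
  have hη' : 0 ≤ 2 * R / c * ε ^ (m + 1) := by positivity
  -- Only the variable in which `K` has a large derivative is moved; the other one is kept.
  rcases hsp with h | h
  · obtain ⟨p', hp', hpp⟩ := exists_root (f := fun p => (iterate d m).K ε J p X)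
      (f' := fun p => kDer d m vp ε J p X) (x := p) (M := B) hc hη
      (fun p' _ => (hasDerivAt_K hd m hJ).2.1) (fun p' h' => by
        have := hF.lip_p p' X p X (by
          have := abs_le.1 hp; have := abs_le.1 h'; rw [abs_le]; constructor <;> linarith) hp4
        rwa [sub_self, abs_zero, add_zero] at this) hB.le h hk g1 g2
    rw [e1] at hpp
    exact ⟨p', X, hp', by rwa [abs_sub_comm], by rwa [sub_self, abs_zero]⟩
  · obtain ⟨X', hX', hXX⟩ := exists_root (f := fun X => (iterate d m).K ε J p X)
      (f' := fun X => kDer d m vX ε J p X) (x := X) (M := B) hc hη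
      (fun p' _ => (hasDerivAt_K hd m hJ).2.2) (fun X' h' => by
        have := hF.lip_X p X' p X hp4 hp4
        rwa [sub_self, abs_zero, zero_add] at this) hB.le h hk g1 g2
    rw [e1] at hXX
    exact ⟨p, X', hX', by rwa [sub_self, abs_zero], by rwa [abs_sub_comm]⟩

theorem exists_slow (G : Geom d a c₀ D₀ D₁) (m k : ℕ) {L δ : ℝ} (hL : 0 < L) (hδ : 0 < δ) :
    ∃ B B₀, 0 < B ∧ 0 < B₀ ∧ ∀ᶠ ε : ℝ in 𝓝[>] 0, Slow d a c₀ D₀ D₁ m k L (radius a D₀) B B₀ δ ε := by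
  obtain ⟨B, hB⟩ := exists_tame G m k hL
  obtain ⟨B₀, hB₀⟩ := (eventually_NFBound G.prof 0 G.radius_pos).exists
  have hB0 := hB₀.pos
  have hc := speedMin_pos hδ hB0
  have hBpos : 0 < B := by
    obtain ⟨ε, hε⟩ := hB.exists
    exact hε.small.nf.pos
  refine ⟨B, B₀, hBpos, hB0, ?_⟩
  filter_upwards [hB, eventually_mul_le _ (slowMargin_pos hδ hB0), eventually_mul_le _ hc,
    eventually_mul_le _ one_pos, eventually_mul_le _ one_pos, eventually_mul_le _ (half_pos hc),
    eventually_mul_le _ one_pos] with ε h0 h1 h2 h3 h4 h5 h6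
  exact ⟨h0, hB₀, hδ, h1, h2, h3, h4, h5, h6⟩

end


/-! ### Comparison of the ray with the averaged motion -/

section
variable {d : ℝ → ℝ} {a c₀ D₀ D₁ : ℝ} {m k : ℕ} {L ρ B B₀ δ ε T : ℝ} {x y px py Φ : ℝ → ℝ}
  {w v : ℝ → Point}

/-- The improved variables `w` along the ray, compared with the slow curve. -/
structure Companion (d : ℝ → ℝ) (m : ℕ) (ε T : ℝ) (Φ x : ℝ → ℝ) (I q : ℝ → ℝ) (w : ℝ → Point) (η : ℝ) :
    Prop where
  init_p : q 0 = (w 0).p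
  init_X : slowX d m ε (w 0).I Φ q x 0 = ε * (w 0).x
  init_φ : slowPhase d m ε (w 0).I Φ q x 0 = (w 0).φ
  drift : ∀ t ∈ Icc 0 T, |(w t).I - (w 0).I| ≤ η
  close_p : ∀ t ∈ Icc 0 T, |(w t).p - q t| ≤ η
  close_φ : ∀ t ∈ Icc 0 T, |(w t).φ - slowPhase d m ε (w 0).I Φ q x t| ≤ η
  close_X : ∀ t ∈ Icc 0 T, |ε * (w t).x - slowX d m ε (w 0).I Φ q x t| ≤ η
  act : ∀ t ∈ Icc 0 T, |I t - ((w 0).I + ε * pd vu (iterate d m).Smap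
    (ε, (w 0).I, sawtooth (Φ t), (w t).p, ε * x t))| ≤ 2 * η

/-- The actual image uses the improved action at time `t`, the slow curve the one at time `0`. These
differ by the conserved drift, and the Lipschitz dependence of the change of variables turns this
into equally small differences of the other variables. -/
theorem Tame.exists_companion (hS : Tame d a c₀ D₀ D₁ m k L ρ B ε) (hr : IsRay d ε T x y px py)
    (hT0 : 0 ≤ T) (hT : ε ^ k * T ≤ L) (h0 : a ≤ action d ε (x 0) (py 0))
    (hΦ : IsPhaseLift d ε T x y py Φ)
    (hw : ∀ t ∈ Icc 0 T, IsImage d (m + 1) ε a (rayPoint d ε x px py Φ t) (w t)) :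
    a / 2 ≤ (w 0).I ∧ (w 0).I ≤ 2 * D₀ ∧ |(w 0).I - action d ε (x 0) (py 0)| ≤ ε * B ∧
    ∃ q, SlowCurve d m ρ ε T (slowRate a c₀ D₀ D₁ B L * ε ^ (m + 1)) (w 0).I
      (fun t => action d ε (x t) (py t)) (fun t => pHat d ε (x t) (y t) (px t) (py t)) Φ x q ∧
      Companion d m ε T Φ x (fun t => action d ε (x t) (py t)) q w
        (driftRate a c₀ D₀ D₁ B L * ε ^ (m + 1)) := by
  have hs := hS.small
  have hB := hs.nf
  have hB0 := hB.pos
  have hε := hs.ε_pos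
  have hε1 := hs.ε_le
  have ha := hs.geom.a_pos
  have h0T : (0 : ℝ) ∈ Icc 0 T := ⟨le_rfl, hT0⟩
  have hgood := fun t ht => hS.goodState hr hT0 hT h0 (t := t) ht
  have hsaw := fun t ht => hS.sawtooth_phase hr hT0 hT h0 hΦ (t := t) ht
  have g0 := hgood 0 h0T
  have haD : a ≤ D₀ := h0.trans g0.act_le
  have him : ∀ t ∈ Icc 0 T, ImageAt d m ρ B ε (action d ε (x t) (py t)) (sawtooth (Φ t))
      (pHat d ε (x t) (y t) (px t) (py t)) (ε * x t) (w t).I (w t).p ∧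
      (w t).φ = Φ t + ε * pd vI (iterate d m).Smap (ε, (w t).I, sawtooth (Φ t), (w t).p, ε * x t) ∧
      (w t).x = x t + ε * pd vp (iterate d m).Smap (ε, (w t).I, sawtooth (Φ t), (w t).p, ε * x t) := by
    intro t ht
    have g := hgood t ht
    have h := hw t ht
    rw [rayPoint_eq (hsaw t ht)] at h
    exact (hs.isImage_iff haD g.act_ge g.act_le g.mom_le).1 h
  have him0 := (him 0 h0T).1
  have hact0 := him0.act_le
  obtain ⟨hJl, hJu⟩ : a / 2 ≤ (w 0).I ∧ (w 0).I ≤ 2 * D₀ := by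
    have h1 := abs_le.1 hact0
    have h2 := hs.s2
    constructor
    · linarith [h1.1]
    · linarith [h1.2, g0.act_le]
  refine ⟨hJl, hJu, hact0, ?_⟩
  have him0' := him0
  rw [hsaw 0 h0T] at him0'
  obtain ⟨q, hq⟩ := hS.exists_slowCurve hr hT0 hT h0 hΦ him0'
  refine ⟨q, hq, ?_⟩
  -- All differences are bounded by the drift itself rather than by its a priori bound; at `t = 0`
  -- the drift is zero, so the initial values agree exactly, as shadowing requires.
  have key : ∀ t ∈ Icc 0 T, |(w t).p - q t| ≤ |(w t).I - (w 0).I| ∧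
      |(w t).φ - slowPhase d m ε (w 0).I Φ q x t| ≤ |(w t).I - (w 0).I| ∧
      |ε * (w t).x - slowX d m ε (w 0).I Φ q x t| ≤ |(w t).I - (w 0).I| ∧
      |action d ε (x t) (py t) - ((w 0).I + ε * pd vu (iterate d m).Smap
        (ε, (w 0).I, sawtooth (Φ t), (w t).p, ε * x t))| ≤ 2 * |(w t).I - (w 0).I| := by
    intro t ht
    obtain ⟨h', e1, e2⟩ := him t ht
    have hg := hgood t ht
    have hp' : |(w t).p| ≤ 8 := by
      have := abs_le.1 hg.mom_le
      have := abs_le.1 h'.mom_le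
      have : ε ^ 2 * B ≤ 1 := by nlinarith [hs.s1]
      rw [abs_le]; constructor <;> linarith
    have hm2 : (ε, (w 0).I, sawtooth (Φ t), (w t).p, ε * x t) ∈ Dom ρ :=
      hs.mem_Dom (by linarith) (by linarith [hs.geom.D₀_pos]) (abs_sawtooth_le (Φ t)) hp'
    have h2 := stable_mom hB hε hs.s1 (hq.mem t ht) hm2 (hq.mom t ht) h'.mom
    rw [sub_self, abs_zero, mul_zero, zero_add, abs_sub_comm (q t)] at h2
    have lip1 : ∀ v ∈ dirs, |pd v (iterate d m).Smap (ε, (w t).I, sawtooth (Φ t), (w t).p, ε * x t) -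
        pd v (iterate d m).Smap (ε, (w 0).I, sawtooth (Φ t), (w t).p, ε * x t)| ≤
        B * |(w t).I - (w 0).I| := by
      intro v hv
      have := (hB.S1_lip v hv _ h'.mem _ hm2).trans
        (mul_le_mul_of_nonneg_left (norm_mk_sub_mk_le ε _ _ _ _ _ _ _ _) hB0.le)
      simpa only [sub_self, abs_zero, add_zero] using this
    have lip2 : ∀ v ∈ dirs, |pd v (iterate d m).Smap (ε, (w t).I, sawtooth (Φ t), (w t).p, ε * x t) -
        pd v (iterate d m).Smap (mixedPt ε (w 0).I Φ q x t)| ≤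
        B * (|(w t).I - (w 0).I| + |(w t).p - q t|) := by
      intro v hv
      have := (hB.S1_lip v hv _ h'.mem _ (hq.mem t ht)).trans
        (mul_le_mul_of_nonneg_left (norm_mk_sub_mk_le ε _ _ _ _ _ _ _ _) hB0.le)
      simpa only [sub_self, abs_zero, add_zero] using this
    have hεB : ε * B ≤ 1 / 10 := by linarith [hs.s1]
    set Δ := |(w t).I - (w 0).I| with hΔ
    have hΔ0 : 0 ≤ Δ := abs_nonneg _
    have h5 : |(w t).p - q t| ≤ Δ := by
      refine h2.trans ?_
      have h3 := lip1 vX (by simp)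
      rw [abs_sub_comm] at h3
      calc _ ≤ 2 * ε ^ 2 * (B * Δ) := mul_le_mul_of_nonneg_left h3 (by positivity)
        _ = (2 * ε) * (ε * B) * Δ := by ring
        _ ≤ 1 * (1 / 10) * Δ := by gcongr; linarith
        _ ≤ _ := by linarith
    have h6 : ∀ v ∈ dirs, ε * |pd v (iterate d m).Smap (ε, (w t).I, sawtooth (Φ t), (w t).p, ε * x t) -
        pd v (iterate d m).Smap (mixedPt ε (w 0).I Φ q x t)| ≤ Δ := by
      intro v hv
      calc _ ≤ ε * (B * (Δ + |(w t).p - q t|)) := mul_le_mul_of_nonneg_left (lip2 v hv) hε.le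
        _ = (ε * B) * (Δ + |(w t).p - q t|) := by ring
        _ ≤ (1 / 10) * (Δ + Δ) := by gcongr
        _ ≤ _ := by linarith
    refine ⟨h5, ?_, ?_, ?_⟩
    · rw [slowPhase, e1, add_sub_add_left_eq_sub, ← mul_sub, abs_mul, abs_of_pos hε]
      exact h6 vI (by simp)
    · rw [slowX, e2, mul_add, ← mul_assoc, ← sq, add_sub_add_left_eq_sub, ← mul_sub, abs_mul,
        abs_of_pos (by positivity), sq, mul_assoc]
      exact (mul_le_of_le_one_left (by positivity) (by linarith)).trans (h6 vp (by simp))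
    · rw [← h'.act, add_sub_add_comm, ← mul_sub]
      refine (abs_add_le _ _).trans ?_
      rw [abs_mul, abs_of_pos hε]
      have : ε * |pd vu (iterate d m).Smap (ε, (w t).I, sawtooth (Φ t), (w t).p, ε * x t) -
          pd vu (iterate d m).Smap (ε, (w 0).I, sawtooth (Φ t), (w t).p, ε * x t)| ≤ Δ := by
        calc _ ≤ ε * (B * Δ) := mul_le_mul_of_nonneg_left (lip1 vu vu_mem) hε.le
          _ = (ε * B) * Δ := by ring
          _ ≤ (1 / 10) * Δ := by gcongr
          _ ≤ _ := by linarith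
      linarith
  have hdrift : ∀ t ∈ Icc 0 T, |(w t).I - (w 0).I| ≤ driftRate a c₀ D₀ D₁ B L * ε ^ (m + 1) := by
    intro t ht
    have h' := (him t ht).1
    rw [hsaw t ht] at h'
    exact (hS.image_at hr hT0 hT h0 ht).2 _ _ _ _ him0' h'
  obtain ⟨i1, i2, i3, -⟩ := key 0 h0T
  rw [sub_self, abs_zero] at i1 i2 i3
  have hz : ∀ {u v : ℝ}, |u - v| ≤ 0 → v = u := fun h => by
    linarith [abs_nonpos_iff.1 h]
  exact ⟨hz i1, hz i3, hz i2, hdrift, fun t ht => (key t ht).1.trans (hdrift t ht),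
    fun t ht => (key t ht).2.1.trans (hdrift t ht), fun t ht => (key t ht).2.2.1.trans (hdrift t ht),
    fun t ht => (key t ht).2.2.2.trans (by linarith [hdrift t ht])⟩

/-- Rescaling to the slow time. -/
theorem approx_rescale {G kp kX : ℝ → ℝ → ℝ} {e : ℝ} {p X φ : ℝ → ℝ} (hε : 0 < ε)
    (hp : ∀ t ∈ Icc 0 T, |p t| ≤ 4) (cp : ContinuousOn p (Icc 0 T)) (cX : ContinuousOn X (Icc 0 T))
    (cφ : ContinuousOn φ (Icc 0 T)) (hder : ∀ t ∈ Ico 0 T, ∃ p' X' φ' : ℝ,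
      HasDerivWithinAt p p' (Ici t) t ∧ HasDerivWithinAt X X' (Ici t) t ∧
      HasDerivWithinAt φ φ' (Ici t) t ∧ |p' + ε * kX (p t) (X t)| ≤ ε * e ∧
      |X' - ε * kp (p t) (X t)| ≤ ε * e ∧ |φ' - G (p t) (X t)| ≤ e) :
    Approx G kp kX e (ε * T) (fun s => p (s / ε)) (fun s => X (s / ε)) (fun s => ε * φ (s / ε)) := by
  have hmem : ∀ s ∈ Icc 0 (ε * T), s / ε ∈ Icc 0 T := fun s hs =>
    ⟨div_nonneg hs.1 hε.le, by rw [div_le_iff₀ hε, mul_comm]; exact hs.2⟩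
  have hc : ∀ {f : ℝ → ℝ}, ContinuousOn f (Icc 0 T) →
      ContinuousOn (fun s => f (s / ε)) (Icc 0 (ε * T)) := fun hf =>
    hf.comp (by fun_prop) hmem
  have hd : ∀ {f : ℝ → ℝ} {f' s : ℝ}, HasDerivWithinAt f f' (Ici (s / ε)) (s / ε) →
      HasDerivWithinAt (fun s => f (s / ε)) (f' / ε) (Ici s) s := by
    intro f f' s hf
    have h2 : HasDerivWithinAt (fun s : ℝ => s / ε) (1 / ε) (Ici s) s :=
      (hasDerivWithinAt_id s (Ici s)).div_const ε
    have := HasDerivWithinAt.comp s hf h2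
      (fun u hu => mem_Ici.2 (div_le_div_of_nonneg_right (mem_Ici.1 hu) hε.le))
    rw [mul_one_div] at this
    exact this
  refine ⟨fun s hs => hp _ (hmem s hs), hc cp, hc cX, (hc cφ).const_smul ε, fun s hs => ?_⟩
  have hs' : s / ε ∈ Ico 0 T :=
    ⟨div_nonneg hs.1 hε.le, by rw [div_lt_iff₀ hε, mul_comm]; exact hs.2⟩
  obtain ⟨p', X', φ', d1, d2, d3, b1, b2, b3⟩ := hder _ hs'
  refine ⟨p' / ε, X' / ε, φ', hd d1, hd d2, ?_, ?_, ?_, b3⟩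
  · exact ((hd d3).const_mul ε).congr_deriv (by field_simp)
  · rw [show p' / ε + kX (p (s / ε)) (X (s / ε)) = (p' + ε * kX (p (s / ε)) (X (s / ε))) / ε by
      field_simp, abs_div, abs_of_pos hε, div_le_iff₀ hε, mul_comm e]
    exact b1
  · rw [show X' / ε - kp (p (s / ε)) (X (s / ε)) = (X' - ε * kp (p (s / ε)) (X (s / ε))) / ε by
      field_simp, abs_div, abs_of_pos hε, div_le_iff₀ hε, mul_comm e]
    exact b2

theorem SlowCurve.approx {e J : ℝ} {I P q : ℝ → ℝ} (hε : 0 < ε)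
    (hq : SlowCurve d m ρ ε T e J I P Φ x q) :
    Approx (kDer d m vI ε J) (kDer d m vp ε J) (kDer d m vX ε J) e (ε * T) (fun s => q (s / ε))
      (fun s => slowX d m ε J Φ q x (s / ε)) (fun s => ε * slowPhase d m ε J Φ q x (s / ε)) := by
  refine approx_rescale hε (fun t ht => by linarith [hq.q_le t ht]) hq.cont_q hq.cont_X hq.cont_phase
    fun t ht => ?_
  obtain ⟨q', φ', Y', d1, d2, d3, b1, b2, b3⟩ := hq.deriv t ht
  exact ⟨q', Y', φ', d1, d3, d2, b1, b3, b2⟩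

/-- A solution of the averaged system conserves the action and the energy. -/
theorem IsApproxSolution.conserved (hd : Profile d) (hv : IsApproxSolution d (m + 1) ε T v)
    (hJ : 0 < (v 0).I) {t : ℝ} (ht : t ∈ Icc 0 T) : (v t).I = (v 0).I ∧
      (iterate d m).K ε (v 0).I (v t).p (ε * (v t).x) =
        (iterate d m).K ε (v 0).I (v 0).p (ε * (v 0).x) := by
  have hsub : ∀ s ∈ Ico 0 T, Icc 0 T ∈ 𝓝[Ici s] s := fun s hs =>
    mem_of_superset (Icc_mem_nhdsGE hs.2) (Icc_subset_Icc_left hs.1)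
  have hI : ∀ t ∈ Icc 0 T, (v t).I = (v 0).I :=
    constant_of_has_deriv_right_zero (fun s hs => (hv s hs).1.continuousWithinAt)
      fun s hs => (hv s ⟨hs.1, hs.2.le⟩).1.mono_of_mem_nhdsWithin (hsub s hs)
  have hK : ∀ s ∈ Icc 0 T, HasDerivWithinAt
      (fun s => (iterate d m).K ε (v 0).I (v s).p (ε * (v s).x)) 0 (Icc 0 T) s := by
    intro s hs
    obtain ⟨-, -, h3, h4⟩ := hv s hs
    change HasDerivWithinAt (fun s => (v s).p)
      (-(ε * deriv (fun X => (iterate d m).K ε (v s).I (v s).p X) (ε * (v s).x))) (Icc 0 T) s at h3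
    change HasDerivWithinAt (fun s => (v s).x)
      (deriv (fun p => (iterate d m).K ε (v s).I p (ε * (v s).x)) (v s).p) (Icc 0 T) s at h4
    rw [hI s hs, (hasDerivAt_K hd m hJ).2.2.deriv] at h3
    rw [hI s hs, (hasDerivAt_K hd m hJ).2.1.deriv] at h4
    exact (hasDerivWithinAt_K hd m hJ h3 (h4.const_mul ε)).congr_deriv (by ring)
  exact ⟨hI t ht, constant_of_has_deriv_right_zero (fun s hs => (hK s hs).continuousWithinAt)
    (fun s hs => (hK s ⟨hs.1, hs.2.le⟩).mono_of_mem_nhdsWithin (hsub s hs)) t ht⟩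

/-- At `|p| = 3` the unperturbed energy is at least `8`, which contradicts conservation of an energy
of size at most one. The crossing time is taken because `K` is close to `𝓗₀` only for bounded
momenta. -/
theorem IsApproxSolution.mom_le (hs : Small d a c₀ D₀ D₁ m ρ B ε)
    (hv : IsApproxSolution d (m + 1) ε T v) (h1 : a / 4 ≤ (v 0).I) (h2 : (v 0).I ≤ 3 * D₀)
    (hp : |(v 0).p| ≤ 3) (hk : |(iterate d m).K ε (v 0).I (v 0).p (ε * (v 0).x)| ≤ 1) {t : ℝ}
    (ht : t ∈ Icc 0 T) : |(v t).p| ≤ 3 := by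
  by_contra hcon
  have hd := hs.geom.prof
  have hJ : 0 < (v 0).I := by linarith [hs.geom.a_pos]
  have hcont : ContinuousOn (fun s => |(v s).p|) (Icc 0 t) := fun s hs' =>
    ((hv s ⟨hs'.1, hs'.2.trans ht.2⟩).2.2.1.continuousWithinAt.mono
      (Icc_subset_Icc_right ht.2)).abs
  obtain ⟨s, hs', hp3⟩ := intermediate_value_Icc ht.1 hcont ⟨hp, (not_le.1 hcon).le⟩
  have hc := (hv.conserved hd hJ (t := s) ⟨hs'.1, hs'.2.trans ht.2⟩).2
  rw [← hc] at hk
  beta_reduce at hp3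
  have hb := abs_le.1 (hs.nf.K_sub (ε, (v 0).I, 0, (v s).p, ε * (v s).x)
    (hs.mem_Dom h1 h2 (by rw [abs_zero]; exact Real.pi_pos.le) (by linarith)) hs.ε_pos.le)
  change -(B * ε) ≤ (iterate d m).K ε (v 0).I (v s).p (ε * (v s).x) -
    (iterate d 0).K ε (v 0).I (v s).p (ε * (v s).x) ∧ _ at hb
  have hz : (iterate d 0).K ε (v 0).I (v s).p (ε * (v s).x) ≥ 8 := by
    rw [K_zero, ← sq_abs, hp3, gap]
    have : 0 ≤ Real.pi ^ 2 * (v 0).I ^ 2 / d (ε * (v s).x) ^ 2 := by positivity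
    linarith
  linarith [hb.1, (abs_le.1 hk).2, hs.s1]

theorem IsApproxSolution.approx (hs : Small d a c₀ D₀ D₁ m ρ B ε)
    (hv : IsApproxSolution d (m + 1) ε T v) (h1 : a / 4 ≤ (v 0).I) (h2 : (v 0).I ≤ 3 * D₀)
    (hp : |(v 0).p| ≤ 3) (hk : |(iterate d m).K ε (v 0).I (v 0).p (ε * (v 0).x)| ≤ 1) :
    Approx (kDer d m vI ε (v 0).I) (kDer d m vp ε (v 0).I) (kDer d m vX ε (v 0).I) 0 (ε * T)
      (fun s => (v (s / ε)).p) (fun s => ε * (v (s / ε)).x) (fun s => ε * (v (s / ε)).φ) := by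
  have hd := hs.geom.prof
  have hJ : 0 < (v 0).I := by linarith [hs.geom.a_pos]
  refine approx_rescale (p := fun s => (v s).p) (X := fun s => ε * (v s).x) (φ := fun s => (v s).φ)
    hs.ε_pos (fun t ht => by linarith [hv.mom_le hs h1 h2 hp hk ht])
    (fun t ht => (hv t ht).2.2.1.continuousWithinAt)
    (fun t ht => ((hv t ht).2.2.2.const_mul ε).continuousWithinAt)
    (fun t ht => (hv t ht).2.1.continuousWithinAt) fun t ht => ?_
  have htI : t ∈ Icc 0 T := ⟨ht.1, ht.2.le⟩
  have hnh : Icc 0 T ∈ 𝓝[Ici t] t :=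
    mem_of_superset (Icc_mem_nhdsGE ht.2) (Icc_subset_Icc_left ht.1)
  obtain ⟨-, e2, e3, e4⟩ := hv t htI
  have hN : normalForm d (m + 1) = iterate d m := rfl
  rw [hN, (hv.conserved hd hJ htI).1] at e2 e3 e4
  rw [(hasDerivAt_K hd m hJ).1.deriv] at e2
  rw [(hasDerivAt_K hd m hJ).2.2.deriv] at e3
  rw [(hasDerivAt_K hd m hJ).2.1.deriv] at e4
  refine ⟨_, _, _, e3.mono_of_mem_nhdsWithin hnh, (e4.const_mul ε).mono_of_mem_nhdsWithin hnh,
    e2.mono_of_mem_nhdsWithin hnh, ?_, ?_, ?_⟩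
  · rw [neg_add_cancel, abs_zero, mul_zero]
  · rw [sub_self, abs_zero, mul_zero]
  · rw [sub_self, abs_zero]

end


/-! ### Accuracy of the averaged motion -/

section
variable {d : ℝ → ℝ} {a c₀ D₀ D₁ : ℝ} {m k : ℕ} {L ρ B B₀ δ ε T : ℝ} {x y px py Φ : ℝ → ℝ}
  {w v : ℝ → Point}

/-- The accuracy `ε ^ (r - k)`, where `r = m + 1`. -/
def accuracy (m k : ℕ) (ε : ℝ) : ℝ := ε ^ (((m + 1 : ℕ) : ℤ) - k)

theorem accuracy_mul (hε : 0 < ε) : accuracy m k ε * ε = ε ^ (((m + 1 : ℕ) : ℤ) - k + 1) := by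
  rw [accuracy, zpow_add_one₀ hε.ne']

theorem Small.pow_le_accuracy (hs : Small d a c₀ D₀ D₁ m ρ B ε) (hk : 1 ≤ k) :
    ε ^ (m + 1) ≤ accuracy m k ε * ε := by
  rw [accuracy_mul hs.ε_pos, ← zpow_natCast]
  exact zpow_le_zpow_right_of_le_one₀ hs.ε_pos (by linarith [hs.ε_le]) (by omega)

theorem accuracy_pos (hε : 0 < ε) : 0 < accuracy m k ε := zpow_pos hε _

/-- In slow time the interval has length `ε T ≤ L ε ^ (1 - k)`, which turns the error `ε ^ r` into
`ε ^ (r - k + 1)`; `k ≥ 1` covers the part that does not grow. -/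
theorem Tame.error_le (hS : Tame d a c₀ D₀ D₁ m k L ρ B ε) (hk : 1 ≤ k) (hT : ε ^ k * T ≤ L) :
    ε ^ (m + 1) * (1 + ε * T) ≤ (1 + L) * (accuracy m k ε * ε) := by
  have hε := hS.small.ε_pos
  have h1 := hS.small.pow_le_accuracy hk
  have h2 : ε ^ (m + 1) = accuracy m k ε * ε ^ k := by
    rw [accuracy, zpow_sub₀ hε.ne', zpow_natCast, zpow_natCast, div_mul_cancel₀ _ (by positivity)]
  have h3 : ε ^ (m + 1) * (ε * T) = (accuracy m k ε * ε) * (ε ^ k * T) := by rw [h2]; ring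
  have h4 := mul_le_mul_of_nonneg_left hT (mul_pos (accuracy_pos (m := m) (k := k) hε) hε).le
  linarith

/-- The constant in the accuracy of the averaged motion. -/
def motionRate (a c₀ D₀ D₁ B B₀ L δ : ℝ) : ℝ :=
  shadowRate B (1 / speedMin δ B₀ ^ 2) * slowRate a c₀ D₀ D₁ B L * (1 + L)

/-- Shadowing in the slow time `ε t`, with `lam = 1 / speedMin ^ 2` as the bound for the inverse
squared gradient of `K`. -/
theorem Slow.slowCurve_close (hS : Slow d a c₀ D₀ D₁ m k L ρ B B₀ δ ε) (hk : 1 ≤ k) (hT0 : 0 ≤ T)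
    (hT : ε ^ k * T ≤ L) {I P q : ℝ → ℝ} (h1 : a / 4 ≤ (v 0).I) (h2 : (v 0).I ≤ 3 * D₀)
    (hq : SlowCurve d m ρ ε T (slowRate a c₀ D₀ D₁ B L * ε ^ (m + 1)) (v 0).I I P Φ x q)
    (hsp : ∀ t ∈ Icc 0 T, speedMin δ B₀ ≤ |kDer d m vp ε (v 0).I (q t) (slowX d m ε (v 0).I Φ q x t)| ∨
      speedMin δ B₀ ≤ |kDer d m vX ε (v 0).I (q t) (slowX d m ε (v 0).I Φ q x t)|)
    (hv : IsApproxSolution d (m + 1) ε T v) (i1 : q 0 = (v 0).p)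
    (i2 : slowX d m ε (v 0).I Φ q x 0 = ε * (v 0).x)
    (i3 : slowPhase d m ε (v 0).I Φ q x 0 = (v 0).φ) {t : ℝ} (ht : t ∈ Icc 0 T) :
    |q t - (v t).p| ≤ motionRate a c₀ D₀ D₁ B B₀ L δ * (accuracy m k ε * ε) ∧
    |slowX d m ε (v 0).I Φ q x t - ε * (v t).x| ≤
      motionRate a c₀ D₀ D₁ B B₀ L δ * (accuracy m k ε * ε) ∧
    |slowPhase d m ε (v 0).I Φ q x t - (v t).φ| ≤
      motionRate a c₀ D₀ D₁ B B₀ L δ * accuracy m k ε := by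
  have hs := hS.tame.small
  have hε := hs.ε_pos
  have hc := speedMin_pos hS.δ_pos hS.nf₀.pos
  have hc1 : speedMin δ B₀ ≤ 1 := by
    unfold speedMin
    linarith [min_le_right (slowMargin δ B₀) 1]
  have hB := hs.nf.one_le
  have hR := hS.tame.slowRate_pos
  have hpow : ε ^ (m + 1) ≤ ε := by simpa using hs.pow_le (i := 1) (j := m + 1) (by omega)
  have hη : 0 < ε ^ (m + 1) := by positivity
  set c := speedMin δ B₀ with hcdef
  set R := slowRate a c₀ D₀ D₁ B L with hRdef
  have hlam : 1 ≤ 1 / c ^ 2 := by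
    rw [one_le_div (by positivity)]
    exact pow_le_one₀ hc.le hc1
  have hpos : 0 < errorFactor B (1 / c ^ 2) := by
    have : 0 < 1 / c ^ 2 := by positivity
    have hB0 := hs.nf.pos
    unfold errorFactor stepShift stepDist trackDist
    positivity
  have hsm : errorFactor B (1 / c ^ 2) * (R * ε ^ (m + 1)) ≤ 1 := by
    refine le_trans ?_ hS.t3
    rw [← mul_assoc]
    exact mul_le_mul_of_nonneg_left hpow (by positivity)
  have hlow : ∀ A C : ℝ, c ≤ |A| ∨ c ≤ |C| → 1 ≤ 1 / c ^ 2 * (A ^ 2 + C ^ 2) := by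
    intro A C h
    rw [div_mul_eq_mul_div, one_mul, one_le_div (by positivity)]
    have hA := sq_nonneg A
    have hC := sq_nonneg C
    rcases h with h | h
    · have := pow_le_pow_left₀ hc.le h 2
      rw [sq_abs] at this; linarith
    · have := pow_le_pow_left₀ hc.le h 2
      rw [sq_abs] at this; linarith
  have hp3 : |(v 0).p| ≤ 3 := by rw [← i1]; exact hq.q_le 0 ⟨le_rfl, hT0⟩
  have hk0 : |(iterate d m).K ε (v 0).I (v 0).p (ε * (v 0).x)| ≤ R * ε ^ (m + 1) := by
    have := hq.level 0 ⟨le_rfl, hT0⟩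
    rw [i1, i2] at this
    exact this
  have hk1 : |(iterate d m).K ε (v 0).I (v 0).p (ε * (v 0).x)| ≤ 1 :=
    hk0.trans ((mul_le_mul_of_nonneg_left hpow hR.le).trans hS.t6)
  have hmem : ∀ s ∈ Icc 0 (ε * T), s / ε ∈ Icc 0 T := fun s hs =>
    ⟨div_nonneg hs.1 hε.le, by rw [div_le_iff₀ hε, mul_comm]; exact hs.2⟩
  have hJ : 0 < (v 0).I := by linarith [hs.geom.a_pos]
  have main := shadowing (hs.slowField h1 h2) (e := R * ε ^ (m + 1)) (by positivity) hlam hsm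
    (hq.approx hε) (hv.approx hs h1 h2 hp3 hk1) (fun s hs' => hlow _ _ (hsp _ (hmem s hs')))
    (fun s hs' => hq.level _ (hmem s hs'))
    (fun s hs' => by rw [(hv.conserved hs.geom.prof hJ (hmem s hs')).2]; exact hk0)
    (by rw [zero_div]; exact i1) (by rw [zero_div]; exact i2) (by rw [zero_div, i3])
    (ε * t) ⟨mul_nonneg hε.le ht.1, mul_le_mul_of_nonneg_left ht.2 hε.le⟩
  rw [mul_div_cancel_left₀ _ hε.ne'] at main
  have hsh : 0 ≤ shadowRate B (1 / c ^ 2) := by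
    have : 0 < 1 / c ^ 2 := by positivity
    have hB0 := hs.nf.pos
    unfold shadowRate trackRate stepShift stepDist trackDist
    positivity
  have hE : shadowRate B (1 / c ^ 2) * (R * ε ^ (m + 1)) * (1 + ε * T) ≤
      motionRate a c₀ D₀ D₁ B B₀ L δ * (accuracy m k ε * ε) := by
    have := mul_le_mul_of_nonneg_left (hS.tame.error_le hk hT) (mul_nonneg hsh hR.le)
    unfold motionRate
    rw [← hcdef, ← hRdef]
    linarith
  obtain ⟨m1, m2, m3⟩ := main
  refine ⟨m1.trans hE, m2.trans hE, ?_⟩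
  -- Shadowing controls `ε` times the fast phase, so one power of `ε` is divided out.
  have m4 := m3.trans hE
  rw [← mul_sub, abs_mul, abs_of_pos hε, mul_comm, ← mul_assoc] at m4
  exact le_of_mul_le_mul_right m4 hε

/-! ### Recovering the original variables -/

theorem isChange_iff (hd : Profile d) {z w : Point} (hw : 0 < w.I) :
    IsChange d (m + 1) ε z w ↔
      z.I = w.I + ε * pd vu (iterate d m).Smap (ε, w.I, sawtooth z.φ, w.p, ε * z.x) ∧
      w.φ = z.φ + ε * pd vI (iterate d m).Smap (ε, w.I, sawtooth z.φ, w.p, ε * z.x) ∧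
      z.p = w.p + ε ^ 2 * pd vX (iterate d m).Smap (ε, w.I, sawtooth z.φ, w.p, ε * z.x) ∧
      w.x = z.x + ε * pd vp (iterate d m).Smap (ε, w.I, sawtooth z.φ, w.p, ε * z.x) := by
  have hSm := (pol_iterate hd m).1
  have hN : normalForm d (m + 1) = iterate d m := rfl
  have eq1 := dI_eq hd hSm (z := (ε, w.I, sawtooth z.φ, w.p, ε * z.x)) hw
  have eq2 := dφ_eq hd hSm (z := (ε, w.I, sawtooth z.φ, w.p, ε * z.x)) hw
  have eq3 := dp_eq hd hSm (z := (ε, w.I, sawtooth z.φ, w.p, ε * z.x)) hw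
  have eq4 := dX_eq hd hSm (z := (ε, w.I, sawtooth z.φ, w.p, ε * z.x)) hw
  simp only at eq1 eq2 eq3 eq4
  rw [IsChange, hN, eq1, eq2, eq3, eq4]

/-- For given new variables the equations for phase and coordinate close up: they involve only
`∂S/∂I` and `∂S/∂p`, which are Lipschitz around the phase circle, so they form a contraction. Action
and momentum are then explicit. -/
theorem Small.existsUnique_change (hs : Small d a c₀ D₀ D₁ m ρ B ε) {w : Point} (h1 : a / 4 ≤ w.I)
    (h2 : w.I ≤ 3 * D₀) (hp : |w.p| ≤ 8) : ∃! z, IsChange d (m + 1) ε z w := by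
  have hε := hs.ε_pos
  have hB := hs.nf.pos
  have hw : 0 < w.I := by linarith [hs.geom.a_pos]
  set F : ℝ × ℝ → ℝ × ℝ := fun u =>
    (w.φ - ε * pd vI (iterate d m).Smap (ε, w.I, sawtooth u.1, w.p, ε * u.2),
      w.x - ε * pd vp (iterate d m).Smap (ε, w.I, sawtooth u.1, w.p, ε * u.2)) with hF
  have hcon : ContractingWith (1 / 2) F := by
    refine ⟨by norm_num, LipschitzWith.of_dist_le_mul fun u u' => ?_⟩
    have d1 : |u.1 - u'.1| ≤ dist u u' := le_max_left _ _
    have d2 : |u.2 - u'.2| ≤ dist u u' := le_max_right _ _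
    have gen : ∀ (c : ℝ) (v : E5), v = vI ∨ v = vp ∨ v = vX →
        dist (c - ε * pd v (iterate d m).Smap (ε, w.I, sawtooth u.1, w.p, ε * u.2))
          (c - ε * pd v (iterate d m).Smap (ε, w.I, sawtooth u'.1, w.p, ε * u'.2)) ≤
        1 / 2 * dist u u' := by
      intro c v hv
      have h := hs.abs_pd_sawtooth_sub_le hv (φ := u.1) (φ' := u'.1) (X := ε * u.2) (X' := ε * u'.2)
        h1 h2 hp hp
      rw [sub_self, abs_zero, add_zero, ← mul_sub, abs_mul, abs_of_pos hε] at h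
      rw [dist_sub_left, Real.dist_eq, ← mul_sub, abs_mul, abs_of_pos hε]
      have h3 : ε * |u.2 - u'.2| ≤ dist u u' :=
        (mul_le_of_le_one_left (abs_nonneg _) (by linarith [hs.ε_le])).trans d2
      have h4 := h.trans (mul_le_mul_of_nonneg_left (add_le_add d1 h3) hB.le)
      have h5 := mul_le_mul_of_nonneg_left h4 hε.le
      have hd0 : 0 ≤ dist u u' := dist_nonneg
      have h6 := mul_le_mul_of_nonneg_right hs.s1 hd0
      linarith
    have e : ((1 / 2 : NNReal) : ℝ) = 1 / 2 := by norm_num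
    rw [e]
    exact max_le (gen _ _ (Or.inl rfl)) (gen _ _ (Or.inr (Or.inl rfl)))
  have hfix := hcon.fixedPoint_isFixedPt
  set u := ContractingWith.fixedPoint F hcon with hu
  have f1 : w.φ - ε * pd vI (iterate d m).Smap (ε, w.I, sawtooth u.1, w.p, ε * u.2) = u.1 :=
    congrArg Prod.fst hfix
  have f2 : w.x - ε * pd vp (iterate d m).Smap (ε, w.I, sawtooth u.1, w.p, ε * u.2) = u.2 :=
    congrArg Prod.snd hfix
  refine ⟨⟨w.I + ε * pd vu (iterate d m).Smap (ε, w.I, sawtooth u.1, w.p, ε * u.2), u.1,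
    w.p + ε ^ 2 * pd vX (iterate d m).Smap (ε, w.I, sawtooth u.1, w.p, ε * u.2), u.2⟩,
    (isChange_iff hs.geom.prof hw).2 ⟨rfl, by linarith, rfl, by linarith⟩, fun z hz => ?_⟩
  obtain ⟨e1, e2, e3, e4⟩ := (isChange_iff hs.geom.prof hw).1 hz
  have hz' : Function.IsFixedPt F (z.φ, z.x) := Prod.ext (by simp only [hF]; linarith)
    (by simp only [hF]; linarith)
  have := hcon.fixedPoint_unique hz'
  have k1 : z.φ = u.1 := congrArg Prod.fst this
  have k2 : z.x = u.2 := congrArg Prod.snd this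
  rw [k1, k2] at e1 e3
  exact Point.ext e1 k1 e3 k2

/-- The original variables depend continuously on the mixed ones. -/
theorem Small.recover (hs : Small d a c₀ D₀ D₁ m ρ B ε) {z' w' : Point} (h1 : a / 4 ≤ w'.I)
    (h2 : w'.I ≤ 3 * D₀) {q E b e I P φ X : ℝ} (hq : |q| ≤ 8) (hp : |w'.p| ≤ 8) (hz : IsChange d (m + 1) ε z' w')
    (hb : 0 ≤ b) (hE : 0 ≤ E)
    (hI : |I - w'.I - ε * pd vu (iterate d m).Smap (ε, w'.I, sawtooth φ, q, X)| ≤ e)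
    (hP : P = q + ε ^ 2 * pd vX (iterate d m).Smap (ε, w'.I, sawtooth φ, q, X))
    (hqp : |q - w'.p| ≤ b * (E * ε))
    (hX : |X + ε ^ 2 * pd vp (iterate d m).Smap (ε, w'.I, sawtooth φ, q, X) - ε * w'.x| ≤ b * (E * ε))
    (hφ : |φ + ε * pd vI (iterate d m).Smap (ε, w'.I, sawtooth φ, q, X) - w'.φ| ≤ b * E) :
    |φ - z'.φ| ≤ 6 * b * E ∧ |P - z'.p| ≤ 2 * b * (E * ε) ∧ |X - ε * z'.x| ≤ 2 * b * (E * ε) ∧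
      |I - z'.I| ≤ e + 2 * B * ε ∧ (sawtooth φ - sawtooth z'.φ = φ - z'.φ →
        |I - z'.I| ≤ e + 6 * B * b * (E * ε)) := by
  have hε := hs.ε_pos
  have hε1 := hs.ε_le
  have hB := hs.nf.pos
  have hw : 0 < w'.I := by linarith [hs.geom.a_pos]
  obtain ⟨e1, e2, e3, e4⟩ := (isChange_iff hs.geom.prof hw).1 hz
  have hεB : ε * B ≤ 1 / 10 := by linarith [hs.s1]
  -- All corrections are Lipschitz in this combined distance with constants at most `1/10`, so it
  -- can be absorbed and is at most `6 b E`.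
  set s := |φ - z'.φ| + |q - w'.p| + |X - ε * z'.x| with hsdef
  have hs0 : 0 ≤ s := by positivity
  have lip : ∀ v : E5, v = vI ∨ v = vp ∨ v = vX →
      |pd v (iterate d m).Smap (ε, w'.I, sawtooth φ, q, X) -
        pd v (iterate d m).Smap (ε, w'.I, sawtooth z'.φ, w'.p, ε * z'.x)| ≤ B * s := fun v hv =>
    hs.abs_pd_sawtooth_sub_le hv h1 h2 hq hp
  have sm1 : ε * (B * s) ≤ s / 10 := by
    have := mul_le_mul_of_nonneg_right hεB hs0
    linarith
  have sm2 : ε ^ 2 * (B * s) ≤ ε * (s / 10) := by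
    have := mul_le_mul_of_nonneg_left sm1 hε.le
    linarith
  have sm3 : ε * (s / 10) ≤ s / 10 := mul_le_of_le_one_left (by positivity) (by linarith)
  have gφ : |φ - z'.φ| ≤ b * E + s / 10 := by
    have l := mul_le_mul_of_nonneg_left (lip vI (Or.inl rfl)) hε.le
    rw [← abs_of_pos hε, ← abs_mul, abs_of_pos hε, mul_sub] at l
    have l2 := abs_le.1 l
    have l3 := abs_le.1 hφ
    rw [abs_le]
    constructor <;> linarith [l2.1, l2.2, l3.1, l3.2]
  have gX : |X - ε * z'.x| ≤ b * (E * ε) + ε * (s / 10) := by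
    have l := mul_le_mul_of_nonneg_left (lip vp (Or.inr (Or.inl rfl))) (sq_nonneg ε)
    rw [← abs_of_nonneg (sq_nonneg ε), ← abs_mul, abs_of_nonneg (sq_nonneg ε), mul_sub] at l
    have l2 := abs_le.1 l
    have l3 := abs_le.1 hX
    have e5 : ε * w'.x = ε * z'.x +
        ε ^ 2 * pd vp (iterate d m).Smap (ε, w'.I, sawtooth z'.φ, w'.p, ε * z'.x) := by
      rw [e4]; ring
    rw [abs_le]
    constructor <;> linarith [l2.1, l2.2, l3.1, l3.2]
  have hbE : 0 ≤ b * E := mul_nonneg hb hE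
  have hle : b * (E * ε) ≤ b * E / 10 := by
    have := mul_le_mul_of_nonneg_left hε1 hbE
    linarith
  have hs6 : s ≤ 6 * b * E := by linarith
  have hsε : ε * (s / 10) ≤ b * (E * ε) := by
    have := mul_le_mul_of_nonneg_left hs6 hε.le
    have : 0 ≤ b * E * ε := by positivity
    linarith
  refine ⟨?_, ?_, by linarith, ?_, fun hsaw => ?_⟩
  · linarith [abs_nonneg (q - w'.p), abs_nonneg (X - ε * z'.x)]
  · have l := mul_le_mul_of_nonneg_left (lip vX (Or.inr (Or.inr rfl))) (sq_nonneg ε)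
    rw [← abs_of_nonneg (sq_nonneg ε), ← abs_mul, abs_of_nonneg (sq_nonneg ε), mul_sub] at l
    have l2 := abs_le.1 l
    have l3 := abs_le.1 hqp
    rw [abs_le]
    constructor <;> linarith [l2.1, l2.2, l3.1, l3.2]
  -- `∂S/∂φ` may jump between the two phases, so only its size is used here.
  · have s1 := hs.nf.S1 vu vu_mem _ (hs.mem_Dom (X := X) h1 h2 (abs_sawtooth_le φ) hq)
    have s2 := hs.nf.S1 vu vu_mem _ (hs.mem_Dom (X := ε * z'.x) h1 h2 (abs_sawtooth_le z'.φ) hp)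
    have l := mul_le_mul_of_nonneg_left ((abs_sub _ _).trans (add_le_add s1 s2)) hε.le
    rw [← abs_of_pos hε, ← abs_mul, abs_of_pos hε, mul_sub] at l
    have l2 := abs_le.1 l
    have l3 := abs_le.1 hI
    rw [abs_le]
    constructor <;> linarith [l2.1, l2.2, l3.1, l3.2]
  -- Without a jump in between, the difference of the sawtooths is that of the phases, and the
  -- Lipschitz bound applies.
  · have s1 := (hs.nf.S1_lip vu vu_mem _ (hs.mem_Dom (X := X) h1 h2 (abs_sawtooth_le φ) hq) _
      (hs.mem_Dom (X := ε * z'.x) h1 h2 (abs_sawtooth_le z'.φ) hp)).trans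
      (mul_le_mul_of_nonneg_left (norm_mk_sub_mk_le ε _ _ _ _ _ _ _ _) hB.le)
    rw [sub_self, abs_zero, zero_add, hsaw] at s1
    have l := mul_le_mul_of_nonneg_left (s1.trans (mul_le_mul_of_nonneg_left hs6 hB.le)) hε.le
    rw [← abs_of_pos hε, ← abs_mul, abs_of_pos hε, mul_sub] at l
    have l2 := abs_le.1 l
    have l3 := abs_le.1 hI
    rw [abs_le]
    constructor <;> linarith [l2.1, l2.2, l3.1, l3.2]

end


/-! ### Description of the original variables -/

section
variable {d : ℝ → ℝ} {a c₀ D₀ D₁ : ℝ} {m k : ℕ} {L ρ B B₀ δ ε T : ℝ} {x y px py Φ : ℝ → ℝ}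
  {w v : ℝ → Point}

theorem Slow.motionRate_nonneg (hS : Slow d a c₀ D₀ D₁ m k L ρ B B₀ δ ε) :
    0 ≤ motionRate a c₀ D₀ D₁ B B₀ L δ := by
  have := speedMin_pos hS.δ_pos hS.nf₀.pos
  have := hS.tame.slowRate_pos
  have := hS.tame.small.nf.pos
  have := hS.tame.L_pos
  unfold motionRate shadowRate trackRate stepShift stepDist trackDist
  positivity

theorem Tame.existsUnique_image (hS : Tame d a c₀ D₀ D₁ m k L ρ B ε) (hr : IsRay d ε T x y px py)
    (hT0 : 0 ≤ T) (hT : ε ^ k * T ≤ L) (h0 : a ≤ action d ε (x 0) (py 0))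
    (hΦ : IsPhaseLift d ε T x y py Φ) {t : ℝ} (ht : t ∈ Icc 0 T) :
    ∃! w, IsImage d (m + 1) ε a (rayPoint d ε x px py Φ t) w := by
  have g := hS.goodState hr hT0 hT h0 ht
  have haD : a ≤ D₀ := h0.trans (hS.goodState hr hT0 hT h0 ⟨le_rfl, hT0⟩).act_le
  rw [rayPoint_eq (hS.sawtooth_phase hr hT0 hT h0 hΦ ht)]
  exact hS.small.existsUnique_image haD g.act_ge g.act_le g.mom_le

theorem Tame.improved_action (hS : Tame d a c₀ D₀ D₁ m k L ρ B ε) (hr : IsRay d ε T x y px py)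
    (hT0 : 0 ≤ T) (hT : ε ^ k * T ≤ L) (h0 : a ≤ action d ε (x 0) (py 0))
    (hΦ : IsPhaseLift d ε T x y py Φ)
    (hw : ∀ t ∈ Icc 0 T, IsImage d (m + 1) ε a (rayPoint d ε x px py Φ t) (w t)) {t : ℝ}
    (ht : t ∈ Icc 0 T) : |(w t).I - (w 0).I| ≤ driftRate a c₀ D₀ D₁ B L * ε ^ (m + 1) ∧
      |action d ε (x t) (py t) - ((w 0).I + ε * (normalForm d (m + 1)).dφ ε (w 0).I (sawtooth (Φ t))
        (w t).p (ε * x t))| ≤ 2 * driftRate a c₀ D₀ D₁ B L * ε ^ (m + 1) := by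
  obtain ⟨h1, -, -, q, -, hc⟩ := hS.exists_companion hr hT0 hT h0 hΦ hw
  refine ⟨hc.drift t ht, ?_⟩
  have hd := hS.small.geom.prof
  have eq := dφ_eq hd (pol_iterate hd m).1 (z := (ε, (w 0).I, sawtooth (Φ t), (w t).p, ε * x t))
    (by linarith [hS.small.geom.a_pos] : 0 < (w 0).I)
  have hN : normalForm d (m + 1) = iterate d m := rfl
  simp only at eq
  rw [hN, eq, mul_assoc]
  exact hc.act t ht

theorem Slow.near_level (hS : Slow d a c₀ D₀ D₁ m k L ρ B B₀ δ ε) (hr : IsRay d ε T x y px py)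
    (hT0 : 0 ≤ T) (hT : ε ^ k * T ≤ L) (h0 : a ≤ action d ε (x 0) (py 0))
    (hΦ : IsPhaseLift d ε T x y py Φ)
    (hw : ∀ t ∈ Icc 0 T, IsImage d (m + 1) ε a (rayPoint d ε x px py Φ t) (w t))
    (hslow : SlowCondition d δ (action d ε (x 0) (py 0)) (ε * x 0)) {t : ℝ} (ht : t ∈ Icc 0 T) :
    ∃ P X, (normalForm d (m + 1)).K ε (w 0).I P X = 0 ∧
      |(w t).p - P| ≤ (driftRate a c₀ D₀ D₁ B L +
        2 * slowRate a c₀ D₀ D₁ B L / speedMin δ B₀) * ε ^ (m + 1) ∧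
      |ε * (w t).x - X| ≤ (driftRate a c₀ D₀ D₁ B L +
        2 * slowRate a c₀ D₀ D₁ B L / speedMin δ B₀) * ε ^ (m + 1) := by
  obtain ⟨h1, h2, h3, q, hq, hc⟩ := hS.tame.exists_companion hr hT0 hT h0 hΦ hw
  have ha := hS.tame.small.geom.a_pos
  have hD := hS.tame.small.geom.D₀_pos
  obtain ⟨P, X, e1, e2, e3⟩ := hS.exists_level (by linarith) (by linarith) (hq.q_le t ht)
    (hq.level t ht) (hS.speed hr hT0 hT h0 hslow h1 h2 h3 hq t ht)
  refine ⟨P, X, e1, ?_, ?_⟩ <;> rw [add_mul]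
  · exact (abs_sub_le _ (q t) _).trans (add_le_add (hc.close_p t ht) e2)
  · exact (abs_sub_le _ (slowX d m ε (w 0).I Φ q x t) _).trans (add_le_add (hc.close_X t ht) e3)

/-- The slow curve is the intermediary: it is within the drift of the improved variables, within the
shadowing error of the averaged solution, and tied to the original variables by the momentum and
action equations with frozen action. -/
theorem Slow.averaged_motion (hS : Slow d a c₀ D₀ D₁ m k L ρ B B₀ δ ε) (hk : 1 ≤ k)
    (hr : IsRay d ε T x y px py) (hT0 : 0 ≤ T) (hT : ε ^ k * T ≤ L)
    (h0 : a ≤ action d ε (x 0) (py 0)) (hΦ : IsPhaseLift d ε T x y py Φ)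
    (hw : ∀ t ∈ Icc 0 T, IsImage d (m + 1) ε a (rayPoint d ε x px py Φ t) (w t))
    (hslow : SlowCondition d δ (action d ε (x 0) (py 0)) (ε * x 0))
    (hv : IsApproxSolution d (m + 1) ε T v) (hv0 : v 0 = w 0) {t : ℝ} (ht : t ∈ Icc 0 T) :
    (|(w t).I - (v t).I| ≤ driftRate a c₀ D₀ D₁ B L * ε ^ (m + 1) ∧
      |(w t).φ - (v t).φ| ≤ (driftRate a c₀ D₀ D₁ B L + motionRate a c₀ D₀ D₁ B B₀ L δ) *
        accuracy m k ε ∧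
      |(w t).p - (v t).p| ≤ (driftRate a c₀ D₀ D₁ B L + motionRate a c₀ D₀ D₁ B B₀ L δ) *
        (accuracy m k ε * ε) ∧
      |ε * (w t).x - ε * (v t).x| ≤ (driftRate a c₀ D₀ D₁ B L + motionRate a c₀ D₀ D₁ B B₀ L δ) *
        (accuracy m k ε * ε)) ∧
    (∃! z, IsChange d (m + 1) ε z (v t)) ∧ ∀ z, IsChange d (m + 1) ε z (v t) →
      |Φ t - z.φ| ≤ 6 * motionRate a c₀ D₀ D₁ B B₀ L δ * accuracy m k ε ∧
      |pHat d ε (x t) (y t) (px t) (py t) - z.p| ≤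
        2 * motionRate a c₀ D₀ D₁ B B₀ L δ * (accuracy m k ε * ε) ∧
      |ε * x t - ε * z.x| ≤ 2 * motionRate a c₀ D₀ D₁ B B₀ L δ * (accuracy m k ε * ε) ∧
      |action d ε (x t) (py t) - z.I| ≤ (slowRate a c₀ D₀ D₁ B L + 2 * B) * ε ∧
      (sawtooth (Φ t) - sawtooth z.φ = Φ t - z.φ → |action d ε (x t) (py t) - z.I| ≤
        (slowRate a c₀ D₀ D₁ B L + 6 * B * motionRate a c₀ D₀ D₁ B B₀ L δ) *
          (accuracy m k ε * ε)) := by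
  obtain ⟨h1, h2, h3, q, hq, hc⟩ := hS.tame.exists_companion hr hT0 hT h0 hΦ hw
  have hs := hS.tame.small
  have hε := hs.ε_pos
  have ha := hs.geom.a_pos
  have hD := hs.geom.D₀_pos
  have hM := hS.motionRate_nonneg
  have hκ := hS.tame.driftRate_pos
  have hR := hS.tame.slowRate_pos
  have hsp := hS.speed hr hT0 hT h0 hslow h1 h2 h3 hq
  have ci := hc.init_p
  have cX := hc.init_X
  have cφ := hc.init_φ
  have dr := hc.drift t ht
  have dp := hc.close_p t ht
  have dX := hc.close_X t ht
  have dφ := hc.close_φ t ht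
  rw [← hv0] at h1 h2 hsp ci cX cφ hq dX dφ dr
  have hJ : 0 < (v 0).I := by linarith
  have g1 : a / 4 ≤ (v 0).I := by linarith
  have g2 : (v 0).I ≤ 3 * D₀ := by linarith
  obtain ⟨m1, m2, m3⟩ := hS.slowCurve_close hk hT0 hT g1 g2 hq hsp hv ci cX cφ ht
  have hcons := hv.conserved hs.geom.prof hJ ht
  have hp3 : |(v 0).p| ≤ 3 := by rw [← ci]; exact hq.q_le 0 ⟨le_rfl, hT0⟩
  have hpow : ε ^ (m + 1) ≤ ε := by simpa using hs.pow_le (i := 1) (j := m + 1) (by omega)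
  have hk1 : |(iterate d m).K ε (v 0).I (v 0).p (ε * (v 0).x)| ≤ 1 := by
    have := hq.level 0 ⟨le_rfl, hT0⟩
    rw [ci, cX] at this
    exact this.trans ((mul_le_mul_of_nonneg_left hpow hR.le).trans hS.t6)
  have hvp := hv.mom_le hs g1 g2 hp3 hk1 ht
  have hacc := hs.pow_le_accuracy hk
  have hE : 0 < accuracy m k ε := accuracy_pos hε
  have hEε : accuracy m k ε * ε ≤ accuracy m k ε :=
    mul_le_of_le_one_right hE.le (by linarith [hs.ε_le])
  have hκη := mul_le_mul_of_nonneg_left hacc hκ.le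
  have hκη' := mul_le_mul_of_nonneg_left hEε hκ.le
  have hRη := mul_le_mul_of_nonneg_left hacc hR.le
  have hRε := mul_le_mul_of_nonneg_left hpow hR.le
  rw [← hcons.1] at g1 g2
  refine ⟨⟨by rw [hcons.1]; exact dr, ?_, ?_, ?_⟩,
    hs.existsUnique_change g1 g2 (by linarith), fun z hz => ?_⟩
  · refine (abs_sub_le _ _ _).trans ((add_le_add dφ m3).trans ?_)
    linarith
  · refine (abs_sub_le _ _ _).trans ((add_le_add dp m1).trans ?_)
    linarith
  · refine (abs_sub_le _ _ _).trans ((add_le_add dX m2).trans ?_)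
    linarith
  · have hact := hq.act t ht
    have hmom := hq.mom t ht
    rw [slowX, mixedPt, ← hcons.1] at m2
    rw [slowPhase, mixedPt, ← hcons.1] at m3
    rw [mixedPt, ← hcons.1] at hact hmom
    obtain ⟨r1, r2, r3, r4, r5⟩ := hs.recover g1 g2 (by linarith [hq.q_le t ht]) (by linarith) hz hM
      hE.le hact hmom.symm m1 m2 m3
    refine ⟨r1, r2, r3, r4.trans ?_, fun h => (r5 h).trans ?_⟩ <;> linarith

end

end Waveguide

end
-- Assembly of the constants.
theorem mainTheorem6
    (d : ℝ → ℝ) (hd : ContDiff ℝ (⊤ : ℕ∞) d)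
    (hd_bdd : ∀ n : ℕ, ∃ B : ℝ, ∀ X : ℝ, |iteratedDeriv n d X| ≤ B)
    (hd_pos : ∃ c : ℝ, 0 < c ∧ ∀ X : ℝ, c ≤ d X) :
    -- conservation of the original action
    (∀ (r : ℕ) (a L : ℝ), 0 < a → 0 < L →
      ∃ C ε₀ : ℝ, 0 < C ∧ 0 < ε₀ ∧ ∀ ε : ℝ, 0 < ε → ε < ε₀ →
      ∀ T : ℝ, 0 ≤ T → T ≤ L * ε ^ (-(r : ℤ)) →
      ∀ x y px py : ℝ → ℝ, Waveguide.IsRay d ε T x y px py →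
      a ≤ Waveguide.action d ε (x 0) (py 0) →
      ∀ t ∈ Set.Icc 0 T,
        |Waveguide.action d ε (x t) (py t) - Waveguide.action d ε (x 0) (py 0)| ≤ C * ε) ∧
    -- description of the original variables
    (∀ (r k : ℕ) (a δ L : ℝ), 1 ≤ r → 1 ≤ k → 0 < a → 0 < δ → 0 < L →
      ∃ C ε₀ : ℝ, 0 < C ∧ 0 < ε₀ ∧ ∀ ε : ℝ, 0 < ε → ε < ε₀ →
      ∀ T : ℝ, 0 ≤ T → T ≤ L * ε ^ (-(k : ℤ)) →
      ∀ x y px py Φ : ℝ → ℝ, Waveguide.IsRay d ε T x y px py →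
      Waveguide.IsPhaseLift d ε T x y py Φ →
      a ≤ Waveguide.action d ε (x 0) (py 0) →
      ∀ z : ℝ → Waveguide.Point, z = Waveguide.rayPoint d ε x px py Φ →
      -- the change of variables is well defined along the ray
      (∀ t ∈ Set.Icc 0 T, ∃! w : Waveguide.Point, Waveguide.IsImage d r ε a (z t) w) ∧
      ∀ w : ℝ → Waveguide.Point, (∀ t ∈ Set.Icc 0 T, Waveguide.IsImage d r ε a (z t) (w t)) →
        (∀ t ∈ Set.Icc 0 T,
          |(w t).I - (w 0).I| ≤ C * ε ^ r ∧
          |(z t).I - ((w 0).I + ε * (Waveguide.normalForm d r).dφ ε (w 0).I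
            (Waveguide.sawtooth (z t).φ) (w t).p (ε * (z t).x))| ≤ C * ε ^ r) ∧
        (Waveguide.SlowCondition d δ (z 0).I (ε * (z 0).x) →
          (∀ t ∈ Set.Icc 0 T, ∃ P X : ℝ, (Waveguide.normalForm d r).K ε (w 0).I P X = 0 ∧
            |(w t).p - P| ≤ C * ε ^ r ∧ |ε * (w t).x - X| ≤ C * ε ^ r) ∧
          ∀ v : ℝ → Waveguide.Point, Waveguide.IsApproxSolution d r ε T v → v 0 = w 0 →
          ∀ t ∈ Set.Icc 0 T,
            -- accuracy in the new variables
            |(w t).I - (v t).I| ≤ C * ε ^ r ∧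
            |(w t).φ - (v t).φ| ≤ C * ε ^ ((r : ℤ) - k) ∧
            |(w t).p - (v t).p| ≤ C * ε ^ ((r : ℤ) - k + 1) ∧
            |ε * (w t).x - ε * (v t).x| ≤ C * ε ^ ((r : ℤ) - k + 1) ∧
            -- accuracy in the original variables, recovered from the approximate solution
            (∃! z' : Waveguide.Point, Waveguide.IsChange d r ε z' (v t)) ∧
            ∀ z' : Waveguide.Point, Waveguide.IsChange d r ε z' (v t) →
              |(z t).φ - z'.φ| ≤ C * ε ^ ((r : ℤ) - k) ∧
              |(z t).p - z'.p| ≤ C * ε ^ ((r : ℤ) - k + 1) ∧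
              |ε * (z t).x - ε * z'.x| ≤ C * ε ^ ((r : ℤ) - k + 1) ∧
              |(z t).I - z'.I| ≤ C * ε ∧
              (Waveguide.sawtooth (z t).φ - Waveguide.sawtooth z'.φ = (z t).φ - z'.φ →
                |(z t).I - z'.I| ≤ C * ε ^ ((r : ℤ) - k + 1)))) := by
  have hP : Waveguide.Profile d := ⟨hd, hd_bdd, hd_pos⟩
  refine ⟨fun r a L ha hL => ?_, fun r k a δ L hr hk ha hδ hL => ?_⟩
  · obtain ⟨C, hC, h⟩ := Waveguide.action_conservation hP r ha hL
    obtain ⟨ε₀, hε₀, hsub⟩ := mem_nhdsGT_iff_exists_Ioo_subset.1 h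
    exact ⟨C, ε₀, hC, hε₀, fun ε h1 h2 => hsub ⟨h1, h2⟩⟩
  -- For `r ≥ 1` the normal form consists of `m = r - 1` steps, with residual of order `ε ^ r`.
  obtain ⟨m, rfl⟩ : ∃ m, r = m + 1 := ⟨r - 1, by omega⟩
  obtain ⟨c₀, D₀, D₁, G⟩ := Waveguide.exists_geom hP ha
  obtain ⟨B, B₀, hB, hB₀, h⟩ := Waveguide.exists_slow G m k hL hδ
  obtain ⟨ε₀, hε₀, hsub⟩ := mem_nhdsGT_iff_exists_Ioo_subset.1 h
  -- The rates do not depend on `ε`; one admissible value is enough to obtain their signs before `C`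
  -- is chosen.
  obtain ⟨ε₁, hS₁⟩ := h.exists
  have hκ := hS₁.tame.driftRate_pos
  have hR := hS₁.tame.slowRate_pos
  have hM := hS₁.motionRate_nonneg
  have hc := Waveguide.speedMin_pos hδ hB₀
  set κ := Waveguide.driftRate a c₀ D₀ D₁ B L with hκ_def
  set R := Waveguide.slowRate a c₀ D₀ D₁ B L with hR_def
  set M := Waveguide.motionRate a c₀ D₀ D₁ B B₀ L δ with hM_def
  set c := Waveguide.speedMin δ B₀ with hc_def
  have hRc : 0 ≤ 2 * R / c := by positivity
  have hBM : 0 ≤ 6 * B * M := by positivity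
  obtain ⟨C, hC⟩ : ∃ C, C = 2 * κ + 2 * R / c + R + 2 * B + 6 * M + 6 * B * M := ⟨_, rfl⟩
  refine ⟨C, ε₀, by linarith, hε₀, fun ε hε hεε T hT0 hT x y px py Φ hray hΦ h0 z hz => ?_⟩
  have hS : Waveguide.Slow d a c₀ D₀ D₁ m k L (Waveguide.radius a D₀) B B₀ δ ε := hsub ⟨hε, hεε⟩
  have hT' := hS.tame.time_le hT
  subst hz
  refine ⟨fun t ht => hS.tame.existsUnique_image hray hT0 hT' h0 hΦ ht, fun w hw =>
    ⟨fun t ht => ?_, fun hslow => ⟨fun t ht => ?_, fun v hv hv0 t ht => ?_⟩⟩⟩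
  · obtain ⟨h1, h2⟩ := hS.tame.improved_action hray hT0 hT' h0 hΦ hw ht
    exact ⟨h1.trans (mul_le_mul_of_nonneg_right (by linarith) (by positivity)),
      h2.trans (mul_le_mul_of_nonneg_right (by linarith) (by positivity))⟩
  · obtain ⟨P, X, h1, h2, h3⟩ := hS.near_level hray hT0 hT' h0 hΦ hw hslow ht
    exact ⟨P, X, h1, h2.trans (mul_le_mul_of_nonneg_right (by linarith) (by positivity)),
      h3.trans (mul_le_mul_of_nonneg_right (by linarith) (by positivity))⟩
  · obtain ⟨⟨w1, w2, w3, w4⟩, hex, hrec⟩ :=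
      hS.averaged_motion hk hray hT0 hT' h0 hΦ hw hslow hv hv0 ht
    have hE : 0 < Waveguide.accuracy m k ε := Waveguide.accuracy_pos hε
    have hEε := mul_pos hE hε
    rw [← Waveguide.accuracy_mul hε]
    have up : ∀ {u K E : ℝ}, |u| ≤ K * E → 0 < E → K ≤ C → |u| ≤ C * E := fun h h' hK =>
      h.trans (mul_le_mul_of_nonneg_right hK h'.le)
    rw [Waveguide.rayPoint_eq (hS.tame.sawtooth_phase hray hT0 hT' h0 hΦ ht)]
    refine ⟨up w1 (by positivity) (by linarith), up w2 hE (by linarith),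
      up w3 hEε (by linarith), up w4 hEε (by linarith), hex, fun z' hz' => ?_⟩
    obtain ⟨r1, r2, r3, r4, r5⟩ := hrec z' hz'
    exact ⟨up r1 hE (by linarith), up r2 hEε (by linarith), up r3 hEε (by linarith),
      up r4 hε (by linarith), fun h => up (r5 h) hEε (by linarith)⟩
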